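/- Let $k\ge 3$ and let $\mathcal H=\{L_1,\dots,L_k\}$, $L_i(n)=A_in+B_i$ with $A_i\in\{1,2,\dots\}$ and $B_i\in\mathbf Z$, be admissible: the $L_i$ are pairwise distinct and, with $\mathcal P(n)=\prod_{i=1}^kL_i(n)$, $\#\{1\le n\le p:\mathcal P(n)\equiv 0 \bmod p\}<p$ for every prime $p$. Let $$\mathcal R_k=\Big\{t\in[0,1]^k:\sum_{i=1}^kt_i\le1\Big\},\qquad \mathcal R_k'=\Big\{t\in[0,1]^k:\sum_{i\ne j}t_i\le1\text{ for each }j\Big\}.$$ Let $\vartheta,\vartheta_0>0$ and let $W_0:[0,\vartheta_0/\vartheta]\to\mathbf R_{\ge0}$ be piecewise smooth: $[0,\vartheta_0/\vartheta]$ splits into finitely many intervals on the interior of each of which $W_0$ agrees with a $C^1$ function on the closed interval. Assume that either 1. $\vartheta_0+2\vartheta<1$, and put $\mathcal S=\mathcal R_k$; or 2. $\vartheta_0+\frac{2k}{k-1}\vartheta<1$, and put $\mathcal S=\mathcal R_k'$. Then there is a constant $C>0$, depending only on $k,\mathcal H,\vartheta,\vartheta_0,W_0$ (and on which of the two cases is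 considered), such that the following holds for every - function $F:\mathbf R^k\to\mathbf R_{\ge0}$ with $\operatorname{supp}F\subset\mathcal S$, differentiable in the interior of $\mathcal S$, and with $F_{\max}=\sup_{t\in[0,1]^k}\big(|F(t)|+\sum_{i=1}^k|\frac{\partial F}{\partial t_i}(t)|\big)<\infty$ (a partial derivative that does not exist counts as $0$); - real $N>16$ such that $D_0:=\log\log\log N$ satisfies $D_0>A_iB_j-A_jB_i$ and $D_0>A_i$ for all $i,j$; - integer $\nu_0$ with $(\mathcal P(\nu_0),W)=1$, where $W=\prod_{p<D_0}p$; - real $\epsilon$ with $0<\epsilon<\vartheta_0/\vartheta$. Put $R=N^{\vartheta}$, $R_0=N^{\vartheta_0}$. For positive integers $r_1,\dots,r_k$ with product $r$ let $$y_{r_1,\dots,r_k}=F\Big(\frac{\log r_1}{\log R},\dots,\frac{\log r_k}{\log R}\Big)$$ if $r$ is square-free, $(r,W)=1$ and $r/r_j<R$ for each $j$, and $y_{r_1,\dots,r_k}=0$ otherwise. Let $$\lambda_{d_1,\dots,d_k}=\Big(\prod_{i=1}^k\mu(d_i)d_i\Big)\sum_{\substack{r_1,\dots,r_k\\ d_i\mid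 r_i\ \forall i}}\frac{y_{r_1,\dots,r_k}}{\prod_{i=1}^k\varphi(r_i)},\qquad \Lambda_{\mathrm{Sel}}^2(n)=\Big(\sum_{\substack{d_1,\dots,d_k\\ d_i\mid L_i(n)\ \forall i}}\lambda_{d_1,\dots,d_k}\Big)^2 .$$ Then $$\Sigma_0:=\sum_{\substack{N<n\le2N\\ n\equiv\nu_0\bmod W}}\Big(\sum_{\substack{p\mid\mathcal P(n)\\ p\le R_0}}W_0\Big(\frac{\log p}{\log R}\Big)\Big)\Lambda_{\mathrm{Sel}}^2(n)$$ ($p$ running over primes) satisfies $$\left|\Sigma_0-\frac{\varphi(W)^kN(\log R)^k}{W^{k+1}}\sum_{j=1}^kJ_0^{(j)}\right|\le C\,\frac{F_{\max}^2\,\varphi(W)^kN(\log R)^k}{W^{k+1}}\Big(\epsilon+\frac{|\log\epsilon|}{D_0}\Big),$$ where $$J_0^{(j)}=\int_\epsilon^{\vartheta_0/\vartheta}\frac{W_0(y)}{y}I_0^{(j)}(y)\,dy,\qquad I_0^{(j)}(y)=\int_{[0,1]^k}\big(F(t)-F(t+ye_j)\big)^2\,dt,$$ and $e_j$ is the $j$-th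 standard basis vector of $\mathbf R^k$. -/

import Mathlib

noncomputable section

namespace AlmostPrimeSieve

/-! ### Linear forms -/

/-- The linear form `L_i(n) = A_i n + B_i`. -/
def linForm {k : ℕ} (A : Fin k → ℕ) (B : Fin k → ℤ) (i : Fin k) (n : ℤ) : ℤ :=
  (A i : ℤ) * n + B i

/-- The product `P(n) = ∏ i, L_i(n)`. -/
def prodForm {k : ℕ} (A : Fin k → ℕ) (B : Fin k → ℤ) (n : ℤ) : ℤ :=
  ∏ i, linForm A B i n

/-- `ν_p = #{1 ≤ n ≤ p : P(n) ≡ 0 mod p}`. -/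
def nuCount {k : ℕ} (A : Fin k → ℕ) (B : Fin k → ℤ) (p : ℕ) : ℕ :=
  ((Finset.Icc 1 p).filter (fun n : ℕ => (p : ℤ) ∣ prodForm A B (n : ℤ))).card

/-- Admissible tuples of forms `A_i n + B_i` with positive integers `A_i` and integers `B_i`. -/
structure Admissible {k : ℕ} (A : Fin k → ℕ) (B : Fin k → ℤ) : Prop where
  pos : ∀ i, 0 < A i
  distinct : ∀ i j, i ≠ j → (A i, B i) ≠ (A j, B j)
  nu_lt : ∀ p : ℕ, p.Prime → nuCount A B p < p

/-! ### The parameters `D₀` and `W` -/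

/-- `D₀ = log log log N`. -/
def D0 (N : ℝ) : ℝ := Real.log (Real.log (Real.log N))

/-- `W` is the product of the primes `p < D₀`; here `p < ⌈D₀⌉₊` means `(p : ℝ) < D₀`. -/
def primorialW (N : ℝ) : ℕ := ∏ p ∈ (Finset.range ⌈D0 N⌉₊).filter Nat.Prime, p

/-- The standing largeness assumptions on `N`. -/
structure LargeEnough {k : ℕ} (A : Fin k → ℕ) (B : Fin k → ℤ) (N : ℝ) : Prop where
  gt_sixteen : 16 < N
  cross_lt : ∀ i j, ((((A i : ℤ) * B j - (A j : ℤ) * B i : ℤ)) : ℝ) < D0 N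
  coeff_lt : ∀ i, (A i : ℝ) < D0 N

/-! ### The supports and the smooth function `F` -/

/-- `R_k = {t ∈ [0,1]^k : ∑ t_i ≤ 1}`. -/
def simplexRegion (k : ℕ) : Set (Fin k → ℝ) :=
  {t | (∀ i, t i ∈ Set.Icc (0 : ℝ) 1) ∧ ∑ i, t i ≤ 1}

/-- `R'_k = {t ∈ [0,1]^k : ∑_{i ≠ j} t_i ≤ 1 for each j}`. -/
def extendedRegion (k : ℕ) : Set (Fin k → ℝ) :=
  {t | (∀ i, t i ∈ Set.Icc (0 : ℝ) 1) ∧ ∀ j, ∑ i ∈ Finset.univ.erase j, t i ≤ 1}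

/-- The quantity `|F(t)| + ∑_i |∂F/∂t_i (t)|`. A partial derivative that does not exist (which,
for the functions considered, can happen on the boundary of the support region only)
contributes `0`. -/
def sizeAt {k : ℕ} (F : (Fin k → ℝ) → ℝ) (t : Fin k → ℝ) : ℝ :=
  |F t| + ∑ i, |deriv (fun s : ℝ => F (Function.update t i s)) (t i)|

/-- `F_max`, the supremum of `|F| + ∑_i |∂F/∂t_i|` over `[0,1]^k`. -/
def Fmax {k : ℕ} (F : (Fin k → ℝ) → ℝ) : ℝ :=
  sSup (sizeAt F '' Set.Icc 0 1)

/-- The functions `F` that define the sieve: nonnegative, supported on the (closed) region `S`,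
differentiable in the interior of `S`, and with `F_max` finite. -/
structure IsSieveFunction {k : ℕ} (S : Set (Fin k → ℝ)) (F : (Fin k → ℝ) → ℝ) : Prop where
  nonneg : ∀ t, 0 ≤ F t
  supp : tsupport F ⊆ S
  diff : DifferentiableOn ℝ F (interior S)
  bdd : BddAbove (sizeAt F '' Set.Icc 0 1)

/-! ### The sieve weights -/

open scoped Classical in
/-- `y_{r_1,…,r_k} = F(log r_1 / log R, …, log r_k / log R)` if `r = ∏ r_i` is square-free, coprime
to `W` and `r / r_j < R` for each `j`, and `0` otherwise. -/
def sieveY {k : ℕ} (W : ℕ) (R : ℝ) (F : (Fin k → ℝ) → ℝ) (r : Fin k → ℕ) : ℝ :=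
  if Squarefree (∏ i, r i) ∧ Nat.Coprime (∏ i, r i) W ∧
      ∀ j, ((∏ i ∈ Finset.univ.erase j, r i : ℕ) : ℝ) < R then
    F (fun i => Real.log (r i) / Real.log R)
  else 0

/-- The tuples of positive integers at most `R`. For `k ≥ 2` every tuple at which `y` does not
vanish lies in this box, and so does every tuple that divides such a one coordinatewise. -/
def box (k : ℕ) (R : ℝ) : Finset (Fin k → ℕ) :=
  Fintype.piFinset (fun _ : Fin k => Finset.Icc 1 ⌊R⌋₊)

open scoped Classical in
/-- `λ_{d_1,…,d_k} = (∏ μ(d_i) d_i) ∑_{r : d_i ∣ r_i} y_{r_1,…,r_k} / ∏ φ(r_i)`. -/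
def sieveLambda {k : ℕ} (W : ℕ) (R : ℝ) (F : (Fin k → ℝ) → ℝ) (d : Fin k → ℕ) : ℝ :=
  (∏ i, ((ArithmeticFunction.moebius (d i) : ℤ) : ℝ) * (d i : ℝ)) *
    ∑ r ∈ (box k R).filter (fun r => ∀ i, d i ∣ r i),
      sieveY W R F r / ∏ i, (Nat.totient (r i) : ℝ)

open scoped Classical in
/-- `Λ²_Sel(n) = (∑_{d : d_i ∣ L_i(n)} λ_{d_1,…,d_k})²`. -/
def selbergWeight {k : ℕ} (A : Fin k → ℕ) (B : Fin k → ℤ) (W : ℕ) (R : ℝ)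
    (F : (Fin k → ℝ) → ℝ) (n : ℤ) : ℝ :=
  (∑ d ∈ (box k R).filter (fun d => ∀ i, (d i : ℤ) ∣ linForm A B i n), sieveLambda W R F d) ^ 2

open scoped Classical in
/-- `Σ₀`, with `R₀ = N^ϑ₀` and `R = N^ϑ`: the sum over the integers `N < n ≤ 2N` with
`n ≡ ν₀ mod W` of `(∑_{p ∣ P(n), p ≤ R₀} W₀(log p / log R)) Λ²_Sel(n)`. -/
def sigma0 {k : ℕ} (A : Fin k → ℕ) (B : Fin k → ℤ) (θ θ₀ : ℝ) (W₀ : ℝ → ℝ)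
    (F : (Fin k → ℝ) → ℝ) (N : ℝ) (ν₀ : ℤ) : ℝ :=
  ∑ n ∈ (Finset.Ioc ⌊N⌋₊ ⌊2 * N⌋₊).filter (fun n : ℕ => (n : ℤ) ≡ ν₀ [ZMOD (primorialW N : ℤ)]),
    (∑ p ∈ (Finset.Icc 1 ⌊N ^ θ₀⌋₊).filter
        (fun p : ℕ => p.Prime ∧ (p : ℤ) ∣ prodForm A B (n : ℤ)),
      W₀ (Real.log p / Real.log (N ^ θ))) *
    selbergWeight A B (primorialW N) (N ^ θ) F (n : ℤ)

/-! ### The main term -/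

/-- `I₀^{(j)}(y) = ∫_{[0,1]^k} (F(t) - F(t_1, …, t_j + y, …, t_k))² dt`. -/
def I0 {k : ℕ} (F : (Fin k → ℝ) → ℝ) (j : Fin k) (y : ℝ) : ℝ :=
  ∫ t in Set.Icc (0 : Fin k → ℝ) 1, (F t - F (Function.update t j (t j + y))) ^ 2

/-- `J₀^{(j)} = ∫_ε^{ϑ₀/ϑ} (W₀(y)/y) I₀^{(j)}(y) dy`. -/
def J0 {k : ℕ} (θ θ₀ : ℝ) (W₀ : ℝ → ℝ) (F : (Fin k → ℝ) → ℝ) (ε : ℝ) (j : Fin k) : ℝ :=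
  ∫ y in ε..(θ₀ / θ), W₀ y / y * I0 F j y

/-- The common size `φ(W)^k N (log R)^k / W^{k+1}`, with `R = N^ϑ`. -/
def mainSize (k : ℕ) (θ N : ℝ) : ℝ :=
  (Nat.totient (primorialW N) : ℝ) ^ k * N * Real.log (N ^ θ) ^ k / (primorialW N : ℝ) ^ (k + 1)

/-- `f` is piecewise smooth on `[a, b]`: there are finitely many points `a = x_0 < … < x_m = b` such
that on each open interval `(x_i, x_{i+1})` the function `f` agrees with a function of class `C¹`
on the closed interval. Only one continuous derivative is asked for, so the notion includes
the functions that are piecewise `C^∞`. -/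
def PiecewiseSmoothOn (f : ℝ → ℝ) (a b : ℝ) : Prop :=
  ∃ (m : ℕ) (x : ℕ → ℝ), x 0 = a ∧ x m = b ∧ (∀ i < m, x i < x (i + 1)) ∧
    ∀ i < m, ∃ g : ℝ → ℝ, ContDiffOn ℝ 1 g (Set.Icc (x i) (x (i + 1))) ∧
      Set.EqOn f g (Set.Ioo (x i) (x (i + 1)))

end AlmostPrimeSieve

end

open AlmostPrimeSieve

open AlmostPrimeSieve

section

open MeasureTheory Set

/-! ### Sums against finitely many atoms compared with integrals -/

/-! Let M be the product of the primes up to max(R, R₀) that do not divide W. A prime p dividing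
P(n), with n ≡ ν₀ mod W, does not divide W, and because D₀ exceeds all the cross terms A_i B_l - A_l
B_i it divides exactly one L_j(n). So Σ₀ is a sum over p and j of W₀(log p / log R) times the sum of
Λ²(n) over the n with p ∣ L_j(n). Write M = pm. On such n the divisors with p ∣ d_j pair with those
prime to p, and Λ² becomes the square attached to the modulus m and to the shifted variables y_r -
y_{..,p r_j,..} + (p-1)⁻¹ ∑_{i≠j} y_{..,p r_i,..} (`lambdaOf_add_mulAt`). Opening the square and
counting in residue classes gives N/(Wp) times the quadratic form `selbergForm`, up to the square of
the ℓ¹ norm of λ. That norm is at most F_max R^κ N^{o(1)}, where κ bounds ∑ t_i on the support: κ =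
1 for the simplex and κ = k/(k-1) for the extended region. Summed over p ≤ R₀ this is admissible
exactly because θ₀ + 2κθ < 1 (`abs_sigma0_sub_le`, `exists_sum_abs_lambdaOf_le`).

The form is squeezed rather than diagonalised exactly. Splitting off one prime q of m
(`selbergForm_lambdaOf_mul`) leaves two diagonal contributions and one negative non-diagonal one.
Dropping the latter gives `selbergForm_le`, and bounding it by Cauchy-Schwarz gives
`le_selbergForm`, with weights that differ from ∏ 1/r_i by factors 1 + O(1/q). As every q is at
least D₀, these weights agree with ∏ 1/r_i on average up to a relative error O(1/D₀).

The harmonic sum over integers prime to W, placed at log n / log R, is (φ(W)/W) log R times Lebesgue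
measure on [0,1] up to an error O(W). The function F is Lipschitz along the axes only inside an open
convex set U, so on a line it is Lipschitz on an interval and zero outside. Koksma's inequality
handles such functions one coordinate at a time (`sum_piFinset_sub_integral_le`). The boundary of
the region lies in finitely many hyperplanes, which carry little mass. Hence the form at p is about
((φ(W)/W) log R)^k I₀(log p / log R) (`abs_primeForm_sub_le`), and it is also O(y) times that power
for p = R^y, up to small terms (`primeForm_le`).

For the sum over p, Mertens' first theorem says that the masses log p/(p log R) at log p / log R
approximate Lebesgue measure. Primes above R^{1/D₀} give the integral of W₀(y) I₀(y)/y from 1/D₀ on,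
with error O((1 + log D₀)/D₀); smaller primes contribute O(1/D₀) by the second estimate
(`exists_sum_primes_sub_integral_le`). The function I₀ is Lipschitz with I₀(0) = 0, so W₀ I₀/y is
bounded and moving the truncation from 1/D₀ to ε costs O(|ε - 1/D₀|). Finally (1 + log D)/D is at
most 4(ε + |log ε|/D) for every ε. For bounded N a trivial bound suffices, since ε + |log ε|/D₀ is
then bounded below. -/

/-- `f` is Lipschitz with constant `L` and bounded by `M` on some interval inside `[lo, hi]`, and
vanishes on the rest of `[lo, hi]`. -/
def PieceLip (lo hi L M : ℝ) (f : ℝ → ℝ) : Prop :=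
  ∃ I : Set ℝ, I.OrdConnected ∧ I ⊆ Icc lo hi ∧ (∀ x ∈ I, ∀ y ∈ I, |f x - f y| ≤ L * |x - y|) ∧
    (∀ x ∈ I, |f x| ≤ M) ∧ ∀ x ∈ Icc lo hi, x ∉ I → f x = 0

/-- The product rule on the intersection of the two intervals, which is again an interval. Sums have
no such closure, since a union of two intervals need not be one; this is why squares of differences
are expanded into products later. -/
theorem PieceLip.mul {lo hi L₁ M₁ L₂ M₂ : ℝ} {f g : ℝ → ℝ} (hM₁ : 0 ≤ M₁)
    (hf : PieceLip lo hi L₁ M₁ f)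
    (hg : PieceLip lo hi L₂ M₂ g) :
    PieceLip lo hi (L₁ * M₂ + L₂ * M₁) (M₁ * M₂) (fun x => f x * g x) := by
  obtain ⟨I, hI, hIs, h1, h2, h3⟩ := hf
  obtain ⟨J, hJ, hJs, h4, h5, h6⟩ := hg
  refine ⟨I ∩ J, hI.inter hJ, fun x hx => hIs hx.1, ?_, ?_, ?_⟩
  · intro x hx y hy
    have e : f x * g x - f y * g y = (f x - f y) * g x + f y * (g x - g y) := by ring
    rw [e]
    refine (abs_add_le _ _).trans ?_
    rw [abs_mul, abs_mul]
    have a1 := mul_le_mul (h1 x hx.1 y hy.1) (h5 x hx.2) (abs_nonneg _)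
      ((abs_nonneg _).trans (h1 x hx.1 y hy.1))
    have a2 := mul_le_mul (h2 y hy.1) (h4 x hx.2 y hy.2) (abs_nonneg _) hM₁
    linarith
  · intro x hx
    rw [abs_mul]
    exact mul_le_mul (h2 x hx.1) (h5 x hx.2) (abs_nonneg _) hM₁
  · intro x hx hn
    by_cases h : x ∈ I
    · have : x ∉ J := fun hJ => hn ⟨h, hJ⟩
      simp [h6 x hx this]
    · simp [h3 x hx h]

/-- Layer cake: both integrals are integrals over t in (0, T] of the measure of {ψ ≥ t} ∩ I.
Monotonicity makes each such set an interval, so the hypothesis on intervals applies at every level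
t. -/
theorem setIntegral_monotoneOn_discrepancy {μ : Measure ℝ} [IsFiniteMeasure μ] {lo hi c E T : ℝ}
    (hT : 0 ≤ T) (H : ∀ J : Set ℝ, J.OrdConnected → J ⊆ Icc lo hi →
      |μ.real J - c * volume.real J| ≤ E)
    {I : Set ℝ} (hI : I.OrdConnected) (hIs : I ⊆ Icc lo hi) {ψ : ℝ → ℝ} (hψ : MonotoneOn ψ I)
    (h0 : ∀ x ∈ I, 0 ≤ ψ x) (hψT : ∀ x ∈ I, ψ x ≤ T) :
    |∫ x in I, ψ x ∂μ - c * ∫ x in I, ψ x| ≤ T * E := by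
  have hIm : MeasurableSet I := hI.measurableSet
  have hvol : volume I < ⊤ := (measure_mono hIs).trans_lt (by simp)
  have key : ∀ (ν : Measure ℝ), ν I < ⊤ →
      (IntegrableOn (fun t => ν.real ({a | t ≤ ψ a} ∩ I)) (Ioc 0 T) volume) ∧
      ∫ x in I, ψ x ∂ν = ∫ t in Ioc 0 T, ν.real ({a | t ≤ ψ a} ∩ I) := by
    intro ν hν
    have : IsFiniteMeasure (ν.restrict I) := ⟨by simpa using hν⟩
    have hInt : Integrable ψ (ν.restrict I) := by
      refine Integrable.of_bound (aemeasurable_restrict_of_monotoneOn hIm hψ).aestronglyMeasurable T ?_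
      filter_upwards [ae_restrict_mem hIm] with x hx
      rw [Real.norm_eq_abs, abs_of_nonneg (h0 x hx)]
      exact hψT x hx
    have hmeas : ∀ t : ℝ, (ν.restrict I).real {a | t ≤ ψ a} = ν.real ({a | t ≤ ψ a} ∩ I) := by
      intro t
      simp [measureReal_def, Measure.restrict_apply' hIm]
    constructor
    · have hanti : Antitone (fun t => ν.real ({a | t ≤ ψ a} ∩ I)) := by
        intro s t hst
        refine measureReal_mono ?_ (ne_top_of_le_ne_top hν.ne (measure_mono inter_subset_right))
        rintro a ⟨ha, haI⟩
        exact ⟨hst.trans ha, haI⟩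
      refine Measure.integrableOn_of_bounded (M := ν.real I) (by simp)
        hanti.measurable.aestronglyMeasurable ?_
      filter_upwards with t
      rw [Real.norm_eq_abs, abs_of_nonneg measureReal_nonneg]
      exact measureReal_mono inter_subset_right hν.ne
    · rw [hInt.integral_eq_integral_Ioc_meas_le (M := T)]
      · simp_rw [hmeas]
      · filter_upwards [ae_restrict_mem hIm] with x hx using h0 x hx
      · filter_upwards [ae_restrict_mem hIm] with x hx using hψT x hx
  obtain ⟨i1, e1⟩ := key μ (measure_lt_top _ _)
  obtain ⟨i2, e2⟩ := key volume hvol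
  rw [e1, e2, ← integral_const_mul, ← integral_sub i1 (i2.const_mul c)]
  have := norm_setIntegral_le_of_norm_le_const (μ := (volume : Measure ℝ)) (s := Ioc 0 T) (C := E)
    (f := fun t => μ.real ({a | t ≤ ψ a} ∩ I) - c * volume.real ({a | t ≤ ψ a} ∩ I)) (by simp)
    (by
      intro t ht
      refine H _ ⟨?_⟩ (fun x hx => hIs hx.2)
      rintro x ⟨hx, hxI⟩ y ⟨hy, hyI⟩ z hz
      have hzI := hI.out hxI hyI hz
      exact ⟨le_trans hx (hψ hxI hzI hz.1), hzI⟩)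
  rw [Real.norm_eq_abs] at this
  refine this.trans ?_
  simp [hT, mul_comm]

theorem PieceLip.aestronglyMeasurable {lo hi L M : ℝ} {f : ℝ → ℝ} (hf : PieceLip lo hi L M f)
    (μ : Measure ℝ) : AEStronglyMeasurable f (μ.restrict (Icc lo hi)) := by
  obtain ⟨I, hI, hIs, h1, h2, h3⟩ := hf
  have hc : ContinuousOn f I := by
    have : LipschitzOnWith (Real.toNNReal L) f I := by
      refine LipschitzOnWith.of_dist_le_mul fun x hx y hy => ?_
      rw [Real.dist_eq, Real.dist_eq]
      exact (h1 x hx y hy).trans (mul_le_mul_of_nonneg_right (Real.le_coe_toNNReal L) (abs_nonneg _))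
    exact this.continuousOn
  have e : (Icc lo hi).EqOn f (I.indicator f) := by
    intro x hx
    by_cases h : x ∈ I
    · simp [h]
    · simp [h, h3 x hx h]
  have hm : AEStronglyMeasurable (I.indicator f) (μ.restrict (Icc lo hi)) :=
    (((aestronglyMeasurable_indicator_iff hI.measurableSet).2
      (hc.aestronglyMeasurable hI.measurableSet))).restrict
  refine hm.congr ?_
  filter_upwards [ae_restrict_mem measurableSet_Icc] with x hx using (e hx).symm

theorem PieceLip.bound {lo hi L M : ℝ} {f : ℝ → ℝ} (hM : 0 ≤ M) (hf : PieceLip lo hi L M f) :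
    ∀ x ∈ Icc lo hi, |f x| ≤ M := by
  obtain ⟨I, hI, hIs, h1, h2, h3⟩ := hf
  intro x hx
  by_cases h : x ∈ I
  · exact h2 x h
  · simpa [h3 x hx h] using hM

theorem PieceLip.integrableOn {lo hi L M : ℝ} {f : ℝ → ℝ} (hM : 0 ≤ M) (hf : PieceLip lo hi L M f)
    (μ : Measure ℝ) [IsLocallyFiniteMeasure μ] : IntegrableOn f (Icc lo hi) μ := by
  have : IsFiniteMeasure (μ.restrict (Icc lo hi)) :=
    ⟨by simpa using isCompact_Icc.measure_lt_top⟩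
  refine Integrable.of_bound (hf.aestronglyMeasurable μ) M ?_
  filter_upwards [ae_restrict_mem measurableSet_Icc] with x hx using hf.bound hM x hx

/-- On its interval f is the difference of two nonnegative nondecreasing functions, f + (L(x - lo) +
M) and L(x - lo) + M, bounded by 2M + L(hi - lo) and M + L(hi - lo). The two bounds add up to the
constant. -/
theorem PieceLip.integral_discrepancy {μ : Measure ℝ} [IsFiniteMeasure μ] {lo hi c E L M : ℝ}
    (hle : lo ≤ hi) (hL : 0 ≤ L) (hM : 0 ≤ M)
    (H : ∀ J : Set ℝ, J.OrdConnected → J ⊆ Icc lo hi → |μ.real J - c * volume.real J| ≤ E)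
    {f : ℝ → ℝ} (hf : PieceLip lo hi L M f) :
    |∫ x in Icc lo hi, f x ∂μ - c * ∫ x in Icc lo hi, f x| ≤ (3 * M + 2 * L * (hi - lo)) * E := by
  have hfM := hf.bound hM
  have hfi := fun ν [IsLocallyFiniteMeasure ν] => hf.integrableOn hM ν
  obtain ⟨I, hI, hIs, h1, h2, h3⟩ := hf
  have hIm := hI.measurableSet
  have eq : ∀ ν : Measure ℝ, ∫ x in Icc lo hi, f x ∂ν = ∫ x in I, f x ∂ν := by
    intro ν
    refine (setIntegral_eq_of_subset_of_forall_sdiff_eq_zero measurableSet_Icc hIs ?_)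
    rintro x ⟨hx, hn⟩
    exact h3 x hx hn
  set ψ₁ : ℝ → ℝ := fun x => f x + (L * (x - lo) + M) with hψ₁
  set ψ₂ : ℝ → ℝ := fun x => L * (x - lo) + M with hψ₂
  have hmul : ∀ x ∈ I, 0 ≤ L * (x - lo) ∧ L * (x - lo) ≤ L * (hi - lo) := fun x hx =>
    ⟨mul_nonneg hL (by linarith [(hIs hx).1]),
      mul_le_mul_of_nonneg_left (by linarith [(hIs hx).2]) hL⟩
  have hLw : 0 ≤ L * (hi - lo) := mul_nonneg hL (by linarith)
  have k1 := setIntegral_monotoneOn_discrepancy (T := 2 * M + L * (hi - lo)) (by linarith) H hI hIs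
    (ψ := ψ₁)
    (by
      intro x hx y hy hxy
      have := (abs_le.1 (h1 x hx y hy)).2
      rw [abs_sub_comm, abs_of_nonneg (by linarith : 0 ≤ y - x)] at this
      simp only [hψ₁]; linarith)
    (by intro x hx; have := abs_le.1 (h2 x hx); have := hmul x hx; simp only [hψ₁]; linarith)
    (by intro x hx; have := abs_le.1 (h2 x hx); have := hmul x hx; simp only [hψ₁]; linarith)
  have k2 := setIntegral_monotoneOn_discrepancy (T := M + L * (hi - lo)) (by linarith) H hI hIs
    (ψ := ψ₂)
    (by
      intro x hx y hy hxy
      have := mul_le_mul_of_nonneg_left hxy hL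
      simp only [hψ₂]; linarith)
    (by intro x hx; have := hmul x hx; simp only [hψ₂]; linarith)
    (by intro x hx; have := hmul x hx; simp only [hψ₂]; linarith)
  have split : ∀ ν : Measure ℝ, [IsLocallyFiniteMeasure ν] →
      ∫ x in I, ψ₁ x ∂ν = ∫ x in I, f x ∂ν + ∫ x in I, ψ₂ x ∂ν := by
    intro ν _
    refine integral_add ((hfi ν).mono_set hIs) ?_
    have : IntegrableOn ψ₂ (Icc lo hi) ν :=
      (by fun_prop : Continuous ψ₂).continuousOn.integrableOn_compact isCompact_Icc
    exact this.mono_set hIs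
  rw [split μ, split volume] at k1
  rw [eq, eq]
  rw [abs_le] at k1 k2 ⊢
  constructor <;> nlinarith [k1.1, k1.2, k2.1, k2.2]

/-- Discrete Koksma inequality. -/
theorem PieceLip.sum_discrepancy {ι : Type*} (A : Finset ι) (w x : ι → ℝ)
    (hw : ∀ n ∈ A, 0 ≤ w n) {lo hi c E L M : ℝ}
    (hle : lo ≤ hi) (hL : 0 ≤ L) (hM : 0 ≤ M) (hx : ∀ n ∈ A, x n ∈ Icc lo hi)
    (H : ∀ J : Set ℝ, J.OrdConnected → J ⊆ Icc lo hi →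
      |∑ n ∈ A, J.indicator (fun _ => w n) (x n) - c * volume.real J| ≤ E)
    {f : ℝ → ℝ} (hf : PieceLip lo hi L M f) :
    |∑ n ∈ A, w n * f (x n) - c * ∫ s in Icc lo hi, f s| ≤ (3 * M + 2 * L * (hi - lo)) * E := by
  classical
  -- A finite sum of point masses. Intervals are measurable, so `H` says precisely that this measure
  -- has small discrepancy on them.
  set μ : Measure ℝ := ∑ n ∈ A, ENNReal.ofReal (w n) • Measure.dirac (x n) with hμ
  have : IsFiniteMeasure μ := by
    refine ⟨?_⟩
    simp [hμ, Measure.finsetSum_apply]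
  have hreal : ∀ J : Set ℝ, J.OrdConnected →
      μ.real J = ∑ n ∈ A, J.indicator (fun _ => w n) (x n) := by
    intro J hJ
    rw [measureReal_def, hμ, Measure.finsetSum_apply, ENNReal.toReal_sum]
    · refine Finset.sum_congr rfl fun n hn => ?_
      rw [Measure.smul_apply, Measure.dirac_apply' _ hJ.measurableSet]
      by_cases h : x n ∈ J <;> simp [h, hw n hn]
    · intro n hn
      rw [Measure.smul_apply, Measure.dirac_apply' _ hJ.measurableSet]
      by_cases h : x n ∈ J <;> simp [h]
  have hInt : ∫ s in Icc lo hi, f s ∂μ = ∑ n ∈ A, w n * f (x n) := by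
    have : μ.restrict (Icc lo hi) = μ := by
      rw [Measure.restrict_eq_self_of_ae_mem]
      rw [ae_iff, hμ, Measure.finsetSum_apply]
      refine Finset.sum_eq_zero fun n hn => ?_
      have h : MeasurableSet {a | a ∉ Icc lo hi} := (measurableSet_Icc).compl
      rw [Measure.smul_apply, Measure.dirac_apply' _ h]
      have := hx n hn
      simp_all
    rw [this, hμ, integral_finsetSum_measure]
    · refine Finset.sum_congr rfl fun n hn => ?_
      rw [integral_smul_measure, integral_dirac, ENNReal.toReal_ofReal (hw n hn), smul_eq_mul]
    · intro n hn
      refine Integrable.smul_measure ?_ (by simp)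
      exact integrable_dirac (by simp)
  rw [← hInt]
  refine PieceLip.integral_discrepancy hle hL hM ?_ hf
  intro J hJ hJs
  rw [hreal J hJ]
  exact H J hJ hJs

/-- The discrepancy over intervals is controlled by the one of the distribution function. -/
theorem discrepancy_of_distribution {ι : Type*} (A : Finset ι) (w x : ι → ℝ)
    (hw : ∀ n ∈ A, 0 ≤ w n) {lo hi c E : ℝ} (hc : 0 ≤ c) (hE : 0 ≤ E)
    (H : ∀ t ∈ Icc lo hi, |∑ n ∈ A, (Iic t).indicator (fun _ => w n) (x n) - c * (t - lo)| ≤ E) :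
    ∀ J : Set ℝ, J.OrdConnected → J ⊆ Icc lo hi →
      |∑ n ∈ A, J.indicator (fun _ => w n) (x n) - c * volume.real J| ≤ 2 * E := by
  classical
  intro J hJ hJs
  rcases J.eq_empty_or_nonempty with rfl | hne
  · simpa using hE
  set a := sInf J with ha
  set b := sSup J with hb
  have hbb : BddBelow J := bddBelow_Icc.mono hJs
  have hba : BddAbove J := bddAbove_Icc.mono hJs
  have haI : a ∈ Icc lo hi := by
    obtain ⟨z, hz⟩ := hne
    exact ⟨le_csInf ⟨z, hz⟩ fun y hy => (hJs hy).1, (csInf_le hbb hz).trans (hJs hz).2⟩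
  have hbI : b ∈ Icc lo hi := by
    obtain ⟨z, hz⟩ := hne
    exact ⟨(hJs hz).1.trans (le_csSup hba hz), csSup_le ⟨z, hz⟩ fun y hy => (hJs hy).2⟩
  have hab : a ≤ b := by
    obtain ⟨z, hz⟩ := hne
    exact (csInf_le hbb hz).trans (le_csSup hba hz)
  have hsub1 : Ioo a b ⊆ J := by
    rintro z ⟨hz1, hz2⟩
    obtain ⟨u, hu, hu'⟩ := exists_lt_of_csInf_lt hne hz1
    obtain ⟨v, hv, hv'⟩ := exists_lt_of_lt_csSup hne hz2
    exact hJ.out hu hv ⟨hu'.le, hv'.le⟩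
  have hsub2 : J ⊆ Icc a b := fun z hz => ⟨csInf_le hbb hz, le_csSup hba hz⟩
  have hvol : volume.real J = b - a := by
    have h1 := measureReal_mono (μ := (volume : Measure ℝ)) hsub1
      (ne_top_of_le_ne_top (by simp) (measure_mono hsub2))
    have h2 := measureReal_mono (μ := (volume : Measure ℝ)) hsub2 (by simp)
    simp only [Real.volume_real_Ioo, Real.volume_real_Icc] at h1 h2
    rw [max_eq_left (by linarith)] at h1 h2
    linarith
  set D : Set ℝ → ℝ := fun S => ∑ n ∈ A, S.indicator (fun _ => w n) (x n) with hD
  have Dmono : ∀ S T : Set ℝ, (∀ n ∈ A, x n ∈ S → x n ∈ T) → D S ≤ D T := by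
    intro S T hST
    refine Finset.sum_le_sum fun n hn => ?_
    by_cases h : x n ∈ S
    · simp [h, hST n hn h]
    · by_cases h' : x n ∈ T <;> simp [h, h', hw n hn]
  have Dnn : ∀ S : Set ℝ, 0 ≤ D S := by
    intro S
    refine Finset.sum_nonneg fun n hn => ?_
    by_cases h : x n ∈ S <;> simp [h, hw n hn]
  -- Distribution function with the endpoint removed: compare with the closed one at a point t' < t
  -- with c(t - t') ≤ ε. At t = lo there is no room on the left and positivity is enough.
  have strict : ∀ t ∈ Icc lo hi, |D (Iio t) - c * (t - lo)| ≤ E := by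
    intro t ht
    rw [abs_le]
    constructor
    · refine le_of_forall_pos_le_add fun ε hε => ?_
      by_cases hlt : t = lo
      · have := Dnn (Iio t)
        simp only [hlt, sub_self, mul_zero, sub_zero] at this ⊢
        linarith
      have hlt' : lo < t := lt_of_le_of_ne ht.1 (Ne.symm hlt)
      obtain ⟨t', ht'1, ht'2, ht'3⟩ : ∃ t', lo ≤ t' ∧ t' < t ∧ c * (t - t') ≤ ε := by
        refine ⟨max lo (t - ε / (c + 1)), le_max_left _ _, max_lt hlt' ?_, ?_⟩
        · have : 0 < ε / (c + 1) := by positivity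
          linarith
        · have h1 : t - max lo (t - ε / (c + 1)) ≤ ε / (c + 1) := by
            linarith [le_max_right lo (t - ε / (c + 1))]
          calc c * (t - max lo (t - ε / (c + 1))) ≤ c * (ε / (c + 1)) :=
                mul_le_mul_of_nonneg_left h1 hc
            _ ≤ ε := by
              rw [mul_div_assoc', div_le_iff₀ (by linarith)]
              nlinarith
      have h1 := (abs_le.1 (H t' ⟨ht'1, ht'2.le.trans ht.2⟩)).1
      have h2 : D (Iic t') ≤ D (Iio t) := Dmono _ _ fun n _ h => lt_of_le_of_lt h ht'2
      simp only [hD] at h2 ⊢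
      nlinarith
    · have h1 := (abs_le.1 (H t ht)).2
      have h2 : D (Iio t) ≤ D (Iic t) := Dmono _ _ fun n _ h => le_of_lt (mem_Iio.1 h)
      simp only [hD] at h2 ⊢
      linarith
  have up : D J ≤ D (Iic b) - D (Iio a) := by
    rw [le_sub_iff_add_le, hD]
    simp only
    rw [← Finset.sum_add_distrib]
    refine Finset.sum_le_sum fun n hn => ?_
    have := hw n hn
    by_cases h : x n ∈ J
    · have h1 := hsub2 h
      have h2 : ¬ x n < a := not_lt.2 h1.1
      simp [h, h1.2, h2]
    · by_cases h2 : x n < a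
      · have : x n ≤ b := h2.le.trans hab
        simp [h, h2, this]
      · by_cases h3 : x n ≤ b <;> simp [h, h2, h3, this]
  have down : D (Iio b) - D (Iic a) ≤ D J := by
    rw [sub_le_iff_le_add, hD]
    simp only
    rw [← Finset.sum_add_distrib]
    refine Finset.sum_le_sum fun n hn => ?_
    have := hw n hn
    by_cases h : x n ∈ J
    · by_cases h2 : x n ≤ a <;> by_cases h3 : x n < b <;> simp [h, h2, h3, this]
    · by_cases h3 : x n < b
      · have h4 : x n ≤ a := by
          by_contra h5
          exact h (hsub1 ⟨not_le.1 h5, h3⟩)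
        simp [h, h4, h3]
      · by_cases h4 : x n ≤ a <;> simp [h, h3, h4, this]
  have a1 := abs_le.1 (H a haI)
  have a2 := abs_le.1 (H b hbI)
  have a3 := abs_le.1 (strict a haI)
  have a4 := abs_le.1 (strict b hbI)
  rw [hvol, abs_le]
  simp only [hD] at up down a3 a4
  constructor <;> nlinarith

theorem integral_Icc_succ {k : ℕ} (Φ : (Fin (k + 1) → ℝ) → ℝ) (hΦ : Measurable Φ) {M : ℝ}
    (hM : ∀ t, |Φ t| ≤ M) :
    ∫ t in Icc (0 : Fin (k + 1) → ℝ) 1, Φ t =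
      ∫ t in Icc (0 : Fin k → ℝ) 1, ∫ s in Icc (0 : ℝ) 1, Φ (Fin.cons s t) := by
  have mp := (volume_preserving_piFinSuccAbove (fun _ : Fin (k + 1) => ℝ) 0).symm
  have hpre : (MeasurableEquiv.piFinSuccAbove (fun _ : Fin (k + 1) => ℝ) 0).symm ⁻¹'
      (Icc (0 : Fin (k + 1) → ℝ) 1) = (Icc (0 : ℝ) 1) ×ˢ (Icc (0 : Fin k → ℝ) 1) := by
    ext ⟨s, t⟩
    simp only [mem_preimage, MeasurableEquiv.piFinSuccAbove_symm_apply, mem_Icc, Pi.le_def,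
      Fin.forall_fin_succ, mem_prod, Fin.insertNthEquiv_zero]
    simp [Fin.consEquiv]
    tauto
  have h1 := mp.setIntegral_preimage_emb
    (MeasurableEquiv.measurableEmbedding _) Φ (Icc (0 : Fin (k + 1) → ℝ) 1)
  rw [← h1, hpre]
  have hrw : ∀ z : ℝ × (Fin k → ℝ),
      Φ ((MeasurableEquiv.piFinSuccAbove (fun _ : Fin (k + 1) => ℝ) 0).symm z) =
        Φ (Fin.cons z.1 z.2) := by
    rintro ⟨s, t⟩
    simp [MeasurableEquiv.piFinSuccAbove_symm_apply, Fin.consEquiv]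
  simp_rw [hrw]
  rw [Measure.volume_eq_prod, ← Measure.prod_restrict, integral_prod_symm]
  rw [Measure.prod_restrict]
  refine Measure.integrableOn_of_bounded (M := M) ?_ ?_ (Filter.Eventually.of_forall fun z => hM _)
  · rw [← Measure.volume_eq_prod, ← hpre, mp.measure_preimage_emb
      (MeasurableEquiv.measurableEmbedding _)]
    exact (isCompact_Icc.measure_lt_top).ne
  · have : Measurable fun z : ℝ × (Fin k → ℝ) => Φ (Fin.cons z.1 z.2) := by
      refine hΦ.comp ?_
      refine measurable_pi_lambda _ fun i => ?_
      refine Fin.cases ?_ (fun j => ?_) i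
      · simpa using measurable_fst
      · have := (measurable_pi_apply j).comp (measurable_snd : Measurable
          (Prod.snd : ℝ × (Fin k → ℝ) → (Fin k → ℝ)))
        simpa [Function.comp_def] using this
    exact this.aestronglyMeasurable

/-- Replacing a product of atomic measures by a multiple of Lebesgue measure, one coordinate at a
time. -/
theorem sum_piFinset_sub_integral_le {ι : Type*} [DecidableEq ι] (A : Finset ι) (w x : ι → ℝ)
    (hw : ∀ n ∈ A, 0 ≤ w n) {c K δ : ℝ} (hc : 0 ≤ c) (hcK : c ≤ K) (hA : ∑ n ∈ A, w n ≤ K)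
    (k : ℕ) (Φ : (Fin k → ℝ) → ℝ) (hΦ : Measurable Φ) {M : ℝ} (hM : ∀ t, |Φ t| ≤ M)
    (hδ : ∀ l t, |∑ n ∈ A, w n * Φ (Function.update t l (x n)) -
      c * ∫ s in Icc (0 : ℝ) 1, Φ (Function.update t l s)| ≤ δ) :
    |∑ r ∈ Fintype.piFinset (fun _ : Fin k => A), (∏ i, w (r i)) * Φ (fun i => x (r i)) -
      c ^ k * ∫ t in Icc (0 : Fin k → ℝ) 1, Φ t| ≤ k * K ^ (k - 1) * δ := by
  induction k with
  | zero =>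
    have h0 : Icc (0 : Fin 0 → ℝ) 1 = univ := by
      ext t; simp [Subsingleton.elim t 0, Subsingleton.elim (1 : Fin 0 → ℝ) 0]
    have h1 : ∀ t : Fin 0 → ℝ, Φ t = Φ 0 := fun t => by rw [Subsingleton.elim t 0]
    have h2 : volume.real (univ : Set (Fin 0 → ℝ)) = 1 := by
      simp [measureReal_def, volume_pi]
    rw [h0, setIntegral_univ]
    simp_rw [h1]
    simp [h2]
  | succ k ih =>
    have hK : 0 ≤ K := hc.trans hcK
    have hup0 : ∀ (s u : ℝ) (t : Fin k → ℝ),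
        Function.update (Fin.cons u t : Fin (k + 1) → ℝ) 0 s = Fin.cons s t := by
      intro s u t
      exact Fin.update_cons_zero (α := fun _ => ℝ) u t s
    have hups : ∀ (s u : ℝ) (t : Fin k → ℝ) (l : Fin k),
        Function.update (Fin.cons u t : Fin (k + 1) → ℝ) l.succ s =
          Fin.cons u (Function.update t l s) := by
      intro s u t l
      exact (Fin.cons_update (α := fun _ => ℝ) u t l s).symm
    have hmeas : ∀ u : ℝ, Measurable fun t : Fin k → ℝ => Φ (Fin.cons u t) := by
      intro u
      refine hΦ.comp (measurable_pi_lambda _ fun i => ?_)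
      refine Fin.cases ?_ (fun j => ?_) i
      · simp
      · simpa using measurable_pi_apply j
    have hδ0 : 0 ≤ δ := (abs_nonneg _).trans (hδ 0 0)
    have IH : ∀ u : ℝ, |∑ r ∈ Fintype.piFinset (fun _ : Fin k => A),
        (∏ i, w (r i)) * Φ (Fin.cons u (fun i => x (r i))) -
        c ^ k * ∫ t in Icc (0 : Fin k → ℝ) 1, Φ (Fin.cons u t)| ≤ k * K ^ (k - 1) * δ := by
      intro u
      refine ih (fun t => Φ (Fin.cons u t)) (hmeas u) (fun t => hM _) ?_
      intro l t
      have := hδ l.succ (Fin.cons u t)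
      simpa only [hups] using this
    have hsum : ∑ r ∈ Fintype.piFinset (fun _ : Fin (k + 1) => A),
        (∏ i, w (r i)) * Φ (fun i => x (r i)) =
        ∑ n ∈ A, w n * ∑ r ∈ Fintype.piFinset (fun _ : Fin k => A),
          (∏ i, w (r i)) * Φ (Fin.cons (x n) (fun i => x (r i))) := by
      simp_rw [Finset.mul_sum]
      rw [← Finset.sum_product']
      refine Finset.sum_bij' (fun r _ => (r 0, Fin.tail r)) (fun z _ => Fin.cons z.1 z.2)
        ?_ ?_ ?_ ?_ ?_
      · intro r hr
        rw [Fintype.mem_piFinset] at hr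
        simp only [Finset.mem_product, Fintype.mem_piFinset]
        exact ⟨hr 0, fun i => hr i.succ⟩
      · rintro ⟨n, r⟩ hr
        simp only [Finset.mem_product, Fintype.mem_piFinset] at hr ⊢
        intro i
        refine Fin.cases ?_ (fun j => ?_) i
        · simpa using hr.1
        · simpa using hr.2 j
      · intro r _
        simp
      · rintro ⟨n, r⟩ _
        simp
      · intro r _
        rw [Fin.prod_univ_succ, mul_assoc]
        congr 1
        congr 1
        congr 1
        funext i
        refine Fin.cases ?_ (fun j => ?_) i
        · simp
        · simp [Fin.tail]
    have hInt : ∀ u : ℝ, IntegrableOn (fun t : Fin k → ℝ => Φ (Fin.cons u t)) (Icc 0 1) := by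
      intro u
      exact Measure.integrableOn_of_bounded (M := M) (isCompact_Icc.measure_lt_top).ne
        (hmeas u).aestronglyMeasurable (Filter.Eventually.of_forall fun z => hM _)
    have hint2 : IntegrableOn (fun t : Fin k → ℝ => ∫ s in Icc (0 : ℝ) 1, Φ (Fin.cons s t))
        (Icc 0 1) := by
      have hm2 : Measurable (Function.uncurry fun (t : Fin k → ℝ) (s : ℝ) =>
          Φ (Fin.cons s t)) := by
        refine hΦ.comp (measurable_pi_lambda _ fun i => ?_)
        refine Fin.cases ?_ (fun j => ?_) i
        · simpa using measurable_snd
        · have := (measurable_pi_apply j).comp (measurable_fst : Measurable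
            (Prod.fst : (Fin k → ℝ) × ℝ → (Fin k → ℝ)))
          simpa [Function.comp_def] using this
      refine Measure.integrableOn_of_bounded (M := M) (isCompact_Icc.measure_lt_top).ne
        (hm2.stronglyMeasurable.integral_prod_right).aestronglyMeasurable
        (Filter.Eventually.of_forall fun z => ?_)
      have := norm_setIntegral_le_of_norm_le_const (μ := (volume : Measure ℝ)) (s := Icc (0 : ℝ) 1)
        (C := M) (f := fun s => Φ (Fin.cons s z)) (by simp) (fun s _ => hM _)
      simpa using this
    rw [hsum, integral_Icc_succ Φ hΦ hM]
    set S : ℝ → ℝ := fun u => ∑ r ∈ Fintype.piFinset (fun _ : Fin k => A),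
        (∏ i, w (r i)) * Φ (Fin.cons u (fun i => x (r i))) with hS
    set G : ℝ → ℝ := fun u => ∫ t in Icc (0 : Fin k → ℝ) 1, Φ (Fin.cons u t) with hG
    -- With the first coordinate frozen at an atom, the remaining k coordinates are replaced by the
    -- induction hypothesis; the total mass of the frozen coordinate is at most K.
    have e1 : |∑ n ∈ A, w n * S (x n) - ∑ n ∈ A, w n * (c ^ k * G (x n))| ≤
        K * (k * K ^ (k - 1) * δ) := by
      rw [← Finset.sum_sub_distrib]
      refine (Finset.abs_sum_le_sum_abs _ _).trans ?_
      calc ∑ n ∈ A, |w n * S (x n) - w n * (c ^ k * G (x n))|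
          ≤ ∑ n ∈ A, w n * (k * K ^ (k - 1) * δ) := by
            refine Finset.sum_le_sum fun n hn => ?_
            rw [← mul_sub, abs_mul, abs_of_nonneg (hw n hn)]
            exact mul_le_mul_of_nonneg_left (IH (x n)) (hw n hn)
        _ = (∑ n ∈ A, w n) * (k * K ^ (k - 1) * δ) := by rw [Finset.sum_mul]
        _ ≤ _ := mul_le_mul_of_nonneg_right hA (by positivity)
    -- The first coordinate is replaced under the integral over the other coordinates, where the
    -- bound δ is uniform in t and the cube has volume 1.
    have e2 : |∑ n ∈ A, w n * (c ^ k * G (x n)) -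
        c ^ (k + 1) * ∫ t in Icc (0 : Fin k → ℝ) 1, ∫ s in Icc (0 : ℝ) 1, Φ (Fin.cons s t)| ≤
        K ^ k * δ := by
      have e3 : ∑ n ∈ A, w n * (c ^ k * G (x n)) =
          c ^ k * ∫ t in Icc (0 : Fin k → ℝ) 1, ∑ n ∈ A, w n * Φ (Fin.cons (x n) t) := by
        rw [integral_finsetSum _ (fun n _ => (hInt (x n)).const_mul _), Finset.mul_sum]
        refine Finset.sum_congr rfl fun n _ => ?_
        rw [integral_const_mul]
        ring
      rw [e3, pow_succ, mul_assoc, ← mul_sub, ← integral_const_mul c, abs_mul,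
        abs_of_nonneg (pow_nonneg hc k),
        ← integral_sub (integrable_finsetSum _ (fun n _ => (hInt (x n)).const_mul _))
          (hint2.const_mul c)]
      refine mul_le_mul (pow_le_pow_left₀ hc hcK k) ?_ (abs_nonneg _) (pow_nonneg hK k)
      have := norm_setIntegral_le_of_norm_le_const (μ := (volume : Measure (Fin k → ℝ)))
        (s := Icc (0 : Fin k → ℝ) 1) (C := δ)
        (f := fun t => ∑ n ∈ A, w n * Φ (Fin.cons (x n) t) -
          c * ∫ s in Icc (0 : ℝ) 1, Φ (Fin.cons s t)) (isCompact_Icc.measure_lt_top) (by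
          intro t _
          have := hδ 0 (Fin.cons 0 t)
          simpa only [hup0, Real.norm_eq_abs] using this)
      refine this.trans ?_
      simp [measureReal_def, Real.volume_Icc_pi]
    have : K * (k * K ^ (k - 1) * δ) = k * K ^ k * δ := by
      rcases k with _ | k
      · simp
      · simp only [Nat.add_sub_cancel, pow_succ]; ring
    rw [this] at e1
    have := abs_le.1 e1
    have := abs_le.1 e2
    rw [abs_le]
    push_cast
    constructor <;> linarith

end

section

open Finset

/-! ### Sums over primes -/

/-- The primes up to `n`. -/
def primesTo (n : ℕ) : Finset ℕ := (Icc 1 n).filter Nat.Prime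

theorem mem_primesTo {n p : ℕ} : p ∈ primesTo n ↔ p.Prime ∧ p ≤ n := by
  simp only [primesTo, mem_filter, mem_Icc]
  exact ⟨fun h => ⟨h.2, h.1.2⟩, fun h => ⟨⟨h.1.one_lt.le, h.2⟩, h.1⟩⟩

theorem log_factorial_eq_sum (n : ℕ) :
    Real.log (n.factorial : ℝ) = ∑ p ∈ primesTo n, (n.factorial.factorization p : ℝ) * Real.log p := by
  rw [Real.log_nat_eq_sum_factorization]
  refine Finsupp.sum_of_support_subset _ ?_ _ (by simp)
  intro p hp
  rw [Nat.support_factorization, Nat.mem_primeFactors] at hp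
  exact mem_primesTo.2 ⟨hp.1, (hp.1.dvd_factorial).1 hp.2.1⟩

theorem sum_primesTo_log_le (n : ℕ) : ∑ p ∈ primesTo n, Real.log p ≤ Real.log 4 * n := by
  have := Chebyshev.theta_le_log4_mul_x (x := n) (by positivity)
  rw [Chebyshev.theta_eq_sum_Icc] at this
  refine le_trans (le_of_eq ?_) this
  rw [Nat.floor_natCast]
  refine sum_congr ?_ fun _ _ => rfl
  ext p
  rw [mem_primesTo]
  simp only [mem_filter, mem_Icc]
  exact ⟨fun h => ⟨⟨h.1.pos.le, h.2⟩, h.1⟩, fun h => ⟨h.2, h.1.2⟩⟩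

/-- Since log p ≤ 2 √p and p - 1 ≥ p/2, the terms are at most 4 p^(-3/2). This pays for the
difference between n/(p-1) and n/p in Mertens' theorem. -/
theorem exists_sum_log_div_le : ∃ C : ℝ, 0 ≤ C ∧ ∀ s : Finset ℕ, (∀ p ∈ s, p.Prime) →
    ∑ p ∈ s, Real.log p / ((p : ℝ) * ((p : ℝ) - 1)) ≤ C := by
  have hs : Summable fun n : ℕ => 4 * (1 / (n : ℝ) ^ (3 / 2 : ℝ)) :=
    (Real.summable_one_div_nat_rpow.2 (by norm_num)).mul_left 4
  refine ⟨∑' n : ℕ, 4 * (1 / (n : ℝ) ^ (3 / 2 : ℝ)), tsum_nonneg fun n => by positivity,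
    fun s hp => ?_⟩
  refine le_trans (sum_le_sum fun p hps => ?_) (hs.sum_le_tsum s fun n _ => by positivity)
  have h2 : (2 : ℝ) ≤ p := by exact_mod_cast (hp p hps).two_le
  have h1 : Real.log p ≤ 2 * (p : ℝ) ^ (1 / 2 : ℝ) := by
    have := Real.log_le_rpow_div (x := p) (ε := 1 / 2) (by linarith) (by norm_num)
    linarith
  have h3 : (p : ℝ) ^ (3 / 2 : ℝ) * (p : ℝ) ^ (1 / 2 : ℝ) = p ^ 2 := by
    rw [← Real.rpow_add (by linarith), ← Real.rpow_natCast]; norm_num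
  have h4 : 0 < (p : ℝ) ^ (3 / 2 : ℝ) := by positivity
  have h5 : 0 < (p : ℝ) ^ (1 / 2 : ℝ) := by positivity
  rw [div_le_iff₀ (by nlinarith), mul_one_div, div_mul_eq_mul_div, le_div_iff₀ h4]
  nlinarith

/-- Mertens' first theorem. -/
theorem exists_mertens_first : ∃ C : ℝ, 0 ≤ C ∧ ∀ x : ℝ, 1 ≤ x →
    |∑ p ∈ primesTo ⌊x⌋₊, Real.log p / p - Real.log x| ≤ C := by
  obtain ⟨C₀, hC₀, hs⟩ := exists_sum_log_div_le
  refine ⟨C₀ + 1 + Real.log 4, by positivity, fun x hx => ?_⟩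
  set n := ⌊x⌋₊ with hn
  have hn1 : 1 ≤ n := Nat.le_floor (by exact_mod_cast hx)
  have hnR : (1 : ℝ) ≤ n := by exact_mod_cast hn1
  have hnx : (n : ℝ) ≤ x := Nat.floor_le (by linarith)
  have hxn : x ≤ 2 * n := by linarith [(Nat.lt_floor_add_one x).le]
  have hlog1 : Real.log n ≤ Real.log x := Real.log_le_log (by linarith) hnx
  have hlog2 : Real.log x ≤ Real.log 2 + Real.log n := by
    rw [← Real.log_mul (by norm_num) (by linarith)]
    exact Real.log_le_log (by linarith) hxn
  have hl4 : Real.log 4 = 2 * Real.log 2 := by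
    rw [show (4 : ℝ) = 2 ^ 2 by norm_num, Real.log_pow]; norm_num
  have hl2 : Real.log 2 ≤ 1 := by linarith [Real.log_two_lt_d9]
  have hl2' : 0 ≤ Real.log 2 := Real.log_nonneg (by norm_num)
  have hfac1 : Real.log (n.factorial : ℝ) ≤ n * Real.log n := by
    rw [← Real.log_pow]
    exact Real.log_le_log (by exact_mod_cast n.factorial_pos) (by exact_mod_cast Nat.factorial_le_pow n)
  have hfac2 : n * Real.log n - n ≤ Real.log (n.factorial : ℝ) := by
    have := Stirling.le_log_factorial_stirling (n := n) (by omega)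
    have h1 : 0 ≤ Real.log n := Real.log_nonneg hnR
    have h2 : 0 ≤ Real.log (2 * Real.pi) := Real.log_nonneg (by linarith [Real.pi_gt_three])
    linarith
  rw [log_factorial_eq_sum] at hfac1 hfac2
  -- The exponent of p in n! is at least ⌊n/p⌋ > n/p - 1; the loss ∑ log p is controlled by
  -- Chebyshev's bound θ(n) ≤ n log 4.
  have up : n * ∑ p ∈ primesTo n, Real.log p / p ≤ n * Real.log n + Real.log 4 * n := by
    have : ∑ p ∈ primesTo n, ((n : ℝ) / p - 1) * Real.log p ≤
        ∑ p ∈ primesTo n, (n.factorial.factorization p : ℝ) * Real.log p := by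
      refine sum_le_sum fun p hp => ?_
      have hp' := mem_primesTo.1 hp
      refine mul_le_mul_of_nonneg_right ?_ (Real.log_nonneg (by exact_mod_cast hp'.1.one_lt.le))
      have h1 : n / p ≤ n.factorial.factorization p := by
        rw [Nat.factorization_factorial hp'.1 (Nat.lt_succ_self (Nat.log p n))]
        have : 1 ∈ Finset.Ico 1 (Nat.log p n).succ := by
          rw [Finset.mem_Ico]
          exact ⟨le_rfl, Nat.succ_lt_succ (Nat.log_pos hp'.1.one_lt hp'.2)⟩
        simpa using Finset.single_le_sum (f := fun i => n / p ^ i) (fun i _ => Nat.zero_le _) this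
      have h2 : (n : ℝ) / p < (n / p : ℕ) + 1 := by
        rw [← Nat.floor_div_eq_div (K := ℝ)]
        exact Nat.lt_floor_add_one _
      have h3 : ((n / p : ℕ) : ℝ) ≤ n.factorial.factorization p := by exact_mod_cast h1
      linarith
    have e : ∑ p ∈ primesTo n, ((n : ℝ) / p - 1) * Real.log p =
        n * (∑ p ∈ primesTo n, Real.log p / p) - ∑ p ∈ primesTo n, Real.log p := by
      rw [mul_sum, ← sum_sub_distrib]
      exact sum_congr rfl fun p _ => by ring
    have := sum_primesTo_log_le n
    linarith
  -- The exponent of p in n! is at most n/(p-1) = n/p + n/(p(p-1)), and the second part sums to at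
  -- most n C₀.
  have down : n * Real.log n - n ≤ n * ∑ p ∈ primesTo n, Real.log p / p + n * C₀ := by
    have h1 : ∑ p ∈ primesTo n, (n.factorial.factorization p : ℝ) * Real.log p ≤
        ∑ p ∈ primesTo n, (n * (Real.log p / p) +
          n * (Real.log p / ((p : ℝ) * ((p : ℝ) - 1)))) := by
      refine sum_le_sum fun p hp => ?_
      have hp' := mem_primesTo.1 hp
      have hp2 : (2 : ℝ) ≤ p := by exact_mod_cast hp'.1.two_le
      have hl : 0 ≤ Real.log p := Real.log_nonneg (by linarith)
      have h1 : (n.factorial.factorization p : ℝ) ≤ (n : ℝ) / (p - 1) := by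
        have h := Nat.factorization_factorial_le_div_pred hp'.1 n
        have h' : ((n.factorial.factorization p : ℕ) : ℝ) ≤ ((n / (p - 1) : ℕ) : ℝ) := by
          exact_mod_cast h
        refine h'.trans (Nat.cast_div_le.trans (le_of_eq ?_))
        rw [Nat.cast_sub hp'.1.one_lt.le, Nat.cast_one]
      have h2 : (n : ℝ) * (Real.log p / p) + n * (Real.log p / ((p : ℝ) * ((p : ℝ) - 1))) =
          (n : ℝ) / (p - 1) * Real.log p := by
        have : (p : ℝ) - 1 ≠ 0 := by linarith
        field_simp
        ring
      rw [h2]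
      exact mul_le_mul_of_nonneg_right h1 hl
    rw [sum_add_distrib, ← mul_sum, ← mul_sum] at h1
    have h2 := hs (primesTo n) fun p hp => (mem_primesTo.1 hp).1
    have h3 := mul_le_mul_of_nonneg_left h2 (by positivity : (0 : ℝ) ≤ n)
    linarith
  have up' : ∑ p ∈ primesTo n, Real.log p / p ≤ Real.log n + Real.log 4 := by
    have : (n : ℝ) * ∑ p ∈ primesTo n, Real.log p / p ≤ n * (Real.log n + Real.log 4) := by linarith
    exact le_of_mul_le_mul_left this (by linarith)
  have down' : Real.log n - 1 - C₀ ≤ ∑ p ∈ primesTo n, Real.log p / p := by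
    have : (n : ℝ) * (Real.log n - 1 - C₀) ≤ n * ∑ p ∈ primesTo n, Real.log p / p := by linarith
    exact le_of_mul_le_mul_left this (by linarith)
  rw [abs_le]
  constructor <;> linarith

/-- A weak form of the divergence rate of the sum of the reciprocals of the primes. -/
theorem exists_sum_inv_primes_le : ∃ C : ℝ, 0 ≤ C ∧ ∀ x : ℝ, Real.exp 1 ≤ x →
    ∑ p ∈ primesTo ⌊x⌋₊, (1 : ℝ) / p ≤ C * Real.sqrt (Real.log x) := by
  obtain ⟨C₀, hC₀, hm⟩ := exists_mertens_first
  refine ⟨3 + C₀, by positivity, fun x hx => ?_⟩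
  have he : (1 : ℝ) ≤ Real.exp 1 := Real.one_le_exp (by norm_num)
  have hx1 : 1 ≤ x := he.trans hx
  have hl1 : 1 ≤ Real.log x := by
    rw [Real.le_log_iff_exp_le (by linarith)]; exact hx
  -- Splitting point: below exp(s) the primes are bounded by the harmonic sum 1 + s; above it 1/p ≤
  -- (log p / p)/s, and Mertens gives (s² + C₀)/s.
  set s := Real.sqrt (Real.log x) with hs
  have hs1 : 1 ≤ s := Real.one_le_sqrt.2 hl1
  have hss : s * s = Real.log x := Real.mul_self_sqrt (by linarith)
  have key : ∀ p ∈ primesTo ⌊x⌋₊, (1 : ℝ) / p ≤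
      (if p ∈ Icc 1 ⌊Real.exp s⌋₊ then (1 : ℝ) / p else 0) + (Real.log p / p) / s := by
    intro p hp
    have hp' := mem_primesTo.1 hp
    have hp1 : (1 : ℝ) ≤ p := by exact_mod_cast hp'.1.one_lt.le
    have hl : 0 ≤ Real.log p := Real.log_nonneg hp1
    by_cases h : p ∈ Icc 1 ⌊Real.exp s⌋₊
    · rw [if_pos h]
      have : 0 ≤ (Real.log p / p) / s := by positivity
      linarith
    · rw [if_neg h, zero_add, div_right_comm]
      refine div_le_div_of_nonneg_right ?_ (by linarith)
      rw [le_div_iff₀ (by linarith), one_mul]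
      rw [mem_Icc, not_and, not_le] at h
      have h1 := Nat.lt_of_floor_lt (h hp'.1.one_lt.le)
      rw [Real.le_log_iff_exp_le (by linarith)]
      exact h1.le
  refine (sum_le_sum key).trans ?_
  rw [sum_add_distrib, ← sum_div, ← sum_filter]
  have a1 : ∑ p ∈ (primesTo ⌊x⌋₊).filter (fun p => p ∈ Icc 1 ⌊Real.exp s⌋₊), (1 : ℝ) / p ≤
      1 + s := by
    calc _ ≤ ∑ p ∈ Icc 1 ⌊Real.exp s⌋₊, (1 : ℝ) / p := by
          refine sum_le_sum_of_subset_of_nonneg ?_ fun _ _ _ => by positivity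
          intro p hp
          exact (mem_filter.1 hp).2
      _ = (harmonic ⌊Real.exp s⌋₊ : ℝ) := by
          rw [harmonic_eq_sum_Icc]
          push_cast
          simp
      _ ≤ 1 + Real.log (Real.exp s) :=
          harmonic_floor_le_one_add_log _ (Real.one_le_exp (by linarith))
      _ = 1 + s := by rw [Real.log_exp]
  have a2 := (abs_le.1 (hm x hx1)).2
  have a3 : (∑ p ∈ primesTo ⌊x⌋₊, Real.log p / p) / s ≤ s + C₀ := by
    rw [div_le_iff₀ (by linarith)]
    nlinarith
  nlinarith

/-! ### Harmonic sums over integers free of a set of primes -/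

/-- `∑_{n ≤ x} 1/n` over the `n` that no prime of `P` divides. -/
noncomputable def siftedHarmonic (P : Finset ℕ) (x : ℝ) : ℝ :=
  ∑ n ∈ (Icc 1 ⌊x⌋₊).filter (fun n => ∀ p ∈ P, ¬ p ∣ n), (1 : ℝ) / n

/-- Legendre's recursion. The multiples of the new prime q that survive P are the q n' with n' ≤ x/q
surviving P, because no prime of P divides q. -/
theorem siftedHarmonic_insert {P : Finset ℕ} (hP : ∀ p ∈ P, p.Prime) {q : ℕ} (hq : q.Prime)
    (hqP : q ∉ P) (x : ℝ) :
    siftedHarmonic (insert q P) x = siftedHarmonic P x - 1 / q * siftedHarmonic P (x / q) := by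
  rw [eq_sub_iff_add_eq]
  have e : 1 / (q : ℝ) * siftedHarmonic P (x / q) =
      ∑ n ∈ ((Icc 1 ⌊x⌋₊).filter (fun n => ∀ p ∈ P, ¬ p ∣ n)).filter (fun n => q ∣ n),
        (1 : ℝ) / n := by
    rw [siftedHarmonic, mul_sum]
    refine sum_bij' (fun n _ => q * n) (fun n _ => n / q) ?_ ?_ ?_ ?_ ?_
    · intro n hn
      simp only [mem_filter, mem_Icc, dvd_mul_right, and_true] at hn ⊢
      refine ⟨⟨Nat.mul_pos hq.pos hn.1.1, ?_⟩, ?_⟩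
      · have h := hn.1.2
        rw [Nat.floor_div_natCast, Nat.le_div_iff_mul_le hq.pos] at h
        linarith
      · intro p hp hd
        rcases ((hP p hp).dvd_mul).1 hd with h | h
        · exact hqP (((Nat.prime_dvd_prime_iff_eq (hP p hp) hq).1 h) ▸ hp)
        · exact hn.2 p hp h
    · intro n hn
      simp only [mem_filter, mem_Icc] at hn ⊢
      obtain ⟨m, rfl⟩ := hn.2
      rw [Nat.mul_div_cancel_left _ hq.pos]
      refine ⟨⟨Nat.pos_of_ne_zero ?_, ?_⟩, fun p hp hd => hn.1.2 p hp (hd.mul_left q)⟩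
      · rintro rfl
        simp at hn
      · rw [Nat.floor_div_natCast, Nat.le_div_iff_mul_le hq.pos]
        linarith [hn.1.1.2]
    · intro n _
      exact Nat.mul_div_cancel_left _ hq.pos
    · intro n hn
      exact Nat.mul_div_cancel' (mem_filter.1 hn).2
    · intro n _
      push_cast
      rw [one_div_mul_one_div]
  rw [e, siftedHarmonic, siftedHarmonic,
    ← sum_filter_add_sum_filter_not ((Icc 1 ⌊x⌋₊).filter (fun n => ∀ p ∈ P, ¬ p ∣ n))
      (fun n => q ∣ n), add_comm]
  congr 1
  refine sum_congr ?_ fun _ _ => rfl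
  ext n
  simp only [mem_filter, forall_mem_insert]
  tauto

/-- Induction on P through Legendre's recursion. The positive part of the logarithm makes the
formula valid for x < 1 as well, which the recursion reaches through x/q. Adding q turns an error 2W
into at most 2W + W + 1 ≤ 4W ≤ 2qW. -/
theorem abs_siftedHarmonic_sub_le (P : Finset ℕ) (hP : ∀ p ∈ P, p.Prime) (x : ℝ) (hx : 0 ≤ x) :
    |siftedHarmonic P x - (∏ p ∈ P, (1 - 1 / (p : ℝ))) * max (Real.log x) 0| ≤
      2 * ∏ p ∈ P, (p : ℝ) := by
  induction P using Finset.induction_on generalizing x with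
  | empty =>
    have e : siftedHarmonic ∅ x = harmonic ⌊x⌋₊ := by
      rw [harmonic_eq_sum_Icc, siftedHarmonic]
      push_cast
      simp
    rw [e, prod_empty, prod_empty, one_mul, mul_one]
    rcases lt_or_ge x 1 with h | h
    · rw [Nat.floor_eq_zero.2 h, max_eq_right (Real.log_nonpos hx h.le)]
      simp
    · rw [max_eq_left (Real.log_nonneg h)]
      have h1 := log_le_harmonic_floor x hx
      have h2 := harmonic_floor_le_one_add_log x h
      rw [abs_le]; constructor <;> linarith
  | insert q P hqP ih =>
    have hq : q.Prime := hP q (mem_insert_self _ _)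
    have hP' : ∀ p ∈ P, p.Prime := fun p hp => hP p (mem_insert_of_mem hp)
    have hq2 : (2 : ℝ) ≤ q := by exact_mod_cast hq.two_le
    rw [siftedHarmonic_insert hP' hq hqP, prod_insert hqP, prod_insert hqP]
    have i1 := abs_le.1 (ih hP' x hx)
    have i2 := abs_le.1 (ih hP' (x / q) (by positivity))
    set ρ := ∏ p ∈ P, (1 - 1 / (p : ℝ)) with hρ
    set W := ∏ p ∈ P, (p : ℝ) with hW
    have hρ0 : 0 ≤ ρ := prod_nonneg fun p hp => by
      have : (1 : ℝ) ≤ p := by exact_mod_cast (hP' p hp).one_lt.le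
      rw [sub_nonneg, div_le_one (by linarith)]; exact this
    have hρ1 : ρ ≤ 1 := prod_le_one (fun p hp => by
      have : (1 : ℝ) ≤ p := by exact_mod_cast (hP' p hp).one_lt.le
      rw [sub_nonneg, div_le_one (by linarith)]; exact this) fun p hp => by
        have : 0 ≤ 1 / (p : ℝ) := by positivity
        linarith
    have hW1 : 1 ≤ W := by
      have : (1 : ℝ) = ∏ p ∈ P, (1 : ℝ) := by simp
      rw [this]
      exact prod_le_prod (fun _ _ => by norm_num) fun p hp => by
        exact_mod_cast (hP' p hp).one_lt.le
    have hlq : 0 ≤ Real.log q := Real.log_nonneg (by linarith)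
    have hlq' : Real.log q ≤ q - 1 := Real.log_le_sub_one_of_pos (by linarith)
    have m1 : max (Real.log (x / q)) 0 ≤ max (Real.log x) 0 := by
      rcases hx.eq_or_lt with rfl | h
      · simp
      · rw [Real.log_div h.ne' (by linarith)]
        exact max_le_max (by linarith) le_rfl
    have m2 : max (Real.log x) 0 ≤ max (Real.log (x / q)) 0 + Real.log q := by
      rcases hx.eq_or_lt with rfl | h
      · simpa using hlq
      · rw [Real.log_div h.ne' (by linarith)]
        refine max_le ?_ ?_
        · linarith [le_max_left (Real.log x - Real.log q) 0]
        · linarith [le_max_right (Real.log x - Real.log q) 0]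
    set a := max (Real.log x) 0
    set b := max (Real.log (x / q)) 0
    set S := siftedHarmonic P x
    set T := siftedHarmonic P (x / q)
    set u : ℝ := 1 / q with hu
    have hu0 : 0 < u := by positivity
    have hu1 : u ≤ 1 / 2 := by rw [hu]; exact one_div_le_one_div_of_le (by norm_num) hq2
    have huq : u * q = 1 := by rw [hu]; field_simp
    have hb : 0 ≤ ρ * (a - b) ∧ ρ * (a - b) ≤ q := by
      refine ⟨mul_nonneg hρ0 (by linarith), ?_⟩
      calc ρ * (a - b) ≤ 1 * q := mul_le_mul hρ1 (by linarith) (by linarith) (by norm_num)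
        _ = q := one_mul _
    have e : S - u * T - (1 - u) * ρ * a = (S - ρ * a) - u * (T - ρ * b) + u * (ρ * (a - b)) := by
      ring
    rw [e]
    have c1 : u * (T - ρ * b) ≤ u * (2 * W) := mul_le_mul_of_nonneg_left i2.2 hu0.le
    have c2 : u * (-(2 * W)) ≤ u * (T - ρ * b) := mul_le_mul_of_nonneg_left i2.1 hu0.le
    have c3 : u * (ρ * (a - b)) ≤ 1 := by
      rw [← huq]; exact mul_le_mul_of_nonneg_left hb.2 hu0.le
    have c4 : 0 ≤ u * (ρ * (a - b)) := mul_nonneg hu0.le hb.1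
    have c5 : u * (2 * W) ≤ W := by nlinarith
    have c6 : 2 * W ≤ q * W := mul_le_mul_of_nonneg_right hq2 (by linarith)
    rw [abs_le]
    constructor <;> linarith

theorem sum_sifted_interval_le (P : Finset ℕ) (hP : ∀ p ∈ P, p.Prime) {X Y : ℝ} (hX : 0 < X)
    (hXY : X ≤ Y) :
    ∑ n ∈ (Icc 1 ⌊Y⌋₊).filter (fun n => (∀ p ∈ P, ¬ p ∣ n) ∧ X ≤ n), (1 : ℝ) / n ≤
      (∏ p ∈ P, (1 - 1 / (p : ℝ))) * Real.log (Y / X) + 5 * ∏ p ∈ P, (p : ℝ) := by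
  have hY : 0 < Y := hX.trans_le hXY
  have i1 := (abs_le.1 (abs_siftedHarmonic_sub_le P hP Y hY.le)).2
  have i2 := (abs_le.1 (abs_siftedHarmonic_sub_le P hP (X / 2) (by positivity))).1
  set ρ := ∏ p ∈ P, (1 - 1 / (p : ℝ)) with hρ
  set W := ∏ p ∈ P, (p : ℝ) with hW
  have hpos : ∀ p ∈ P, 0 ≤ 1 - 1 / (p : ℝ) := fun p hp => by
    have : (1 : ℝ) ≤ p := by exact_mod_cast (hP p hp).one_lt.le
    rw [sub_nonneg, div_le_one (by linarith)]; exact this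
  have hρ0 : 0 ≤ ρ := prod_nonneg hpos
  have hρ1 : ρ ≤ 1 := prod_le_one hpos fun p hp => by
    have : 0 ≤ 1 / (p : ℝ) := by positivity
    linarith
  have hW1 : 1 ≤ W := by
    have : (1 : ℝ) = ∏ p ∈ P, (1 : ℝ) := by simp
    rw [this]
    exact prod_le_prod (fun _ _ => by norm_num) fun p hp => by
      exact_mod_cast (hP p hp).one_lt.le
  have hlog : Real.log (Y / X) = Real.log Y - Real.log X := Real.log_div hY.ne' hX.ne'
  have hlXY : Real.log X ≤ Real.log Y := Real.log_le_log hX hXY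
  -- The lower end is included, so the initial segment to subtract must stop strictly below X;
  -- stopping at X/2 costs only log 2 ≤ 1.
  have hdec : ∑ n ∈ (Icc 1 ⌊Y⌋₊).filter (fun n => (∀ p ∈ P, ¬ p ∣ n) ∧ X ≤ n), (1 : ℝ) / n +
      siftedHarmonic P (X / 2) ≤ siftedHarmonic P Y := by
    rw [siftedHarmonic, ← sum_union]
    · refine sum_le_sum_of_subset_of_nonneg ?_ fun _ _ _ => by positivity
      intro n hn
      simp only [mem_union, mem_filter, mem_Icc] at hn ⊢
      rcases hn with hn | hn
      · exact ⟨hn.1, hn.2.1⟩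
      · exact ⟨⟨hn.1.1, hn.1.2.trans (Nat.floor_le_floor (by linarith))⟩, hn.2⟩
    · rw [disjoint_left]
      intro n hn hn'
      simp only [mem_filter, mem_Icc] at hn hn'
      have := (Nat.le_floor_iff (by positivity)).1 hn'.1.2
      linarith [hn.2.2]
  have hmax : Real.log X - 1 ≤ max (Real.log (X / 2)) 0 := by
    rw [Real.log_div hX.ne' (by norm_num)]
    linarith [le_max_left (Real.log X - Real.log 2) 0, Real.log_two_lt_d9]
  rw [hlog]
  rcases le_total Y 1 with h | h
  · rw [max_eq_right (Real.log_nonpos hY.le h)] at i1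
    have : 0 ≤ siftedHarmonic P (X / 2) := sum_nonneg fun _ _ => by positivity
    have := mul_nonneg hρ0 (sub_nonneg.2 hlXY)
    linarith
  · rw [max_eq_left (Real.log_nonneg h)] at i1
    have := mul_le_mul_of_nonneg_left hmax hρ0
    linarith

end

/-! ### Multiplicative majorants of the diagonal weights -/

section

open Finset

/-- `(1/n) ∏_{q ∣ n} (1 + 6/q)`, a majorant of `n/φ(n)²`. -/
noncomputable def majorant (n : ℕ) : ℝ := 1 / n * ∏ q ∈ n.primeFactors, (1 + 6 / (q : ℝ))

theorem one_div_le_majorant (n : ℕ) : 1 / (n : ℝ) ≤ majorant n := by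
  rw [majorant]
  refine le_mul_of_one_le_right (by positivity) ?_
  have : (1 : ℝ) = ∏ p ∈ n.primeFactors, (1 : ℝ) := by simp
  rw [this]
  refine prod_le_prod (fun _ _ => by norm_num) fun p _ => ?_
  have : 0 ≤ 6 / (p : ℝ) := by positivity
  simpa using this

theorem majorant_nonneg (n : ℕ) : 0 ≤ majorant n :=
  le_trans (by positivity) (one_div_le_majorant n)

theorem sum_inv_sq_le {D : ℝ} (hD : 1 ≤ D) (s : Finset ℕ) (hs : ∀ q ∈ s, D ≤ q) :
    ∑ q ∈ s, 1 / (q : ℝ) ^ 2 ≤ 2 / D := by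
  set m := ⌈D⌉₊ with hm
  have hm1 : 1 ≤ m := Nat.one_le_ceil_iff.2 (by linarith)
  have h1 : s ⊆ Ioo (m - 1) (s.sup id + 1) := by
    intro q hq
    rw [mem_Ioo]
    have h2 : m ≤ q := Nat.ceil_le.2 (hs q hq)
    have h3 : q ≤ s.sup id := le_sup (f := id) hq
    omega
  calc ∑ q ∈ s, 1 / (q : ℝ) ^ 2 ≤ ∑ q ∈ Ioo (m - 1) (s.sup id + 1), 1 / (q : ℝ) ^ 2 :=
        sum_le_sum_of_subset_of_nonneg h1 fun _ _ _ => by positivity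
    _ = ∑ q ∈ Ioo (m - 1) (s.sup id + 1), ((q : ℝ) ^ 2)⁻¹ := by simp
    _ ≤ 2 / ((m - 1 : ℕ) + 1) := sum_Ioo_inv_sq_le _ _
    _ = 2 / m := by rw [Nat.cast_sub hm1]; simp
    _ ≤ 2 / D := by
        refine div_le_div_of_nonneg_left (by norm_num) (by linarith) (Nat.le_ceil D)

theorem prod_one_add_inv_sq_le {D a : ℝ} (hD : 1 ≤ D) (ha : 0 ≤ a) (s : Finset ℕ)
    (hs : ∀ q ∈ s, D ≤ q) :
    ∏ q ∈ s, (1 + a / (q : ℝ) ^ 2) ≤ Real.exp (2 * a / D) := by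
  calc ∏ q ∈ s, (1 + a / (q : ℝ) ^ 2) ≤ ∏ q ∈ s, Real.exp (a / (q : ℝ) ^ 2) :=
        prod_le_prod (fun _ _ => by positivity) fun q _ => by
          rw [add_comm]; exact Real.add_one_le_exp _
    _ = Real.exp (∑ q ∈ s, a / (q : ℝ) ^ 2) := by rw [Real.exp_sum]
    _ ≤ _ := by
        refine Real.exp_le_exp.2 ?_
        have := mul_le_mul_of_nonneg_left (sum_inv_sq_le hD s hs) ha
        rw [mul_sum] at this
        calc ∑ q ∈ s, a / (q : ℝ) ^ 2 = ∑ q ∈ s, a * (1 / (q : ℝ) ^ 2) :=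
              sum_congr rfl fun _ _ => by ring
          _ ≤ _ := this
          _ = _ := by ring

/-- Expand the product over q ∣ n into subsets s of the primes outside P. For fixed s, the n
divisible by d = ∏ s are d times sifted integers in [X/d, Y/d], and the sifted bound U depends only
on Y/X. Each s contributes at most ∏ 6/q² times U, and ∏ (1 + 6/q²) ≤ exp(12/D) because q ≥ D. -/
theorem sum_majorant_interval_le (P : Finset ℕ) (hP : ∀ p ∈ P, p.Prime) {D : ℝ} (hD : 1 ≤ D)
    (hPD : ∀ q : ℕ, q.Prime → q ∉ P → D ≤ q) {X Y : ℝ} (hX : 0 < X) (hXY : X ≤ Y) :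
    ∑ n ∈ (Icc 1 ⌊Y⌋₊).filter (fun n => (∀ p ∈ P, ¬ p ∣ n) ∧ X ≤ n), majorant n ≤
      Real.exp (12 / D) * ((∏ p ∈ P, (1 - 1 / (p : ℝ))) * Real.log (Y / X) +
        5 * ∏ p ∈ P, (p : ℝ)) := by
  set A := (Icc 1 ⌊Y⌋₊).filter (fun n => (∀ p ∈ P, ¬ p ∣ n) ∧ X ≤ n) with hA
  set U := (∏ p ∈ P, (1 - 1 / (p : ℝ))) * Real.log (Y / X) + 5 * ∏ p ∈ P, (p : ℝ) with hU
  set Q := (primesTo ⌊Y⌋₊).filter (fun q => q ∉ P) with hQ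
  have hQp : ∀ q ∈ Q, q.Prime := fun q hq => (mem_primesTo.1 (mem_filter.1 hq).1).1
  have hQP : ∀ q ∈ Q, q ∉ P := fun q hq => (mem_filter.1 hq).2
  have hsub : ∀ n ∈ A, n.primeFactors ⊆ Q := by
    intro n hn q hq
    simp only [hA, mem_filter, mem_Icc] at hn
    rw [Nat.mem_primeFactors] at hq
    refine mem_filter.2 ⟨mem_primesTo.2 ⟨hq.1, (Nat.le_of_dvd hn.1.1 hq.2.1).trans hn.1.2⟩, ?_⟩
    exact fun h => hn.2.1 q h hq.2.1
  have step : ∀ n ∈ A, majorant n =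
      ∑ s ∈ Q.powerset, if s ⊆ n.primeFactors then (∏ q ∈ s, 6 / (q : ℝ)) * (1 / n) else 0 := by
    intro n hn
    rw [majorant, prod_one_add, ← sum_filter, mul_sum]
    have : Q.powerset.filter (fun s => s ⊆ n.primeFactors) = n.primeFactors.powerset := by
      ext s
      simp only [mem_filter, mem_powerset]
      exact ⟨fun h => h.2, fun h => ⟨h.trans (hsub n hn), h⟩⟩
    rw [this]
    exact sum_congr rfl fun _ _ => by ring
  rw [sum_congr rfl step, sum_comm]
  have inner : ∀ s ∈ Q.powerset,
      ∑ n ∈ A, (if s ⊆ n.primeFactors then (∏ q ∈ s, 6 / (q : ℝ)) * (1 / (n : ℝ)) else 0) ≤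
        (∏ q ∈ s, 6 / (q : ℝ) ^ 2) * U := by
    intro s hs
    rw [mem_powerset] at hs
    set d := ∏ q ∈ s, q with hd
    have hd0 : 0 < d := prod_pos fun q hq => (hQp q (hs hq)).pos
    have hdR : (0 : ℝ) < d := by exact_mod_cast hd0
    rw [← sum_filter, ← mul_sum]
    have hdiv : ∀ n ∈ A, s ⊆ n.primeFactors → d ∣ n := by
      intro n _ h
      refine (prod_dvd_prod_of_subset _ _ _ h).trans (Nat.prod_primeFactors_dvd n)
    have h1 : ∑ n ∈ A.filter (fun n => s ⊆ n.primeFactors), 1 / (n : ℝ) ≤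
        ∑ m ∈ (Icc 1 ⌊Y / d⌋₊).filter (fun n => (∀ p ∈ P, ¬ p ∣ n) ∧ X / d ≤ n),
          1 / (d : ℝ) * (1 / (m : ℝ)) := by
      have hinj : Set.InjOn (fun n => n / d)
          (A.filter (fun n => s ⊆ n.primeFactors) : Set ℕ) := by
        intro a ha b hb hab
        simp only [coe_filter, Set.mem_ofPred_eq] at ha hb
        obtain ⟨a', rfl⟩ := hdiv a ha.1 ha.2
        obtain ⟨b', rfl⟩ := hdiv b hb.1 hb.2
        simp only [Nat.mul_div_cancel_left _ hd0] at hab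
        rw [hab]
      have himg : (A.filter (fun n => s ⊆ n.primeFactors)).image (fun n => n / d) ⊆
          (Icc 1 ⌊Y / d⌋₊).filter (fun n => (∀ p ∈ P, ¬ p ∣ n) ∧ X / d ≤ n) := by
        intro m hm
        obtain ⟨n, hn, rfl⟩ := mem_image.1 hm
        have hn' := mem_filter.1 hn
        obtain ⟨b, rfl⟩ := hdiv n hn'.1 hn'.2
        have hA' := hn'.1
        simp only [hA, mem_filter, mem_Icc] at hA'
        simp only [mem_filter, mem_Icc, Nat.mul_div_cancel_left _ hd0]
        refine ⟨⟨Nat.pos_of_ne_zero ?_, ?_⟩, fun p hp h => hA'.2.1 p hp (h.mul_left d), ?_⟩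
        · rintro rfl
          simp at hA'
        · rw [Nat.floor_div_natCast, Nat.le_div_iff_mul_le hd0]
          linarith [hA'.1.2]
        · rw [div_le_iff₀ hdR]
          have := hA'.2.2
          push_cast at this
          linarith
      refine le_trans (le_of_eq ?_) (sum_le_sum_of_subset_of_nonneg himg
        fun _ _ _ => by positivity)
      rw [sum_image hinj]
      refine sum_congr rfl fun n hn => ?_
      obtain ⟨b, rfl⟩ := hdiv n (mem_filter.1 hn).1 (mem_filter.1 hn).2
      rw [Nat.mul_div_cancel_left _ hd0, one_div_mul_one_div]
      push_cast
      rfl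
    have h2 := sum_sifted_interval_le P hP (X := X / d) (Y := Y / d) (by positivity)
      (div_le_div_of_nonneg_right hXY hdR.le)
    rw [div_div_div_cancel_right₀ hdR.ne', ← hU] at h2
    rw [← mul_sum] at h1
    have h3 : (∏ q ∈ s, 6 / (q : ℝ) ^ 2) = (∏ q ∈ s, 6 / (q : ℝ)) * (1 / d) := by
      rw [hd]
      push_cast
      rw [one_div, ← prod_inv_distrib, ← prod_mul_distrib]
      refine prod_congr rfl fun q hq => ?_
      have : (q : ℝ) ≠ 0 := by exact_mod_cast (hQp q (hs hq)).ne_zero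
      field_simp
    rw [h3, mul_assoc]
    refine mul_le_mul_of_nonneg_left (h1.trans ?_) (prod_nonneg fun _ _ => by positivity)
    exact mul_le_mul_of_nonneg_left h2 (by positivity)
  have hU0 : 0 ≤ U := by
    have h1 : 0 ≤ ∑ n ∈ (Icc 1 ⌊Y⌋₊).filter (fun n => (∀ p ∈ P, ¬ p ∣ n) ∧ X ≤ n), (1 : ℝ) / n :=
      sum_nonneg fun _ _ => by positivity
    exact h1.trans (sum_sifted_interval_le P hP hX hXY)
  refine (sum_le_sum inner).trans ?_
  rw [← sum_mul, ← prod_one_add]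
  refine mul_le_mul_of_nonneg_right ?_ hU0
  have := prod_one_add_inv_sq_le hD (a := 6) (by norm_num) Q
    fun q hq => hPD q (hQp q hq) (hQP q hq)
  refine this.trans (le_of_eq ?_)
  norm_num

end

section

open Finset

/-! ### The Selberg quadratic form in `k` dimensions -/

/-- The tuples whose product divides `m`. -/
def divTuples (k m : ℕ) : Finset (Fin k → ℕ) :=
  (Fintype.piFinset fun _ : Fin k => m.divisors).filter fun r => ∏ i, r i ∣ m

theorem mem_divTuples {k m : ℕ} (hm : m ≠ 0) {r : Fin k → ℕ} :
    r ∈ divTuples k m ↔ ∏ i, r i ∣ m := by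
  simp only [divTuples, mem_filter, Fintype.mem_piFinset, Nat.mem_divisors]
  exact ⟨fun h => h.2, fun h => ⟨fun i => ⟨(dvd_prod_of_mem r (mem_univ i)).trans h, hm⟩, h⟩⟩

theorem divTuples_one (k : ℕ) : divTuples k 1 = {fun _ => 1} := by
  ext r
  rw [mem_divTuples one_ne_zero, mem_singleton, Nat.dvd_one, prod_eq_one_iff]
  exact ⟨fun h => funext fun i => h i (mem_univ i), fun h i _ => by rw [h]⟩

/-- The tuple `r` with its `i`-th entry multiplied by `q`. -/
def mulAt {k : ℕ} (q : ℕ) (i : Fin k) (r : Fin k → ℕ) : Fin k → ℕ :=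
  Function.update r i (r i * q)

@[simp] theorem mulAt_same {k : ℕ} (q : ℕ) (i : Fin k) (r : Fin k → ℕ) :
    mulAt q i r i = r i * q := by simp [mulAt]

theorem mulAt_of_ne {k : ℕ} (q : ℕ) {i l : Fin k} (h : l ≠ i) (r : Fin k → ℕ) :
    mulAt q i r l = r l := by simp [mulAt, h]

theorem prod_mulAt {k : ℕ} {M : Type*} [CommMonoid M] (f : ℕ → M) (q : ℕ) (i : Fin k)
    (r : Fin k → ℕ) (h : f (r i * q) = f (r i) * f q) :
    ∏ l, f (mulAt q i r l) = (∏ l, f (r l)) * f q := by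
  rw [← mul_prod_erase univ _ (mem_univ i), ← mul_prod_erase univ (fun l => f (r l)) (mem_univ i),
    mulAt_same, h, prod_congr rfl fun l hl => by rw [mulAt_of_ne q (ne_of_mem_erase hl)]]
  rw [mul_assoc, mul_assoc, mul_comm (f q)]

theorem not_dvd_of_mem_divTuples {k m q : ℕ} (hm : m ≠ 0) (hqm : ¬ q ∣ m) {r : Fin k → ℕ}
    (hr : r ∈ divTuples k m) (i : Fin k) : ¬ q ∣ r i := fun h =>
  hqm ((h.trans (dvd_prod_of_mem r (mem_univ i))).trans ((mem_divTuples hm).1 hr))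

theorem mulAt_injective {k q : ℕ} (hq : q ≠ 0) (i : Fin k) : Function.Injective (mulAt q i) := by
  intro r s h
  funext l
  have := congrFun h l
  by_cases hl : l = i
  · subst hl
    simpa [hq] using this
  · rwa [mulAt_of_ne q hl, mulAt_of_ne q hl] at this

theorem divTuples_mul {k m q : ℕ} (hm : m ≠ 0) (hq : q.Prime) :
    divTuples k (q * m) =
      divTuples k m ∪ univ.biUnion fun i => (divTuples k m).image (mulAt q i) := by
  have hqm0 : q * m ≠ 0 := mul_ne_zero hq.ne_zero hm
  ext r
  simp only [mem_union, mem_biUnion, mem_univ, true_and, mem_image, mem_divTuples hm,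
    mem_divTuples hqm0]
  constructor
  · intro h
    by_cases hqr : q ∣ ∏ i, r i
    · right
      obtain ⟨i, _, hi⟩ := (Prime.dvd_finsetProd_iff hq.prime _).1 hqr
      obtain ⟨c, hc⟩ := hi
      refine ⟨i, Function.update r i c, ?_, ?_⟩
      · have e : mulAt q i (Function.update r i c) = r := by
          funext l
          by_cases hl : l = i
          · subst hl; simp [hc, mul_comm]
          · simp [mulAt_of_ne, hl]
        have h2 := prod_mulAt (fun n => n) q i (Function.update r i c) rfl
        rw [e] at h2
        rw [h2, mul_comm] at h
        exact Nat.dvd_of_mul_dvd_mul_left hq.pos h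
      · funext l
        by_cases hl : l = i
        · subst hl; simp [hc, mul_comm]
        · simp [mulAt_of_ne, hl]
    · left
      exact (Nat.Coprime.dvd_of_dvd_mul_left
        ((Nat.Prime.coprime_iff_not_dvd hq).2 hqr).symm h)
  · rintro (h | ⟨i, s, hs, rfl⟩)
    · exact h.mul_left q
    · rw [prod_mulAt (fun n => n) q i s rfl, mul_comm]
      exact Nat.mul_dvd_mul_left q hs

/-- A tuple whose product divides qm, with q ∤ m, contains q in no coordinate or in exactly one. All
inductions on the primes of the modulus rest on this splitting. -/
theorem sum_divTuples_mul {k m q : ℕ} {M : Type*} [AddCommMonoid M] (hm : m ≠ 0) (hq : q.Prime)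
    (hqm : ¬ q ∣ m) (G : (Fin k → ℕ) → M) :
    ∑ r ∈ divTuples k (q * m), G r =
      ∑ r ∈ divTuples k m, G r + ∑ i, ∑ r ∈ divTuples k m, G (mulAt q i r) := by
  rw [divTuples_mul hm hq, sum_union, sum_biUnion]
  · congr 1
    refine sum_congr rfl fun i _ => ?_
    rw [sum_image fun _ _ _ _ h => mulAt_injective hq.ne_zero i h]
  · intro i _ l _ hil
    rw [Function.onFun, disjoint_left]
    intro r hr hr'
    obtain ⟨s, hs, rfl⟩ := mem_image.1 hr
    obtain ⟨t, ht, e⟩ := mem_image.1 hr'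
    have := congrFun e i
    rw [mulAt_same, mulAt_of_ne q hil] at this
    exact not_dvd_of_mem_divTuples hm hqm ht i ⟨s i, by rw [this, mul_comm]⟩
  · rw [disjoint_left]
    intro r hr hr'
    obtain ⟨i, _, hi⟩ := mem_biUnion.1 hr'
    obtain ⟨s, hs, rfl⟩ := mem_image.1 hi
    exact not_dvd_of_mem_divTuples hm hqm hr i ⟨s i, by rw [mulAt_same, mul_comm]⟩

noncomputable section

/-- The density of the integers `n` with `d_i ∣ L_i(n)` and `e_i ∣ L_i(n)` for all `i`. -/
def pairDensity {k : ℕ} (d e : Fin k → ℕ) : ℝ :=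
  open scoped Classical in
  if Squarefree (∏ i, (d i).lcm (e i)) then 1 / ((∏ i, (d i).lcm (e i) : ℕ) : ℝ) else 0

theorem pairDensity_comm {k : ℕ} (d e : Fin k → ℕ) : pairDensity d e = pairDensity e d := by
  simp only [pairDensity, Nat.lcm_comm]

theorem lcm_mul_of_not_dvd {a b q : ℕ} (hq : q.Prime) (hb : ¬ q ∣ b) :
    (a * q).lcm b = a.lcm b * q := by
  have hc : Nat.Coprime q b := (Nat.Prime.coprime_iff_not_dvd hq).2 hb
  have hg : (a * q).gcd b = a.gcd b := Nat.Coprime.gcd_mul_right_cancel a hc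
  rcases Nat.eq_zero_or_pos (a.gcd b) with h | h
  · rw [Nat.gcd_eq_zero_iff] at h
    simp [h.1]
  · rw [Nat.lcm, Nat.lcm, hg, Nat.div_mul_right_comm (Dvd.dvd.mul_right (Nat.gcd_dvd_left a b) b)]
    congr 1
    ring

theorem not_dvd_lcm {a b q : ℕ} (hq : q.Prime) (ha : ¬ q ∣ a) (hb : ¬ q ∣ b) :
    ¬ q ∣ a.lcm b := fun h => by
  have := h.trans (Nat.lcm_dvd_mul a b)
  rcases (hq.dvd_mul).1 this with h | h
  · exact ha h
  · exact hb h

theorem pairDensity_of_eq_mulAt {k q : ℕ} (hq : q.Prime) (i : Fin k) {d e d' e' : Fin k → ℕ}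
    (hd : ∀ l, ¬ q ∣ d l) (he : ∀ l, ¬ q ∣ e l)
    (h : (fun l => (d' l).lcm (e' l)) = mulAt q i fun l => (d l).lcm (e l)) :
    pairDensity d' e' = 1 / q * pairDensity d e := by
  have h1 : ∏ l, (d' l).lcm (e' l) = (∏ l, (d l).lcm (e l)) * q := by
    have := prod_mulAt (fun n => n) q i (fun l => (d l).lcm (e l)) rfl
    rw [← h] at this
    exact this
  have h2 : ¬ q ∣ ∏ l, (d l).lcm (e l) := by
    intro h
    obtain ⟨l, _, hl⟩ := (Prime.dvd_finsetProd_iff hq.prime _).1 h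
    exact not_dvd_lcm hq (hd l) (he l) hl
  have h3 : Squarefree (∏ l, (d' l).lcm (e' l)) ↔ Squarefree (∏ l, (d l).lcm (e l)) := by
    rw [h1, Nat.squarefree_mul ((Nat.Prime.coprime_iff_not_dvd hq).2 h2).symm]
    exact ⟨fun h => h.1, fun h => ⟨h, hq.prime.squarefree⟩⟩
  simp only [pairDensity]
  rw [h1] at h3 ⊢
  by_cases hs : Squarefree (∏ l, (d l).lcm (e l))
  · rw [if_pos hs, if_pos (h3.2 hs), Nat.cast_mul, one_div_mul_one_div, mul_comm]
  · rw [if_neg hs, if_neg fun h => hs (h3.1 h), mul_zero]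

theorem pairDensity_mulAt_left {k q : ℕ} (hq : q.Prime) (i : Fin k) {d e : Fin k → ℕ}
    (hd : ∀ l, ¬ q ∣ d l) (he : ∀ l, ¬ q ∣ e l) :
    pairDensity (mulAt q i d) e = 1 / q * pairDensity d e := by
  refine pairDensity_of_eq_mulAt hq i hd he (funext fun l => ?_)
  by_cases hl : l = i
  · subst hl
    rw [mulAt_same, mulAt_same, lcm_mul_of_not_dvd hq (he l)]
  · rw [mulAt_of_ne q hl, mulAt_of_ne q hl]

theorem pairDensity_mulAt_both {k q : ℕ} (hq : q.Prime) (i : Fin k) {d e : Fin k → ℕ}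
    (hd : ∀ l, ¬ q ∣ d l) (he : ∀ l, ¬ q ∣ e l) :
    pairDensity (mulAt q i d) (mulAt q i e) = 1 / q * pairDensity d e := by
  refine pairDensity_of_eq_mulAt hq i hd he (funext fun l => ?_)
  by_cases hl : l = i
  · subst hl
    rw [mulAt_same, mulAt_same, mulAt_same, Nat.lcm_mul_right]
  · rw [mulAt_of_ne q hl, mulAt_of_ne q hl, mulAt_of_ne q hl]

/-- Here q divides the least common multiples at two coordinates, so their product is not
squarefree. It mirrors the fact that no prime of the modulus divides two of the forms at the same n.
-/
theorem pairDensity_mulAt_ne {k q : ℕ} (hq : q.Prime) {i l : Fin k} (hil : i ≠ l)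
    (d e : Fin k → ℕ) : pairDensity (mulAt q i d) (mulAt q l e) = 0 := by
  rw [pairDensity, if_neg]
  intro h
  have h1 : q ∣ (mulAt q i d i).lcm (mulAt q l e i) :=
    (Dvd.intro_left _ (mulAt_same q i d).symm).trans (Nat.dvd_lcm_left _ _)
  have h2 : q ∣ (mulAt q i d l).lcm (mulAt q l e l) :=
    (Dvd.intro_left _ (mulAt_same q l e).symm).trans (Nat.dvd_lcm_right _ _)
  have h3 : q * q ∣ ∏ j, (mulAt q i d j).lcm (mulAt q l e j) := by
    rw [← mul_prod_erase univ _ (mem_univ i)]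
    exact mul_dvd_mul h1 (h2.trans (dvd_prod_of_mem (fun j => (mulAt q i d j).lcm (mulAt q l e j))
      (mem_erase.2 ⟨hil.symm, mem_univ l⟩)))
  exact hq.one_lt.ne' (Nat.isUnit_iff.1 (h q h3))

/-- The quadratic form with matrix `pairDensity`, as a bilinear form. -/
def selbergForm (k m : ℕ) (a b : (Fin k → ℕ) → ℝ) : ℝ :=
  ∑ d ∈ divTuples k m, ∑ e ∈ divTuples k m, a d * b e * pairDensity d e

/-- `selbergForm` as a bundled bilinear map. -/
def selbergBilin (k m : ℕ) : ((Fin k → ℕ) → ℝ) →ₗ[ℝ] ((Fin k → ℕ) → ℝ) →ₗ[ℝ] ℝ :=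
  LinearMap.mk₂ ℝ (selbergForm k m)
    (by intro a b c; simp [selbergForm, add_mul, sum_add_distrib])
    (by intro t a b; simp [selbergForm, mul_assoc, mul_sum])
    (by intro a b c; simp [selbergForm, add_mul, mul_add, sum_add_distrib])
    (by intro t a b; simp [selbergForm, mul_assoc, mul_sum, mul_left_comm])

theorem selbergBilin_apply (k m : ℕ) (a b : (Fin k → ℕ) → ℝ) :
    selbergBilin k m a b = selbergForm k m a b := rfl

theorem selbergForm_congr {k m : ℕ} {a b a' b' : (Fin k → ℕ) → ℝ}
    (ha : ∀ d ∈ divTuples k m, a d = a' d) (hb : ∀ d ∈ divTuples k m, b d = b' d) :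
    selbergForm k m a b = selbergForm k m a' b' :=
  sum_congr rfl fun d hd => sum_congr rfl fun e he => by rw [ha d hd, hb e he]

/-- Let a_i be the part of a with q in coordinate i. By the divisor splitting the form is (a,a) +
(2/q) ∑ (a,a_i) + (1/q) ∑ (a_i,a_i), the products of different a_i, a_l having density zero.
Completing the square isolates a + (1/q) ∑ a_i, which for Selberg weights is the weight attached to
the smaller modulus. -/
theorem selbergForm_mul {k m q : ℕ} (hm : m ≠ 0) (hq : q.Prime) (hqm : ¬ q ∣ m)
    (a : (Fin k → ℕ) → ℝ) :
    selbergForm k (q * m) a a =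
      selbergForm k m (a + (1 / (q : ℝ)) • ∑ i, a ∘ mulAt q i)
          (a + (1 / (q : ℝ)) • ∑ i, a ∘ mulAt q i) +
        1 / q * ∑ i, selbergForm k m (a ∘ mulAt q i) (a ∘ mulAt q i) -
        1 / (q : ℝ) ^ 2 * selbergForm k m (∑ i, a ∘ mulAt q i) (∑ i, a ∘ mulAt q i) := by
  have h1 : selbergForm k (q * m) a a = selbergForm k m a a +
      1 / q * ∑ i, selbergForm k m a (a ∘ mulAt q i) +
      1 / q * ∑ i, selbergForm k m (a ∘ mulAt q i) a +
      1 / q * ∑ i, selbergForm k m (a ∘ mulAt q i) (a ∘ mulAt q i) := by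
    have nd : ∀ d ∈ divTuples k m, ∀ l, ¬ q ∣ d l := fun d hd l =>
      not_dvd_of_mem_divTuples hm hqm hd l
    rw [selbergForm, sum_divTuples_mul hm hq hqm]
    simp_rw [sum_divTuples_mul hm hq hqm]
    simp_rw [sum_add_distrib]
    rw [show selbergForm k m a a = ∑ d ∈ divTuples k m, ∑ e ∈ divTuples k m,
      a d * a e * pairDensity d e from rfl, add_assoc, add_assoc, add_assoc]
    congr 1
    congr 1
    · rw [sum_comm, mul_sum]
      refine sum_congr rfl fun i _ => ?_
      rw [selbergForm, mul_sum]
      refine sum_congr rfl fun d hd => ?_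
      rw [mul_sum]
      refine sum_congr rfl fun e he => ?_
      rw [pairDensity_comm, pairDensity_mulAt_left hq i (nd e he) (nd d hd), pairDensity_comm]
      simp only [Function.comp_apply]
      ring
    · congr 1
      · rw [mul_sum]
        refine sum_congr rfl fun i _ => ?_
        rw [selbergForm, mul_sum]
        refine sum_congr rfl fun d hd => ?_
        rw [mul_sum]
        refine sum_congr rfl fun e he => ?_
        rw [pairDensity_mulAt_left hq i (nd d hd) (nd e he)]
        simp only [Function.comp_apply]
        ring
      · rw [mul_sum]
        refine sum_congr rfl fun i _ => ?_
        rw [selbergForm, mul_sum]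
        refine sum_congr rfl fun d hd => ?_
        rw [sum_eq_single i, mul_sum]
        · refine sum_congr rfl fun e he => ?_
          rw [pairDensity_mulAt_both hq i (nd d hd) (nd e he)]
          simp only [Function.comp_apply]
          ring
        · intro l _ hl
          refine sum_eq_zero fun e _ => ?_
          rw [pairDensity_mulAt_ne hq hl.symm, mul_zero]
        · simp
  have h2 : ∑ i, selbergForm k m a (a ∘ mulAt q i) = selbergForm k m a (∑ i, a ∘ mulAt q i) := by
    simp only [← selbergBilin_apply, map_sum]
  have h3 : ∑ i, selbergForm k m (a ∘ mulAt q i) a = selbergForm k m (∑ i, a ∘ mulAt q i) a := by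
    simp only [← selbergBilin_apply, map_sum, LinearMap.sum_apply]
  rw [h1, h2, h3]
  generalize ∑ i, a ∘ mulAt q i = u
  simp only [← selbergBilin_apply, map_add, map_smul, LinearMap.add_apply,
    LinearMap.smul_apply, smul_eq_mul]
  ring

/-- Cauchy-Schwarz for a positive semidefinite form, obtained by summing the form at x_i - x_l over
all pairs. -/
theorem selbergForm_sum_le {k m : ℕ} (hnn : ∀ a, 0 ≤ selbergForm k m a a)
    (x : Fin k → (Fin k → ℕ) → ℝ) :
    selbergForm k m (∑ i, x i) (∑ i, x i) ≤ k * ∑ i, selbergForm k m (x i) (x i) := by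
  have h : 0 ≤ ∑ i, ∑ l, selbergForm k m (x i - x l) (x i - x l) :=
    sum_nonneg fun i _ => sum_nonneg fun l _ => hnn _
  have e : ∑ i, ∑ l, selbergForm k m (x i - x l) (x i - x l) =
      2 * (k * ∑ i, selbergForm k m (x i) (x i)) -
        2 * selbergForm k m (∑ i, x i) (∑ i, x i) := by
    simp only [← selbergBilin_apply, map_sub, map_sum, LinearMap.sub_apply, LinearMap.sum_apply,
      sum_sub_distrib, sum_const, card_univ, Fintype.card_fin, nsmul_eq_mul, ← mul_sum]
    rw [sum_comm (f := fun i l => selbergBilin k m (x l) (x i))]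
    ring
  linarith

theorem selbergForm_one (k : ℕ) (a : (Fin k → ℕ) → ℝ) :
    selbergForm k 1 a a = a (fun _ => 1) ^ 2 := by
  simp [selbergForm, divTuples_one, pairDensity, sq]

/-- Induction on the primes of m. The negative term of `selbergForm_mul` is at most (k/q²) ∑ by
Cauchy-Schwarz, which k ≤ q makes no larger than the positive term (1/q) ∑. -/
theorem selbergForm_nonneg {k m : ℕ} (hm : Squarefree m)
    (hmk : ∀ q : ℕ, q.Prime → q ∣ m → k ≤ q) (a : (Fin k → ℕ) → ℝ) : 0 ≤ selbergForm k m a a := by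
  induction m using induction_on_primes generalizing a with
  | zero => simp at hm
  | one => rw [selbergForm_one]; positivity
  | prime_mul q m hq ih =>
    have hm' : Squarefree m := hm.of_mul_right
    have hm0 : m ≠ 0 := hm'.ne_zero
    have hqm : ¬ q ∣ m := fun h =>
      hq.one_lt.ne' (Nat.isUnit_iff.1 (hm q (Nat.mul_dvd_mul_left q h)))
    have IH := ih hm' fun p hp h => hmk p hp (h.mul_left q)
    rw [selbergForm_mul hm0 hq hqm]
    have h1 := IH (a + (1 / (q : ℝ)) • ∑ i, a ∘ mulAt q i)
    have h2 := selbergForm_sum_le IH fun i => a ∘ mulAt q i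
    have h3 : 0 ≤ ∑ i, selbergForm k m (a ∘ mulAt q i) (a ∘ mulAt q i) :=
      sum_nonneg fun i _ => IH _
    have hq0 : (0 : ℝ) < q := by exact_mod_cast hq.pos
    have hkq : (k : ℝ) ≤ q := by exact_mod_cast hmk q hq (dvd_mul_right q m)
    have h4 : 1 / (q : ℝ) ^ 2 * selbergForm k m (∑ i, a ∘ mulAt q i) (∑ i, a ∘ mulAt q i) ≤
        1 / q * ∑ i, selbergForm k m (a ∘ mulAt q i) (a ∘ mulAt q i) := by
      rw [div_mul_eq_mul_div, div_mul_eq_mul_div, one_mul, one_mul, div_le_div_iff₀ (by positivity) hq0]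
      nlinarith [mul_le_mul_of_nonneg_right hkq h3]
    linarith

/-- The weights `λ` attached to `y`. -/
def lambdaOf (k m : ℕ) (y : (Fin k → ℕ) → ℝ) (d : Fin k → ℕ) : ℝ :=
  (∏ i, ((ArithmeticFunction.moebius (d i) : ℤ) : ℝ) * (d i : ℝ)) *
    ∑ r ∈ (divTuples k m).filter (fun r => ∀ i, d i ∣ r i),
      y r / ∏ i, (Nat.totient (r i) : ℝ)

theorem lambdaOf_add (k m : ℕ) (y z : (Fin k → ℕ) → ℝ) :
    lambdaOf k m (y + z) = lambdaOf k m y + lambdaOf k m z := by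
  funext d
  simp [lambdaOf, add_div, sum_add_distrib, mul_add]

theorem lambdaOf_smul (k m : ℕ) (t : ℝ) (y : (Fin k → ℕ) → ℝ) :
    lambdaOf k m (t • y) = t • lambdaOf k m y := by
  funext d
  simp only [lambdaOf, Pi.smul_apply, smul_eq_mul, mul_div_assoc, ← mul_sum]
  ring

/-- `lambdaOf` as a linear map. -/
def lambdaLin (k m : ℕ) : ((Fin k → ℕ) → ℝ) →ₗ[ℝ] ((Fin k → ℕ) → ℝ) where
  toFun := lambdaOf k m
  map_add' := lambdaOf_add k m
  map_smul' := lambdaOf_smul k m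

theorem lambdaLin_apply (k m : ℕ) (y : (Fin k → ℕ) → ℝ) :
    lambdaLin k m y = lambdaOf k m y := rfl

theorem prod_totient_mulAt {k q : ℕ} (hq : q.Prime) (i : Fin k) {r : Fin k → ℕ}
    (hr : ¬ q ∣ r i) :
    ∏ l, (Nat.totient (mulAt q i r l) : ℝ) = (∏ l, (Nat.totient (r l) : ℝ)) * ((q : ℝ) - 1) := by
  rw [prod_mulAt (fun n => (Nat.totient n : ℝ)), Nat.totient_prime hq,
    Nat.cast_sub hq.one_lt.le, Nat.cast_one]
  rw [Nat.totient_mul ((Nat.Prime.coprime_iff_not_dvd hq).2 hr).symm, Nat.cast_mul]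

/-- For d prime to q the multiples r of d split by whether and where r contains q; a factor q
contributes φ(q) = q - 1 to the denominator. -/
theorem lambdaOf_mul_of_mem {k m q : ℕ} (hm : m ≠ 0) (hq : q.Prime) (hqm : ¬ q ∣ m)
    (y : (Fin k → ℕ) → ℝ) {d : Fin k → ℕ} (hd : d ∈ divTuples k m) :
    lambdaOf k (q * m) y d =
      lambdaOf k m y d + 1 / ((q : ℝ) - 1) * ∑ i, lambdaOf k m (y ∘ mulAt q i) d := by
  have nd : ∀ d ∈ divTuples k m, ∀ l, ¬ q ∣ d l := fun d hd l =>
    not_dvd_of_mem_divTuples hm hqm hd l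
  simp only [lambdaOf, sum_filter]
  rw [sum_divTuples_mul hm hq hqm, mul_add, mul_sum (s := univ), mul_sum (s := univ)]
  congr 1
  refine sum_congr rfl fun i _ => ?_
  rw [mul_left_comm]
  congr 1
  rw [mul_sum]
  refine sum_congr rfl fun r hr => ?_
  have hiff : (∀ l, d l ∣ mulAt q i r l) ↔ ∀ l, d l ∣ r l := by
    refine forall_congr' fun l => ?_
    by_cases hl : l = i
    · subst hl
      rw [mulAt_same]
      exact Nat.Coprime.dvd_mul_right ((Nat.Prime.coprime_iff_not_dvd hq).2 (nd d hd l)).symm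
    · rw [mulAt_of_ne q hl]
  by_cases h : ∀ l, d l ∣ r l
  · rw [if_pos h, if_pos (hiff.2 h), prod_totient_mulAt hq i (nd r hr i), one_div_mul_eq_div,
      div_div, Function.comp_apply]
  · rw [if_neg h, if_neg fun h' => h (hiff.1 h'), mul_zero]

/-- If q occurs in coordinate i of d it must occur in coordinate i of every multiple r, so only one
class of the splitting survives. The factor is μ(q) q / φ(q). -/
theorem lambdaOf_mul_mulAt {k m q : ℕ} (hm : m ≠ 0) (hq : q.Prime) (hqm : ¬ q ∣ m)
    (y : (Fin k → ℕ) → ℝ) (i : Fin k) {d : Fin k → ℕ} (hd : d ∈ divTuples k m) :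
    lambdaOf k (q * m) y (mulAt q i d) =
      -((q : ℝ) / ((q : ℝ) - 1)) * lambdaOf k m (y ∘ mulAt q i) d := by
  have nd : ∀ d ∈ divTuples k m, ∀ l, ¬ q ∣ d l := fun d hd l =>
    not_dvd_of_mem_divTuples hm hqm hd l
  simp only [lambdaOf, sum_filter]
  rw [sum_divTuples_mul hm hq hqm,
    prod_mulAt (fun n => ((ArithmeticFunction.moebius n : ℤ) : ℝ) * (n : ℝ))]
  swap
  · rw [ArithmeticFunction.isMultiplicative_moebius.map_mul_of_coprime
      ((Nat.Prime.coprime_iff_not_dvd hq).2 (nd d hd i)).symm]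
    push_cast
    ring
  have z1 : ∑ r ∈ divTuples k m, (if ∀ l, mulAt q i d l ∣ r l then
      y r / ∏ l, (Nat.totient (r l) : ℝ) else 0) = 0 := by
    refine sum_eq_zero fun r hr => if_neg fun h => nd r hr i ?_
    exact (Dvd.intro_left _ (mulAt_same q i d).symm).trans (h i)
  rw [z1, zero_add, sum_eq_single i]
  · rw [ArithmeticFunction.moebius_apply_prime hq]
    have : -((q : ℝ) / ((q : ℝ) - 1)) * ((∏ l, ((ArithmeticFunction.moebius (d l) : ℤ) : ℝ) * (d l : ℝ)) *
        ∑ r ∈ divTuples k m, if ∀ l, d l ∣ r l then (y ∘ mulAt q i) r / ∏ l, (Nat.totient (r l) : ℝ)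
          else 0) = (∏ l, ((ArithmeticFunction.moebius (d l) : ℤ) : ℝ) * (d l : ℝ)) *
          (((-1 : ℤ) : ℝ) * q) * (1 / ((q : ℝ) - 1) * ∑ r ∈ divTuples k m, if ∀ l, d l ∣ r l then (y ∘ mulAt q i) r / ∏ l, (Nat.totient (r l) : ℝ)
          else 0) := by
      push_cast
      ring
    rw [this]
    congr 1
    rw [mul_sum]
    refine sum_congr rfl fun r hr => ?_
    have hiff : (∀ l, mulAt q i d l ∣ mulAt q i r l) ↔ ∀ l, d l ∣ r l := by
      refine forall_congr' fun l => ?_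
      by_cases hl : l = i
      · subst hl
        rw [mulAt_same, mulAt_same]
        exact Nat.mul_dvd_mul_iff_right hq.pos
      · rw [mulAt_of_ne q hl, mulAt_of_ne q hl]
    by_cases h : ∀ l, d l ∣ r l
    · rw [if_pos h, if_pos (hiff.2 h), prod_totient_mulAt hq i (nd r hr i), one_div_mul_eq_div,
        div_div, Function.comp_apply]
    · rw [if_neg h, if_neg fun h' => h (hiff.1 h'), mul_zero]
  · intro l _ hl
    refine sum_eq_zero fun r hr => if_neg fun h => nd r hr i ?_
    have := h i
    rw [mulAt_of_ne q hl.symm] at this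
    exact (Dvd.intro_left _ (mulAt_same q i d).symm).trans this
  · simp

/-- One step of the diagonalisation. -/
theorem selbergForm_lambdaOf_mul {k m q : ℕ} (hm : m ≠ 0) (hq : q.Prime) (hqm : ¬ q ∣ m)
    (y : (Fin k → ℕ) → ℝ) :
    selbergForm k (q * m) (lambdaOf k (q * m) y) (lambdaOf k (q * m) y) =
      selbergForm k m (lambdaOf k m y) (lambdaOf k m y) +
        q / ((q : ℝ) - 1) ^ 2 * ∑ i, selbergForm k m (lambdaOf k m (y ∘ mulAt q i))
          (lambdaOf k m (y ∘ mulAt q i)) -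
        1 / ((q : ℝ) - 1) ^ 2 * selbergForm k m (∑ i, lambdaOf k m (y ∘ mulAt q i))
          (∑ i, lambdaOf k m (y ∘ mulAt q i)) := by
  have hq1 : (q : ℝ) - 1 ≠ 0 := by
    have : (1 : ℝ) < q := by exact_mod_cast hq.one_lt
    linarith
  have hq0 : (q : ℝ) ≠ 0 := by exact_mod_cast hq.ne_zero
  rw [selbergForm_mul hm hq hqm]
  have e0 : ∀ i, ∀ d ∈ divTuples k m, (lambdaOf k (q * m) y ∘ mulAt q i) d =
      ((-((q : ℝ) / ((q : ℝ) - 1))) • lambdaOf k m (y ∘ mulAt q i)) d := fun i d hd =>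
    lambdaOf_mul_mulAt hm hq hqm y i hd
  -- The completed square collapses: the sum over i enters with 1/(q-1) from the first recursion and
  -- with -(1/q) q/(q-1) from the second.
  have e1 : ∀ d ∈ divTuples k m,
      (lambdaOf k (q * m) y + (1 / (q : ℝ)) • ∑ i, lambdaOf k (q * m) y ∘ mulAt q i) d =
        lambdaOf k m y d := by
    intro d hd
    simp only [Pi.add_apply, Pi.smul_apply, Finset.sum_apply, smul_eq_mul]
    rw [lambdaOf_mul_of_mem hm hq hqm y hd, sum_congr rfl fun i _ => e0 i d hd]
    simp only [Pi.smul_apply, smul_eq_mul, ← mul_sum]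
    field_simp
    ring
  have e2 : ∀ d ∈ divTuples k m, (∑ i, lambdaOf k (q * m) y ∘ mulAt q i) d =
      ((-((q : ℝ) / ((q : ℝ) - 1))) • ∑ i, lambdaOf k m (y ∘ mulAt q i)) d := by
    intro d hd
    rw [smul_sum, Finset.sum_apply, Finset.sum_apply]
    exact sum_congr rfl fun i _ => e0 i d hd
  rw [selbergForm_congr e1 e1, selbergForm_congr e2 e2,
    sum_congr rfl fun i _ => selbergForm_congr (e0 i) (e0 i)]
  simp only [← selbergBilin_apply, map_smul, LinearMap.smul_apply, smul_eq_mul]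
  simp only [← mul_sum]
  field_simp

/-- Upper weights `∏ r_i / φ(r_i)²`. -/
def upperWeight {k : ℕ} (r : Fin k → ℕ) : ℝ := ∏ i, (r i : ℝ) / (Nat.totient (r i) : ℝ) ^ 2

/-- Lower weights `∏ (1/r_i) ∏_{q ∣ r_i} (1 - k/q)`. -/
def lowerWeight {k : ℕ} (r : Fin k → ℕ) : ℝ :=
  ∏ i, (1 / (r i : ℝ) * ∏ q ∈ (r i).primeFactors, (1 - (k : ℝ) / q))

theorem upperWeight_mulAt {k q : ℕ} (hq : q.Prime) (i : Fin k) {r : Fin k → ℕ}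
    (hr : ¬ q ∣ r i) : upperWeight (mulAt q i r) = q / ((q : ℝ) - 1) ^ 2 * upperWeight r := by
  rw [upperWeight, prod_mulAt (fun n => (n : ℝ) / (Nat.totient n : ℝ) ^ 2), Nat.totient_prime hq,
    Nat.cast_sub hq.one_lt.le, Nat.cast_one, upperWeight, mul_comm]
  rw [Nat.totient_mul ((Nat.Prime.coprime_iff_not_dvd hq).2 hr).symm, Nat.cast_mul, Nat.cast_mul,
    mul_pow, mul_div_mul_comm]

theorem lowerWeight_mulAt {k q : ℕ} (hq : q.Prime) (i : Fin k) {r : Fin k → ℕ}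
    (hr : ¬ q ∣ r i) :
    lowerWeight (mulAt q i r) = 1 / (q : ℝ) * (1 - k / q) * lowerWeight r := by
  rw [lowerWeight, prod_mulAt (fun n => 1 / (n : ℝ) * ∏ q ∈ n.primeFactors, (1 - (k : ℝ) / q)),
    hq.primeFactors, prod_singleton, lowerWeight, mul_comm]
  have hc := ((Nat.Prime.coprime_iff_not_dvd hq).2 hr).symm
  rw [hc.primeFactors_mul, prod_union hc.disjoint_primeFactors, Nat.cast_mul,
    ← one_div_mul_one_div, hq.primeFactors, prod_singleton]
  ring

/-- The last term in the one-prime identity is minus a nonnegative number and may be dropped. What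
remains is diagonal, with weight q/(q-1)² for each prime q of r. -/
theorem selbergForm_le {k m : ℕ} (hm : Squarefree m) (hmk : ∀ q : ℕ, q.Prime → q ∣ m → k ≤ q)
    (y : (Fin k → ℕ) → ℝ) :
    selbergForm k m (lambdaOf k m y) (lambdaOf k m y) ≤
      ∑ r ∈ divTuples k m, upperWeight r * y r ^ 2 := by
  induction m using induction_on_primes generalizing y with
  | zero => simp at hm
  | one => simp [selbergForm_one, divTuples_one, upperWeight, lambdaOf]
  | prime_mul q m hq ih =>
    have hm' : Squarefree m := hm.of_mul_right
    have hm0 : m ≠ 0 := hm'.ne_zero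
    have hqm : ¬ q ∣ m := fun h =>
      hq.one_lt.ne' (Nat.isUnit_iff.1 (hm q (Nat.mul_dvd_mul_left q h)))
    have hmk' : ∀ p : ℕ, p.Prime → p ∣ m → k ≤ p := fun p hp h => hmk p hp (h.mul_left q)
    have IH := ih hm' hmk'
    have nd : ∀ d ∈ divTuples k m, ∀ l, ¬ q ∣ d l := fun d hd l =>
      not_dvd_of_mem_divTuples hm0 hqm hd l
    rw [selbergForm_lambdaOf_mul hm0 hq hqm, sum_divTuples_mul hm0 hq hqm]
    have h1 := selbergForm_nonneg hm' hmk' (∑ i, lambdaOf k m (y ∘ mulAt q i))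
    have h2 : 0 ≤ 1 / ((q : ℝ) - 1) ^ 2 := by positivity
    have h3 := mul_nonneg h2 h1
    have h4 : q / ((q : ℝ) - 1) ^ 2 * ∑ i, selbergForm k m (lambdaOf k m (y ∘ mulAt q i))
          (lambdaOf k m (y ∘ mulAt q i)) ≤
        ∑ i, ∑ r ∈ divTuples k m, upperWeight (mulAt q i r) * y (mulAt q i r) ^ 2 := by
      rw [mul_sum]
      refine sum_le_sum fun i _ => ?_
      refine (mul_le_mul_of_nonneg_left (IH (y ∘ mulAt q i)) (by positivity)).trans (le_of_eq ?_)
      rw [mul_sum]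
      refine sum_congr rfl fun r hr => ?_
      rw [upperWeight_mulAt hq i (nd r hr i), Function.comp_apply, mul_assoc]
    linarith [IH y]

/-- The non-diagonal term is at most k/(q-1)² times the diagonal sum by Cauchy-Schwarz, which leaves
q/(q-1)² (1 - k/q) ≥ (1/q)(1 - k/q) for each prime q of r. The condition k ≤ q keeps this
nonnegative. -/
theorem le_selbergForm {k m : ℕ} (hm : Squarefree m) (hmk : ∀ q : ℕ, q.Prime → q ∣ m → k ≤ q)
    (y : (Fin k → ℕ) → ℝ) :
    ∑ r ∈ divTuples k m, lowerWeight r * y r ^ 2 ≤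
      selbergForm k m (lambdaOf k m y) (lambdaOf k m y) := by
  induction m using induction_on_primes generalizing y with
  | zero => simp at hm
  | one => simp [selbergForm_one, divTuples_one, lowerWeight, lambdaOf]
  | prime_mul q m hq ih =>
    have hm' : Squarefree m := hm.of_mul_right
    have hm0 : m ≠ 0 := hm'.ne_zero
    have hqm : ¬ q ∣ m := fun h =>
      hq.one_lt.ne' (Nat.isUnit_iff.1 (hm q (Nat.mul_dvd_mul_left q h)))
    have hmk' : ∀ p : ℕ, p.Prime → p ∣ m → k ≤ p := fun p hp h => hmk p hp (h.mul_left q)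
    have IH := ih hm' hmk'
    have nd : ∀ d ∈ divTuples k m, ∀ l, ¬ q ∣ d l := fun d hd l =>
      not_dvd_of_mem_divTuples hm0 hqm hd l
    rw [selbergForm_lambdaOf_mul hm0 hq hqm, sum_divTuples_mul hm0 hq hqm]
    have hnn := selbergForm_nonneg hm' hmk'
    have h1 := selbergForm_sum_le hnn fun i => lambdaOf k m (y ∘ mulAt q i)
    set S := ∑ i, selbergForm k m (lambdaOf k m (y ∘ mulAt q i)) (lambdaOf k m (y ∘ mulAt q i))
      with hS
    have hS0 : 0 ≤ S := sum_nonneg fun i _ => hnn _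
    have hq1 : (1 : ℝ) < q := by exact_mod_cast hq.one_lt
    have hkq : (k : ℝ) ≤ q := by exact_mod_cast hmk q hq (dvd_mul_right q m)
    have hkq' : 0 ≤ 1 - (k : ℝ) / q := by
      rw [sub_nonneg, div_le_one (by linarith)]; exact hkq
    have h4 : ∑ i, ∑ r ∈ divTuples k m, lowerWeight (mulAt q i r) * y (mulAt q i r) ^ 2 ≤
        1 / (q : ℝ) * (1 - k / q) * S := by
      rw [hS, mul_sum]
      refine sum_le_sum fun i _ => ?_
      refine le_trans (le_of_eq ?_) (mul_le_mul_of_nonneg_left (IH (y ∘ mulAt q i))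
        (by positivity))
      rw [mul_sum]
      refine sum_congr rfl fun r hr => ?_
      rw [lowerWeight_mulAt hq i (nd r hr i), Function.comp_apply]
      ring
    have h5 : 1 / ((q : ℝ) - 1) ^ 2 * selbergForm k m (∑ i, lambdaOf k m (y ∘ mulAt q i))
          (∑ i, lambdaOf k m (y ∘ mulAt q i)) ≤ 1 / ((q : ℝ) - 1) ^ 2 * (k * S) :=
      mul_le_mul_of_nonneg_left h1 (by positivity)
    have h6 : 1 / (q : ℝ) * (1 - k / q) * S ≤
        q / ((q : ℝ) - 1) ^ 2 * S - 1 / ((q : ℝ) - 1) ^ 2 * (k * S) := by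
      have e : q / ((q : ℝ) - 1) ^ 2 * S - 1 / ((q : ℝ) - 1) ^ 2 * (k * S) =
          q / ((q : ℝ) - 1) ^ 2 * (1 - k / q) * S := by
        have : (q : ℝ) - 1 ≠ 0 := by linarith
        field_simp
      rw [e]
      refine mul_le_mul_of_nonneg_right (mul_le_mul_of_nonneg_right ?_ hkq') hS0
      rw [div_le_div_iff₀ (by linarith) (by nlinarith)]
      nlinarith
    linarith [IH y]

/-- The weights restricted to the multiples of a prime `p` of `L_j(n)`. -/
theorem lambdaOf_add_mulAt {k m p : ℕ} (hm : Squarefree m) (hp : p.Prime) (hpm : ¬ p ∣ m)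
    (y : (Fin k → ℕ) → ℝ) (j : Fin k) {d : Fin k → ℕ} (hd : d ∈ divTuples k m) :
    lambdaOf k (p * m) y d + lambdaOf k (p * m) y (mulAt p j d) =
      lambdaOf k m (fun r => y r - y (mulAt p j r) +
        1 / ((p : ℝ) - 1) * ∑ i ∈ univ.erase j, y (mulAt p i r)) d := by
  have hp1 : (p : ℝ) - 1 ≠ 0 := by
    have : (1 : ℝ) < p := by exact_mod_cast hp.one_lt
    linarith
  have e : (fun r => y r - y (mulAt p j r) +
      1 / ((p : ℝ) - 1) * ∑ i ∈ univ.erase j, y (mulAt p i r)) =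
      y - y ∘ mulAt p j + (1 / ((p : ℝ) - 1)) • ∑ i ∈ univ.erase j, y ∘ mulAt p i := by
    funext r
    simp
  rw [lambdaOf_mul_of_mem hm.ne_zero hp hpm y hd, lambdaOf_mul_mulAt hm.ne_zero hp hpm y j hd, e]
  simp only [← lambdaLin_apply, map_add, map_sub, map_smul, map_sum, Pi.add_apply, Pi.sub_apply,
    Pi.smul_apply, Finset.sum_apply, smul_eq_mul]
  -- The coefficient of `y ∘ mulAt p j` is 1/(p-1) - p/(p-1) = -1.
  rw [← add_sum_erase univ _ (mem_univ j)]
  field_simp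
  ring

/-- Induction on the primes of m. The hypothesis carries the factor 1/∏ r_i so that passing to `y ∘
mulAt q i` gains 1/q. By the two recursions the new prime adds k (1 + q)/(q - 1) · Y/q, and
(q+1)/(q-1) ≤ 3. -/
theorem sum_abs_lambdaOf_le {k m : ℕ} (hm : Squarefree m) (y : (Fin k → ℕ) → ℝ) {Y : ℝ}
    (hY : 0 ≤ Y) (hy : ∀ r ∈ divTuples k m, |y r| ≤ Y / ∏ i, (r i : ℝ)) :
    ∑ d ∈ divTuples k m, |lambdaOf k m y d| ≤ Y * ∏ q ∈ m.primeFactors, (1 + 3 * k / (q : ℝ)) := by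
  induction m using induction_on_primes generalizing y Y with
  | zero => simp at hm
  | one => simpa [divTuples_one, lambdaOf, filter_singleton] using hy
  | prime_mul q m hq ih =>
    have hm' : Squarefree m := hm.of_mul_right
    have hm0 : m ≠ 0 := hm'.ne_zero
    have hqm : ¬ q ∣ m := fun h =>
      hq.one_lt.ne' (Nat.isUnit_iff.1 (hm q (Nat.mul_dvd_mul_left q h)))
    have hq2 : (2 : ℝ) ≤ q := by exact_mod_cast hq.two_le
    have hmem0 : ∀ r ∈ divTuples k m, r ∈ divTuples k (q * m) := fun r hr => by
      rw [divTuples_mul hm0 hq]; exact mem_union_left _ hr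
    have hmem : ∀ i, ∀ r ∈ divTuples k m, mulAt q i r ∈ divTuples k (q * m) := fun i r hr => by
      rw [divTuples_mul hm0 hq]
      exact mem_union_right _ (mem_biUnion.2 ⟨i, mem_univ i, mem_image_of_mem _ hr⟩)
    set T₀ := ∏ q ∈ m.primeFactors, (1 + 3 * k / (q : ℝ)) with hT₀
    have hT₁ : 0 ≤ T₀ := prod_nonneg fun _ _ => by positivity
    have IH0 := ih hm' y hY fun r hr => hy r (hmem0 r hr)
    have IHi : ∀ i, ∑ d ∈ divTuples k m, |lambdaOf k m (y ∘ mulAt q i) d| ≤ Y / q * T₀ := by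
      intro i
      refine ih hm' (y ∘ mulAt q i) (by positivity) fun r hr => ?_
      refine (hy _ (hmem i r hr)).trans (le_of_eq ?_)
      rw [prod_mulAt (fun n => (n : ℝ)) q i r (by push_cast; rfl), mul_comm, div_div]
    rw [sum_divTuples_mul hm0 hq hqm]
    have hc : Nat.Coprime q m := (Nat.Prime.coprime_iff_not_dvd hq).2 hqm
    rw [hc.primeFactors_mul, prod_union hc.disjoint_primeFactors, hq.primeFactors, prod_singleton,
      ← hT₀]
    set T := ∑ i, ∑ d ∈ divTuples k m, |lambdaOf k m (y ∘ mulAt q i) d| with hT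
    have hTle : T ≤ k * (Y / q * T₀) := by
      refine (sum_le_sum fun i _ => IHi i).trans (le_of_eq ?_)
      simp
    have hT0 : 0 ≤ T := sum_nonneg fun _ _ => sum_nonneg fun _ _ => abs_nonneg _
    have b1 : ∑ d ∈ divTuples k m, |lambdaOf k (q * m) y d| ≤ Y * T₀ + 1 / ((q : ℝ) - 1) * T := by
      refine le_trans ?_ (add_le_add IH0 (le_refl (1 / ((q : ℝ) - 1) * T)))
      rw [hT, sum_comm, mul_sum, ← sum_add_distrib]
      refine sum_le_sum fun d hd => ?_
      rw [lambdaOf_mul_of_mem hm0 hq hqm y hd]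
      refine (abs_add_le _ _).trans (add_le_add le_rfl ?_)
      rw [abs_mul, abs_of_nonneg (by rw [one_div_nonneg]; linarith : 0 ≤ 1 / ((q : ℝ) - 1))]
      exact mul_le_mul_of_nonneg_left (abs_sum_le_sum_abs _ _) (by rw [one_div_nonneg]; linarith)
    have b2 : ∑ i, ∑ d ∈ divTuples k m, |lambdaOf k (q * m) y (mulAt q i d)| =
        q / ((q : ℝ) - 1) * T := by
      rw [hT, mul_sum]
      refine sum_congr rfl fun i _ => ?_
      rw [mul_sum]
      refine sum_congr rfl fun d hd => ?_
      rw [lambdaOf_mul_mulAt hm0 hq hqm y i hd, abs_mul, abs_neg,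
        abs_of_nonneg (div_nonneg (by linarith) (by linarith))]
    rw [b2]
    have b3 : 1 / ((q : ℝ) - 1) * T + q / ((q : ℝ) - 1) * T ≤ 3 * T := by
      have : 1 / ((q : ℝ) - 1) * T + q / ((q : ℝ) - 1) * T = (q + 1) / ((q : ℝ) - 1) * T := by ring
      rw [this]
      refine mul_le_mul_of_nonneg_right ?_ hT0
      rw [div_le_iff₀ (by linarith)]
      linarith
    have b4 : Y * ((1 + 3 * k / (q : ℝ)) * T₀) = Y * T₀ + 3 * (k * (Y / q * T₀)) := by ring
    rw [b4]
    linarith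

end

end

section

open Finset

/-! ### Counting in residue classes -/

/-- Rounding N and 2N to integers changes the expected count by at most 1, and a residue class in an
integer interval deviates from expectation by less than 1. -/
theorem abs_card_modEq_sub_le {N : ℝ} (hN : 0 ≤ N) {M : ℕ} (hM : 0 < M) (a : ℤ) :
    |(((Ioc ⌊N⌋₊ ⌊2 * N⌋₊).filter fun n : ℕ => (n : ℤ) ≡ a [ZMOD (M : ℤ)]).card : ℝ) - N / M| ≤
      2 := by
  have hM' : (0 : ℤ) < M := by exact_mod_cast hM
  have hMR : (1 : ℝ) ≤ M := by exact_mod_cast hM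
  have h1 : (((Ioc ⌊N⌋₊ ⌊2 * N⌋₊).filter fun n : ℕ => (n : ℤ) ≡ a [ZMOD (M : ℤ)]).card : ℤ) =
      max (⌊((⌊2 * N⌋₊ : ℤ) - a) / (M : ℚ)⌋ - ⌊((⌊N⌋₊ : ℤ) - a) / (M : ℚ)⌋) 0 := by
    have := Int.Ioc_filter_modEq_card (⌊N⌋₊ : ℤ) (⌊2 * N⌋₊ : ℤ) hM' a
    push_cast at this ⊢
    rw [← this]
    congr 1
    refine card_bij (fun n _ => (n : ℤ)) ?_ ?_ ?_
    · intro n hn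
      simp only [mem_filter, mem_Ioc] at hn ⊢
      exact ⟨by omega, hn.2⟩
    · intro x _ y _ h
      exact_mod_cast h
    · intro z hz
      simp only [mem_filter, mem_Ioc] at hz
      refine ⟨z.toNat, ?_, by omega⟩
      simp only [mem_filter, mem_Ioc]
      have : (z.toNat : ℤ) = z := by omega
      rw [this]
      exact ⟨by omega, hz.2⟩
  have h2 : (((Ioc ⌊N⌋₊ ⌊2 * N⌋₊).filter fun n : ℕ => (n : ℤ) ≡ a [ZMOD (M : ℤ)]).card : ℝ) =
      ((max (⌊((⌊2 * N⌋₊ : ℤ) - a) / (M : ℚ)⌋ - ⌊((⌊N⌋₊ : ℤ) - a) / (M : ℚ)⌋) 0 : ℤ) : ℝ) := by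
    rw [← h1]; simp
  rw [h2]
  set x : ℚ := ((⌊2 * N⌋₊ : ℤ) - a) / (M : ℚ) with hx
  set y : ℚ := ((⌊N⌋₊ : ℤ) - a) / (M : ℚ) with hy
  have x1 : ((⌊x⌋ : ℤ) : ℝ) ≤ (x : ℝ) := by exact_mod_cast Int.floor_le x
  have x2 : (x : ℝ) < (⌊x⌋ : ℤ) + 1 := by exact_mod_cast Int.lt_floor_add_one x
  have y1 : ((⌊y⌋ : ℤ) : ℝ) ≤ (y : ℝ) := by exact_mod_cast Int.floor_le y
  have y2 : (y : ℝ) < (⌊y⌋ : ℤ) + 1 := by exact_mod_cast Int.lt_floor_add_one y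
  have n1 := Nat.floor_le hN
  have n2 := Nat.lt_floor_add_one N
  have n3 := Nat.floor_le (by linarith : 0 ≤ 2 * N)
  have n4 := Nat.lt_floor_add_one (2 * N)
  have hxy : (x : ℝ) - y = ((⌊2 * N⌋₊ : ℝ) - ⌊N⌋₊) / M := by
    rw [hx, hy]; push_cast; ring
  have hd1 : ((⌊2 * N⌋₊ : ℝ) - ⌊N⌋₊) / M ≤ N / M + 1 := by
    rw [div_le_iff₀ (by linarith), add_mul, div_mul_cancel₀ _ (by linarith)]
    linarith
  have hd2 : N / M - 1 ≤ ((⌊2 * N⌋₊ : ℝ) - ⌊N⌋₊) / M := by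
    rw [le_div_iff₀ (by linarith), sub_mul, div_mul_cancel₀ _ (by linarith)]
    linarith
  have hNM : 0 ≤ N / M := by positivity
  push_cast
  rw [abs_le]
  constructor
  · linarith [le_max_left (((⌊x⌋ : ℤ) : ℝ) - (⌊y⌋ : ℤ)) 0]
  · rw [sub_le_iff_le_add]
    exact max_le (by linarith) (by linarith)

/-- Simultaneous divisibility of coprime linear forms is a single congruence. -/
theorem exists_modEq_iff {k : ℕ} (A : Fin k → ℕ) (B : Fin k → ℤ) (W : ℕ) (ν₀ : ℤ)
    (c : Fin k → ℕ) (s : Finset (Fin k)) (hA : ∀ i ∈ s, Nat.Coprime (A i) (c i))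
    (hW : ∀ i ∈ s, Nat.Coprime W (c i))
    (hc : ∀ i ∈ s, ∀ l ∈ s, i ≠ l → Nat.Coprime (c i) (c l)) :
    ∃ a : ℤ, ∀ n : ℤ, (n ≡ ν₀ [ZMOD (W : ℤ)] ∧ ∀ i ∈ s, (c i : ℤ) ∣ linForm A B i n) ↔
      n ≡ a [ZMOD ((W * ∏ i ∈ s, c i : ℕ) : ℤ)] := by
  induction s using Finset.induction_on with
  | empty => exact ⟨ν₀, fun n => by simp⟩
  | insert i s his ih =>
    obtain ⟨a, ha⟩ := ih (fun l hl => hA l (mem_insert_of_mem hl))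
      (fun l hl => hW l (mem_insert_of_mem hl))
      (fun l hl l' hl' => hc l (mem_insert_of_mem hl) l' (mem_insert_of_mem hl'))
    have hi := mem_insert_self i s
    have cop : Nat.Coprime (W * ∏ l ∈ s, c l) (c i) := by
      refine Nat.Coprime.mul_left (hW i hi) (Nat.Coprime.prod_left fun l hl => ?_)
      exact hc l (mem_insert_of_mem hl) i hi fun h => his (h ▸ hl)
    obtain ⟨u, v, huv⟩ := (Nat.isCoprime_iff_coprime.2 (hA i hi))
    obtain ⟨x, y, hxy⟩ := (Nat.isCoprime_iff_coprime.2 cop)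
    -- `b` solves the congruence modulo `c i`
    set b : ℤ := -(B i) * u with hb
    have hbi : (c i : ℤ) ∣ linForm A B i b := ⟨B i * v, by
      rw [linForm, hb]; linear_combination (-(B i)) * huv⟩
    set M : ℤ := ((W * ∏ l ∈ s, c l : ℕ) : ℤ) with hM
    -- Chinese remainder from the Bezout relation xM + y c_i = 1: this number is a modulo M and b
    -- modulo c_i.
    refine ⟨a * (y * c i) + b * (x * M), fun n => ?_⟩
    have e1 : a * (y * c i) + b * (x * M) ≡ a [ZMOD M] := by
      rw [Int.modEq_iff_dvd]
      exact ⟨x * (a - b), by linear_combination (-a) * hxy⟩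
    have e2 : a * (y * c i) + b * (x * M) ≡ b [ZMOD (c i : ℤ)] := by
      rw [Int.modEq_iff_dvd]
      exact ⟨y * (b - a), by linear_combination (-b) * hxy⟩
    have e3 : (c i : ℤ) ∣ linForm A B i n ↔ n ≡ b [ZMOD (c i : ℤ)] := by
      rw [Int.modEq_comm, Int.modEq_iff_dvd]
      have : linForm A B i n = A i * (n - b) + linForm A B i b := by
        simp only [linForm]; ring
      rw [this, dvd_add_left hbi]
      exact ⟨fun h => (Nat.isCoprime_iff_coprime.2 (hA i hi)).symm.dvd_of_dvd_mul_left h,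
        fun h => h.mul_left _⟩
    have e4 : ((W * ∏ l ∈ insert i s, c l : ℕ) : ℤ) = M * c i := by
      rw [prod_insert his, hM]; push_cast; ring
    rw [e4, ← Int.modEq_and_modEq_iff_modEq_mul
      (by rw [hM, Int.natAbs_natCast, Int.natAbs_natCast]; exact cop)]
    constructor
    · rintro ⟨h1, h2⟩
      refine ⟨((ha n).1 ⟨h1, fun l hl => h2 l (mem_insert_of_mem hl)⟩).trans e1.symm,
        (e3.1 (h2 i hi)).trans e2.symm⟩
    · rintro ⟨h1, h2⟩
      obtain ⟨h3, h4⟩ := (ha n).2 (h1.trans e1)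
      refine ⟨h3, fun l hl => ?_⟩
      rcases mem_insert.1 hl with rfl | hl
      · exact e3.2 (h2.trans e2)
      · exact h4 l hl

/-- If the product of c_i = lcm(d_i, e_i) is squarefree, all conditions together amount to one
residue class modulo W p ∏ c_i. If not, then since each c_i divides the squarefree m, some prime of
m divides two of the c_i, and no n can satisfy both divisibilities; the count and the density both
vanish. -/
theorem abs_count_sub_density_le {k : ℕ} (A : Fin k → ℕ) (B : Fin k → ℤ) {W p m : ℕ}
    (hW : 0 < W) (ν₀ : ℤ) (hm : Squarefree m) (hp : p.Prime) (hpm : ¬ p ∣ m)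
    (hWm : Nat.Coprime W (p * m)) (hA : ∀ i, Nat.Coprime (A i) (p * m))
    (hcop : ∀ q : ℕ, q.Prime → q ∣ m → ∀ i l, i ≠ l → ∀ n : ℤ,
      (q : ℤ) ∣ linForm A B i n → ¬ (q : ℤ) ∣ linForm A B l n)
    (j : Fin k) {N : ℝ} (hN : 0 ≤ N) {d e : Fin k → ℕ} (hd : d ∈ divTuples k m)
    (he : e ∈ divTuples k m) :
    |(((Ioc ⌊N⌋₊ ⌊2 * N⌋₊).filter fun n : ℕ => (n : ℤ) ≡ ν₀ [ZMOD (W : ℤ)] ∧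
        (p : ℤ) ∣ linForm A B j n ∧ (∀ i, (d i : ℤ) ∣ linForm A B i n) ∧
          ∀ i, (e i : ℤ) ∣ linForm A B i n).card : ℝ) - N / (W * p) * pairDensity d e| ≤ 2 := by
  set c : Fin k → ℕ := fun i => (d i).lcm (e i) with hc
  have hm0 := hm.ne_zero
  have hdm : ∀ i, d i ∣ m := fun i =>
    (dvd_prod_of_mem d (mem_univ i)).trans ((mem_divTuples hm0).1 hd)
  have hem : ∀ i, e i ∣ m := fun i =>
    (dvd_prod_of_mem e (mem_univ i)).trans ((mem_divTuples hm0).1 he)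
  have hcm : ∀ i, c i ∣ m := fun i => Nat.lcm_dvd (hdm i) (hem i)
  have hcdvd : ∀ n : ℤ, ((∀ i, (d i : ℤ) ∣ linForm A B i n) ∧ ∀ i, (e i : ℤ) ∣ linForm A B i n) ↔
      ∀ i, (c i : ℤ) ∣ linForm A B i n := by
    intro n
    rw [← forall_and]
    refine forall_congr' fun i => ?_
    rw [hc]
    simp only [Int.natCast_dvd]
    exact Nat.lcm_dvd_iff.symm
  simp_rw [hcdvd]
  by_cases hsq : Squarefree (∏ i, c i)
  · have hdens : pairDensity d e = 1 / ((∏ i, c i : ℕ) : ℝ) := by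
      rw [pairDensity, if_pos hsq]
    have hpair : ∀ i l, i ≠ l → Nat.Coprime (c i) (c l) := by
      intro i l hil
      have h1 : c i * c l ∣ ∏ i, c i := by
        rw [← mul_prod_erase univ c (mem_univ i)]
        exact mul_dvd_mul_left _ (dvd_prod_of_mem c (mem_erase.2 ⟨hil.symm, mem_univ l⟩))
      exact (Nat.squarefree_mul_iff.1 (hsq.squarefree_of_dvd h1)).1
    have hpc : ∀ i, Nat.Coprime p (c i) := fun i =>
      (Nat.Prime.coprime_iff_not_dvd hp).2 fun h => hpm (h.trans (hcm i))
    have hc' : ∀ i, mulAt p j c i ∣ p * m := by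
      intro i
      by_cases h : i = j
      · subst h
        rw [mulAt_same, mul_comm]
        exact mul_dvd_mul_left p (hcm i)
      · rw [mulAt_of_ne p h]
        exact (hcm i).mul_left p
    -- The condition p ∣ L_j(n) is absorbed by multiplying the j-th modulus by p, which is prime to
    -- all c_i.
    obtain ⟨a, ha⟩ := exists_modEq_iff A B W ν₀ (mulAt p j c) univ
      (fun i _ => (hA i).of_dvd_right (hc' i)) (fun i _ => hWm.of_dvd_right (hc' i))
      (by
        intro i _ l _ hil
        by_cases h : i = j
        · subst h
          rw [mulAt_same, mulAt_of_ne p hil.symm]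
          exact (hpair i l hil).mul_left (hpc l)
        · rw [mulAt_of_ne p h]
          by_cases h' : l = j
          · subst h'
            rw [mulAt_same]
            exact (hpair i l hil).mul_right (hpc i).symm
          · rw [mulAt_of_ne p h']
            exact hpair i l hil)
    have hiff : ∀ n : ℤ, (n ≡ ν₀ [ZMOD (W : ℤ)] ∧ (p : ℤ) ∣ linForm A B j n ∧
        ∀ i, (c i : ℤ) ∣ linForm A B i n) ↔ n ≡ a [ZMOD ((W * (p * ∏ i, c i) : ℕ) : ℤ)] := by
      intro n
      have := ha n
      rw [prod_mulAt (fun n => n) p j c rfl, mul_comm (∏ i, c i) p] at this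
      rw [← this]
      refine and_congr_right fun _ => ⟨fun h i _ => ?_, fun h => ⟨?_, fun i => ?_⟩⟩
      · by_cases hi : i = j
        · subst hi
          rw [mulAt_same, Nat.cast_mul, mul_comm]
          exact (Nat.isCoprime_iff_coprime.2 (hpc i)).mul_dvd h.1 (h.2 i)
        · rw [mulAt_of_ne p hi]
          exact h.2 i
      · have := h j (mem_univ j)
        rw [mulAt_same, Nat.cast_mul] at this
        exact (Dvd.intro_left _ rfl).trans this
      · have := h i (mem_univ i)
        by_cases hi : i = j
        · subst hi
          rw [mulAt_same, Nat.cast_mul] at this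
          exact (Dvd.intro _ rfl).trans this
        · rwa [mulAt_of_ne p hi] at this
    simp_rw [hiff]
    have hpos : 0 < W * (p * ∏ i, c i) :=
      Nat.mul_pos hW (Nat.mul_pos hp.pos (Nat.pos_of_ne_zero hsq.ne_zero))
    have := abs_card_modEq_sub_le hN hpos a
    rw [hdens]
    have e1 : N / (W * p) * (1 / ((∏ i, c i : ℕ) : ℝ)) = N / ((W * (p * ∏ i, c i) : ℕ) : ℝ) := by
      push_cast
      rw [div_mul_div_comm, mul_one, mul_assoc]
    rw [e1]
    exact this
  · have hdens : pairDensity d e = 0 := by rw [pairDensity, if_neg hsq]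
    rw [hdens, mul_zero, sub_zero]
    have : ((Ioc ⌊N⌋₊ ⌊2 * N⌋₊).filter fun n : ℕ => (n : ℤ) ≡ ν₀ [ZMOD (W : ℤ)] ∧
        (p : ℤ) ∣ linForm A B j n ∧ ∀ i, (c i : ℤ) ∣ linForm A B i n) = ∅ := by
      refine filter_eq_empty_iff.2 fun n _ h => hsq ?_
      have hpair : ∀ i l, i ≠ l → Nat.Coprime (c i) (c l) := by
        intro i l hil
        refine Nat.coprime_of_dvd fun q hq h1 h2 => ?_
        refine hcop q hq (h1.trans (hcm i)) i l hil n ?_ ?_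
        · exact (Int.natCast_dvd_natCast.2 h1).trans (h.2.2 i)
        · exact (Int.natCast_dvd_natCast.2 h2).trans (h.2.2 l)
      refine (Finset.squarefree_prod_of_pairwise_isCoprime ?_ fun i _ =>
        hm.squarefree_of_dvd (hcm i))
      intro i _ l _ hil
      exact Nat.coprime_iff_isRelPrime.1 (hpair i l hil)
    rw [this]
    simp

/-- Open the square and count n for each pair (d, e); every pair costs at most 2 |κ_d κ_e|. -/
theorem abs_sum_sq_sub_selbergForm_le {k : ℕ} (A : Fin k → ℕ) (B : Fin k → ℤ) {W p m : ℕ}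
    (hW : 0 < W) (ν₀ : ℤ) (hm : Squarefree m) (hp : p.Prime) (hpm : ¬ p ∣ m)
    (hWm : Nat.Coprime W (p * m)) (hA : ∀ i, Nat.Coprime (A i) (p * m))
    (hcop : ∀ q : ℕ, q.Prime → q ∣ m → ∀ i l, i ≠ l → ∀ n : ℤ,
      (q : ℤ) ∣ linForm A B i n → ¬ (q : ℤ) ∣ linForm A B l n)
    (j : Fin k) {N : ℝ} (hN : 0 ≤ N) (κ : (Fin k → ℕ) → ℝ) :
    |∑ n ∈ (Ioc ⌊N⌋₊ ⌊2 * N⌋₊).filter (fun n : ℕ => (n : ℤ) ≡ ν₀ [ZMOD (W : ℤ)] ∧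
        (p : ℤ) ∣ linForm A B j n),
      (∑ d ∈ (divTuples k m).filter (fun d => ∀ i, (d i : ℤ) ∣ linForm A B i n), κ d) ^ 2 -
      N / (W * p) * selbergForm k m κ κ| ≤ 2 * (∑ d ∈ divTuples k m, |κ d|) ^ 2 := by
  have e1 : ∑ n ∈ (Ioc ⌊N⌋₊ ⌊2 * N⌋₊).filter (fun n : ℕ => (n : ℤ) ≡ ν₀ [ZMOD (W : ℤ)] ∧
        (p : ℤ) ∣ linForm A B j n),
      (∑ d ∈ (divTuples k m).filter (fun d => ∀ i, (d i : ℤ) ∣ linForm A B i n), κ d) ^ 2 =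
      ∑ d ∈ divTuples k m, ∑ e ∈ divTuples k m, κ d * κ e *
        (((Ioc ⌊N⌋₊ ⌊2 * N⌋₊).filter fun n : ℕ => (n : ℤ) ≡ ν₀ [ZMOD (W : ℤ)] ∧
        (p : ℤ) ∣ linForm A B j n ∧ (∀ i, (d i : ℤ) ∣ linForm A B i n) ∧
          ∀ i, (e i : ℤ) ∣ linForm A B i n).card : ℝ) := by
    have e2 : ∀ n : ℕ, (∑ d ∈ (divTuples k m).filter (fun d => ∀ i, (d i : ℤ) ∣ linForm A B i n),
        κ d) ^ 2 = ∑ d ∈ divTuples k m, ∑ e ∈ divTuples k m, κ d * κ e *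
        (if (∀ i, (d i : ℤ) ∣ linForm A B i n) ∧ (∀ i, (e i : ℤ) ∣ linForm A B i n) then 1 else 0) := by
      intro n
      rw [sq, sum_filter, sum_mul_sum]
      refine sum_congr rfl fun d _ => sum_congr rfl fun e _ => ?_
      by_cases h1 : ∀ i, (d i : ℤ) ∣ linForm A B i n <;>
        by_cases h2 : ∀ i, (e i : ℤ) ∣ linForm A B i n <;> simp [h1, h2]
    simp_rw [e2]
    rw [sum_comm]
    refine sum_congr rfl fun d _ => ?_
    rw [sum_comm]
    refine sum_congr rfl fun e _ => ?_
    rw [← mul_sum, sum_boole, filter_filter]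
    simp_rw [and_assoc]
  rw [e1, selbergForm, mul_sum, ← sum_sub_distrib]
  refine (abs_sum_le_sum_abs _ _).trans ?_
  have e3 : 2 * (∑ d ∈ divTuples k m, |κ d|) ^ 2 =
      ∑ d ∈ divTuples k m, ∑ e ∈ divTuples k m, |κ d| * |κ e| * 2 := by
    rw [sq, sum_mul_sum, mul_sum]
    refine sum_congr rfl fun d _ => ?_
    rw [mul_sum]
    exact sum_congr rfl fun e _ => by ring
  rw [e3]
  refine sum_le_sum fun d hd => ?_
  rw [mul_sum, ← sum_sub_distrib]
  refine (abs_sum_le_sum_abs _ _).trans (sum_le_sum fun e he => ?_)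
  have := abs_count_sub_density_le A B hW ν₀ hm hp hpm hWm hA hcop j hN hd he
  rw [show N / (W * p) * (κ d * κ e * pairDensity d e) =
    κ d * κ e * (N / (W * p) * pairDensity d e) by ring, ← mul_sub, abs_mul, abs_mul]
  exact mul_le_mul_of_nonneg_left this (by positivity)

end

section

open Finset

/-! ### Arithmetic of admissible tuples -/

/-- A common prime factor q of A_i and B_i would make L_i vanish identically modulo q, giving ν_q =
q. So A_i and B_i are coprime, and a vanishing determinant forces two forms to coincide. -/
theorem cross_ne_zero {k : ℕ} {A : Fin k → ℕ} {B : Fin k → ℤ} (hAB : Admissible A B)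
    {i l : Fin k} (hil : i ≠ l) : (A i : ℤ) * B l - (A l : ℤ) * B i ≠ 0 := by
  have hcont : ∀ i, IsCoprime (A i : ℤ) (B i) := by
    intro i
    rw [Int.isCoprime_iff_gcd_eq_one]
    by_contra hne
    obtain ⟨q, hq, hqd⟩ := Nat.exists_prime_and_dvd hne
    have h1 : (q : ℤ) ∣ A i := (Int.natCast_dvd_natCast.2 hqd).trans (Int.gcd_dvd_left _ _)
    have h2 : (q : ℤ) ∣ B i := (Int.natCast_dvd_natCast.2 hqd).trans (Int.gcd_dvd_right _ _)
    have h3 := hAB.nu_lt q hq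
    rw [nuCount, filter_true_of_mem] at h3
    · simp at h3
    · intro n _
      refine Dvd.dvd.trans ?_ (dvd_prod_of_mem (fun i => linForm A B i n) (mem_univ i))
      exact dvd_add (h1.mul_right _) h2
  intro h
  have h1 : (A i : ℤ) ∣ A l := (hcont i).dvd_of_dvd_mul_right ⟨B l, by linarith⟩
  have h2 : (A l : ℤ) ∣ A i := (hcont l).dvd_of_dvd_mul_right ⟨B i, by linarith⟩
  have h3 : A i = A l := Nat.dvd_antisymm (Int.natCast_dvd_natCast.1 h1) (Int.natCast_dvd_natCast.1 h2)
  refine hAB.distinct i l hil ?_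
  rw [h3]
  have h4 : (A l : ℤ) ≠ 0 := by exact_mod_cast (hAB.pos l).ne'
  rw [h3, sub_eq_zero] at h
  rw [mul_left_cancel₀ h4 h]

/-- The primes whose product is `W`. -/
noncomputable def smallPrimes (N : ℝ) : Finset ℕ := (range ⌈D0 N⌉₊).filter Nat.Prime

theorem prime_of_mem_smallPrimes {N : ℝ} {p : ℕ} (h : p ∈ smallPrimes N) : p.Prime :=
  (mem_filter.1 h).2

theorem prime_dvd_primorialW {N : ℝ} {q : ℕ} (hq : q.Prime) :
    q ∣ primorialW N ↔ q ∈ smallPrimes N := by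
  rw [primorialW, Prime.dvd_finsetProd_iff hq.prime]
  constructor
  · rintro ⟨p, hp, hd⟩
    rwa [(Nat.prime_dvd_prime_iff_eq hq (mem_filter.1 hp).2).1 hd]
  · exact fun h => ⟨q, h, dvd_rfl⟩

theorem D0_le_of_not_dvd {N : ℝ} {q : ℕ} (hq : q.Prime) (h : ¬ q ∣ primorialW N) : D0 N ≤ q := by
  rw [prime_dvd_primorialW hq, smallPrimes, mem_filter, mem_range, not_and] at h
  have := fun h' => h h' hq
  rw [imp_false, not_lt] at this
  exact Nat.ceil_le.1 this

theorem primorialW_pos (N : ℝ) : 0 < primorialW N :=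
  prod_pos fun _ hp => (prime_of_mem_smallPrimes hp).pos

theorem not_dvd_coeff {k : ℕ} {A : Fin k → ℕ} {B : Fin k → ℤ} (hAB : Admissible A B) {N : ℝ}
    (hN : LargeEnough A B N) {q : ℕ} (hq : q.Prime) (h : ¬ q ∣ primorialW N) (i : Fin k) :
    ¬ q ∣ A i := fun hd => by
  have h1 := Nat.le_of_dvd (hAB.pos i) hd
  have h2 := D0_le_of_not_dvd hq h
  have h3 := hN.coeff_lt i
  have h4 : (q : ℝ) ≤ A i := by exact_mod_cast h1
  linarith

/-- Such a q would divide the determinant A_i B_l - A_l B_i, which is nonzero and smaller than D₀ ≤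
q in absolute value. -/
theorem not_dvd_two_forms {k : ℕ} {A : Fin k → ℕ} {B : Fin k → ℤ} (hAB : Admissible A B) {N : ℝ}
    (hN : LargeEnough A B N) {q : ℕ} (hq : q.Prime) (h : ¬ q ∣ primorialW N) {i l : Fin k}
    (hil : i ≠ l) {n : ℤ} (h1 : (q : ℤ) ∣ linForm A B i n) : ¬ (q : ℤ) ∣ linForm A B l n := by
  intro h2
  have h3 : (q : ℤ) ∣ (A i : ℤ) * B l - (A l : ℤ) * B i := by
    have e : (A i : ℤ) * B l - (A l : ℤ) * B i =
        A i * linForm A B l n - A l * linForm A B i n := by simp only [linForm]; ring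
    rw [e]
    exact dvd_sub (h2.mul_left _) (h1.mul_left _)
  have h4 := Int.le_of_dvd (abs_pos.2 (cross_ne_zero hAB hil)) ((dvd_abs _ _).2 h3)
  have h5 := D0_le_of_not_dvd hq h
  have h6 := hN.cross_lt i l
  have h7 := hN.cross_lt l i
  have h8 : ((q : ℤ) : ℝ) ≤ ((|(A i : ℤ) * B l - (A l : ℤ) * B i| : ℤ) : ℝ) := by exact_mod_cast h4
  rw [Int.cast_abs] at h8
  push_cast at h6 h7 h8
  rcases abs_cases ((A i : ℝ) * B l - (A l : ℝ) * B i) with ⟨h9, _⟩ | ⟨h9, _⟩ <;> linarith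

theorem not_dvd_prodForm {k : ℕ} {A : Fin k → ℕ} {B : Fin k → ℤ} {N : ℝ} {ν₀ : ℤ}
    (hν : IsCoprime (prodForm A B ν₀) (primorialW N : ℤ)) {q : ℕ} (hq : q.Prime)
    (h : q ∣ primorialW N) {n : ℤ} (hn : n ≡ ν₀ [ZMOD (primorialW N : ℤ)]) :
    ¬ (q : ℤ) ∣ prodForm A B n := by
  intro hd
  have h1 : (q : ℤ) ∣ primorialW N := Int.natCast_dvd_natCast.2 h
  have h2 : prodForm A B n ≡ prodForm A B ν₀ [ZMOD (q : ℤ)] := by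
    have hn' := hn.of_dvd h1
    rw [prodForm, prodForm]
    refine Int.ModEq.prod fun i _ => ?_
    exact (hn'.mul_left _).add_right _
  have h3 : (q : ℤ) ∣ prodForm A B ν₀ := h2.dvd_iff.1 hd
  have h4 := hν.isUnit_of_dvd' h3 h1
  exact (Nat.prime_iff_prime_int.1 hq).not_isUnit h4

theorem prime_dvd_prodForm {k : ℕ} {A : Fin k → ℕ} {B : Fin k → ℤ} {q : ℕ} (hq : q.Prime) (n : ℤ) :
    (q : ℤ) ∣ prodForm A B n ↔ ∃ i, (q : ℤ) ∣ linForm A B i n := by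
  rw [prodForm, Prime.dvd_finsetProd_iff (Nat.prime_iff_prime_int.1 hq)]
  simp

/-! ### The Selberg weights in terms of `divTuples` -/

/-- The product of the primes up to `Z` that do not divide `W`. -/
def roughProduct (W Z : ℕ) : ℕ := ∏ q ∈ (primesTo Z).filter (fun q => ¬ q ∣ W), q

theorem prime_dvd_roughProduct {W Z q : ℕ} (hq : q.Prime) :
    q ∣ roughProduct W Z ↔ q ≤ Z ∧ ¬ q ∣ W := by
  rw [roughProduct, Prime.dvd_finsetProd_iff hq.prime]
  constructor
  · rintro ⟨p, hp, hd⟩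
    rw [mem_filter, mem_primesTo] at hp
    rw [(Nat.prime_dvd_prime_iff_eq hq hp.1.1).1 hd]
    exact ⟨hp.1.2, hp.2⟩
  · exact fun h => ⟨q, mem_filter.2 ⟨mem_primesTo.2 ⟨hq, h.1⟩, h.2⟩, dvd_rfl⟩

theorem squarefree_roughProduct (W Z : ℕ) : Squarefree (roughProduct W Z) := by
  refine Finset.squarefree_prod_of_pairwise_isCoprime ?_ fun q hq =>
    (mem_primesTo.1 (mem_filter.1 hq).1).1.prime.squarefree
  intro p hp q hq hpq
  exact Nat.coprime_iff_isRelPrime.1 ((Nat.coprime_primes (mem_primesTo.1 (mem_filter.1 hp).1).1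
    (mem_primesTo.1 (mem_filter.1 hq).1).1).2 hpq)

theorem coprime_roughProduct (W Z : ℕ) : Nat.Coprime W (roughProduct W Z) :=
  Nat.coprime_of_dvd fun _ hq h1 h2 => ((prime_dvd_roughProduct hq).1 h2).2 h1

/-- Because k ≥ 2, each r_i divides some partial product r/r_j with j ≠ i, hence is below R. So both
finite index sets used for the weights contain the support of y. -/
theorem sieveY_support {k : ℕ} (hk : 2 ≤ k) {W Z : ℕ} {R : ℝ} (hZ : ⌊R⌋₊ ≤ Z)
    {F : (Fin k → ℝ) → ℝ} {r : Fin k → ℕ} (hr : sieveY W R F r ≠ 0) :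
    r ∈ box k R ∧ ∏ i, r i ∣ roughProduct W Z := by
  rw [sieveY] at hr
  split_ifs at hr with h
  · obtain ⟨hsq, hcop, hlt⟩ := h
    have hpos : ∀ i, 0 < r i := fun i => Nat.pos_of_ne_zero fun h0 =>
      hsq.ne_zero (prod_eq_zero (mem_univ i) h0)
    have hle : ∀ i, r i ≤ ⌊R⌋₊ := by
      intro i
      have : Nontrivial (Fin k) := Fin.nontrivial_iff_two_le.2 hk
      obtain ⟨j, hj⟩ := exists_ne i
      refine Nat.le_floor (le_trans ?_ (hlt j).le)
      exact_mod_cast single_le_prod' (f := r) (fun l _ => hpos l) (mem_erase.2 ⟨hj.symm, mem_univ i⟩)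
    refine ⟨Fintype.mem_piFinset.2 fun i => mem_Icc.2 ⟨hpos i, hle i⟩, ?_⟩
    rw [← Nat.prod_primeFactors_of_squarefree hsq]
    refine prod_dvd_prod_of_subset _ _ _ fun q hq => ?_
    rw [Nat.mem_primeFactors] at hq
    refine mem_filter.2 ⟨mem_primesTo.2 ⟨hq.1, ?_⟩, fun hW => ?_⟩
    · obtain ⟨i, _, hi⟩ := (Prime.dvd_finsetProd_iff hq.1.prime _).1 hq.2.1
      exact (Nat.le_of_dvd (hpos i) hi).trans ((hle i).trans hZ)
    · exact Nat.not_coprime_of_dvd_of_dvd hq.1.one_lt hq.2.1 hW hcop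
  · exact absurd rfl hr

/-- The box and the set of divisor tuples differ only where y vanishes. The cut-off Z may exceed R,
so that the modulus also contains the primes p ≤ R₀ of the outer sum. -/
theorem sieveLambda_eq_lambdaOf {k : ℕ} (hk : 2 ≤ k) {W Z : ℕ} {R : ℝ} (hZ : ⌊R⌋₊ ≤ Z)
    (F : (Fin k → ℝ) → ℝ) (d : Fin k → ℕ) :
    sieveLambda W R F d = lambdaOf k (roughProduct W Z) (sieveY W R F) d := by
  have h0 := (squarefree_roughProduct W Z).ne_zero
  rw [sieveLambda, lambdaOf]
  congr 1
  refine sum_bij_ne_zero (fun r _ _ => r) ?_ ?_ ?_ ?_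
  · intro r hr hne
    rw [mem_filter] at hr ⊢
    exact ⟨(mem_divTuples h0).2 (sieveY_support hk hZ (left_ne_zero_of_mul hne)).2, hr.2⟩
  · intro _ _ _ _ _ _ h
    exact h
  · intro r hr hne
    rw [mem_filter] at hr
    exact ⟨r, mem_filter.2 ⟨(sieveY_support hk hZ (left_ne_zero_of_mul hne)).1, hr.2⟩, hne, rfl⟩
  · intro _ _ _
    rfl

theorem lambdaOf_support {k m : ℕ} {y : (Fin k → ℕ) → ℝ} {d : Fin k → ℕ}
    (h : lambdaOf k m y d ≠ 0) : ∃ r, y r ≠ 0 ∧ ∀ i, d i ∣ r i := by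
  obtain ⟨r, hr, hne⟩ := exists_ne_zero_of_sum_ne_zero (right_ne_zero_of_mul h)
  exact ⟨r, left_ne_zero_of_mul hne, (mem_filter.1 hr).2⟩

theorem selbergWeight_eq {k : ℕ} (hk : 2 ≤ k) (A : Fin k → ℕ) (B : Fin k → ℤ) {W Z : ℕ} {R : ℝ}
    (hZ : ⌊R⌋₊ ≤ Z) (F : (Fin k → ℝ) → ℝ) (n : ℤ) :
    selbergWeight A B W R F n =
      (∑ d ∈ (divTuples k (roughProduct W Z)).filter (fun d => ∀ i, (d i : ℤ) ∣ linForm A B i n),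
        lambdaOf k (roughProduct W Z) (sieveY W R F) d) ^ 2 := by
  have h0 := (squarefree_roughProduct W Z).ne_zero
  rw [selbergWeight]
  congr 1
  refine sum_bij_ne_zero (fun r _ _ => r) ?_ ?_ ?_ ?_
  · intro d hd hne
    rw [sieveLambda_eq_lambdaOf hk hZ] at hne
    obtain ⟨r, hr, hdr⟩ := lambdaOf_support hne
    rw [mem_filter] at hd ⊢
    exact ⟨(mem_divTuples h0).2 ((prod_dvd_prod_of_dvd _ _ fun i _ => hdr i).trans
      (sieveY_support hk hZ hr).2), hd.2⟩
  · intro _ _ _ _ _ _ h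
    exact h
  · intro d hd hne
    obtain ⟨r, hr, hdr⟩ := lambdaOf_support hne
    rw [mem_filter] at hd
    refine ⟨d, mem_filter.2 ⟨?_, hd.2⟩, by rwa [sieveLambda_eq_lambdaOf hk hZ], rfl⟩
    have hb := (sieveY_support hk hZ hr).1
    rw [AlmostPrimeSieve.box, Fintype.mem_piFinset] at hb ⊢
    intro i
    have := mem_Icc.1 (hb i)
    rw [mem_Icc]
    exact ⟨Nat.pos_of_dvd_of_pos (hdr i) this.1, (Nat.le_of_dvd this.1 (hdr i)).trans this.2⟩
  · intro d _ _
    exact sieveLambda_eq_lambdaOf hk hZ F d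

/-- The variables of the diagonalised form for the integers with `p ∣ L_j(n)`. -/
noncomputable def shiftedY {k : ℕ} (p : ℕ) (j : Fin k) (y : (Fin k → ℕ) → ℝ) (r : Fin k → ℕ) : ℝ :=
  y r - y (mulAt p j r) + 1 / ((p : ℝ) - 1) * ∑ i ∈ univ.erase j, y (mulAt p i r)

/-- As p divides L_j(n) and no other form, a tuple d dividing the forms may carry p only in
coordinate j, and carrying it there imposes no new condition. The two kinds of d add up by
`lambdaOf_add_mulAt`. -/
theorem sum_filter_lambdaOf_eq {k m p : ℕ} {A : Fin k → ℕ} {B : Fin k → ℤ} (hm : Squarefree m)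
    (hp : p.Prime) (hpm : ¬ p ∣ m) (j : Fin k) {n : ℤ} (hn : (p : ℤ) ∣ linForm A B j n)
    (hn' : ∀ i, i ≠ j → ¬ (p : ℤ) ∣ linForm A B i n) (y : (Fin k → ℕ) → ℝ) :
    ∑ d ∈ (divTuples k (p * m)).filter (fun d => ∀ i, (d i : ℤ) ∣ linForm A B i n),
        lambdaOf k (p * m) y d =
      ∑ d ∈ (divTuples k m).filter (fun d => ∀ i, (d i : ℤ) ∣ linForm A B i n),
        lambdaOf k m (shiftedY p j y) d := by
  rw [sum_filter, sum_divTuples_mul hm.ne_zero hp hpm, sum_eq_single j, ← sum_add_distrib,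
    sum_filter]
  · refine sum_congr rfl fun d hd => ?_
    have hiff : (∀ i, (mulAt p j d i : ℤ) ∣ linForm A B i n) ↔
        ∀ i, (d i : ℤ) ∣ linForm A B i n := by
      refine forall_congr' fun i => ?_
      by_cases hi : i = j
      · subst hi
        rw [mulAt_same, Nat.cast_mul]
        refine ⟨fun h => (Dvd.intro _ rfl).trans h, fun h => ?_⟩
        have : Nat.Coprime (d i) p := ((Nat.Prime.coprime_iff_not_dvd hp).2
          (not_dvd_of_mem_divTuples hm.ne_zero hpm hd i)).symm
        exact (Nat.isCoprime_iff_coprime.2 this).mul_dvd h hn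
      · rw [mulAt_of_ne p hi]
    by_cases h : ∀ i, (d i : ℤ) ∣ linForm A B i n
    · rw [if_pos h, if_pos (hiff.2 h), if_pos h, lambdaOf_add_mulAt hm hp hpm y j hd]
      rfl
    · rw [if_neg h, if_neg fun h' => h (hiff.1 h'), if_neg h, add_zero]
  · intro i _ hi
    refine sum_eq_zero fun d _ => if_neg fun h => hn' i hi ?_
    have := h i
    rw [mulAt_same, Nat.cast_mul] at this
    exact (Dvd.intro_left _ rfl).trans this
  · simp

theorem sum_abs_lambdaOf_shiftedY_le {k m p : ℕ} (hm : Squarefree m) (hp : p.Prime)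
    (hpm : ¬ p ∣ m) (j : Fin k) (y : (Fin k → ℕ) → ℝ) :
    ∑ d ∈ divTuples k m, |lambdaOf k m (shiftedY p j y) d| ≤
      ∑ d ∈ divTuples k (p * m), |lambdaOf k (p * m) y d| := by
  rw [sum_divTuples_mul hm.ne_zero hp hpm]
  have h1 : ∑ d ∈ divTuples k m, |lambdaOf k (p * m) y (mulAt p j d)| ≤
      ∑ i, ∑ d ∈ divTuples k m, |lambdaOf k (p * m) y (mulAt p i d)| :=
    single_le_sum (f := fun i => ∑ d ∈ divTuples k m, |lambdaOf k (p * m) y (mulAt p i d)|)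
      (fun i _ => sum_nonneg fun _ _ => abs_nonneg _) (mem_univ j)
  refine le_trans ?_ (add_le_add le_rfl h1)
  rw [← sum_add_distrib]
  refine sum_le_sum fun d hd => ?_
  have := lambdaOf_add_mulAt hm hp hpm y j hd
  rw [show lambdaOf k m (shiftedY p j y) d = _ from this.symm]
  exact abs_add_le _ _

/-- The quadratic form that belongs to the integers with `p ∣ L_j(n)`. -/
noncomputable def primeForm (k : ℕ) (M p : ℕ) (j : Fin k) (y : (Fin k → ℕ) → ℝ) : ℝ :=
  selbergForm k (M / p) (lambdaOf k (M / p) (shiftedY p j y))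
    (lambdaOf k (M / p) (shiftedY p j y))

/-- The primes up to `x` that do not divide `W`. -/
def roughPrimes (W x : ℕ) : Finset ℕ := (primesTo x).filter (fun q => ¬ q ∣ W)

theorem mem_roughPrimes {W x p : ℕ} : p ∈ roughPrimes W x ↔ (p.Prime ∧ p ≤ x) ∧ ¬ p ∣ W := by
  rw [roughPrimes, mem_filter, mem_primesTo]

theorem roughProduct_facts {W Z p : ℕ} (hp : p.Prime) (hpZ : p ≤ Z) (hpW : ¬ p ∣ W) :
    roughProduct W Z = p * (roughProduct W Z / p) ∧ Squarefree (roughProduct W Z / p) ∧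
      ¬ p ∣ roughProduct W Z / p := by
  have h := Nat.mul_div_cancel' ((prime_dvd_roughProduct hp).2 ⟨hpZ, hpW⟩)
  have hsq := squarefree_roughProduct W Z
  refine ⟨h.symm, ?_, fun hd => ?_⟩
  · rw [← h] at hsq; exact hsq.of_mul_right
  · rw [← h] at hsq
    exact hp.one_lt.ne' (Nat.isUnit_iff.1 (hsq p (Nat.mul_dvd_mul_left p hd)))

/-- Interchange the sums over n and p and apply the count for each pair (p, j). There are at most
N^θ₀ primes and k forms, each with weight at most M₀ and counting error at most twice the squared ℓ¹
norm. -/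
theorem abs_sigma0_sub_le {k : ℕ} (hk : 2 ≤ k) {A : Fin k → ℕ} {B : Fin k → ℤ}
    (hAB : Admissible A B) {θ θ₀ : ℝ} {W₀ : ℝ → ℝ} {F : (Fin k → ℝ) → ℝ} {N : ℝ}
    (hN : LargeEnough A B N) {ν₀ : ℤ} (hν : IsCoprime (prodForm A B ν₀) (primorialW N : ℤ))
    {Z : ℕ} (hZ : ⌊N ^ θ⌋₊ ≤ Z) (hZ₀ : ⌊N ^ θ₀⌋₊ ≤ Z) {M₀ : ℝ} (hM₀ : 0 ≤ M₀)
    (hW₀ : ∀ p ∈ roughPrimes (primorialW N) ⌊N ^ θ₀⌋₊,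
      |W₀ (Real.log p / Real.log (N ^ θ))| ≤ M₀) :
    |sigma0 A B θ θ₀ W₀ F N ν₀ -
      ∑ p ∈ roughPrimes (primorialW N) ⌊N ^ θ₀⌋₊, ∑ j, W₀ (Real.log p / Real.log (N ^ θ)) *
        (N / (primorialW N * p) * primeForm k (roughProduct (primorialW N) Z) p j
          (sieveY (primorialW N) (N ^ θ) F))| ≤
      N ^ θ₀ * (k * (M₀ * (2 * (∑ d ∈ divTuples k (roughProduct (primorialW N) Z),
        |lambdaOf k (roughProduct (primorialW N) Z)
          (sieveY (primorialW N) (N ^ θ) F) d|) ^ 2))) := by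
  set W := primorialW N with hW
  set M := roughProduct W Z with hM
  set y := sieveY W (N ^ θ) F with hy
  set P := roughPrimes W ⌊N ^ θ₀⌋₊ with hP
  set w : ℕ → ℝ := fun p => W₀ (Real.log p / Real.log (N ^ θ)) with hw
  have hN0 : 0 ≤ N := by linarith [hN.gt_sixteen]
  set S : Finset ℕ := (Ioc ⌊N⌋₊ ⌊2 * N⌋₊).filter (fun n : ℕ => (n : ℤ) ≡ ν₀ [ZMOD (W : ℤ)]) with hS
  -- Primes dividing W never divide P(n) here, because P(ν₀) is prime to W; every other prime
  -- divisor of P(n) is attached to exactly one j.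
  have hdec : sigma0 A B θ θ₀ W₀ F N ν₀ = ∑ p ∈ P, ∑ j, w p *
      ∑ n ∈ (Ioc ⌊N⌋₊ ⌊2 * N⌋₊).filter (fun n : ℕ => (n : ℤ) ≡ ν₀ [ZMOD (W : ℤ)] ∧
        (p : ℤ) ∣ linForm A B j n), selbergWeight A B W (N ^ θ) F n := by
    have h1 : ∀ n ∈ S, ∑ p ∈ (Icc 1 ⌊N ^ θ₀⌋₊).filter
        (fun p : ℕ => p.Prime ∧ (p : ℤ) ∣ prodForm A B (n : ℤ)), w p =
        ∑ p ∈ P, ∑ j, if (p : ℤ) ∣ linForm A B j n then w p else 0 := by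
      intro n hn
      rw [hS, mem_filter] at hn
      have h2 : ∀ p ∈ P, (∑ j, if (p : ℤ) ∣ linForm A B j n then w p else 0) =
          if (p : ℤ) ∣ prodForm A B n then w p else 0 := by
        intro p hp
        rw [hP, mem_roughPrimes] at hp
        by_cases h : (p : ℤ) ∣ prodForm A B n
        · obtain ⟨i, hi⟩ := (prime_dvd_prodForm hp.1.1 n).1 h
          rw [if_pos h, sum_eq_single i, if_pos hi]
          · intro l _ hl
            exact if_neg (not_dvd_two_forms hAB hN hp.1.1 hp.2 hl.symm hi)
          · simp
        · rw [if_neg h]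
          refine sum_eq_zero fun i _ => if_neg fun hi => h ?_
          exact (prime_dvd_prodForm hp.1.1 n).2 ⟨i, hi⟩
      rw [sum_congr rfl h2, ← sum_filter]
      refine sum_congr ?_ fun _ _ => rfl
      ext p
      simp only [mem_filter, hP, mem_roughPrimes, mem_Icc]
      constructor
      · rintro ⟨⟨_, h3⟩, h4, h5⟩
        exact ⟨⟨⟨h4, h3⟩, fun h6 => not_dvd_prodForm hν h4 h6 hn.2 h5⟩, h5⟩
      · rintro ⟨⟨⟨h3, h4⟩, _⟩, h6⟩
        exact ⟨⟨h3.one_lt.le, h4⟩, h3, h6⟩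
    have h3 : sigma0 A B θ θ₀ W₀ F N ν₀ = ∑ n ∈ S,
        (∑ p ∈ P, ∑ j, if (p : ℤ) ∣ linForm A B j n then w p else 0) *
          selbergWeight A B W (N ^ θ) F n := by
      rw [sigma0]
      exact sum_congr rfl fun n hn => by rw [← h1 n hn]
    rw [h3]
    simp_rw [sum_mul]
    rw [sum_comm]
    refine sum_congr rfl fun p _ => ?_
    rw [sum_comm]
    refine sum_congr rfl fun j _ => ?_
    conv_rhs => rw [mul_sum, ← filter_filter, ← hS, sum_filter]
    refine sum_congr rfl fun n _ => ?_
    by_cases h : (p : ℤ) ∣ linForm A B j n <;> simp [h]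
  rw [hdec, ← sum_sub_distrib]
  refine (abs_sum_le_sum_abs _ _).trans ?_
  set T := ∑ d ∈ divTuples k M, |lambdaOf k M y d| with hT
  have hT0 : 0 ≤ T := sum_nonneg fun _ _ => abs_nonneg _
  have main : ∀ p ∈ P, |∑ j, w p *
      ∑ n ∈ (Ioc ⌊N⌋₊ ⌊2 * N⌋₊).filter (fun n : ℕ => (n : ℤ) ≡ ν₀ [ZMOD (W : ℤ)] ∧
        (p : ℤ) ∣ linForm A B j n), selbergWeight A B W (N ^ θ) F n -
      ∑ j, w p * (N / (W * p) * primeForm k M p j y)| ≤ k * (M₀ * (2 * T ^ 2)) := by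
    intro p hp
    have hwp := hW₀ p hp
    rw [hP, mem_roughPrimes] at hp
    obtain ⟨hMp, hsq, hpm⟩ := roughProduct_facts hp.1.1 (hp.1.2.trans hZ₀) hp.2
    rw [← hM] at hMp hsq hpm
    set m := M / p with hm
    have hWM : Nat.Coprime W M := coprime_roughProduct W Z
    have hcopr : ∀ q : ℕ, q.Prime → q ∣ M → ¬ q ∣ W := fun q hq hd =>
      ((prime_dvd_roughProduct hq).1 hd).2
    rw [← sum_sub_distrib]
    refine (abs_sum_le_sum_abs _ _).trans ?_
    have : (k : ℝ) * (M₀ * (2 * T ^ 2)) = ∑ _j : Fin k, M₀ * (2 * T ^ 2) := by simp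
    rw [this]
    refine sum_le_sum fun j _ => ?_
    rw [← mul_sub, abs_mul]
    refine mul_le_mul hwp ?_ (abs_nonneg _) hM₀
    have e1 : ∑ n ∈ (Ioc ⌊N⌋₊ ⌊2 * N⌋₊).filter (fun n : ℕ => (n : ℤ) ≡ ν₀ [ZMOD (W : ℤ)] ∧
        (p : ℤ) ∣ linForm A B j n), selbergWeight A B W (N ^ θ) F n =
        ∑ n ∈ (Ioc ⌊N⌋₊ ⌊2 * N⌋₊).filter (fun n : ℕ => (n : ℤ) ≡ ν₀ [ZMOD (W : ℤ)] ∧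
        (p : ℤ) ∣ linForm A B j n),
        (∑ d ∈ (divTuples k m).filter (fun d => ∀ i, (d i : ℤ) ∣ linForm A B i n),
          lambdaOf k m (shiftedY p j y) d) ^ 2 := by
      refine sum_congr rfl fun n hn => ?_
      have hpj := (mem_filter.1 hn).2.2
      rw [selbergWeight_eq hk A B hZ F, ← hM, ← hy, hMp, sum_filter_lambdaOf_eq hsq hp.1.1 hpm j hpj
        fun i hi => not_dvd_two_forms hAB hN hp.1.1 hp.2 hi.symm hpj]
    rw [e1]
    refine (abs_sum_sq_sub_selbergForm_le A B (primorialW_pos N) ν₀ hsq hp.1.1 hpm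
      (by rw [← hMp]; exact hWM) ?_ ?_ j hN0 _).trans ?_
    · intro i
      rw [← hMp]
      refine Nat.coprime_of_dvd fun q hq h1 h2 => ?_
      exact not_dvd_coeff hAB hN hq (hcopr q hq h2) i h1
    · intro q hq hqm i l hil n h1
      refine not_dvd_two_forms hAB hN hq (hcopr q hq ?_) hil h1
      rw [hMp]
      exact hqm.mul_left p
    · have h2 := sum_abs_lambdaOf_shiftedY_le hsq hp.1.1 hpm j y
      rw [← hMp, ← hT] at h2
      have h3 : 0 ≤ ∑ d ∈ divTuples k m, |lambdaOf k m (shiftedY p j y) d| :=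
        sum_nonneg fun _ _ => abs_nonneg _
      have := pow_le_pow_left₀ h3 h2 2
      linarith
  refine (sum_le_sum main).trans ?_
  rw [sum_const, nsmul_eq_mul]
  refine mul_le_mul_of_nonneg_right ?_ (by positivity)
  have hcard : P.card ≤ ⌊N ^ θ₀⌋₊ := by
    calc P.card ≤ (Icc 1 ⌊N ^ θ₀⌋₊).card := card_le_card fun p hp => by
          rw [hP, mem_roughPrimes] at hp
          exact mem_Icc.2 ⟨hp.1.1.one_lt.le, hp.1.2⟩
      _ = ⌊N ^ θ₀⌋₊ := by simp
  calc (P.card : ℝ) ≤ (⌊N ^ θ₀⌋₊ : ℝ) := by exact_mod_cast hcard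
    _ ≤ N ^ θ₀ := Nat.floor_le (Real.rpow_nonneg hN0 _)

end

section

open MeasureTheory Set

/-! ### Functions that are Lipschitz along the axes inside a convex set -/

/-- `f` takes values in `[0, K]`, vanishes off `U`, and is `K`-Lipschitz on the segments of `U`
parallel to the axes. -/
structure AxisLip {k : ℕ} (U : Set (Fin k → ℝ)) (K : ℝ) (f : (Fin k → ℝ) → ℝ) : Prop where
  measurable : Measurable f
  nonneg : ∀ t, 0 ≤ f t
  le : ∀ t, f t ≤ K
  zero : ∀ t, t ∉ U → f t = 0
  lip : ∀ t l s s', Function.update t l s ∈ U → Function.update t l s' ∈ U →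
    |f (Function.update t l s) - f (Function.update t l s')| ≤ K * |s - s'|

variable {k : ℕ} {U : Set (Fin k → ℝ)} {K : ℝ} {f : (Fin k → ℝ) → ℝ}

theorem AxisLip.const_nonneg (hf : AxisLip U K f) : 0 ≤ K := (hf.nonneg 0).trans (hf.le 0)

/-- The set of parameters at which a line parallel to an axis lies in a convex set. -/
theorem ordConnected_line (hU : Convex ℝ U) (t : Fin k → ℝ) (l : Fin k) (y : ℝ) :
    {s : ℝ | Function.update t l (s + y) ∈ U}.OrdConnected := by
  refine ⟨fun s hs s' hs' z hz => ?_⟩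
  rcases eq_or_lt_of_le (hz.1.trans hz.2) with h | h
  · have : z = s := le_antisymm (h ▸ hz.2) hz.1
    rw [this]; exact hs
  · have hpos : 0 < s' - s := by linarith
    have := hU hs hs' (a := (s' - z) / (s' - s)) (b := (z - s) / (s' - s))
      (div_nonneg (by linarith [hz.2]) hpos.le) (div_nonneg (by linarith [hz.1]) hpos.le)
      (by rw [← add_div, div_eq_one_iff_eq hpos.ne']; ring)
    have e : ((s' - z) / (s' - s)) • Function.update t l (s + y) +
        ((z - s) / (s' - s)) • Function.update t l (s' + y) = Function.update t l (z + y) := by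
      funext i
      by_cases hi : i = l
      · subst hi
        simp only [Pi.add_apply, Pi.smul_apply, Function.update_self, smul_eq_mul]
        field_simp
        ring
      · simp only [Pi.add_apply, Pi.smul_apply, Function.update_of_ne hi, smul_eq_mul]
        field_simp
        ring
    rw [e] at this
    exact this

theorem AxisLip.pieceLip (hU : Convex ℝ U) (hf : AxisLip U K f) (t : Fin k → ℝ) (l : Fin k)
    (y : ℝ) : PieceLip 0 1 K K fun s => f (Function.update t l (s + y)) := by
  refine ⟨{s | Function.update t l (s + y) ∈ U} ∩ Icc 0 1,
    (ordConnected_line hU t l y).inter ordConnected_Icc, inter_subset_right, ?_, ?_, ?_⟩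
  · intro s hs s' hs'
    have := hf.lip t l (s + y) (s' + y) hs.1 hs'.1
    rwa [add_sub_add_right_eq_sub] at this
  · intro s _
    rw [abs_of_nonneg (hf.nonneg _)]
    exact hf.le _
  · intro s hs hn
    exact hf.zero _ fun h => hn ⟨h, hs⟩

/-- Take a and b to be the ends of the interval in which the line meets U. Between s and s' the
function varies by K(s' - s), plus a jump of at most K whenever an end lies between them. -/
theorem AxisLip.abs_sub_le (hU : Convex ℝ U) (hU1 : U ⊆ Icc 0 1) (hf : AxisLip U K f)
    (t : Fin k → ℝ) (l : Fin k) : ∃ a b : ℝ, ∀ s s', s ≤ s' →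
      |f (Function.update t l s) - f (Function.update t l s')| ≤
        K * (s' - s) + K * ((Icc s s').indicator 1 a + (Icc s s').indicator 1 b) := by
  set J : Set ℝ := {s : ℝ | Function.update t l s ∈ U} with hJ
  have hJc : J.OrdConnected := by simpa using ordConnected_line hU t l 0
  have hK := hf.const_nonneg
  have hJb : J ⊆ Icc 0 1 := by
    intro s hs
    have := hU1 hs
    have h1 := this.1 l
    have h2 := this.2 l
    simp only [Function.update_self] at h1 h2
    exact ⟨h1, h2⟩
  refine ⟨sInf J, sSup J, fun s s' hss => ?_⟩
  have i1 : ∀ x : ℝ, (0 : ℝ) ≤ (Icc s s').indicator 1 x := fun x =>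
    indicator_nonneg (fun _ _ => by simp) x
  have h1 := i1 (sInf J)
  have h2 := i1 (sSup J)
  have hb1 : BddBelow J := bddBelow_Icc.mono hJb
  have hb2 : BddAbove J := bddAbove_Icc.mono hJb
  have hKs : 0 ≤ K * (s' - s) := mul_nonneg hK (by linarith)
  by_cases hs : s ∈ J
  · by_cases hs' : s' ∈ J
    · have := hf.lip t l s s' hs hs'
      rw [abs_sub_comm s s', abs_of_nonneg (by linarith : 0 ≤ s' - s)] at this
      have := mul_nonneg hK (add_nonneg h1 h2)
      linarith
    · rw [hf.zero _ hs', sub_zero, abs_of_nonneg (hf.nonneg _)]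
      have hmem : sSup J ∈ Icc s s' := by
        refine ⟨le_csSup hb2 hs, csSup_le ⟨s, hs⟩ fun z hz => ?_⟩
        by_contra hlt
        exact hs' (hJc.out hs hz ⟨hss, (not_le.1 hlt).le⟩)
      rw [indicator_of_mem hmem]
      have := mul_nonneg hK h1
      simp only [Pi.one_apply]
      linarith [hf.le (Function.update t l s)]
  · rw [hf.zero _ hs, zero_sub, abs_neg, abs_of_nonneg (hf.nonneg _)]
    by_cases hs' : s' ∈ J
    · have hmem : sInf J ∈ Icc s s' := by
        refine ⟨le_csInf ⟨s', hs'⟩ fun z hz => ?_, csInf_le hb1 hs'⟩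
        by_contra hlt
        exact hs (hJc.out hz hs' ⟨(not_le.1 hlt).le, hss⟩)
      rw [indicator_of_mem hmem]
      have := mul_nonneg hK h2
      simp only [Pi.one_apply]
      linarith [hf.le (Function.update t l s')]
    · rw [hf.zero _ hs']
      have := mul_nonneg hK (add_nonneg h1 h2)
      linarith

/-- `(f(t) - f(t + y e_j))²`. -/
def shiftSq (f : (Fin k → ℝ) → ℝ) (j : Fin k) (y : ℝ) (t : Fin k → ℝ) : ℝ :=
  (f t - f (Function.update t j (t j + y))) ^ 2

theorem measurable_shift (hf : Measurable f) (j : Fin k) (y : ℝ) :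
    Measurable fun t : Fin k → ℝ => f (Function.update t j (t j + y)) := by
  refine hf.comp (measurable_pi_lambda _ fun i => ?_)
  by_cases hi : i = j
  · subst hi
    simp only [Function.update_self]
    exact Measurable.add_const (f := fun t : Fin k → ℝ => t i) (measurable_pi_apply i) y
  · simp only [Function.update_of_ne hi]
    exact measurable_pi_apply i

theorem AxisLip.measurable_shiftSq (hf : AxisLip U K f) (j : Fin k) (y : ℝ) :
    Measurable (shiftSq f j y) :=
  (hf.measurable.sub (measurable_shift hf.measurable j y)).pow_const 2

theorem shiftSq_nonneg (f : (Fin k → ℝ) → ℝ) (j : Fin k) (y : ℝ) (t : Fin k → ℝ) :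
    0 ≤ shiftSq f j y t := sq_nonneg _

theorem AxisLip.shiftSq_le (hf : AxisLip U K f) (j : Fin k) (y : ℝ) (t : Fin k → ℝ) :
    shiftSq f j y t ≤ K ^ 2 := by
  have h1 := hf.nonneg t
  have h2 := hf.le t
  have h3 := hf.nonneg (Function.update t j (t j + y))
  have h4 := hf.le (Function.update t j (t j + y))
  rw [shiftSq, sq_le_sq, abs_of_nonneg (h1.trans h2), abs_le]
  constructor <;> linarith

/-- On a line the function is (g - h)² with g and h each supported on one interval, though g - h
need not be. Expanding into g², gh, h² gives three functions of the right class with constants L =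
2K² and M = K²; each costs 7K² E, and the coefficients 1, 2, 1 give 28. -/
theorem AxisLip.shiftSq_discrepancy {ι : Type*} (hU : Convex ℝ U) (hf : AxisLip U K f) (j : Fin k)
    (y : ℝ) (A : Finset ι) (w x : ι → ℝ) (hw : ∀ n ∈ A, 0 ≤ w n) {c E : ℝ}
    (hx : ∀ n ∈ A, x n ∈ Icc (0 : ℝ) 1)
    (H : ∀ J : Set ℝ, J.OrdConnected → J ⊆ Icc 0 1 →
      |∑ n ∈ A, J.indicator (fun _ => w n) (x n) - c * volume.real J| ≤ E)
    (l : Fin k) (t : Fin k → ℝ) :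
    |∑ n ∈ A, w n * shiftSq f j y (Function.update t l (x n)) -
      c * ∫ s in Icc (0 : ℝ) 1, shiftSq f j y (Function.update t l s)| ≤ 28 * K ^ 2 * E := by
  have hK := hf.const_nonneg
  -- the two restrictions to the line
  obtain ⟨g, h, hg, hh, hgh⟩ : ∃ g h : ℝ → ℝ, PieceLip 0 1 K K g ∧ PieceLip 0 1 K K h ∧
      ∀ s, shiftSq f j y (Function.update t l s) = (g s - h s) ^ 2 := by
    by_cases hl : l = j
    · subst hl
      refine ⟨_, _, hf.pieceLip hU t l 0, hf.pieceLip hU t l y, fun s => ?_⟩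
      simp [shiftSq]
    · refine ⟨_, _, hf.pieceLip hU t l 0,
        hf.pieceLip hU (Function.update t j (t j + y)) l 0, fun s => ?_⟩
      simp only [shiftSq, add_zero, Function.update_of_ne (Ne.symm hl)]
      rw [Function.update_comm hl]
  have p1 := (hg.mul hK hg)
  have p2 := (hg.mul hK hh)
  have p3 := (hh.mul hK hh)
  have hKK : 0 ≤ K * K := mul_nonneg hK hK
  have d1 := p1.sum_discrepancy A w x hw zero_le_one (by linarith) hKK hx H
  have d2 := p2.sum_discrepancy A w x hw zero_le_one (by linarith) hKK hx H
  have d3 := p3.sum_discrepancy A w x hw zero_le_one (by linarith) hKK hx H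
  have i1 := p1.integrableOn hKK volume
  have i2 := p2.integrableOn hKK volume
  have i3 := p3.integrableOn hKK volume
  have e1 : ∑ n ∈ A, w n * shiftSq f j y (Function.update t l (x n)) =
      ∑ n ∈ A, w n * (g (x n) * g (x n)) - 2 * ∑ n ∈ A, w n * (g (x n) * h (x n)) +
        ∑ n ∈ A, w n * (h (x n) * h (x n)) := by
    rw [Finset.mul_sum, ← Finset.sum_sub_distrib, ← Finset.sum_add_distrib]
    refine Finset.sum_congr rfl fun n _ => ?_
    rw [hgh]
    ring
  have e2 : ∫ s in Icc (0 : ℝ) 1, shiftSq f j y (Function.update t l s) =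
      (∫ s in Icc (0 : ℝ) 1, g s * g s) - 2 * (∫ s in Icc (0 : ℝ) 1, g s * h s) +
        ∫ s in Icc (0 : ℝ) 1, h s * h s := by
    rw [← integral_const_mul, ← integral_sub i1 (i2.const_mul 2)]
    have i12 : IntegrableOn (fun s => g s * g s - 2 * (g s * h s)) (Icc (0 : ℝ) 1) volume :=
      i1.sub (i2.const_mul 2)
    rw [← integral_add i12 i3]
    refine integral_congr_ae (Filter.Eventually.of_forall fun s => ?_)
    simp only [hgh]
    ring
  rw [e1, e2]
  rw [abs_le] at d1 d2 d3 ⊢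
  constructor <;> nlinarith [d1.1, d1.2, d2.1, d2.2, d3.1, d3.2]

end

/-! ### Integration over the cube by lines -/

section

open MeasureTheory Set

/-- The cube carries a product of probability measures, so an integral over it is an average of
integrals over the lines in direction j. -/
theorem lintegral_cube_le {k : ℕ} {G : (Fin k → ℝ) → ENNReal} (hG : Measurable G) (j : Fin k)
    {B : ENNReal} (hB : ∀ t, ∫⁻ s in Icc (0 : ℝ) 1, G (Function.update t j s) ≤ B) :
    ∫⁻ t in Icc (0 : Fin k → ℝ) 1, G t ≤ B := by
  set μ : Fin k → Measure ℝ := fun _ => (volume : Measure ℝ).restrict (Icc 0 1) with hμ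
  have e : (volume : Measure (Fin k → ℝ)).restrict (Icc 0 1) = Measure.pi μ := by
    rw [hμ, ← Measure.restrict_pi_pi, ← volume_pi, ← pi_univ_Icc]
    rfl
  have hp : ∀ i, IsProbabilityMeasure (μ i) := fun i => ⟨by simp [hμ]⟩
  rw [e]
  refine (lintegral_le_of_lmarginal_le (μ := μ) {j} hG (measurable_const (a := B)) ?_).trans ?_
  · rw [lmarginal_singleton, lmarginal_singleton]
    intro t
    refine (hB t).trans ?_
    rw [lintegral_const, (hp j).measure_univ, mul_one]
  · rw [lintegral_const, Measure.pi_univ, Finset.prod_congr rfl fun i _ => (hp i).measure_univ,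
      Finset.prod_const_one, mul_one]

theorem setIntegral_cube_le {k : ℕ} {G : (Fin k → ℝ) → ℝ} (hG : Measurable G)
    (h0 : ∀ t, 0 ≤ G t) {M : ℝ} (hM : ∀ t, G t ≤ M) (j : Fin k) {B : ℝ}
    (hB : ∀ t, ∫ s in Icc (0 : ℝ) 1, G (Function.update t j s) ≤ B) :
    ∫ t in Icc (0 : Fin k → ℝ) 1, G t ≤ B := by
  have hB0 : 0 ≤ B := (integral_nonneg fun s => h0 _).trans (hB 0)
  rw [integral_eq_lintegral_of_nonneg_ae (Filter.Eventually.of_forall h0)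
    hG.aestronglyMeasurable]
  refine ENNReal.toReal_le_of_le_ofReal hB0
    (lintegral_cube_le (G := fun t => ENNReal.ofReal (G t)) (ENNReal.measurable_ofReal.comp hG) j fun t => ?_)
  have hm : Measurable fun s => G (Function.update t j s) := hG.comp (measurable_update t)
  have hi : IntegrableOn (fun s => G (Function.update t j s)) (Icc (0 : ℝ) 1) volume :=
    Measure.integrableOn_of_bounded (M := M) (by simp) hm.aestronglyMeasurable
      (Filter.Eventually.of_forall fun s => by
        rw [Real.norm_eq_abs, abs_of_nonneg (h0 _)]; exact hM _)
  rw [← ofReal_integral_eq_lintegral_ofReal hi (Filter.Eventually.of_forall fun s => h0 _)]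
  exact ENNReal.ofReal_le_ofReal (hB t)

/-- A line in a direction l with a_l ≠ 0 meets the hyperplane in at most one point. -/
theorem volume_cube_inter_hyperplane {k : ℕ} {a : Fin k → ℝ} (ha : a ≠ 0) (b : ℝ) :
    (volume : Measure (Fin k → ℝ)).restrict (Icc 0 1) {t | ∑ i, a i * t i = b} = 0 := by
  obtain ⟨l, hl⟩ : ∃ l, a l ≠ 0 := by
    by_contra h
    push Not at h
    exact ha (funext h)
  have hm : MeasurableSet {t : Fin k → ℝ | ∑ i, a i * t i = b} :=
    (isClosed_eq (by fun_prop) continuous_const).measurableSet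
  rw [← lintegral_indicator_one hm]
  refine le_antisymm (lintegral_cube_le (measurable_one.indicator hm) l fun t => ?_) bot_le
  have hsub : {s : ℝ | Function.update t l s ∈ {t : Fin k → ℝ | ∑ i, a i * t i = b}} ⊆
      {(b - ∑ i ∈ Finset.univ.erase l, a i * t i) / a l} := by
    intro s hs
    have : ∑ i, a i * Function.update t l s i = b := hs
    rw [← Finset.add_sum_erase _ _ (Finset.mem_univ l), Function.update_self] at this
    rw [Finset.sum_congr rfl fun i hi => by
      rw [Function.update_of_ne (Finset.ne_of_mem_erase hi)]] at this
    rw [mem_singleton_iff, eq_div_iff hl]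
    linarith
  have hm' : MeasurableSet
      {s : ℝ | Function.update t l s ∈ {t : Fin k → ℝ | ∑ i, a i * t i = b}} :=
    measurable_update t hm
  have : (fun s : ℝ => ({t : Fin k → ℝ | ∑ i, a i * t i = b}.indicator 1 :
      (Fin k → ℝ) → ENNReal) (Function.update t l s)) =
      {s : ℝ | Function.update t l s ∈ {t : Fin k → ℝ | ∑ i, a i * t i = b}}.indicator 1 := by
    rfl
  rw [this, lintegral_indicator_one hm']
  refine (measure_mono hsub).trans ?_
  refine (Measure.restrict_apply_le _ _).trans ?_
  simp

/-! ### The regions of support -/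

/-- `U` is an open convex subset of `S ⊆ [0,1]^k`, the points of `S` outside `U` lie on at most
`2k+1` hyperplanes, and `∑ t_i ≤ κ` on `S`. -/
structure SieveRegion {k : ℕ} (S U : Set (Fin k → ℝ)) (κ : ℝ) : Prop where
  isOpen : IsOpen U
  convex : Convex ℝ U
  subset : U ⊆ S
  cube : S ⊆ Icc 0 1
  sum_le : ∀ t ∈ S, ∑ i, t i ≤ κ
  sum_erase_lt : ∀ t ∈ U, ∀ j, ∑ i ∈ Finset.univ.erase j, t i < 1
  boundary : ∃ P : Finset ((Fin k → ℝ) × ℝ), P.card ≤ 2 * k + 1 ∧ (∀ q ∈ P, q.1 ≠ 0) ∧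
    ∀ t ∈ S, t ∉ U → ∃ q ∈ P, ∑ i, q.1 i * t i = q.2

theorem sum_single_mul {k : ℕ} (j : Fin k) (t : Fin k → ℝ) :
    ∑ i, (Pi.single j 1 : Fin k → ℝ) i * t i = t j := by
  rw [Finset.sum_eq_single j]
  · simp
  · intro i _ hi
    simp [hi]
  · simp

theorem sum_erase_eq {k : ℕ} (j : Fin k) (t : Fin k → ℝ) :
    ∑ i, ((1 : Fin k → ℝ) - (Pi.single j 1 : Fin k → ℝ) : Fin k → ℝ) i * t i =
      ∑ i ∈ Finset.univ.erase j, t i := by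
  simp only [Pi.sub_apply, Pi.one_apply, sub_mul, one_mul, Finset.sum_sub_distrib]
  rw [sum_single_mul, ← Finset.add_sum_erase _ _ (Finset.mem_univ j)]
  ring

theorem sum_sum_erase {k : ℕ} (t : Fin k → ℝ) :
    ∑ j, ∑ i ∈ Finset.univ.erase j, t i = ((k : ℝ) - 1) * ∑ i, t i := by
  have : ∀ j, ∑ i ∈ Finset.univ.erase j, t i = ∑ i, t i - t j := fun j => by
    rw [← Finset.add_sum_erase _ _ (Finset.mem_univ j)]; ring
  simp only [this, Finset.sum_sub_distrib, Finset.sum_const, Finset.card_univ, Fintype.card_fin,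
    nsmul_eq_mul]
  ring

open Classical in
/-- The hyperplanes `t_i = 0`, `∑_{i≠j} t_i = 1` and `∑ t_i = 1`. -/
noncomputable def facePlanes (k : ℕ) : Finset ((Fin k → ℝ) × ℝ) :=
  (Finset.univ.image fun j : Fin k => ((Pi.single j 1 : Fin k → ℝ), (0 : ℝ))) ∪
    (Finset.univ.image fun j : Fin k => ((1 : Fin k → ℝ) - Pi.single j 1, (1 : ℝ))) ∪ {(1, 1)}

theorem facePlanes_card (k : ℕ) : (facePlanes k).card ≤ 2 * k + 1 := by
  classical
  refine (Finset.card_union_le _ _).trans ?_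
  have h1 := Finset.card_union_le
    (Finset.univ.image fun j : Fin k => ((Pi.single j 1 : Fin k → ℝ), (0 : ℝ)))
    (Finset.univ.image fun j : Fin k => ((1 : Fin k → ℝ) - Pi.single j 1, (1 : ℝ)))
  have h2 := Finset.card_image_le (s := Finset.univ)
    (f := fun j : Fin k => ((Pi.single j 1 : Fin k → ℝ), (0 : ℝ)))
  have h3 := Finset.card_image_le (s := Finset.univ)
    (f := fun j : Fin k => ((1 : Fin k → ℝ) - Pi.single j 1, (1 : ℝ)))
  simp only [Finset.card_univ, Fintype.card_fin] at h2 h3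
  rw [Finset.card_singleton]
  omega

theorem facePlanes_ne_zero {k : ℕ} (hk : 2 ≤ k) : ∀ q ∈ facePlanes k, q.1 ≠ 0 := by
  classical
  intro q hq
  simp only [facePlanes, Finset.mem_union, Finset.mem_image, Finset.mem_univ, true_and,
    Finset.mem_singleton] at hq
  have hj : ∀ j : Fin k, ∃ i, i ≠ j := fun j => by
    have : Nontrivial (Fin k) := Fin.nontrivial_iff_two_le.2 hk
    exact exists_ne j
  rcases hq with (⟨j, rfl⟩ | ⟨j, rfl⟩) | rfl
  · intro h
    have := congrFun h j
    simp at this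
  · intro h
    obtain ⟨i, hi⟩ := hj j
    have := congrFun h i
    simp [hi] at this
  · intro h
    have := congrFun h ⟨0, by omega⟩
    simp at this

theorem mem_facePlanes_single {k : ℕ} (j : Fin k) :
    ((Pi.single j 1 : Fin k → ℝ), (0 : ℝ)) ∈ facePlanes k := by
  classical
  simp only [facePlanes, Finset.mem_union, Finset.mem_image, Finset.mem_univ, true_and]
  exact Or.inl (Or.inl ⟨j, rfl⟩)

theorem mem_facePlanes_erase {k : ℕ} (j : Fin k) :
    ((1 : Fin k → ℝ) - Pi.single j 1, (1 : ℝ)) ∈ facePlanes k := by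
  classical
  simp only [facePlanes, Finset.mem_union, Finset.mem_image, Finset.mem_univ, true_and]
  exact Or.inl (Or.inr ⟨j, rfl⟩)

theorem mem_facePlanes_one (k : ℕ) : ((1 : Fin k → ℝ), (1 : ℝ)) ∈ facePlanes k := by
  classical
  simp [facePlanes]

theorem convex_pos_sum_lt {k : ℕ} : Convex ℝ {t : Fin k → ℝ | ∀ i, 0 < t i} := by
  have : {t : Fin k → ℝ | ∀ i, 0 < t i} = ⋂ i, {t : Fin k → ℝ | 0 < t i} := by
    ext t; simp
  rw [this]
  exact convex_iInter fun i => convex_halfSpace_gt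
    (f := fun t : Fin k → ℝ => t i) ⟨fun _ _ => rfl, fun _ _ => rfl⟩ 0

theorem convex_sum_lt {k : ℕ} (s : Finset (Fin k)) :
    Convex ℝ {t : Fin k → ℝ | ∑ i ∈ s, t i < 1} :=
  convex_halfSpace_lt (f := fun t : Fin k → ℝ => ∑ i ∈ s, t i)
    ⟨fun x y => by simp [Finset.sum_add_distrib], fun c x => by simp [Finset.mul_sum]⟩ 1

theorem isOpen_pos {k : ℕ} : IsOpen {t : Fin k → ℝ | ∀ i, 0 < t i} := by
  have : {t : Fin k → ℝ | ∀ i, 0 < t i} = ⋂ i, {t : Fin k → ℝ | 0 < t i} := by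
    ext t; simp
  rw [this]
  exact isOpen_iInter_of_finite fun i => isOpen_lt continuous_const (by fun_prop)

theorem sieveRegion_simplex {k : ℕ} (hk : 3 ≤ k) :
    SieveRegion (simplexRegion k)
      ({t | ∀ i, 0 < t i} ∩ {t | ∑ i ∈ (Finset.univ : Finset (Fin k)), t i < 1}) 1 := by
  have hle : ∀ t : Fin k → ℝ, (∀ i, 0 ≤ t i) → ∀ j, t j ≤ ∑ i, t i := fun t ht j =>
    Finset.single_le_sum (fun i _ => ht i) (Finset.mem_univ j)
  refine ⟨isOpen_pos.inter (isOpen_lt (by fun_prop) continuous_const),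
    convex_pos_sum_lt.inter (convex_sum_lt _), ?_, ?_, fun t ht => ht.2, ?_,
    facePlanes k, facePlanes_card k, facePlanes_ne_zero (by omega), ?_⟩
  · rintro t ⟨h1, h2⟩
    exact ⟨fun i => ⟨(h1 i).le, (hle t (fun i => (h1 i).le) i).trans (le_of_lt h2)⟩, le_of_lt h2⟩
  · rintro t ⟨h1, -⟩
    exact ⟨fun i => (h1 i).1, fun i => (h1 i).2⟩
  · rintro t ⟨h1, h2⟩ j
    have h2' : ∑ i, t i < 1 := h2
    rw [← Finset.add_sum_erase _ _ (Finset.mem_univ j)] at h2'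
    linarith [h1 j]
  · rintro t ⟨h1, h2⟩ hn
    by_cases h : ∀ i, 0 < t i
    · refine ⟨_, mem_facePlanes_one k, ?_⟩
      have : ¬ ∑ i, t i < 1 := fun h' => hn ⟨h, h'⟩
      simp only [Pi.one_apply, one_mul]
      linarith
    · push Not at h
      obtain ⟨j, hj⟩ := h
      refine ⟨_, mem_facePlanes_single j, ?_⟩
      rw [sum_single_mul]
      exact le_antisymm hj (h1 j).1

theorem sieveRegion_extended {k : ℕ} (hk : 3 ≤ k) :
    SieveRegion (extendedRegion k)
      ({t | ∀ i, 0 < t i} ∩ ⋂ j, {t | ∑ i ∈ Finset.univ.erase j, t i < 1})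
      ((k : ℝ) / ((k : ℝ) - 1)) := by
  have hk1 : (0 : ℝ) < (k : ℝ) - 1 := by
    have : (3 : ℝ) ≤ k := by exact_mod_cast hk
    linarith
  refine ⟨isOpen_pos.inter (isOpen_iInter_of_finite fun j =>
      isOpen_lt (by fun_prop) continuous_const),
    convex_pos_sum_lt.inter (convex_iInter fun j => convex_sum_lt _), ?_, ?_, ?_,
    fun t ht j => mem_iInter.1 ht.2 j,
    facePlanes k, facePlanes_card k, facePlanes_ne_zero (by omega), ?_⟩
  · rintro t ⟨h1, h2⟩
    have h2' : ∀ j, ∑ i ∈ Finset.univ.erase j, t i < 1 := fun j => mem_iInter.1 h2 j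
    refine ⟨fun i => ⟨(h1 i).le, ?_⟩, fun j => (h2' j).le⟩
    have : Nontrivial (Fin k) := Fin.nontrivial_iff_two_le.2 (by omega)
    obtain ⟨j, hj⟩ := exists_ne i
    refine le_trans ?_ (h2' j).le
    exact Finset.single_le_sum (fun i _ => (h1 i).le)
      (Finset.mem_erase.2 ⟨hj.symm, Finset.mem_univ i⟩)
  · rintro t ⟨h1, -⟩
    exact ⟨fun i => (h1 i).1, fun i => (h1 i).2⟩
  · rintro t ⟨-, h2⟩
    -- Adding the k constraints counts every t_i exactly k - 1 times.
    rw [le_div_iff₀ hk1, mul_comm, ← sum_sum_erase]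
    calc ∑ j, ∑ i ∈ Finset.univ.erase j, t i ≤ ∑ _j : Fin k, (1 : ℝ) :=
          Finset.sum_le_sum fun j _ => h2 j
      _ = k := by simp
  · rintro t ⟨h1, h2⟩ hn
    by_cases h : ∀ i, 0 < t i
    · have : ¬ ∀ j, ∑ i ∈ Finset.univ.erase j, t i < 1 := fun h' =>
        hn ⟨h, mem_iInter.2 h'⟩
      push Not at this
      obtain ⟨j, hj⟩ := this
      refine ⟨_, mem_facePlanes_erase j, ?_⟩
      rw [sum_erase_eq]
      exact le_antisymm (h2 j) hj
    · push Not at h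
      obtain ⟨j, hj⟩ := h
      refine ⟨_, mem_facePlanes_single j, ?_⟩
      rw [sum_single_mul]
      exact le_antisymm hj (h1 j).1

/-! ### The sieve function -/

variable {k : ℕ} {S U : Set (Fin k → ℝ)} {κ : ℝ} {F : (Fin k → ℝ) → ℝ}

theorem sizeAt_nonneg (F : (Fin k → ℝ) → ℝ) (t : Fin k → ℝ) : 0 ≤ sizeAt F t :=
  add_nonneg (abs_nonneg _) (Finset.sum_nonneg fun _ _ => abs_nonneg _)

theorem AlmostPrimeSieve.IsSieveFunction.sizeAt_le (hF : IsSieveFunction S F) {t : Fin k → ℝ}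
    (ht : t ∈ Icc 0 1) : sizeAt F t ≤ Fmax F := le_csSup hF.bdd ⟨t, ht, rfl⟩

theorem AlmostPrimeSieve.IsSieveFunction.Fmax_nonneg (hF : IsSieveFunction S F) : 0 ≤ Fmax F :=
  (sizeAt_nonneg F 0).trans (hF.sizeAt_le ⟨le_rfl, zero_le_one⟩)

theorem AlmostPrimeSieve.IsSieveFunction.eq_zero (hF : IsSieveFunction S F) {t : Fin k → ℝ}
    (ht : t ∉ S) : F t = 0 :=
  image_eq_zero_of_notMem_tsupport fun h => ht (hF.supp h)

theorem AlmostPrimeSieve.IsSieveFunction.le_Fmax (hF : IsSieveFunction S F)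
    (hS : SieveRegion S U κ) (t : Fin k → ℝ) : F t ≤ Fmax F := by
  by_cases ht : t ∈ S
  · refine le_trans ?_ (hF.sizeAt_le (hS.cube ht))
    refine (le_abs_self _).trans (le_add_of_nonneg_right ?_)
    exact Finset.sum_nonneg fun _ _ => abs_nonneg _
  · rw [hF.eq_zero ht]
    exact hF.Fmax_nonneg

/-- F need not be continuous at the boundary of S, so it is cut off to the open set U. There `Fmax`
bounds the partial derivatives, and the mean value theorem on the interval in which a line meets U
gives the Lipschitz bound along the axes. -/
theorem SieveRegion.axisLip (hS : SieveRegion S U κ) (hF : IsSieveFunction S F) :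
    AxisLip U (Fmax F) (U.indicator F) := by
  have hUi : U ⊆ interior S := interior_maximal hS.subset hS.isOpen
  refine ⟨?_, fun t => indicator_nonneg (fun t _ => hF.nonneg t) t, fun t => ?_,
    fun t ht => indicator_of_notMem ht F, fun t l s s' hs hs' => ?_⟩
  · classical
    have := ContinuousOn.measurable_piecewise (f := F) (g := fun _ => (0 : ℝ)) (s := U)
      ((hF.diff.mono hUi).continuousOn) continuousOn_const hS.isOpen.measurableSet
    convert this using 1
    ext t
    by_cases ht : t ∈ U
    · rw [indicator_of_mem ht, piecewise_eq_of_mem _ _ _ ht]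
    · rw [indicator_of_notMem ht, piecewise_eq_of_notMem _ _ _ ht]
  · by_cases ht : t ∈ U
    · rw [indicator_of_mem ht]; exact hF.le_Fmax hS t
    · rw [indicator_of_notMem ht]; exact hF.Fmax_nonneg
  · rw [indicator_of_mem hs, indicator_of_mem hs']
    set J : Set ℝ := {s : ℝ | Function.update t l s ∈ U} with hJ
    have hJc : Convex ℝ J := by
      have := ordConnected_line hS.convex t l 0
      simp only [add_zero] at this
      exact this.convex
    have hd : ∀ x ∈ J, DifferentiableAt ℝ (fun s => F (Function.update t l s)) x := by
      intro x hx
      have h1 : DifferentiableAt ℝ F (Function.update t l x) :=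
        (hF.diff _ (hUi hx)).differentiableAt (isOpen_interior.mem_nhds (hUi hx))
      exact h1.comp x (hasDerivAt_update t l x).differentiableAt
    have hb : ∀ x ∈ J, ‖deriv (fun s => F (Function.update t l s)) x‖ ≤ Fmax F := by
      intro x hx
      have h1 := hF.sizeAt_le (hS.cube (hS.subset hx))
      refine le_trans ?_ h1
      have h2 : |deriv (fun s => F (Function.update (Function.update t l x) l s))
          (Function.update t l x l)| ≤ ∑ i, |deriv (fun s => F (Function.update
            (Function.update t l x) i s)) (Function.update t l x i)| :=
        Finset.single_le_sum (f := fun i => |deriv (fun s => F (Function.update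
            (Function.update t l x) i s)) (Function.update t l x i)|)
          (fun _ _ => abs_nonneg _) (Finset.mem_univ l)
      simp only [Function.update_idem, Function.update_self] at h2
      rw [Real.norm_eq_abs]
      refine h2.trans ?_
      exact le_add_of_nonneg_left (abs_nonneg _)
    have := hJc.norm_image_sub_le_of_norm_deriv_le hd hb hs' hs
    simpa only [Real.norm_eq_abs] using this

theorem log_prod_erase {r : Fin k → ℕ} (hr : ∀ i, r i ≠ 0) (s : Finset (Fin k)) :
    Real.log ((∏ i ∈ s, r i : ℕ) : ℝ) = ∑ i ∈ s, Real.log (r i) := by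
  push_cast
  exact Real.log_prod fun i _ => by exact_mod_cast hr i

/-- Off the boundary of the region, `y_r` depends on `F` inside `U` only. -/
theorem SieveRegion.sieveY_eq (hS : SieveRegion S U κ) (hF : IsSieveFunction S F) {W : ℕ} {R : ℝ}
    (hR : 1 < R) {r : Fin k → ℕ} (hr : Squarefree (∏ i, r i)) (hrW : Nat.Coprime (∏ i, r i) W)
    (hb : ¬ ((fun i => Real.log (r i) / Real.log R) ∈ S ∧
      (fun i => Real.log (r i) / Real.log R) ∉ U)) :
    sieveY W R F r = U.indicator F fun i => Real.log (r i) / Real.log R := by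
  have hlR : 0 < Real.log R := Real.log_pos hR
  have hr0 : ∀ i, r i ≠ 0 := fun i h =>
    hr.ne_zero (Finset.prod_eq_zero (Finset.mem_univ i) h)
  by_cases hU : (fun i => Real.log (r i) / Real.log R) ∈ U
  · rw [indicator_of_mem hU, sieveY, if_pos]
    refine ⟨hr, hrW, fun j => ?_⟩
    have h1 := hS.sum_erase_lt _ hU j
    rw [← Finset.sum_div, div_lt_one hlR, ← log_prod_erase hr0] at h1
    have hpos : 0 < ∏ i ∈ Finset.univ.erase j, r i :=
      Nat.pos_of_ne_zero (Finset.prod_ne_zero_iff.2 fun i _ => hr0 i)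
    exact (Real.log_lt_log_iff (by exact_mod_cast hpos) (by linarith)).1 h1
  · have hS' : (fun i => Real.log (r i) / Real.log R) ∉ S := fun h => hb ⟨h, hU⟩
    rw [indicator_of_notMem hU, sieveY, hF.eq_zero hS', ite_self]

theorem SieveRegion.sieveY_nonneg (hF : IsSieveFunction S F) (W : ℕ) (R : ℝ) (r : Fin k → ℕ) :
    0 ≤ sieveY W R F r := by
  unfold sieveY
  split_ifs
  · exact hF.nonneg _
  · exact le_rfl

theorem SieveRegion.sieveY_le (hS : SieveRegion S U κ) (hF : IsSieveFunction S F) (W : ℕ) (R : ℝ)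
    (r : Fin k → ℕ) : sieveY W R F r ≤ Fmax F := by
  unfold sieveY
  split_ifs
  · exact hF.le_Fmax hS _
  · exact hF.Fmax_nonneg

/-- `y_r` vanishes unless `∏ r_i ≤ R^κ`. -/
theorem SieveRegion.sieveY_eq_zero_of_lt (hS : SieveRegion S U κ) (hF : IsSieveFunction S F)
    {W : ℕ} {R : ℝ} (hR : 1 < R) {r : Fin k → ℕ} (h : R ^ κ < ((∏ i, r i : ℕ) : ℝ)) :
    sieveY W R F r = 0 := by
  have hlR : 0 < Real.log R := Real.log_pos hR
  rw [sieveY, hF.eq_zero, ite_self]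
  intro hmem
  have h1 := hS.sum_le _ hmem
  have hr0 : ∀ i, r i ≠ 0 := by
    intro i hi
    rw [Finset.prod_eq_zero (Finset.mem_univ i) hi] at h
    have := Real.rpow_nonneg (show 0 ≤ R by linarith) κ
    push_cast at h
    linarith
  rw [← Finset.sum_div, div_le_iff₀ hlR, ← log_prod_erase hr0] at h1
  have h2 := Real.log_lt_log (Real.rpow_pos_of_pos (by linarith) κ) h
  rw [Real.log_rpow (by linarith)] at h2
  linarith

/-! ### The functional `I₀` -/

/-- F and its cut-off differ only on finitely many hyperplanes. The points whose translate by y e_j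
meets such a hyperplane lie on a parallel one, with right-hand side b - a_j y; all of them are null
sets. -/
theorem SieveRegion.I0_eq (hS : SieveRegion S U κ) (hF : IsSieveFunction S F) (j : Fin k) (y : ℝ) :
    I0 F j y = ∫ t in Icc (0 : Fin k → ℝ) 1, shiftSq (U.indicator F) j y t := by
  obtain ⟨P, -, hP0, hP⟩ := hS.boundary
  unfold I0
  refine integral_congr_ae ?_
  have h1 : ∀ᵐ t ∂(volume : Measure (Fin k → ℝ)).restrict (Icc 0 1),
      ∀ q ∈ P, ∑ i, q.1 i * t i ≠ q.2 := by
    rw [Filter.eventually_all_finset]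
    intro q hq
    rw [ae_iff]
    simpa using volume_cube_inter_hyperplane (hP0 q hq) q.2
  have h2 : ∀ᵐ t ∂(volume : Measure (Fin k → ℝ)).restrict (Icc 0 1),
      ∀ q ∈ P, ∑ i, q.1 i * t i ≠ q.2 - q.1 j * y := by
    rw [Filter.eventually_all_finset]
    intro q hq
    rw [ae_iff]
    simpa using volume_cube_inter_hyperplane (hP0 q hq) (q.2 - q.1 j * y)
  have hind : ∀ t : Fin k → ℝ, (∀ q ∈ P, ∑ i, q.1 i * t i ≠ q.2) → F t = U.indicator F t := by
    intro t ht
    by_cases hU : t ∈ U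
    · rw [indicator_of_mem hU]
    · rw [indicator_of_notMem hU, hF.eq_zero]
      intro hSt
      obtain ⟨q, hq, he⟩ := hP t hSt hU
      exact ht q hq he
  filter_upwards [h1, h2] with t ht1 ht2
  rw [shiftSq, ← hind t ht1, ← hind]
  intro q hq he
  refine ht2 q hq ?_
  rw [← he]
  have : ∀ i, q.1 i * Function.update t j (t j + y) i =
      q.1 i * t i + if i = j then q.1 j * y else 0 := by
    intro i
    by_cases hi : i = j
    · subst hi; simp; ring
    · simp [hi]
  simp only [this, Finset.sum_add_distrib, Finset.sum_ite_eq', Finset.mem_univ, if_true]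
  ring

theorem setIntegral_indicator_point_le (a d e : ℝ) (h : d ≤ e) :
    ∫ s in Icc (0 : ℝ) 1, (Icc (s + d) (s + e)).indicator (1 : ℝ → ℝ) a ≤ e - d := by
  have : ∀ s, (Icc (s + d) (s + e)).indicator (1 : ℝ → ℝ) a =
      (Icc (a - e) (a - d)).indicator (fun _ => (1 : ℝ)) s := by
    intro s
    have hiff : a ∈ Icc (s + d) (s + e) ↔ s ∈ Icc (a - e) (a - d) := by
      simp only [mem_Icc]
      constructor <;> rintro ⟨h1, h2⟩ <;> constructor <;> linarith
    by_cases hs : s ∈ Icc (a - e) (a - d)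
    · rw [indicator_of_mem hs, indicator_of_mem (hiff.2 hs), Pi.one_apply]
    · rw [indicator_of_notMem hs, indicator_of_notMem (fun h => hs (hiff.1 h))]
  simp only [this]
  calc ∫ s in Icc (0 : ℝ) 1, (Icc (a - e) (a - d)).indicator (fun _ => (1 : ℝ)) s
      ≤ ∫ s, (Icc (a - e) (a - d)).indicator (fun _ => (1 : ℝ)) s := by
        refine setIntegral_le_integral ?_ (Filter.Eventually.of_forall fun s =>
          indicator_nonneg (fun _ _ => zero_le_one) s)
        exact (integrable_indicator_iff measurableSet_Icc).2 (by simp)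
    _ = e - d := by
        rw [integral_indicator_const _ measurableSet_Icc]
        simp [h]

/-- The difference of squares is at most 2K times the change of f between the shifts y and y'. On a
line in direction j that change is at most K(y' - y), plus K when one of two jump points lies in
between, which happens on a set of s of length at most y' - y for each. In all 2K · 3K (y' - y). -/
theorem AxisLip.integral_shiftSq_sub_le {K : ℝ} {f : (Fin k → ℝ) → ℝ} (hU : Convex ℝ U)
    (hU1 : U ⊆ Icc 0 1) (hf : AxisLip U K f) (j : Fin k) {y y' : ℝ} (hy : y ≤ y') :
    |(∫ t in Icc (0 : Fin k → ℝ) 1, shiftSq f j y t) -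
      ∫ t in Icc (0 : Fin k → ℝ) 1, shiftSq f j y' t| ≤ 6 * K ^ 2 * (y' - y) := by
  have hK := hf.const_nonneg
  have hInt : ∀ y, IntegrableOn (shiftSq f j y) (Icc (0 : Fin k → ℝ) 1) volume := fun y =>
    Measure.integrableOn_of_bounded (M := K ^ 2) (isCompact_Icc.measure_lt_top).ne
      (hf.measurable_shiftSq j y).aestronglyMeasurable
      (Filter.Eventually.of_forall fun t => by
        rw [Real.norm_eq_abs, abs_of_nonneg (shiftSq_nonneg _ _ _ _)]
        exact hf.shiftSq_le j y t)
  rw [← integral_sub (hInt y) (hInt y')]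
  refine (abs_integral_le_integral_abs).trans ?_
  have hpt : ∀ t, |shiftSq f j y t - shiftSq f j y' t| ≤
      2 * K * |f (Function.update t j (t j + y)) - f (Function.update t j (t j + y'))| := by
    intro t
    have e : shiftSq f j y t - shiftSq f j y' t =
        -((f (Function.update t j (t j + y)) - f (Function.update t j (t j + y'))) *
          ((f t - f (Function.update t j (t j + y))) +
            (f t - f (Function.update t j (t j + y'))))) := by
      unfold shiftSq; ring
    rw [e, abs_neg, abs_mul, mul_comm]
    refine mul_le_mul_of_nonneg_right ?_ (abs_nonneg _)
    have h1 := hf.nonneg t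
    have h2 := hf.le t
    have h3 := hf.nonneg (Function.update t j (t j + y))
    have h4 := hf.le (Function.update t j (t j + y))
    have h5 := hf.nonneg (Function.update t j (t j + y'))
    have h6 := hf.le (Function.update t j (t j + y'))
    rw [abs_le]
    constructor <;> linarith
  refine setIntegral_cube_le (M := K ^ 2)
    (G := fun t => |shiftSq f j y t - shiftSq f j y' t|)
    ((hf.measurable_shiftSq j y).sub (hf.measurable_shiftSq j y')).abs
    (fun t => abs_nonneg _) (fun t => ?_) j (fun t => ?_)
  · have h1 := hf.shiftSq_le j y t
    have h2 := hf.shiftSq_le j y' t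
    have h3 := shiftSq_nonneg f j y t
    have h4 := shiftSq_nonneg f j y' t
    rw [abs_le]
    constructor <;> linarith
  · obtain ⟨a, b, hab⟩ := hf.abs_sub_le hU hU1 t j
    have hb : ∀ s, |shiftSq f j y (Function.update t j s) -
        shiftSq f j y' (Function.update t j s)| ≤ 2 * K * (K * (y' - y) +
          K * ((Icc (s + y) (s + y')).indicator (1 : ℝ → ℝ) a +
            (Icc (s + y) (s + y')).indicator (1 : ℝ → ℝ) b)) := by
      intro s
      refine (hpt _).trans (mul_le_mul_of_nonneg_left ?_ (by positivity))
      simp only [Function.update_self, Function.update_idem]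
      refine (hab (s + y) (s + y') (by linarith)).trans (le_of_eq ?_)
      ring
    have hind : ∀ a : ℝ, IntegrableOn (fun s : ℝ => (Icc (s + y) (s + y')).indicator (1 : ℝ → ℝ) a)
        (Icc 0 1) volume := by
      intro a
      have hm : Measurable fun s : ℝ => (Icc (s + y) (s + y')).indicator (1 : ℝ → ℝ) a := by
        have h1 : IsClosed {s : ℝ | s + y ≤ a} := isClosed_le (by fun_prop) continuous_const
        have h2 : IsClosed {s : ℝ | a ≤ s + y'} := isClosed_le continuous_const (by fun_prop)
        have : MeasurableSet {s : ℝ | a ∈ Icc (s + y) (s + y')} := (h1.inter h2).measurableSet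
        exact Measurable.ite this measurable_const measurable_const
      refine Measure.integrableOn_of_bounded (M := 1) (by simp) hm.aestronglyMeasurable
        (Filter.Eventually.of_forall fun s => ?_)
      by_cases h : a ∈ Icc (s + y) (s + y')
      · rw [indicator_of_mem h]; simp
      · rw [indicator_of_notMem h]; simp
    have hI1 : IntegrableOn (fun s : ℝ => 2 * K * (K * (y' - y) +
          K * ((Icc (s + y) (s + y')).indicator (1 : ℝ → ℝ) a +
            (Icc (s + y) (s + y')).indicator (1 : ℝ → ℝ) b))) (Icc 0 1) volume :=
      Integrable.const_mul (Integrable.add (integrable_const _)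
        (Integrable.const_mul ((hind a).add (hind b)) K)) (2 * K)
    refine (integral_mono_of_nonneg (Filter.Eventually.of_forall fun s => abs_nonneg _) hI1
      (Filter.Eventually.of_forall hb)).trans ?_
    have hc : IntegrableOn (fun _ : ℝ => K * (y' - y)) (Icc (0 : ℝ) 1) volume :=
      integrable_const _
    have hab' : IntegrableOn (fun s : ℝ => K * ((Icc (s + y) (s + y')).indicator (1 : ℝ → ℝ) a +
            (Icc (s + y) (s + y')).indicator (1 : ℝ → ℝ) b)) (Icc 0 1) volume :=
      Integrable.const_mul ((hind a).add (hind b)) K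
    rw [integral_const_mul, integral_add hc hab', integral_const_mul K,
      integral_const_mul K, integral_add (hind a) (hind b)]
    have h1 := setIntegral_indicator_point_le a y y' hy
    have h2 := setIntegral_indicator_point_le b y y' hy
    simp only [integral_const, MeasurableSet.univ, measureReal_restrict_apply, univ_inter,
      Real.volume_real_Icc, sub_zero, zero_le_one, sup_of_le_left, smul_eq_mul, one_mul]
    nlinarith [mul_nonneg hK hK, mul_le_mul_of_nonneg_left h1 (mul_nonneg hK hK),
      mul_le_mul_of_nonneg_left h2 (mul_nonneg hK hK)]

theorem SieveRegion.abs_I0_sub_le (hS : SieveRegion S U κ) (hF : IsSieveFunction S F) (j : Fin k)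
    (y y' : ℝ) : |I0 F j y - I0 F j y'| ≤ 6 * Fmax F ^ 2 * |y - y'| := by
  have hU1 := hS.subset.trans hS.cube
  rw [hS.I0_eq hF, hS.I0_eq hF]
  rcases le_total y y' with h | h
  · rw [abs_sub_comm y, abs_of_nonneg (sub_nonneg.2 h)]
    exact (hS.axisLip hF).integral_shiftSq_sub_le hS.convex hU1 j h
  · rw [abs_sub_comm, abs_of_nonneg (sub_nonneg.2 h)]
    exact (hS.axisLip hF).integral_shiftSq_sub_le hS.convex hU1 j h

theorem I0_zero (F : (Fin k → ℝ) → ℝ) (j : Fin k) : I0 F j 0 = 0 := by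
  simp [I0]

theorem I0_nonneg (F : (Fin k → ℝ) → ℝ) (j : Fin k) (y : ℝ) : 0 ≤ I0 F j y :=
  integral_nonneg fun _ => sq_nonneg _

/-- Linear decay at 0 makes I₀(y)/y bounded, so the truncation of the main term at small y is
harmless. -/
theorem SieveRegion.I0_le (hS : SieveRegion S U κ) (hF : IsSieveFunction S F) (j : Fin k)
    {y : ℝ} (hy : 0 ≤ y) : I0 F j y ≤ 6 * Fmax F ^ 2 * y := by
  have := hS.abs_I0_sub_le hF j y 0
  rwa [I0_zero, sub_zero, sub_zero, abs_of_nonneg hy, abs_of_nonneg (I0_nonneg F j y)] at this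

end

section

open Finset

/-! ### Weighted sums over a power of a finite set -/

/-- The discrete counterpart of integrating along lines: a uniform bound for the sums along
coordinate l is multiplied by the mass of the other k - 1 coordinates. -/
theorem sum_piFinset_le {ι : Type*} {k : ℕ} (A : Finset ι) (g : ι → ℝ) (hg : ∀ n ∈ A, 0 ≤ g n)
    (G : (Fin k → ι) → ℝ) (l : Fin k) {B : ℝ} (hB0 : 0 ≤ B)
    (hB : ∀ r ∈ Fintype.piFinset (fun _ : Fin k => A),
      ∑ n ∈ A, g n * G (Function.update r l n) ≤ B) :
    ∑ r ∈ Fintype.piFinset (fun _ : Fin k => A), (∏ i, g (r i)) * G r ≤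
      (∑ n ∈ A, g n) ^ (k - 1) * B := by
  classical
  rcases A.eq_empty_or_nonempty with rfl | ⟨a, ha⟩
  · have h0 : Fintype.piFinset (fun _ : Fin k => (∅ : Finset ι)) = ∅ :=
      eq_empty_of_forall_notMem fun r hr => by simpa using Fintype.mem_piFinset.1 hr l
    rw [h0, sum_empty, sum_empty]
    positivity
  -- One representative for each line parallel to the l-th axis, its l-th coordinate being pinned at
  -- an arbitrary a in A.
  set T : Finset (Fin k → ι) := Fintype.piFinset (Function.update (fun _ : Fin k => A) l {a})
    with hT
  have hTA : ∀ r ∈ T, r ∈ Fintype.piFinset (fun _ : Fin k => A) ∧ r l = a := by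
    intro r hr
    rw [hT, Fintype.mem_piFinset] at hr
    have hl : r l = a := by simpa using hr l
    refine ⟨Fintype.mem_piFinset.2 fun i => ?_, hl⟩
    by_cases hi : i = l
    · subst hi; rw [hl]; exact ha
    · simpa [hi] using hr i
  have e1 : ∑ r ∈ Fintype.piFinset (fun _ : Fin k => A), (∏ i, g (r i)) * G r =
      ∑ r ∈ T, ∑ n ∈ A, (∏ i ∈ univ.erase l, g (r i)) * (g n * G (Function.update r l n)) := by
    rw [← sum_product']
    refine sum_bij' (fun r _ => (Function.update r l a, r l))
      (fun z _ => Function.update z.1 l z.2) ?_ ?_ ?_ ?_ ?_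
    · intro r hr
      rw [Fintype.mem_piFinset] at hr
      refine mem_product.2 ⟨Fintype.mem_piFinset.2 fun i => ?_, hr l⟩
      by_cases hi : i = l
      · subst hi; simp
      · simpa [hi] using hr i
    · intro z hz
      rw [mem_product] at hz
      refine Fintype.mem_piFinset.2 fun i => ?_
      by_cases hi : i = l
      · subst hi; simpa using hz.2
      · simpa [hi] using Fintype.mem_piFinset.1 (hTA _ hz.1).1 i
    · intro r _
      simp
    · intro z hz
      rw [mem_product] at hz
      have := (hTA _ hz.1).2
      ext i
      · by_cases hi : i = l
        · subst hi; simp [this]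
        · simp [hi]
      · simp
    · intro r _
      rw [← mul_prod_erase univ _ (mem_univ l)]
      simp only [Function.update_idem, Function.update_eq_self]
      rw [prod_congr rfl fun i hi => by
        rw [← Function.update_of_ne (ne_of_mem_erase hi) a r]]
      ring
  have e2 : ∑ r ∈ T, ∏ i ∈ univ.erase l, g (r i) = (∑ n ∈ A, g n) ^ (k - 1) := by
    have h := prod_univ_sum (Function.update (fun _ : Fin k => A) l {a})
      (fun i n => if i = l then (1 : ℝ) else g n)
    rw [← hT] at h
    have h3 : ∏ i, ∑ n ∈ Function.update (fun _ : Fin k => A) l {a} i,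
        (if i = l then (1 : ℝ) else g n) = (∑ n ∈ A, g n) ^ (k - 1) := by
      rw [← mul_prod_erase univ _ (mem_univ l)]
      simp only [Function.update_self, if_true, sum_singleton, one_mul]
      rw [prod_congr rfl fun i hi => by
        rw [Function.update_of_ne (ne_of_mem_erase hi), sum_congr rfl fun n _ =>
          if_neg (ne_of_mem_erase hi)], prod_const, card_erase_of_mem (mem_univ l), card_univ,
        Fintype.card_fin]
    rw [← h3, h]
    refine sum_congr rfl fun r _ => ?_
    rw [← mul_prod_erase univ (fun i => if i = l then (1 : ℝ) else g (r i)) (mem_univ l),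
      if_pos rfl, one_mul]
    exact prod_congr rfl fun i hi => (if_neg (ne_of_mem_erase hi)).symm
  rw [e1, ← e2, sum_mul]
  refine sum_le_sum fun r hr => ?_
  rw [← mul_sum]
  exact mul_le_mul_of_nonneg_left (hB r (hTA r hr).1) (prod_nonneg fun i _ =>
    hg _ (Fintype.mem_piFinset.1 (hTA r hr).1 i))

theorem sum_piFinset_prod {ι : Type*} {k : ℕ} [DecidableEq ι] (A : Finset ι) (g : ι → ℝ) :
    ∑ r ∈ Fintype.piFinset (fun _ : Fin k => A), ∏ i, g (r i) = (∑ n ∈ A, g n) ^ k := by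
  have := prod_univ_sum (fun _ : Fin k => A) (fun _ n => g n)
  rw [← this, prod_const, card_univ, Fintype.card_fin]

theorem sum_piFinset_filter_le {ι : Type*} {k : ℕ} [DecidableEq ι] (A : Finset ι) (g : ι → ℝ)
    (hg : ∀ n ∈ A, 0 ≤ g n) (q : ι → Prop) [DecidablePred q] {δ : ℝ}
    (hδ : ∑ n ∈ A.filter q, g n ≤ δ * ∑ n ∈ A, g n) (s : Finset (Fin k)) :
    ∑ r ∈ (Fintype.piFinset (fun _ : Fin k => A)).filter (fun r => ∀ i ∈ s, q (r i)),
      ∏ i, g (r i) ≤ δ ^ s.card * (∑ n ∈ A, g n) ^ k := by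
  have h1 : (Fintype.piFinset (fun _ : Fin k => A)).filter (fun r => ∀ i ∈ s, q (r i)) =
      Fintype.piFinset (fun i : Fin k => if i ∈ s then A.filter q else A) := by
    ext r
    simp only [mem_filter, Fintype.mem_piFinset]
    constructor
    · rintro ⟨h, h'⟩ i
      split_ifs with hi
      · exact mem_filter.2 ⟨h i, h' i hi⟩
      · exact h i
    · intro h
      refine ⟨fun i => ?_, fun i hi => ?_⟩
      · have := h i
        split_ifs at this
        · exact (mem_filter.1 this).1
        · exact this
      · have := h i
        rw [if_pos hi] at this
        exact (mem_filter.1 this).2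
  have h2 := prod_univ_sum (fun i : Fin k => if i ∈ s then A.filter q else A) (fun _ n => g n)
  rw [h1, ← h2]
  calc ∏ i : Fin k, ∑ n ∈ (if i ∈ s then A.filter q else A), g n
      ≤ ∏ i : Fin k, ((if i ∈ s then δ else 1) * ∑ n ∈ A, g n) := by
        refine prod_le_prod (fun i _ => sum_nonneg fun n hn => ?_) fun i _ => ?_
        · split_ifs at hn
          · exact hg n (mem_filter.1 hn).1
          · exact hg n hn
        · split_ifs
          · exact hδ
          · rw [one_mul]
    _ = _ := by
        rw [prod_mul_distrib, prod_const, card_univ, Fintype.card_fin, prod_ite_mem,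
          univ_inter, prod_const]

theorem one_sub_sum_le_prod {ι : Type*} (s : Finset ι) (a : ι → ℝ) (h0 : ∀ i ∈ s, 0 ≤ a i)
    (h1 : ∀ i ∈ s, a i ≤ 1) : 1 - ∑ i ∈ s, a i ≤ ∏ i ∈ s, (1 - a i) := by
  classical
  induction s using Finset.induction_on with
  | empty => simp
  | insert b s hb ih =>
    rw [sum_insert hb, prod_insert hb]
    have ih := ih (fun i hi => h0 i (mem_insert_of_mem hi)) (fun i hi => h1 i (mem_insert_of_mem hi))
    have hb0 := h0 b (mem_insert_self b s)
    have hb1 := h1 b (mem_insert_self b s)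
    have hs : 0 ≤ ∑ i ∈ s, a i := sum_nonneg fun i hi => h0 i (mem_insert_of_mem hi)
    nlinarith [mul_le_mul_of_nonneg_left ih (sub_nonneg.2 hb1), mul_nonneg hb0 hs]

/-! ### Weights of tuples -/

theorem squarefree_prod_of {k : ℕ} {r : Fin k → ℕ}
    (h1 : ∀ q : ℕ, q.Prime → ∀ i, ¬ q ^ 2 ∣ r i)
    (h2 : ∀ q : ℕ, q.Prime → ∀ i l, i ≠ l → ¬ (q ∣ r i ∧ q ∣ r l)) : Squarefree (∏ i, r i) := by
  rw [Nat.squarefree_iff_prime_squarefree]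
  intro q hq hd
  obtain ⟨i, -, hi⟩ := (Prime.dvd_finsetProd_iff hq.prime _).1 ((dvd_mul_right q q).trans hd)
  have hc : Nat.Coprime (q ^ 2) (∏ l ∈ univ.erase i, r l) := by
    refine Nat.Coprime.pow_left 2 ((Nat.Prime.coprime_iff_not_dvd hq).2 fun h => ?_)
    obtain ⟨l, hl, hl'⟩ := (Prime.dvd_finsetProd_iff hq.prime _).1 h
    exact h2 q hq i l (ne_of_mem_erase hl).symm ⟨hi, hl'⟩
  rw [← mul_prod_erase univ r (mem_univ i), ← sq] at hd
  exact h1 q hq i (hc.dvd_of_dvd_mul_right hd)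

theorem dvd_of_squarefree {n m : ℕ} (hn : Squarefree n) (hm : m ≠ 0)
    (h : ∀ q : ℕ, q.Prime → q ∣ n → q ∣ m) : n ∣ m := by
  rw [← Nat.prod_primeFactors_of_squarefree hn]
  refine (prod_dvd_prod_of_subset _ m.primeFactors _ fun q hq => ?_).trans
    (Nat.prod_primeFactors_dvd m)
  rw [Nat.mem_primeFactors] at hq ⊢
  exact ⟨hq.1, h q hq.1 hq.2.1, hm⟩

/-- Prime by prime this is (1 - 1/q)⁻² ≤ 1 + 6/q, that is (q + 6)(q - 1)² ≥ q³. The constant 6 is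
forced by q = 2, where equality holds. -/
theorem div_totient_sq_le {n : ℕ} (hn : n ≠ 0) :
    (n : ℝ) / (Nat.totient n : ℝ) ^ 2 ≤ majorant n := by
  have hn' : (0 : ℝ) < n := by exact_mod_cast Nat.pos_of_ne_zero hn
  have h1 : (Nat.totient n : ℝ) = n * ∏ q ∈ n.primeFactors, (1 - (q : ℝ)⁻¹) := by
    have := Nat.totient_eq_mul_prod_factors n
    have h2 : ((Nat.totient n : ℚ) : ℝ) =
      ((n * ∏ q ∈ n.primeFactors, (1 - (q : ℚ)⁻¹) : ℚ) : ℝ) := by rw [this]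
    push_cast at h2
    exact h2
  have hpos : ∀ q ∈ n.primeFactors, 0 < 1 - (q : ℝ)⁻¹ := by
    intro q hq
    have : (1 : ℝ) < q := by exact_mod_cast (Nat.prime_of_mem_primeFactors hq).one_lt
    rw [sub_pos]
    exact inv_lt_one_of_one_lt₀ this
  have hP : 0 < ∏ q ∈ n.primeFactors, (1 - (q : ℝ)⁻¹) := prod_pos hpos
  rw [h1, majorant, div_le_iff₀ (by positivity)]
  have h3 : 1 ≤ (∏ q ∈ n.primeFactors, (1 + 6 / (q : ℝ))) *
      (∏ q ∈ n.primeFactors, (1 - (q : ℝ)⁻¹)) ^ 2 := by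
    rw [← prod_pow, ← prod_mul_distrib]
    have : (1 : ℝ) = ∏ q ∈ n.primeFactors, (1 : ℝ) := by simp
    refine this.le.trans ?_
    refine prod_le_prod (fun _ _ => zero_le_one) fun q hq => ?_
    have hq2 : (2 : ℝ) ≤ q := by exact_mod_cast (Nat.prime_of_mem_primeFactors hq).two_le
    have e : (1 + 6 / (q : ℝ)) * (1 - (q : ℝ)⁻¹) ^ 2 =
        ((q + 6) * (q - 1) ^ 2) / (q : ℝ) ^ 3 := by
      field_simp
    rw [e, le_div_iff₀ (by positivity)]
    nlinarith
  calc (n : ℝ) = n * 1 := by ring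
    _ ≤ n * ((∏ q ∈ n.primeFactors, (1 + 6 / (q : ℝ))) *
      (∏ q ∈ n.primeFactors, (1 - (q : ℝ)⁻¹)) ^ 2) := mul_le_mul_of_nonneg_left h3 hn'.le
    _ = _ := by field_simp

theorem upperWeight_le {k : ℕ} {r : Fin k → ℕ} (hr : ∀ i, r i ≠ 0) :
    upperWeight r ≤ ∏ i, majorant (r i) :=
  prod_le_prod (fun i _ => by positivity) fun i _ => div_totient_sq_le (hr i)

theorem lowerWeight_le {k : ℕ} {r : Fin k → ℕ}
    (hk : ∀ q : ℕ, q.Prime → ∀ i, q ∣ r i → k ≤ q) :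
    lowerWeight r ≤ ∏ i, 1 / (r i : ℝ) := by
  have h : ∀ i, ∀ q ∈ (r i).primeFactors, 0 ≤ 1 - (k : ℝ) / q ∧ 1 - (k : ℝ) / q ≤ 1 := by
    intro i q hq
    have hqp := Nat.prime_of_mem_primeFactors hq
    have : (k : ℝ) ≤ q := by exact_mod_cast hk q hqp i (Nat.dvd_of_mem_primeFactors hq)
    have hq0 : (0 : ℝ) < q := by exact_mod_cast hqp.pos
    have h1 : (k : ℝ) / q ≤ 1 := (div_le_one hq0).2 this
    have h2 : 0 ≤ (k : ℝ) / q := by positivity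
    constructor <;> linarith
  refine prod_le_prod (fun i _ => mul_nonneg (by positivity) (prod_nonneg fun q hq =>
    (h i q hq).1)) fun i _ => ?_
  exact mul_le_of_le_one_right (by positivity) (prod_le_one (fun q hq => (h i q hq).1)
    fun q hq => (h i q hq).2)

end

/-! ### Sifted integers on the logarithmic scale -/

section

open Finset

/-- The integers `1 ≤ n ≤ R` without prime factors in `P`. -/
noncomputable def sifted (P : Finset ℕ) (R : ℝ) : Finset ℕ :=
  (Icc 1 ⌊R⌋₊).filter fun n => ∀ p ∈ P, ¬ p ∣ n

/-- The density of `∑_{n ∈ sifted P R} 1/n` in the variable `log n / log R`. -/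
noncomputable def logDensity (P : Finset ℕ) (R : ℝ) : ℝ :=
  (∏ p ∈ P, (1 - 1 / (p : ℝ))) * Real.log R

/-- A set of primes `P` that contains all primes below `D`, with `k ≤ D`, and a level `R` that is
large in terms of `P`. -/
structure SieveScale (k : ℕ) (P : Finset ℕ) (D R : ℝ) : Prop where
  prime : ∀ p ∈ P, p.Prime
  one_le : 1 ≤ D
  k_le : (k : ℝ) ≤ D
  le_of_notMem : ∀ q : ℕ, q.Prime → q ∉ P → D ≤ q
  one_lt : 1 < R
  prod_le : 5 * ∏ p ∈ P, (p : ℝ) ≤ logDensity P R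

theorem mem_sifted {P : Finset ℕ} {R : ℝ} {n : ℕ} :
    n ∈ sifted P R ↔ (1 ≤ n ∧ n ≤ ⌊R⌋₊) ∧ ∀ p ∈ P, ¬ p ∣ n := by
  rw [sifted, mem_filter, mem_Icc]

section

variable {k : ℕ} {P : Finset ℕ} {D R : ℝ}

theorem SieveScale.log_pos (h : SieveScale k P D R) : 0 < Real.log R := Real.log_pos h.one_lt

theorem SieveScale.one_le_prod (h : SieveScale k P D R) : (1 : ℝ) ≤ ∏ p ∈ P, (p : ℝ) := by
  have : (1 : ℝ) = ∏ p ∈ P, (1 : ℝ) := by simp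
  rw [this]
  exact prod_le_prod (fun _ _ => zero_le_one) fun p hp => by exact_mod_cast (h.prime p hp).one_lt.le

theorem SieveScale.logDensity_pos (h : SieveScale k P D R) : 0 < logDensity P R := by
  linarith [h.prod_le, h.one_le_prod]

theorem SieveScale.log_div_mem (h : SieveScale k P D R) {n : ℕ} (hn : n ∈ sifted P R) :
    Real.log n / Real.log R ∈ Set.Icc (0 : ℝ) 1 := by
  rw [mem_sifted] at hn
  have h1 : (1 : ℝ) ≤ n := by exact_mod_cast hn.1.1
  have h2 : (n : ℝ) ≤ R := (Nat.le_floor_iff (by linarith [h.one_lt])).1 hn.1.2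
  refine ⟨div_nonneg (Real.log_nonneg h1) h.log_pos.le, (div_le_one h.log_pos).2 ?_⟩
  exact Real.log_le_log (by linarith) h2

theorem SieveScale.sum_majorant_le (h : SieveScale k P D R) {a b : ℝ} (hab : a ≤ b) :
    ∑ n ∈ (sifted P R).filter (fun n : ℕ => Real.log n / Real.log R ∈ Set.Icc a b), majorant n ≤
      Real.exp (12 / D) * (logDensity P R * (b - a) + 5 * ∏ p ∈ P, (p : ℝ)) := by
  have hR : 0 < R := by linarith [h.one_lt]
  have h1 := sum_majorant_interval_le P h.prime h.one_le h.le_of_notMem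
    (X := R ^ a) (Y := R ^ b) (Real.rpow_pos_of_pos hR a)
    (Real.rpow_le_rpow_of_exponent_le h.one_lt.le hab)
  rw [← Real.rpow_sub hR, Real.log_rpow hR] at h1
  refine le_trans (sum_le_sum_of_subset_of_nonneg ?_ fun _ _ _ => majorant_nonneg _) (h1.trans ?_)
  · intro n hn
    rw [mem_filter, mem_sifted] at hn
    obtain ⟨⟨⟨hn1, hn2⟩, hn3⟩, hna, hnb⟩ := hn
    have hn0 : (0 : ℝ) < n := by exact_mod_cast hn1
    rw [le_div_iff₀ h.log_pos, ← Real.log_rpow hR,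
      Real.log_le_log_iff (Real.rpow_pos_of_pos hR a) hn0] at hna
    rw [div_le_iff₀ h.log_pos, ← Real.log_rpow hR,
      Real.log_le_log_iff hn0 (Real.rpow_pos_of_pos hR b)] at hnb
    exact mem_filter.2 ⟨mem_Icc.2 ⟨hn1, Nat.le_floor hnb⟩, hn3, hna⟩
  · rw [logDensity]
    apply le_of_eq
    ring

theorem SieveScale.sum_majorant_total_le (h : SieveScale k P D R) :
    ∑ n ∈ sifted P R, majorant n ≤
      Real.exp (12 / D) * (logDensity P R + 5 * ∏ p ∈ P, (p : ℝ)) := by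
  have := h.sum_majorant_le zero_le_one
  rw [filter_true_of_mem fun n hn => h.log_div_mem hn] at this
  simpa using this

theorem SieveScale.sum_majorant_total_le' (h : SieveScale k P D R) :
    ∑ n ∈ sifted P R, majorant n ≤ 2 * Real.exp 12 * logDensity P R := by
  refine h.sum_majorant_total_le.trans ?_
  have h1 : Real.exp (12 / D) ≤ Real.exp 12 :=
    Real.exp_le_exp.2 (div_le_self (by norm_num) h.one_le)
  have h2 := h.prod_le
  have h3 := h.logDensity_pos
  calc _ ≤ Real.exp 12 * (logDensity P R + logDensity P R) := by
        refine mul_le_mul h1 (by linarith) ?_ (Real.exp_pos _).le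
        have := h.one_le_prod
        positivity
    _ = _ := by ring

theorem SieveScale.abs_sum_one_div_sub_le (h : SieveScale k P D R) :
    |∑ n ∈ sifted P R, 1 / (n : ℝ) - logDensity P R| ≤ 2 * ∏ p ∈ P, (p : ℝ) := by
  have h1 := abs_siftedHarmonic_sub_le P h.prime R (by linarith [h.one_lt])
  rwa [max_eq_left h.log_pos.le] at h1

theorem SieveScale.sum_one_div_le (h : SieveScale k P D R) :
    ∑ n ∈ sifted P R, 1 / (n : ℝ) ≤ 2 * logDensity P R := by
  have := (abs_le.1 h.abs_sum_one_div_sub_le).2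
  have h2 := h.prod_le
  have h3 := h.one_le_prod
  linarith

/-- The distribution function of the masses 1/n at log n / log R, taken at t, is the sifted harmonic
sum up to R^t, hence t `logDensity P R` up to 2 ∏ p. Passing to arbitrary intervals doubles the
error. -/
theorem SieveScale.discrepancy (h : SieveScale k P D R) (J : Set ℝ) (hJ : J.OrdConnected)
    (hJ1 : J ⊆ Set.Icc 0 1) :
    |∑ n ∈ sifted P R, J.indicator (fun _ => 1 / (n : ℝ)) (Real.log n / Real.log R) -
      logDensity P R * MeasureTheory.volume.real J| ≤ 4 * ∏ p ∈ P, (p : ℝ) := by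
  have hR : 0 < R := by linarith [h.one_lt]
  have h1 := discrepancy_of_distribution (sifted P R) (fun n => 1 / (n : ℝ))
    (fun n => Real.log n / Real.log R) (fun n _ => by positivity) (lo := 0) (hi := 1)
    h.logDensity_pos.le (E := 2 * ∏ p ∈ P, (p : ℝ)) (by linarith [h.one_le_prod]) ?_ J hJ hJ1
  · refine h1.trans (le_of_eq ?_)
    ring
  · intro t ht
    have h2 := abs_siftedHarmonic_sub_le P h.prime (R ^ t) (Real.rpow_pos_of_pos hR t).le
    rw [Real.log_rpow hR, max_eq_left (mul_nonneg ht.1 h.log_pos.le)] at h2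
    have e : siftedHarmonic P (R ^ t) = ∑ n ∈ sifted P R,
        (Set.Iic t).indicator (fun _ => 1 / (n : ℝ)) (Real.log n / Real.log R) := by
      simp only [Set.indicator_apply]
      rw [← sum_filter]
      refine sum_congr ?_ fun _ _ => rfl
      ext n
      simp only [mem_filter, mem_sifted, mem_Icc, Set.mem_Iic]
      have key : 1 ≤ n → (Real.log n / Real.log R ≤ t ↔ n ≤ ⌊R ^ t⌋₊) := by
        intro hn
        rw [div_le_iff₀ h.log_pos, ← Real.log_rpow hR, Real.log_le_log_iff (by exact_mod_cast hn)
          (Real.rpow_pos_of_pos hR t), Nat.le_floor_iff (Real.rpow_pos_of_pos hR t).le]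
      have hle : ⌊R ^ t⌋₊ ≤ ⌊R⌋₊ := Nat.floor_le_floor (by
        simpa using Real.rpow_le_rpow_of_exponent_le h.one_lt.le ht.2)
      constructor
      · rintro ⟨⟨hn1, hn2⟩, hn3⟩
        exact ⟨⟨⟨hn1, hn2.trans hle⟩, hn3⟩, (key hn1).2 hn2⟩
      · rintro ⟨⟨⟨hn1, hn2⟩, hn3⟩, hn4⟩
        exact ⟨⟨hn1, (key hn1).1 hn4⟩, hn3⟩
    rw [← e]
    refine le_trans (le_of_eq ?_) h2
    rw [logDensity]
    ring_nf

theorem sum_sifted_dvd_le (P : Finset ℕ) (R : ℝ) {d : ℕ} (hd : d ≠ 0) :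
    ∑ n ∈ (sifted P R).filter (fun n => d ∣ n), 1 / (n : ℝ) ≤
      1 / (d : ℝ) * ∑ n ∈ sifted P R, 1 / (n : ℝ) := by
  rw [mul_sum]
  have hd0 := Nat.pos_of_ne_zero hd
  have h1 : ∑ n ∈ (sifted P R).filter (fun n => d ∣ n), 1 / (n : ℝ) =
      ∑ n ∈ ((sifted P R).filter (fun n => d ∣ n)).image (fun n => n / d),
        1 / (d : ℝ) * (1 / (n : ℝ)) := by
    rw [sum_image]
    · refine sum_congr rfl fun n hn => ?_
      obtain ⟨e, rfl⟩ := (mem_filter.1 hn).2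
      rw [Nat.mul_div_cancel_left e hd0]
      push_cast
      rw [one_div_mul_one_div]
    · intro a ha b hb hab
      obtain ⟨e, rfl⟩ := (mem_filter.1 ha).2
      obtain ⟨e', rfl⟩ := (mem_filter.1 hb).2
      simp only [Nat.mul_div_cancel_left _ hd0] at hab
      rw [hab]
  rw [h1]
  refine sum_le_sum_of_subset_of_nonneg ?_ fun _ _ _ => by positivity
  intro n hn
  rw [mem_image] at hn
  obtain ⟨a, ha, rfl⟩ := hn
  obtain ⟨ha1, e, rfl⟩ := mem_filter.1 ha
  rw [Nat.mul_div_cancel_left e hd0]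
  rw [mem_sifted] at ha1 ⊢
  refine ⟨⟨?_, ?_⟩, fun p hp hpe => ha1.2 p hp (hpe.mul_left d)⟩
  · exact Nat.pos_of_ne_zero fun h0 => by simp [h0] at ha1
  · exact (Nat.le_mul_of_pos_left e hd0).trans ha1.1.2

theorem sum_tuples_dvd_le (P : Finset ℕ) (R : ℝ) {d : ℕ} (hd : d ≠ 0) (s : Finset (Fin k)) :
    ∑ r ∈ Fintype.piFinset (fun _ : Fin k => sifted P R),
      (∏ i, 1 / (r i : ℝ)) * (if ∀ i ∈ s, d ∣ r i then 1 else 0) ≤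
      (1 / (d : ℝ)) ^ s.card * (∑ n ∈ sifted P R, 1 / (n : ℝ)) ^ k := by
  have := sum_piFinset_filter_le (k := k) (sifted P R) (fun n => 1 / (n : ℝ))
    (fun n _ => by positivity) (fun n => d ∣ n) (sum_sifted_dvd_le P R hd) s
  rw [sum_filter] at this
  simpa only [mul_ite, mul_one, mul_zero] using this

/-- The tuples over which `le_selbergForm` sums, with their lower weights, carry almost all of the
mass of the tuples of sifted integers. -/
theorem SieveScale.sum_sub_lowerWeight_le (h : SieveScale k P D R) {m p : ℕ} (hm : m ≠ 0)
    (hp : p.Prime) (hpP : p ∉ P)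
    (hmdvd : ∀ q : ℕ, q.Prime → q ≤ ⌊R⌋₊ → q ∉ P → q ≠ p → q ∣ m) :
    ∑ r ∈ Fintype.piFinset (fun _ : Fin k => sifted P R),
      ((∏ i, 1 / (r i : ℝ)) - if ∏ i, r i ∣ m then lowerWeight r else 0) ≤
      7 * k ^ 2 / D * (∑ n ∈ sifted P R, 1 / (n : ℝ)) ^ k := by
  set Q := (primesTo ⌊R⌋₊).filter (fun q => q ∉ P) with hQ
  have hQp : ∀ q ∈ Q, q.Prime := fun q hq => (mem_primesTo.1 (mem_filter.1 hq).1).1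
  have hQD : ∀ q ∈ Q, D ≤ q := fun q hq => h.le_of_notMem q (hQp q hq) (mem_filter.1 hq).2
  set t : Finset (Fin k) → ℕ → (Fin k → ℕ) → ℝ := fun s d r =>
    if ∀ i ∈ s, d ∣ r i then 1 else 0 with ht
  have ht0 : ∀ s d r, 0 ≤ t s d r := fun s d r => by
    simp only [ht]; split_ifs <;> norm_num
  set X := (∑ n ∈ sifted P R, 1 / (n : ℝ)) ^ k with hX
  have hX0 : 0 ≤ X := pow_nonneg (sum_nonneg fun _ _ => by positivity) k
  set a : (Fin k → ℕ) → ℝ := fun r => ∏ i, 1 / (r i : ℝ) with ha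
  have ha0 : ∀ r, 0 ≤ a r := fun r => prod_nonneg fun _ _ => by positivity
  -- Four sources of loss. If ∏ r_i divides m, the factors 1 - k/q lose at most ∑ k/q over the
  -- primes q dividing the r_i. Otherwise a square q² divides some r_i, or a prime divides two
  -- coordinates, or p divides some r_i. On average over r, divisibility of the coordinates in s by
  -- d costs d^(-|s|), so the first three losses sum to multiples of ∑ 1/q² ≤ 2/D and the last to
  -- k/p ≤ k/D.
  have hpt : ∀ r ∈ Fintype.piFinset (fun _ : Fin k => sifted P R),
      (a r - if ∏ i, r i ∣ m then lowerWeight r else 0) ≤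
        (∑ q ∈ Q, ∑ i, (k : ℝ) / q * (a r * t {i} q r)) +
        (∑ q ∈ Q, ∑ i, a r * t {i} (q ^ 2) r) +
        (∑ q ∈ Q, ∑ i, ∑ l ∈ univ.erase i, a r * t {i, l} q r) +
        ∑ i, a r * t {i} p r := by
    intro r hr
    rw [Fintype.mem_piFinset] at hr
    have hr0 : ∀ i, r i ≠ 0 := fun i h0 => by
      have := (mem_sifted.1 (hr i)).1.1
      omega
    have hrQ : ∀ q : ℕ, q.Prime → ∀ i, q ∣ r i → q ∈ Q := by
      intro q hq i hqi
      have h1 := mem_sifted.1 (hr i)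
      refine mem_filter.2 ⟨mem_primesTo.2 ⟨hq, ?_⟩, fun hqP => h1.2 q hqP hqi⟩
      exact (Nat.le_of_dvd h1.1.1 hqi).trans h1.1.2
    have n1 : 0 ≤ ∑ q ∈ Q, ∑ i, (k : ℝ) / q * (a r * t {i} q r) :=
      sum_nonneg fun q _ => sum_nonneg fun i _ =>
        mul_nonneg (by positivity) (mul_nonneg (ha0 r) (ht0 _ _ _))
    have n2 : 0 ≤ ∑ q ∈ Q, ∑ i, a r * t {i} (q ^ 2) r :=
      sum_nonneg fun q _ => sum_nonneg fun i _ => mul_nonneg (ha0 r) (ht0 _ _ _)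
    have n3 : 0 ≤ ∑ q ∈ Q, ∑ i, ∑ l ∈ univ.erase i, a r * t {i, l} q r :=
      sum_nonneg fun q _ => sum_nonneg fun i _ => sum_nonneg fun l _ =>
        mul_nonneg (ha0 r) (ht0 _ _ _)
    have n4 : 0 ≤ ∑ i, a r * t {i} p r :=
      sum_nonneg fun i _ => mul_nonneg (ha0 r) (ht0 _ _ _)
    split_ifs with hd
    · have e : a r - lowerWeight r ≤ ∑ q ∈ Q, ∑ i, (k : ℝ) / q * (a r * t {i} q r) := by
        have e1 : lowerWeight r = a r * ∏ x ∈ univ.sigma fun i => (r i).primeFactors,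
            (1 - (k : ℝ) / x.2) := by
          rw [lowerWeight, prod_mul_distrib, prod_sigma]
        have e2 := one_sub_sum_le_prod (univ.sigma fun i => (r i).primeFactors)
          (fun x => (k : ℝ) / x.2) (fun x _ => by positivity) (fun x hx => by
            rw [mem_sigma] at hx
            have hxp := Nat.prime_of_mem_primeFactors hx.2
            have := hQD _ (hrQ _ hxp _ (Nat.dvd_of_mem_primeFactors hx.2))
            exact div_le_one_of_le₀ (h.k_le.trans this) (by positivity))
        have e3 : ∑ x ∈ univ.sigma fun i => (r i).primeFactors, (k : ℝ) / x.2 ≤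
            ∑ q ∈ Q, ∑ i, (k : ℝ) / q * t {i} q r := by
          rw [sum_sigma, sum_comm (s := Q)]
          refine sum_le_sum fun i _ => ?_
          rw [← sum_filter_add_sum_filter_not Q (fun q => q ∣ r i)]
          have hs : (r i).primeFactors ⊆ Q.filter (fun q => q ∣ r i) := fun q hq => by
            have hqd := Nat.dvd_of_mem_primeFactors hq
            exact mem_filter.2 ⟨hrQ q (Nat.prime_of_mem_primeFactors hq) i hqd, hqd⟩
          refine (sum_le_sum_of_subset_of_nonneg hs fun _ _ _ => by positivity).trans ?_
          refine le_add_of_le_of_nonneg (sum_le_sum fun q hq => ?_)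
            (sum_nonneg fun q _ => mul_nonneg (by positivity) (ht0 _ _ _))
          have : t {i} q r = 1 := by
            simp only [ht, mem_singleton, forall_eq]
            rw [if_pos (mem_filter.1 hq).2]
          rw [this, mul_one]
        have e4 : ∑ q ∈ Q, ∑ i, (k : ℝ) / q * (a r * t {i} q r) =
            a r * ∑ q ∈ Q, ∑ i, (k : ℝ) / q * t {i} q r := by
          simp only [mul_sum]
          exact sum_congr rfl fun q _ => sum_congr rfl fun i _ => by ring
        rw [e4, e1]
        nlinarith [mul_le_mul_of_nonneg_left e2 (ha0 r), mul_le_mul_of_nonneg_left e3 (ha0 r)]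
      linarith
    · rw [sub_zero]
      by_cases c4 : ∃ i, p ∣ r i
      · obtain ⟨i, hi⟩ := c4
        have : a r * t {i} p r ≤ ∑ i, a r * t {i} p r :=
          single_le_sum (f := fun i => a r * t {i} p r)
            (fun i _ => mul_nonneg (ha0 r) (ht0 _ _ _)) (mem_univ i)
        have e : t {i} p r = 1 := by
          simp only [ht, mem_singleton, forall_eq]; rw [if_pos hi]
        rw [e, mul_one] at this
        linarith
      by_cases c2 : ∃ q : ℕ, q.Prime ∧ ∃ i, q ^ 2 ∣ r i
      · obtain ⟨q, hq, i, hi⟩ := c2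
        have hqQ := hrQ q hq i ((dvd_pow_self q two_ne_zero).trans hi)
        have h1 : a r * t {i} (q ^ 2) r ≤ ∑ i, a r * t {i} (q ^ 2) r :=
          single_le_sum (f := fun i => a r * t {i} (q ^ 2) r)
            (fun i _ => mul_nonneg (ha0 r) (ht0 _ _ _)) (mem_univ i)
        have h2 : ∑ i, a r * t {i} (q ^ 2) r ≤ ∑ q ∈ Q, ∑ i, a r * t {i} (q ^ 2) r :=
          single_le_sum (f := fun q => ∑ i, a r * t {i} (q ^ 2) r)
            (fun q _ => sum_nonneg fun i _ => mul_nonneg (ha0 r) (ht0 _ _ _)) hqQ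
        have e : t {i} (q ^ 2) r = 1 := by
          simp only [ht, mem_singleton, forall_eq]; rw [if_pos hi]
        rw [e, mul_one] at h1
        linarith
      by_cases c3 : ∃ q : ℕ, q.Prime ∧ ∃ i l, i ≠ l ∧ q ∣ r i ∧ q ∣ r l
      · obtain ⟨q, hq, i, l, hil, hi, hl⟩ := c3
        have hqQ := hrQ q hq i hi
        have h0 : a r * t {i, l} q r ≤ ∑ l ∈ univ.erase i, a r * t {i, l} q r :=
          single_le_sum (f := fun l => a r * t {i, l} q r)
            (fun l _ => mul_nonneg (ha0 r) (ht0 _ _ _)) (mem_erase.2 ⟨hil.symm, mem_univ l⟩)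
        have h1 : ∑ l ∈ univ.erase i, a r * t {i, l} q r ≤
            ∑ i, ∑ l ∈ univ.erase i, a r * t {i, l} q r :=
          single_le_sum (f := fun i => ∑ l ∈ univ.erase i, a r * t {i, l} q r)
            (fun i _ => sum_nonneg fun l _ => mul_nonneg (ha0 r) (ht0 _ _ _)) (mem_univ i)
        have h2 : ∑ i, ∑ l ∈ univ.erase i, a r * t {i, l} q r ≤
            ∑ q ∈ Q, ∑ i, ∑ l ∈ univ.erase i, a r * t {i, l} q r :=
          single_le_sum (f := fun q => ∑ i, ∑ l ∈ univ.erase i, a r * t {i, l} q r)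
            (fun q _ => sum_nonneg fun i _ => sum_nonneg fun l _ =>
              mul_nonneg (ha0 r) (ht0 _ _ _)) hqQ
        have e : t {i, l} q r = 1 := by
          simp only [ht]
          rw [if_pos]
          intro x hx
          rw [mem_insert, mem_singleton] at hx
          rcases hx with rfl | rfl <;> assumption
        rw [e, mul_one] at h0
        linarith
      -- Without any of the three defects ∏ r_i is squarefree and all its primes divide m, so it
      -- divides m.
      exfalso
      push Not at c2 c3 c4
      refine hd (dvd_of_squarefree (squarefree_prod_of c2 fun q hq i l hil hh =>
        c3 q hq i l hil hh.1 hh.2) hm fun q hq hqd => ?_)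
      obtain ⟨i, -, hi⟩ := (Prime.dvd_finsetProd_iff hq.prime _).1 hqd
      have hqQ := mem_filter.1 (hrQ q hq i hi)
      exact hmdvd q hq (mem_primesTo.1 hqQ.1).2 hqQ.2 fun hqp => c4 i (hqp ▸ hi)
  have hsq : ∑ q ∈ Q, 1 / (q : ℝ) ^ 2 ≤ 2 / D := sum_inv_sq_le h.one_le Q hQD
  have hD : 0 < D := by linarith [h.one_le]
  refine (sum_le_sum hpt).trans ?_
  simp only [sum_add_distrib]
  have b1 : ∑ r ∈ Fintype.piFinset (fun _ : Fin k => sifted P R),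
      ∑ q ∈ Q, ∑ i, (k : ℝ) / q * (a r * t {i} q r) ≤ k ^ 2 * (2 / D) * X := by
    rw [sum_comm]
    calc _ ≤ ∑ q ∈ Q, (k ^ 2 * (1 / (q : ℝ) ^ 2) * X) := by
          refine sum_le_sum fun q hq => ?_
          rw [sum_comm]
          calc _ ≤ ∑ i : Fin k, (k : ℝ) / q * (1 / (q : ℝ) * X) := by
                refine sum_le_sum fun i _ => ?_
                rw [← mul_sum]
                refine mul_le_mul_of_nonneg_left ?_ (by positivity)
                simpa only [card_singleton, pow_one, Nat.cast_pow] using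
                sum_tuples_dvd_le (k := k) P R (hQp q hq).ne_zero {i}
            _ = _ := by
                simp only [sum_const, card_univ, Fintype.card_fin, nsmul_eq_mul]
                ring
      _ = k ^ 2 * (∑ q ∈ Q, 1 / (q : ℝ) ^ 2) * X := by rw [← sum_mul, ← mul_sum]
      _ ≤ _ := by gcongr
  have b2 : ∑ r ∈ Fintype.piFinset (fun _ : Fin k => sifted P R),
      ∑ q ∈ Q, ∑ i, a r * t {i} (q ^ 2) r ≤ k * (2 / D) * X := by
    rw [sum_comm]
    calc _ ≤ ∑ q ∈ Q, (k * (1 / (q : ℝ) ^ 2) * X) := by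
          refine sum_le_sum fun q hq => ?_
          rw [sum_comm]
          calc _ ≤ ∑ i : Fin k, (1 / (q : ℝ) ^ 2 * X) := by
                refine sum_le_sum fun i _ => ?_
                simpa only [card_singleton, pow_one, Nat.cast_pow] using
                sum_tuples_dvd_le (k := k) P R (pow_ne_zero 2 (hQp q hq).ne_zero) {i}
            _ = _ := by
                simp only [sum_const, card_univ, Fintype.card_fin, nsmul_eq_mul]
                ring
      _ = k * (∑ q ∈ Q, 1 / (q : ℝ) ^ 2) * X := by rw [← sum_mul, ← mul_sum]
      _ ≤ _ := by gcongr
  have b3 : ∑ r ∈ Fintype.piFinset (fun _ : Fin k => sifted P R),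
      ∑ q ∈ Q, ∑ i, ∑ l ∈ univ.erase i, a r * t {i, l} q r ≤ k ^ 2 * (2 / D) * X := by
    rw [sum_comm]
    calc _ ≤ ∑ q ∈ Q, (k ^ 2 * (1 / (q : ℝ) ^ 2) * X) := by
          refine sum_le_sum fun q hq => ?_
          rw [sum_comm]
          calc _ ≤ ∑ i : Fin k, ∑ l : Fin k, (1 / (q : ℝ) ^ 2 * X) := by
                refine sum_le_sum fun i _ => ?_
                rw [sum_comm]
                refine (sum_le_sum (g := fun _ => 1 / (q : ℝ) ^ 2 * X) fun l hl => ?_).trans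
                  (sum_le_sum_of_subset_of_nonneg (subset_univ _) fun _ _ _ => by positivity)
                have := sum_tuples_dvd_le (k := k) P R (hQp q hq).ne_zero {i, l}
                rw [card_pair (ne_of_mem_erase hl).symm, one_div_pow] at this
                exact this
            _ = _ := by
                simp only [sum_const, card_univ, Fintype.card_fin, nsmul_eq_mul]
                ring
      _ = k ^ 2 * (∑ q ∈ Q, 1 / (q : ℝ) ^ 2) * X := by rw [← sum_mul, ← mul_sum]
      _ ≤ _ := by gcongr
  have b4 : ∑ r ∈ Fintype.piFinset (fun _ : Fin k => sifted P R),
      ∑ i, a r * t {i} p r ≤ k * (1 / D) * X := by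
    rw [sum_comm]
    calc _ ≤ ∑ i : Fin k, (1 / (p : ℝ) * X) := by
          refine sum_le_sum fun i _ => ?_
          simpa only [card_singleton, pow_one, Nat.cast_pow] using
                sum_tuples_dvd_le (k := k) P R hp.ne_zero {i}
      _ = k * (1 / (p : ℝ)) * X := by
          simp only [sum_const, card_univ, Fintype.card_fin, nsmul_eq_mul]
          ring
      _ ≤ _ := by
          have := h.le_of_notMem p hp hpP
          gcongr
  have hkk : (k : ℝ) ≤ (k : ℝ) ^ 2 := by
    rcases Nat.eq_zero_or_pos k with rfl | h0
    · simp
    · have : (1 : ℝ) ≤ k := by exact_mod_cast h0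
      nlinarith
  have hfin : k ^ 2 * (2 / D) * X + k * (2 / D) * X + k ^ 2 * (2 / D) * X + k * (1 / D) * X ≤
      7 * k ^ 2 / D * X := by
    have e : 7 * (k : ℝ) ^ 2 / D * X - (k ^ 2 * (2 / D) * X + k * (2 / D) * X +
        k ^ 2 * (2 / D) * X + k * (1 / D) * X) = 3 * ((k : ℝ) ^ 2 - k) * (X / D) := by
      field_simp
      ring
    have : 0 ≤ 3 * ((k : ℝ) ^ 2 - k) * (X / D) :=
      mul_nonneg (by linarith) (div_nonneg hX0 hD.le)
    linarith
  linarith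

end

end

/-! ### Sums over tuples in logarithmic coordinates -/

section

open Finset

/-- The point `(log r_i / log R)_i`. -/
noncomputable def logPoint {k : ℕ} (R : ℝ) (r : Fin k → ℕ) : Fin k → ℝ :=
  fun i => Real.log (r i) / Real.log R

theorem logPoint_update {k : ℕ} (R : ℝ) (r : Fin k → ℕ) (l : Fin k) (n : ℕ) :
    logPoint R (Function.update r l n) =
      Function.update (logPoint R r) l (Real.log n / Real.log R) := by
  funext i
  by_cases hi : i = l
  · subst hi; simp [logPoint]
  · simp [logPoint, hi]

theorem logPoint_mulAt {k : ℕ} (R : ℝ) {r : Fin k → ℕ} {p : ℕ} (hp : p ≠ 0) (j : Fin k)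
    (hr : r j ≠ 0) : logPoint R (mulAt p j r) =
      Function.update (logPoint R r) j (logPoint R r j + Real.log p / Real.log R) := by
  rw [mulAt, logPoint_update]
  congr 1
  rw [logPoint, ← add_div, Nat.cast_mul, Real.log_mul (by exact_mod_cast hr) (by exact_mod_cast hp)]

open Classical in
/-- The indicator function of a hyperplane. -/
noncomputable def planeInd {k : ℕ} (a : Fin k → ℝ) (b : ℝ) (t : Fin k → ℝ) : ℝ :=
  if ∑ i, a i * t i = b then 1 else 0

theorem planeInd_nonneg {k : ℕ} (a : Fin k → ℝ) (b : ℝ) (t : Fin k → ℝ) : 0 ≤ planeInd a b t := by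
  unfold planeInd; split_ifs <;> norm_num

theorem sum_mul_update {k : ℕ} (a t : Fin k → ℝ) (j : Fin k) (x : ℝ) :
    ∑ i, a i * Function.update t j x i = ∑ i, a i * t i + a j * (x - t j) := by
  have : ∀ i, a i * Function.update t j x i =
      a i * t i + if i = j then a j * (x - t j) else 0 := by
    intro i
    by_cases hi : i = j
    · subst hi; simp; ring
    · simp [hi]
  simp only [this, sum_add_distrib, sum_ite_eq', mem_univ, if_true]

/-- The number of hyperplanes of `Q` that contain `t` or `t + y e_j`. -/
noncomputable def planeCount {k : ℕ} (Q : Finset ((Fin k → ℝ) × ℝ)) (j : Fin k) (y : ℝ)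
    (t : Fin k → ℝ) : ℝ :=
  ∑ q ∈ Q, (planeInd q.1 q.2 t + planeInd q.1 (q.2 - q.1 j * y) t)

theorem planeCount_nonneg {k : ℕ} (Q : Finset ((Fin k → ℝ) × ℝ)) (j : Fin k) (y : ℝ)
    (t : Fin k → ℝ) : 0 ≤ planeCount Q j y t :=
  sum_nonneg fun _ _ => add_nonneg (planeInd_nonneg _ _ _) (planeInd_nonneg _ _ _)

theorem one_le_planeCount {k : ℕ} {Q : Finset ((Fin k → ℝ) × ℝ)} {j : Fin k} {y : ℝ}
    {t : Fin k → ℝ} {q : (Fin k → ℝ) × ℝ} (hq : q ∈ Q)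
    (h : ∑ i, q.1 i * t i = q.2 ∨ ∑ i, q.1 i * t i = q.2 - q.1 j * y) :
    1 ≤ planeCount Q j y t := by
  have h1 := single_le_sum
    (f := fun q : (Fin k → ℝ) × ℝ => planeInd q.1 q.2 t + planeInd q.1 (q.2 - q.1 j * y) t)
    (fun _ _ => add_nonneg (planeInd_nonneg _ _ _) (planeInd_nonneg _ _ _)) hq
  refine le_trans ?_ h1
  have h2 := planeInd_nonneg q.1 q.2 t
  have h3 := planeInd_nonneg q.1 (q.2 - q.1 j * y) t
  rcases h with h | h
  · have : planeInd q.1 q.2 t = 1 := if_pos h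
    linarith
  · have : planeInd q.1 (q.2 - q.1 j * y) t = 1 := if_pos h
    linarith

section

variable {k : ℕ} {P : Finset ℕ} {D R : ℝ}

theorem SieveScale.exp_le (h : SieveScale k P D R) : Real.exp (12 / D) ≤ Real.exp 12 :=
  Real.exp_le_exp.2 (div_le_self (by norm_num) h.one_le)

/-- Along a coordinate l with a_l ≠ 0 the hyperplane fixes log n / log R to a single value v, and
the majorant mass of the degenerate interval [v, v] is only O(∏ p), without the factor log R. -/
theorem SieveScale.sum_planeInd_le (h : SieveScale k P D R) {a : Fin k → ℝ} (ha : a ≠ 0) (b : ℝ) :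
    ∑ r ∈ Fintype.piFinset (fun _ : Fin k => sifted P R),
      (∏ i, majorant (r i)) * planeInd a b (logPoint R r) ≤
      (∑ n ∈ sifted P R, majorant n) ^ (k - 1) * (Real.exp 12 * (5 * ∏ p ∈ P, (p : ℝ))) := by
  obtain ⟨l, hl⟩ : ∃ l, a l ≠ 0 := by
    by_contra hcon
    push Not at hcon
    exact ha (funext hcon)
  have hW := h.one_le_prod
  refine sum_piFinset_le (sifted P R) majorant (fun n _ => majorant_nonneg n)
    (fun r => planeInd a b (logPoint R r)) l (by positivity) fun r _ => ?_
  set v := logPoint R r l + (b - ∑ i, a i * logPoint R r i) / a l with hv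
  have h1 := h.sum_majorant_le (le_refl v)
  rw [sub_self, mul_zero, zero_add] at h1
  refine le_trans ?_ (h1.trans (mul_le_mul_of_nonneg_right h.exp_le (by positivity)))
  rw [sum_filter]
  refine sum_le_sum fun n _ => ?_
  rw [logPoint_update, planeInd, sum_mul_update]
  split_ifs with h2 h3
  · rw [mul_one]
  · exfalso
    apply h3
    have : Real.log n / Real.log R = v := by
      rw [hv, ← sub_eq_iff_eq_add', eq_div_iff hl]
      linarith
    rw [this]
    exact ⟨le_rfl, le_rfl⟩
  · simpa using majorant_nonneg n
  · simp

theorem SieveScale.sum_planeCount_le (h : SieveScale k P D R) {Q : Finset ((Fin k → ℝ) × ℝ)}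
    (hQ : Q.card ≤ 2 * k + 1) (hQ0 : ∀ q ∈ Q, q.1 ≠ 0) (j : Fin k) (y : ℝ) :
    ∑ r ∈ Fintype.piFinset (fun _ : Fin k => sifted P R),
      (∏ i, majorant (r i)) * planeCount Q j y (logPoint R r) ≤
      (∑ n ∈ sifted P R, majorant n) ^ (k - 1) *
        ((4 * k + 2) * (Real.exp 12 * (5 * ∏ p ∈ P, (p : ℝ)))) := by
  set B := (∑ n ∈ sifted P R, majorant n) ^ (k - 1) * (Real.exp 12 * (5 * ∏ p ∈ P, (p : ℝ)))
    with hB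
  have hW := h.one_le_prod
  have hB0 : 0 ≤ B := mul_nonneg (pow_nonneg (sum_nonneg fun _ _ => majorant_nonneg _) _)
    (by positivity)
  simp only [planeCount, mul_sum]
  rw [sum_comm]
  calc _ ≤ ∑ q ∈ Q, 2 * B := by
        refine sum_le_sum fun q hq => ?_
        simp only [mul_add, sum_add_distrib]
        linarith [h.sum_planeInd_le (hQ0 q hq) q.2,
          h.sum_planeInd_le (hQ0 q hq) (q.2 - q.1 j * y)]
    _ = Q.card * (2 * B) := by rw [sum_const, nsmul_eq_mul]
    _ ≤ (2 * k + 1) * (2 * B) := by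
        refine mul_le_mul_of_nonneg_right ?_ (by positivity)
        exact_mod_cast hQ
    _ = _ := by rw [hB]; ring

/-- On a line in direction j one has (u - v)² ≤ K |u - v|, and |u - v| is at most K y unless one of
the two ends of the support lies in the window of length y to the right of the point. Such windows
carry mass about `logDensity P R` times y. -/
theorem SieveScale.sum_shiftSq_le (h : SieveScale k P D R) {U : Set (Fin k → ℝ)} {K : ℝ}
    {f : (Fin k → ℝ) → ℝ} (hU : Convex ℝ U) (hU1 : U ⊆ Set.Icc 0 1) (hf : AxisLip U K f)
    (j : Fin k) {y : ℝ} (hy : 0 ≤ y) :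
    ∑ r ∈ Fintype.piFinset (fun _ : Fin k => sifted P R),
      (∏ i, majorant (r i)) * shiftSq f j y (logPoint R r) ≤
      (∑ n ∈ sifted P R, majorant n) ^ (k - 1) * (K ^ 2 * ((∑ n ∈ sifted P R, majorant n) * y +
        2 * (Real.exp 12 * (logDensity P R * y + 5 * ∏ p ∈ P, (p : ℝ))))) := by
  have hW := h.one_le_prod
  have hc := h.logDensity_pos
  have hK := hf.const_nonneg
  have hM : 0 ≤ ∑ n ∈ sifted P R, majorant n := sum_nonneg fun _ _ => majorant_nonneg _
  refine sum_piFinset_le (sifted P R) majorant (fun n _ => majorant_nonneg n)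
    (fun r => shiftSq f j y (logPoint R r)) j (by positivity) fun r _ => ?_
  obtain ⟨a, b, hab⟩ := hf.abs_sub_le hU hU1 (logPoint R r) j
  have hI : ∀ a : ℝ, ∑ n ∈ sifted P R, majorant n * (Set.Icc (Real.log n / Real.log R)
      (Real.log n / Real.log R + y)).indicator (1 : ℝ → ℝ) a ≤
      Real.exp 12 * (logDensity P R * y + 5 * ∏ p ∈ P, (p : ℝ)) := by
    intro a
    have h1 := h.sum_majorant_le (show a - y ≤ a by linarith)
    rw [sub_sub_cancel] at h1
    refine le_trans ?_ (h1.trans (mul_le_mul_of_nonneg_right h.exp_le (by positivity)))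
    rw [sum_filter]
    refine sum_le_sum fun n _ => ?_
    rw [Set.indicator_apply]
    split_ifs with h2 h3
    · simp
    · exact absurd ⟨by linarith [h2.2], h2.1⟩ h3
    · simpa using majorant_nonneg n
    · simp
  have hpt : ∀ n : ℕ, shiftSq f j y (logPoint R (Function.update r j n)) ≤
      K ^ 2 * (y + ((Set.Icc (Real.log n / Real.log R)
      (Real.log n / Real.log R + y)).indicator (1 : ℝ → ℝ) a + (Set.Icc (Real.log n / Real.log R)
      (Real.log n / Real.log R + y)).indicator (1 : ℝ → ℝ) b)) := by
    intro n
    have h1 := hab (Real.log n / Real.log R) (Real.log n / Real.log R + y) (by linarith)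
    rw [logPoint_update, shiftSq, Function.update_self, Function.update_idem]
    set u := f (Function.update (logPoint R r) j (Real.log n / Real.log R))
    set v := f (Function.update (logPoint R r) j (Real.log n / Real.log R + y))
    have h2 : |u - v| ≤ K := by
      have := hf.nonneg (Function.update (logPoint R r) j (Real.log n / Real.log R))
      have := hf.le (Function.update (logPoint R r) j (Real.log n / Real.log R))
      have := hf.nonneg (Function.update (logPoint R r) j (Real.log n / Real.log R + y))
      have := hf.le (Function.update (logPoint R r) j (Real.log n / Real.log R + y))
      rw [abs_le]
      constructor <;> linarith
    rw [← sq_abs, sq]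
    refine (mul_le_mul h2 h1 (abs_nonneg _) hK).trans (le_of_eq ?_)
    ring
  calc _ ≤ ∑ n ∈ sifted P R, majorant n * (K ^ 2 * (y + ((Set.Icc (Real.log n / Real.log R)
      (Real.log n / Real.log R + y)).indicator (1 : ℝ → ℝ) a + (Set.Icc (Real.log n / Real.log R)
      (Real.log n / Real.log R + y)).indicator (1 : ℝ → ℝ) b))) :=
        sum_le_sum fun n _ => mul_le_mul_of_nonneg_left (hpt n) (majorant_nonneg n)
    _ = K ^ 2 * ((∑ n ∈ sifted P R, majorant n) * y +
        (∑ n ∈ sifted P R, majorant n * (Set.Icc (Real.log n / Real.log R)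
          (Real.log n / Real.log R + y)).indicator (1 : ℝ → ℝ) a +
        ∑ n ∈ sifted P R, majorant n * (Set.Icc (Real.log n / Real.log R)
          (Real.log n / Real.log R + y)).indicator (1 : ℝ → ℝ) b)) := by
        rw [sum_mul, ← sum_add_distrib, ← sum_add_distrib, mul_sum]
        exact sum_congr rfl fun n _ => by ring
    _ ≤ _ := by
        refine mul_le_mul_of_nonneg_left ?_ (by positivity)
        linarith [hI a, hI b]

/-- The numbers `m` that occur: square-free, with prime factors the primes up to some `Z ≥ R`
outside `P`, except for `p`. -/
structure SieveModulus (P : Finset ℕ) (R : ℝ) (p m : ℕ) : Prop where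
  squarefree : Squarefree m
  dvd : ∀ q : ℕ, q.Prime → q ≤ ⌊R⌋₊ → q ∉ P → q ≠ p → q ∣ m
  notMem : ∀ q : ℕ, q.Prime → q ∣ m → q ∉ P ∧ q ≠ p

variable {S U : Set (Fin k → ℝ)} {κ : ℝ} {F : (Fin k → ℝ) → ℝ} {W p m : ℕ}

/-- Some y at r, or at r with one coordinate multiplied by p, is nonzero, so every r_i is at most R.
This removes the primes between R and Z from the diagonal sums. -/
theorem SieveModulus.mem_sifted_of_ne (hk : 2 ≤ k) (h : SieveScale k P D R)
    (hm : SieveModulus P R p m) (j : Fin k) {r : Fin k → ℕ}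
    (hr : r ∈ divTuples k m) (hne : shiftedY p j (sieveY W R F) r ≠ 0) :
    r ∈ Fintype.piFinset fun _ : Fin k => sifted P R := by
  rw [mem_divTuples hm.squarefree.ne_zero] at hr
  have hP : ∀ i, ∀ q ∈ P, ¬ q ∣ r i := fun i q hq hd =>
    (hm.notMem q (h.prime q hq) ((hd.trans (dvd_prod_of_mem r (mem_univ i))).trans hr)).1 hq
  have hr0 : ∀ i, 1 ≤ r i := fun i => Nat.pos_of_ne_zero fun h0 =>
    hm.squarefree.ne_zero (Nat.eq_zero_of_zero_dvd
      ((prod_eq_zero (mem_univ i) h0 : ∏ i, r i = 0) ▸ hr))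
  suffices ∀ i, r i ≤ ⌊R⌋₊ from
    Fintype.mem_piFinset.2 fun i => mem_sifted.2 ⟨⟨hr0 i, this i⟩, hP i⟩
  have hbox : ∀ r' : Fin k → ℕ, sieveY W R F r' ≠ 0 → ∀ i, 1 ≤ r' i ∧ r' i ≤ ⌊R⌋₊ :=
    fun r' h' i => mem_Icc.1 (Fintype.mem_piFinset.1 (sieveY_support hk (le_refl ⌊R⌋₊) h').1 i)
  have hmul : ∀ l, sieveY W R F (mulAt p l r) ≠ 0 → ∀ i, r i ≤ ⌊R⌋₊ := by
    intro l h' i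
    have h1 := hbox _ h' i
    by_cases hi : i = l
    · subst hi
      rw [mulAt_same] at h1
      refine le_trans (Nat.le_mul_of_pos_right _ (Nat.pos_of_ne_zero fun h0 => ?_)) h1.2
      rw [h0] at h1
      omega
    · rw [mulAt_of_ne p hi] at h1
      exact h1.2
  by_cases h1 : sieveY W R F r = 0
  · by_cases h2 : sieveY W R F (mulAt p j r) = 0
    · have : ∃ i ∈ univ.erase j, sieveY W R F (mulAt p i r) ≠ 0 := by
        by_contra hcon
        push Not at hcon
        exact hne (by rw [shiftedY, h1, h2, sum_eq_zero hcon]; ring)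
      obtain ⟨i, -, hi⟩ := this
      exact hmul i hi
    · exact hmul j h2
  · exact fun i => (hbox r h1 i).2

/-- The difference of the first two terms of the shifted variable reproduces `shiftSq`, except on
the face hyperplanes, which `planeCount` pays for. The terms with factor 1/(p-1) change the square
by O(k²/p). -/
theorem abs_shiftedY_sq_sub_le (hk : 1 ≤ k) (h : SieveScale k P D R) (hm : SieveModulus P R p m)
    (hW : ∀ q : ℕ, q.Prime → q ∣ W → q ∈ P) (hp : p.Prime) (hpP : p ∉ P)
    (hS : SieveRegion S U κ) (hF : IsSieveFunction S F)
    {Q : Finset ((Fin k → ℝ) × ℝ)} (hQ : ∀ t ∈ S, t ∉ U → ∃ q ∈ Q, ∑ i, q.1 i * t i = q.2)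
    (j : Fin k) {r : Fin k → ℕ} (hr : r ∈ divTuples k m) :
    |shiftedY p j (sieveY W R F) r ^ 2 -
      shiftSq (U.indicator F) j (Real.log p / Real.log R) (logPoint R r)| ≤
      Fmax F ^ 2 * (planeCount Q j (Real.log p / Real.log R) (logPoint R r) + 8 * k ^ 2 / p) := by
  rw [mem_divTuples hm.squarefree.ne_zero] at hr
  have hp2 : (2 : ℝ) ≤ p := by exact_mod_cast hp.two_le
  have hk1 : (1 : ℝ) ≤ k := by exact_mod_cast hk
  have hFm := hF.Fmax_nonneg
  set Y := Fmax F with hY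
  have hsq : Squarefree (∏ i, r i) := hm.squarefree.squarefree_of_dvd hr
  have hr0 : ∀ i, r i ≠ 0 := fun i h0 => hsq.ne_zero (prod_eq_zero (mem_univ i) h0)
  have hpr : ¬ p ∣ ∏ i, r i := fun hd => (hm.notMem p hp (hd.trans hr)).2 rfl
  have hcop : Nat.Coprime (∏ i, r i) W := Nat.coprime_of_dvd fun q hq h1 h2 =>
    (hm.notMem q hq (h1.trans hr)).1 (hW q hq h2)
  have hprod : ∏ i, mulAt p j r i = (∏ i, r i) * p := prod_mulAt (fun n => n) p j r rfl
  have hcop' : Nat.Coprime (∏ i, r i) p := ((Nat.Prime.coprime_iff_not_dvd hp).2 hpr).symm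
  have hsq' : Squarefree (∏ i, mulAt p j r i) := by
    rw [hprod, Nat.squarefree_mul hcop']
    exact ⟨hsq, hp.prime.squarefree⟩
  have hcopW' : Nat.Coprime (∏ i, mulAt p j r i) W := by
    rw [hprod]
    exact hcop.mul_left ((Nat.Prime.coprime_iff_not_dvd hp).2 fun hd => hpP (hW p hp hd))
  set y := Real.log p / Real.log R with hy
  have hb1 := fun r' => SieveRegion.sieveY_nonneg hF W R r'
  have hb2 := fun r' => hS.sieveY_le hF W R r'
  -- the main difference
  have hmain : |(sieveY W R F r - sieveY W R F (mulAt p j r)) ^ 2 -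
      shiftSq (U.indicator F) j y (logPoint R r)| ≤ Y ^ 2 * planeCount Q j y (logPoint R r) := by
    have hb : |(sieveY W R F r - sieveY W R F (mulAt p j r)) ^ 2 -
        shiftSq (U.indicator F) j y (logPoint R r)| ≤ Y ^ 2 := by
      have h1 := shiftSq_nonneg (U.indicator F) j y (logPoint R r)
      have h2 := (hS.axisLip hF).shiftSq_le j y (logPoint R r)
      have h3 := sq_nonneg (sieveY W R F r - sieveY W R F (mulAt p j r))
      have h4 : (sieveY W R F r - sieveY W R F (mulAt p j r)) ^ 2 ≤ Y ^ 2 := by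
        rw [sq_le_sq, abs_of_nonneg hFm, abs_le]
        constructor <;> linarith [hb1 r, hb2 r, hb1 (mulAt p j r), hb2 (mulAt p j r)]
      rw [abs_le]
      constructor <;> linarith
    -- A point of S outside U lies on a face plane, where `planeCount` is at least 1 and the trivial
    -- bound Y² is affordable; the same holds for the translated point. If neither happens, the two
    -- squares are equal.
    by_cases c1 : logPoint R r ∈ S ∧ logPoint R r ∉ U
    · obtain ⟨q, hq, he⟩ := hQ _ c1.1 c1.2
      have := one_le_planeCount (j := j) (y := y) hq (Or.inl he)
      nlinarith [sq_nonneg Y]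
    by_cases c2 : logPoint R (mulAt p j r) ∈ S ∧ logPoint R (mulAt p j r) ∉ U
    · obtain ⟨q, hq, he⟩ := hQ _ c2.1 c2.2
      rw [logPoint_mulAt R hp.ne_zero j (hr0 j), sum_mul_update] at he
      have := one_le_planeCount (j := j) (y := y) (t := logPoint R r) hq
        (Or.inr (by rw [← he, hy]; ring))
      nlinarith [sq_nonneg Y]
    have e1 := hS.sieveY_eq hF h.one_lt hsq hcop c1
    have e2 := hS.sieveY_eq hF h.one_lt hsq' hcopW' c2
    have e3 : (fun i => Real.log (mulAt p j r i) / Real.log R) =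
      Function.update (logPoint R r) j (logPoint R r j + y) := logPoint_mulAt R hp.ne_zero j (hr0 j)
    rw [e3] at e2
    have e4 : (sieveY W R F r - sieveY W R F (mulAt p j r)) ^ 2 =
        shiftSq (U.indicator F) j y (logPoint R r) := by
      rw [e1, e2]; rfl
    rw [e4, sub_self, abs_zero]
    exact mul_nonneg (sq_nonneg _) (planeCount_nonneg _ _ _ _)
  -- the remaining terms
  set a := sieveY W R F r - sieveY W R F (mulAt p j r) with ha
  set b := 1 / ((p : ℝ) - 1) * ∑ i ∈ univ.erase j, sieveY W R F (mulAt p i r) with hb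
  have haY : |a| ≤ Y := by
    rw [abs_le]
    constructor <;> linarith [hb1 r, hb2 r, hb1 (mulAt p j r), hb2 (mulAt p j r)]
  have hs0 : 0 ≤ ∑ i ∈ univ.erase j, sieveY W R F (mulAt p i r) := sum_nonneg fun i _ => hb1 _
  have hs1 : ∑ i ∈ univ.erase j, sieveY W R F (mulAt p i r) ≤ k * Y := by
    calc _ ≤ ∑ i, sieveY W R F (mulAt p i r) :=
          sum_le_sum_of_subset_of_nonneg (erase_subset _ _) fun i _ _ => hb1 _
      _ ≤ ∑ _i : Fin k, Y := sum_le_sum fun i _ => hb2 _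
      _ = k * Y := by simp
  have hp1 : 1 / ((p : ℝ) - 1) ≤ 2 / p := by
    rw [div_le_div_iff₀ (by linarith) (by linarith)]
    linarith
  have hb0 : 0 ≤ b := mul_nonneg (by
    have : (0 : ℝ) ≤ (p : ℝ) - 1 := by linarith
    positivity) hs0
  have hbY : b ≤ 2 * k * Y / p := by
    calc b ≤ 2 / p * (k * Y) := mul_le_mul hp1 hs1 hs0 (by positivity)
      _ = _ := by ring
  have hbY2 : b ≤ k * Y := by
    refine hbY.trans ?_
    rw [div_le_iff₀ (by linarith)]
    nlinarith [mul_nonneg (show (0 : ℝ) ≤ k by linarith) hFm]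
  have hrest : |(a + b) ^ 2 - a ^ 2| ≤ Y ^ 2 * (8 * k ^ 2 / p) := by
    have e : (a + b) ^ 2 - a ^ 2 = b * (2 * a + b) := by ring
    rw [e, abs_mul, abs_of_nonneg hb0]
    have h1 : |2 * a + b| ≤ 3 * k * Y := by
      have := abs_le.1 haY
      have hkY : Y ≤ k * Y := le_mul_of_one_le_left hFm hk1
      rw [abs_le]
      constructor <;> linarith
    calc b * |2 * a + b| ≤ 2 * k * Y / p * (3 * k * Y) :=
          mul_le_mul hbY h1 (abs_nonneg _) (by positivity)
      _ = Y ^ 2 * (6 * k ^ 2 / p) := by ring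
      _ ≤ _ := by gcongr; norm_num
  have : shiftedY p j (sieveY W R F) r = a + b := rfl
  rw [this, mul_add]
  have e : (a + b) ^ 2 - shiftSq (U.indicator F) j y (logPoint R r) =
      (a ^ 2 - shiftSq (U.indicator F) j y (logPoint R r)) + ((a + b) ^ 2 - a ^ 2) := by ring
  rw [e]
  exact (abs_add_le _ _).trans (add_le_add hmain hrest)

end

end

/-! ### The quadratic form attached to one prime -/

section

open Finset

theorem pow_sub_pow_le {a b V : ℝ} (hb : 0 ≤ b) (hab : b ≤ a) (haV : a ≤ V) (k : ℕ) :
    a ^ k - b ^ k ≤ k * V ^ (k - 1) * (a - b) := by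
  induction k with
  | zero => simp
  | succ k ih =>
    have ha : 0 ≤ a := hb.trans hab
    have hV : 0 ≤ V := ha.trans haV
    have e : a ^ (k + 1) - b ^ (k + 1) = a * (a ^ k - b ^ k) + b ^ k * (a - b) := by ring
    have h1 : a * (a ^ k - b ^ k) ≤ V * (k * V ^ (k - 1) * (a - b)) :=
      mul_le_mul haV ih (sub_nonneg.2 (pow_le_pow_left₀ hb hab k)) hV
    have h2 : b ^ k * (a - b) ≤ V ^ k * (a - b) :=
      mul_le_mul_of_nonneg_right (pow_le_pow_left₀ hb (hab.trans haV) k) (sub_nonneg.2 hab)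
    have h3 : V * (k * V ^ (k - 1) * (a - b)) = k * V ^ k * (a - b) := by
      rcases k with _ | k
      · simp
      · rw [Nat.add_sub_cancel, pow_succ]; ring
    rw [e, Nat.add_sub_cancel]
    push_cast
    linarith

/-- The constant in the estimates for a single prime. -/
noncomputable def primeConst (k : ℕ) : ℝ := 200 * k ^ 2 * (2 * Real.exp 12) ^ k

/-- Arithmetic only. Here e stands for exp 12, c for `logDensity`, w for ∏ p, Z for the square of
`Fmax`, M for the majorant mass and S for the sum of `shiftSq`. -/
theorem le_of_prime_bounds {k : ℕ} (hk : 2 ≤ k) {e c w y p Z M q S : ℝ} (he1 : 1 ≤ e)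
    (hc0 : 0 < c) (hw1 : 0 ≤ w) (hy : 0 ≤ y) (hp0 : 0 < p) (hZ : 0 ≤ Z) (hM0 : 0 ≤ M)
    (hM : M ≤ 2 * e * c)
    (hq : q ≤ S + Z * (2 * e * c) ^ (k - 1) * ((4 * k + 2) * (e * (5 * w)) +
      8 * k ^ 2 / p * (2 * e * c)))
    (hS : S ≤ M ^ (k - 1) * (Z * (M * y + 2 * (e * (c * y + 5 * w))))) :
    q ≤ 200 * k ^ 2 * (2 * e) ^ k * (Z * c ^ k * (y + 1 / p + w / c)) := by
  have hk1 : (1 : ℝ) ≤ k := by exact_mod_cast (show 1 ≤ k by omega)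
  have hV0 : 0 ≤ 2 * e * c := by positivity
  have h3 : M ^ (k - 1) * (Z * (M * y + 2 * (e * (c * y + 5 * w)))) ≤
      (2 * e * c) ^ (k - 1) * (Z * ((2 * e * c) * y + 2 * (e * (c * y + 5 * w)))) := by
    refine mul_le_mul (pow_le_pow_left₀ hM0 hM _) (mul_le_mul_of_nonneg_left ?_ hZ)
      (by positivity) (by positivity)
    linarith [mul_le_mul_of_nonneg_right hM hy]
  have hVk : (2 * e * c) ^ (k - 1) * c = (2 * e) ^ (k - 1) * c ^ k := by
    rw [mul_pow, mul_assoc, ← pow_succ, Nat.sub_add_cancel (by omega)]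
  have h4 : (2 * e * c) ^ (k - 1) * (Z * ((2 * e * c) * y + 2 * (e * (c * y + 5 * w)))) +
      Z * (2 * e * c) ^ (k - 1) * ((4 * k + 2) * (e * (5 * w)) + 8 * k ^ 2 / p * (2 * e * c)) =
      Z * ((2 * e) ^ (k - 1) * c ^ k) * (2 * e * (2 * y + (10 * k + 10) * (w / c) +
        8 * k ^ 2 * (1 / p))) := by
    rw [← hVk]
    generalize (2 * e * c) ^ (k - 1) = V
    field_simp
    ring
  have h5 : 2 * y + (10 * k + 10) * (w / c) + 8 * k ^ 2 * (1 / p) ≤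
      200 * k ^ 2 * (y + 1 / p + w / c) := by
    have hkk : (1 : ℝ) ≤ (k : ℝ) ^ 2 := by nlinarith
    have : (k : ℝ) ≤ (k : ℝ) ^ 2 := by nlinarith
    have hwc : 0 ≤ w / c := by positivity
    have hpp : 0 ≤ 1 / p := by positivity
    have i1 : 2 * y ≤ 200 * k ^ 2 * y := mul_le_mul_of_nonneg_right (by linarith) hy
    have i2 : (10 * k + 10) * (w / c) ≤ 200 * k ^ 2 * (w / c) :=
      mul_le_mul_of_nonneg_right (by linarith) hwc
    have i3 : 8 * k ^ 2 * (1 / p) ≤ 200 * k ^ 2 * (1 / p) :=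
      mul_le_mul_of_nonneg_right (by linarith) hpp
    linarith
  have h6 : (2 * e) ^ k = (2 * e) ^ (k - 1) * (2 * e) := by
    rw [← pow_succ, Nat.sub_add_cancel (by omega)]
  refine hq.trans ((add_le_add (hS.trans h3) le_rfl).trans (h4.le.trans ?_))
  calc _ ≤ Z * ((2 * e) ^ (k - 1) * c ^ k) * (2 * e *
        (200 * k ^ 2 * (y + 1 / p + w / c))) := by
        refine mul_le_mul_of_nonneg_left (mul_le_mul_of_nonneg_left h5 (by positivity))
          (by positivity)
    _ = _ := by rw [h6]; ring

/-- Adds up four errors: passage from sums to integrals, replacement of the majorant by 1/r, face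
planes together with the 1/p terms, and the deficit of the lower weights. Letters are as in
`le_of_prime_bounds`. -/
theorem prime_error_le {k : ℕ} (hk : 2 ≤ k) {e c w D Z : ℝ} (he1 : 1 ≤ e)
    (hc0 : 0 < c) (hw1 : 1 ≤ w) (hD0 : 0 < D) (hZ0 : 0 ≤ Z) :
    Z * (2 * e * c) ^ (k - 1) * (k * 112 * w) +
      Z * (k * (2 * e * c) ^ (k - 1) * (12 * (e * 2) * (c / D) + 7 * w)) +
      Z * (2 * e * c) ^ (k - 1) * ((4 * k + 2) * (e * (5 * w)) +
        8 * k ^ 2 * (1 / D) * (2 * e * c)) +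
      Z * (7 * k ^ 2 / D * ((2 * e * c) ^ (k - 1) * (2 * e * c))) ≤
      200 * k ^ 2 * (2 * e) ^ k * (Z * c ^ k * (1 / D + w / c)) := by
  have hk1 : (1 : ℝ) ≤ k := by exact_mod_cast (show 1 ≤ k by omega)
  have hkk : (k : ℝ) ≤ (k : ℝ) ^ 2 := by nlinarith
  have hkk1 : (1 : ℝ) ≤ (k : ℝ) ^ 2 := by nlinarith
  have h6 : (2 * e) ^ k = (2 * e) ^ (k - 1) * (2 * e) := by
    rw [← pow_succ, Nat.sub_add_cancel (by omega)]
  have hVk : (2 * e * c) ^ (k - 1) * c = (2 * e) ^ (k - 1) * c ^ k := by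
    rw [mul_pow, mul_assoc, ← pow_succ, Nat.sub_add_cancel (by omega)]
  have hV' : 0 ≤ (2 * e * c) ^ (k - 1) := by positivity
  generalize (2 * e * c) ^ (k - 1) = V' at *
  have e1 : 200 * k ^ 2 * (2 * e) ^ k * (Z * c ^ k * (1 / D + w / c)) =
      Z * V' * (200 * k ^ 2 * (2 * e) * (c / D + w)) := by
    have : c * (1 / D + w / c) = c / D + w := by field_simp
    rw [h6, ← this]
    calc _ = 200 * k ^ 2 * (2 * e) * Z * ((2 * e) ^ (k - 1) * c ^ k) * (1 / D + w / c) := by ring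
      _ = _ := by rw [← hVk]; ring
  have e2 : Z * V' * (k * 112 * w) + Z * (k * V' * (12 * (e * 2) * (c / D) + 7 * w)) +
    Z * V' * ((4 * k + 2) * (e * (5 * w)) + 8 * k ^ 2 * (1 / D) * (2 * e * c)) +
    Z * (7 * k ^ 2 / D * (V' * (2 * e * c))) =
      Z * V' * ((12 * k + 8 * k ^ 2 + 7 * k ^ 2) * (2 * e) * (c / D)
      + (119 * k + (4 * k + 2) * 5 * e) * w) := by
    field_simp; ring
  rw [e1, e2]
  refine mul_le_mul_of_nonneg_left ?_ (mul_nonneg hZ0 hV')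
  rw [mul_add]
  refine add_le_add ?_ ?_
  · refine mul_le_mul_of_nonneg_right ?_ (by positivity)
    refine mul_le_mul_of_nonneg_right ?_ (by positivity)
    linarith
  · refine mul_le_mul_of_nonneg_right ?_ (by linarith)
    have i1 := mul_le_mul_of_nonneg_left he1 (show (0 : ℝ) ≤ k by linarith)
    have i2 := mul_le_mul_of_nonneg_right hkk (show (0 : ℝ) ≤ e by linarith)
    have i3 := mul_le_mul_of_nonneg_right hkk1 (show (0 : ℝ) ≤ e by linarith)
    linarith

section

variable {k : ℕ} {P : Finset ℕ} {D R : ℝ} {S U : Set (Fin k → ℝ)} {κ : ℝ}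
  {F : (Fin k → ℝ) → ℝ} {W p m : ℕ}

theorem SieveModulus.le_of_dvd (h : SieveScale k P D R) (hm : SieveModulus P R p m) {q : ℕ}
    (hq : q.Prime) (hqm : q ∣ m) : k ≤ q := by
  have := h.k_le.trans (h.le_of_notMem q hq (hm.notMem q hq hqm).1)
  exact_mod_cast this

/-- The upper diagonal bound, with the weights raised to the majorant, the tuples enlarged to all
sifted ones and the squares replaced by `shiftSq`. It serves both the O(y) bound and the upper half
of the asymptotic formula. -/
theorem sum_majorant_mul_le (hk : 1 ≤ k) (h : SieveScale k P D R) (hm : SieveModulus P R p m)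
    (hW : ∀ q : ℕ, q.Prime → q ∣ W → q ∈ P) (hp : p.Prime) (hpP : p ∉ P)
    (hS : SieveRegion S U κ) (hF : IsSieveFunction S F) (hk2 : 2 ≤ k) (j : Fin k) :
    selbergForm k m (lambdaOf k m (shiftedY p j (sieveY W R F)))
      (lambdaOf k m (shiftedY p j (sieveY W R F))) ≤
      ∑ r ∈ Fintype.piFinset (fun _ : Fin k => sifted P R), (∏ i, majorant (r i)) *
        shiftSq (U.indicator F) j (Real.log p / Real.log R) (logPoint R r) +
      Fmax F ^ 2 * (2 * Real.exp 12 * logDensity P R) ^ (k - 1) *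
        ((4 * k + 2) * (Real.exp 12 * (5 * ∏ p ∈ P, (p : ℝ))) +
          8 * k ^ 2 / p * (2 * Real.exp 12 * logDensity P R)) := by
  obtain ⟨Q, hQc, hQ0, hQ⟩ := hS.boundary
  set T := Fintype.piFinset (fun _ : Fin k => sifted P R) with hT
  set f := U.indicator F with hf
  set y := Real.log p / Real.log R with hy
  set V := 2 * Real.exp 12 * logDensity P R with hV
  have hM := h.sum_majorant_total_le'
  have hM0 : 0 ≤ ∑ n ∈ sifted P R, majorant n := sum_nonneg fun _ _ => majorant_nonneg _
  have hV0 : 0 ≤ V := hM0.trans hM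
  have hpow : (∑ n ∈ sifted P R, majorant n) ^ (k - 1) ≤ V ^ (k - 1) := pow_le_pow_left₀ hM0 hM _
  have hWp := h.one_le_prod
  have hmaj : ∀ r : Fin k → ℕ, 0 ≤ ∏ i, majorant (r i) := fun r =>
    prod_nonneg fun _ _ => majorant_nonneg _
  refine (selbergForm_le hm.squarefree (fun q hq hqm => hm.le_of_dvd h hq hqm) _).trans ?_
  have h1 : ∑ r ∈ divTuples k m, upperWeight r * shiftedY p j (sieveY W R F) r ^ 2 ≤
      ∑ r ∈ T, (∏ i, majorant (r i)) * (shiftSq f j y (logPoint R r) +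
        Fmax F ^ 2 * (planeCount Q j y (logPoint R r) + 8 * k ^ 2 / p)) := by
    have hg0 : ∀ r, 0 ≤ (∏ i, majorant (r i)) * (shiftSq f j y (logPoint R r) +
        Fmax F ^ 2 * (planeCount Q j y (logPoint R r) + 8 * k ^ 2 / p)) := fun r =>
      mul_nonneg (hmaj r) (add_nonneg (shiftSq_nonneg _ _ _ _) (mul_nonneg (sq_nonneg _)
        (add_nonneg (planeCount_nonneg _ _ _ _) (by positivity))))
    calc _ = ∑ r ∈ (divTuples k m).filter (fun r => r ∈ T),
          upperWeight r * shiftedY p j (sieveY W R F) r ^ 2 := by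
          refine (sum_filter_of_ne fun r hr hne => ?_).symm
          refine hm.mem_sifted_of_ne hk2 h j hr (W := W) (F := F) fun h0 => hne ?_
          rw [h0]; ring
      _ ≤ ∑ r ∈ (divTuples k m).filter (fun r => r ∈ T), (∏ i, majorant (r i)) *
          (shiftSq f j y (logPoint R r) +
            Fmax F ^ 2 * (planeCount Q j y (logPoint R r) + 8 * k ^ 2 / p)) := by
          refine sum_le_sum fun r hr => ?_
          rw [mem_filter] at hr
          have hr0 : ∀ i, r i ≠ 0 := fun i h0 => by
            have := (mem_sifted.1 (Fintype.mem_piFinset.1 hr.2 i)).1.1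
            omega
          refine mul_le_mul (upperWeight_le hr0) ?_ (sq_nonneg _) (hmaj r)
          have := (abs_le.1 (abs_shiftedY_sq_sub_le hk h hm hW hp hpP hS hF hQ j hr.1)).2
          linarith
      _ ≤ _ := sum_le_sum_of_subset_of_nonneg (fun r hr => (mem_filter.1 hr).2)
          fun r _ _ => hg0 r
  refine h1.trans ?_
  have h2 := h.sum_planeCount_le hQc hQ0 j y
  have h3 : ∑ r ∈ T, ∏ i, majorant (r i) ≤ V ^ (k - 1) * V := by
    rw [hT, sum_piFinset_prod, ← pow_succ, Nat.sub_add_cancel hk]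
    exact pow_le_pow_left₀ hM0 hM _
  have e : ∑ r ∈ T, (∏ i, majorant (r i)) * (shiftSq f j y (logPoint R r) +
        Fmax F ^ 2 * (planeCount Q j y (logPoint R r) + 8 * k ^ 2 / p)) =
      ∑ r ∈ T, (∏ i, majorant (r i)) * shiftSq f j y (logPoint R r) +
        Fmax F ^ 2 * (∑ r ∈ T, (∏ i, majorant (r i)) * planeCount Q j y (logPoint R r) +
          8 * k ^ 2 / p * ∑ r ∈ T, ∏ i, majorant (r i)) := by
    rw [mul_sum T _ (8 * (k : ℝ) ^ 2 / p), ← sum_add_distrib, mul_sum, ← sum_add_distrib]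
    exact sum_congr rfl fun r _ => by ring
  rw [e, mul_assoc]
  refine add_le_add le_rfl (mul_le_mul_of_nonneg_left ?_ (sq_nonneg _))
  rw [mul_add]
  refine add_le_add (h2.trans (mul_le_mul_of_nonneg_right hpow (by positivity))) ?_
  refine (mul_le_mul_of_nonneg_left h3 (by positivity)).trans (le_of_eq ?_)
  ring

theorem one_le_exp_twelve : (1 : ℝ) ≤ Real.exp 12 := Real.one_le_exp (by norm_num)

/-- The contribution of a prime `p = R^y` is `O(y)`. -/
theorem primeForm_le (hk : 2 ≤ k) (h : SieveScale k P D R) (hm : SieveModulus P R p m)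
    (hW : ∀ q : ℕ, q.Prime → q ∣ W → q ∈ P) (hp : p.Prime) (hpP : p ∉ P)
    (hS : SieveRegion S U κ) (hF : IsSieveFunction S F) (j : Fin k) :
    selbergForm k m (lambdaOf k m (shiftedY p j (sieveY W R F)))
      (lambdaOf k m (shiftedY p j (sieveY W R F))) ≤
      primeConst k * (Fmax F ^ 2 * logDensity P R ^ k *
        (Real.log p / Real.log R + 1 / p + (∏ p ∈ P, (p : ℝ)) / logDensity P R)) := by
  have hk1 : (1 : ℝ) ≤ k := by exact_mod_cast (show 1 ≤ k by omega)
  have h1 := sum_majorant_mul_le (by omega) h hm hW hp hpP hS hF hk j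
  have hy : 0 ≤ Real.log p / Real.log R :=
    div_nonneg (Real.log_nonneg (by exact_mod_cast hp.one_lt.le)) h.log_pos.le
  have h2 := h.sum_shiftSq_le hS.convex (hS.subset.trans hS.cube) (hS.axisLip hF) j hy
  exact le_of_prime_bounds hk one_le_exp_twelve h.logDensity_pos
    (by linarith [h.one_le_prod]) hy (by exact_mod_cast hp.pos) (sq_nonneg _)
    (sum_nonneg fun _ _ => majorant_nonneg _) h.sum_majorant_total_le' h1 h2

set_option maxHeartbeats 1000000 in
/-- The contribution of a prime `p = R^y` is asymptotically proportional to `I₀(y)`. -/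
theorem abs_primeForm_sub_le (hk : 2 ≤ k) (h : SieveScale k P D R) (hm : SieveModulus P R p m)
    (hW : ∀ q : ℕ, q.Prime → q ∣ W → q ∈ P) (hp : p.Prime) (hpP : p ∉ P)
    (hS : SieveRegion S U κ) (hF : IsSieveFunction S F) (j : Fin k) :
    |selbergForm k m (lambdaOf k m (shiftedY p j (sieveY W R F)))
      (lambdaOf k m (shiftedY p j (sieveY W R F))) -
        logDensity P R ^ k * I0 F j (Real.log p / Real.log R)| ≤
      primeConst k * (Fmax F ^ 2 * logDensity P R ^ k *
        (1 / D + (∏ p ∈ P, (p : ℝ)) / logDensity P R)) := by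
  have hk1 : (1 : ℝ) ≤ k := by exact_mod_cast (show 1 ≤ k by omega)
  have hkk : (k : ℝ) ≤ (k : ℝ) ^ 2 := by nlinarith
  have hkk1 : (1 : ℝ) ≤ (k : ℝ) ^ 2 := by nlinarith
  have hup := sum_majorant_mul_le (by omega) h hm hW hp hpP hS hF hk j
  have hDp := h.le_of_notMem p hp hpP
  have hD1 := h.one_le
  have hlow := h.sum_sub_lowerWeight_le hm.squarefree.ne_zero hp hpP hm.dvd
  have hsel := le_selbergForm hm.squarefree (fun q hq hqm => hm.le_of_dvd h hq hqm)
    (shiftedY p j (sieveY W R F))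
  have hK := hF.Fmax_nonneg
  have hax := hS.axisLip hF
  have hdis := sum_piFinset_sub_integral_le (sifted P R) (fun n => 1 / (n : ℝ))
    (fun n => Real.log n / Real.log R) (fun n _ => by positivity) h.logDensity_pos.le
    (K := 2 * logDensity P R) (by linarith [h.logDensity_pos]) h.sum_one_div_le k
    (shiftSq (U.indicator F) j (Real.log p / Real.log R))
    (hax.measurable_shiftSq j _) (M := Fmax F ^ 2)
    (fun t => by rw [abs_of_nonneg (shiftSq_nonneg _ _ _ _)]; exact hax.shiftSq_le j _ t)
    (δ := 28 * Fmax F ^ 2 * (4 * ∏ p ∈ P, (p : ℝ)))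
    (fun l t => hax.shiftSq_discrepancy hS.convex j _ (sifted P R) (fun n => 1 / (n : ℝ)) _
      (fun n _ => by positivity) (fun n hn => h.log_div_mem hn) h.discrepancy l t)
  rw [← hS.I0_eq hF] at hdis
  change |∑ r ∈ Fintype.piFinset (fun _ : Fin k => sifted P R), (∏ i, 1 / (r i : ℝ)) *
    shiftSq (U.indicator F) j (Real.log p / Real.log R) (logPoint R r) - _| ≤ _ at hdis
  obtain ⟨Q, hQc, hQ0, hQ⟩ := hS.boundary
  have hplane := h.sum_planeCount_le hQc hQ0 j (Real.log p / Real.log R)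
  have hM := h.sum_majorant_total_le'
  have hMD := h.sum_majorant_total_le
  have hm1 := abs_le.1 h.abs_sum_one_div_sub_le
  have hprodle := h.prod_le
  have hmajle : ∑ n ∈ sifted P R, 1 / (n : ℝ) ≤ ∑ n ∈ sifted P R, majorant n :=
    sum_le_sum fun n _ => one_div_le_majorant n
  set T := Fintype.piFinset (fun _ : Fin k => sifted P R) with hT
  set f := U.indicator F with hf
  set y := Real.log p / Real.log R with hydef
  set q := selbergForm k m (lambdaOf k m (shiftedY p j (sieveY W R F)))
      (lambdaOf k m (shiftedY p j (sieveY W R F))) with hq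
  set e := Real.exp 12 with he
  have he1 : 1 ≤ e := one_le_exp_twelve
  set c := logDensity P R with hc
  have hc0 : 0 < c := h.logDensity_pos
  set w := ∏ p ∈ P, (p : ℝ) with hw
  have hw1 : 1 ≤ w := h.one_le_prod
  set M := ∑ n ∈ sifted P R, majorant n with hMdef
  set μ := ∑ n ∈ sifted P R, 1 / (n : ℝ) with hμ
  have hμ0 : 0 ≤ μ := sum_nonneg fun _ _ => by positivity
  have hM0 : 0 ≤ M := hμ0.trans hmajle
  have hp0 : (0 : ℝ) < p := by exact_mod_cast hp.pos
  have hD0 : 0 < D := by linarith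
  set V := 2 * e * c with hV
  have hV0 : 0 ≤ V := by positivity
  have hVc : 2 * c ≤ V := by rw [hV]; nlinarith
  set V' := V ^ (k - 1) with hV'
  have hV'0 : 0 ≤ V' := pow_nonneg hV0 _
  have hVV : V' * V = V ^ k := by rw [hV', ← pow_succ, Nat.sub_add_cancel (by omega)]
  set Z := Fmax F ^ 2 with hZ
  have hZ0 : 0 ≤ Z := sq_nonneg _
  have hpD : 1 / (p : ℝ) ≤ 1 / D := one_div_le_one_div_of_le hD0 hDp
  have hmaj : ∀ r : Fin k → ℕ, 0 ≤ ∏ i, majorant (r i) := fun r =>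
    prod_nonneg fun _ _ => majorant_nonneg _
  have hinv : ∀ r : Fin k → ℕ, 0 ≤ ∏ i, 1 / (r i : ℝ) := fun r =>
    prod_nonneg fun _ _ => by positivity
  have hinvmaj : ∀ r : Fin k → ℕ, ∏ i, 1 / (r i : ℝ) ≤ ∏ i, majorant (r i) := fun r =>
    prod_le_prod (fun _ _ => by positivity) fun _ _ => one_div_le_majorant _
  -- the total error
  have herr : Z * V' * (k * 112 * w) + Z * (k * V' * (12 * (e * 2) * (c / D) + 7 * w)) +
      Z * V' * ((4 * k + 2) * (e * (5 * w)) + 8 * k ^ 2 * (1 / D) * V) +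
      Z * (7 * k ^ 2 / D * (V' * V)) ≤
      primeConst k * (Z * c ^ k * (1 / D + w / c)) :=
    prime_error_le hk he1 hc0 hw1 hD0 hZ0
  have hdis' : k * (2 * c) ^ (k - 1) * (28 * Z * (4 * w)) ≤ Z * V' * (k * 112 * w) := by
    calc _ ≤ k * V' * (28 * Z * (4 * w)) := by
          refine mul_le_mul_of_nonneg_right (mul_le_mul_of_nonneg_left ?_ (by linarith))
            (by positivity)
          exact pow_le_pow_left₀ (by linarith) hVc _
      _ = _ := by ring
  have hdis2 := abs_le.1 (hdis.trans hdis')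
  have hpl : 8 * k ^ 2 / (p : ℝ) * V ≤ 8 * k ^ 2 * (1 / D) * V := by
    refine mul_le_mul_of_nonneg_right ?_ hV0
    rw [div_eq_mul_one_div]
    exact mul_le_mul_of_nonneg_left hpD (by positivity)
  have hs0 := fun r => shiftSq_nonneg f j y (logPoint R r)
  have hs1 := fun r => hax.shiftSq_le j y (logPoint R r)
  rw [abs_le]
  constructor
  · -- lower bound
    have l1 : ∑ r ∈ T, (∏ i, 1 / (r i : ℝ)) * shiftSq f j y (logPoint R r) -
        Z * ∑ r ∈ T, ((∏ i, 1 / (r i : ℝ)) - if ∏ i, r i ∣ m then lowerWeight r else 0) -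
        Z * ∑ r ∈ T, (∏ i, majorant (r i)) * (planeCount Q j y (logPoint R r) + 8 * k ^ 2 / p) ≤
        q := by
      refine le_trans ?_ hsel
      have hlw : ∀ r ∈ divTuples k m, 0 ≤ lowerWeight r ∧ lowerWeight r ≤ ∏ i, 1 / (r i : ℝ) := by
        intro r hr
        rw [mem_divTuples hm.squarefree.ne_zero] at hr
        have hkq : ∀ q : ℕ, q.Prime → ∀ i, q ∣ r i → k ≤ q := fun q hq i hi =>
          hm.le_of_dvd h hq ((hi.trans (dvd_prod_of_mem r (mem_univ i))).trans hr)
        refine ⟨prod_nonneg fun i _ => mul_nonneg (by positivity) (prod_nonneg fun q hq => ?_),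
          lowerWeight_le hkq⟩
        have hqp := Nat.prime_of_mem_primeFactors hq
        have h1 : (k : ℝ) ≤ q := by exact_mod_cast hkq q hqp i (Nat.dvd_of_mem_primeFactors hq)
        have : (k : ℝ) / q ≤ 1 := div_le_one_of_le₀ h1 (by positivity)
        linarith
      -- Lower weights are nonnegative because every prime of m is at least k, so tuples outside T
      -- can be dropped. The tuples of T that are missing from the divisor tuples are charged to
      -- `sum_sub_lowerWeight_le`.
      have hsub : ∑ r ∈ T.filter (fun r => ∏ i, r i ∣ m),
          lowerWeight r * shiftedY p j (sieveY W R F) r ^ 2 ≤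
          ∑ r ∈ divTuples k m, lowerWeight r * shiftedY p j (sieveY W R F) r ^ 2 := by
        refine sum_le_sum_of_subset_of_nonneg (fun r hr => ?_) fun r hr _ =>
          mul_nonneg (hlw r hr).1 (sq_nonneg _)
        exact (mem_divTuples hm.squarefree.ne_zero).2 (mem_filter.1 hr).2
      refine le_trans ?_ hsub
      rw [mul_sum, mul_sum, ← sum_sub_distrib, ← sum_sub_distrib, sum_filter]
      refine sum_le_sum fun r hr => ?_
      have hg := mul_nonneg (hmaj r) (add_nonneg (planeCount_nonneg Q j y (logPoint R r))
        (show (0 : ℝ) ≤ 8 * k ^ 2 / p by positivity))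
      split_ifs with hd
      · have hrd := (mem_divTuples hm.squarefree.ne_zero (k := k)).2 hd
        have i1 := (abs_le.1 (abs_shiftedY_sq_sub_le (by omega) h hm hW hp hpP hS hF hQ j hrd)).1
        have i2 := hlw r hrd
        set G := planeCount Q j y (logPoint R r) + 8 * k ^ 2 / p with hG
        have hG0 : 0 ≤ G := add_nonneg (planeCount_nonneg Q j y (logPoint R r)) (by positivity)
        have i3 : lowerWeight r * (shiftSq f j y (logPoint R r) - Z * G) ≤
            lowerWeight r * shiftedY p j (sieveY W R F) r ^ 2 :=
          mul_le_mul_of_nonneg_left (by linarith) i2.1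
        have i4 : lowerWeight r * (Z * G) ≤ Z * ((∏ i, majorant (r i)) * G) := by
          calc _ ≤ (∏ i, majorant (r i)) * (Z * G) :=
                mul_le_mul_of_nonneg_right (i2.2.trans (hinvmaj r)) (mul_nonneg hZ0 hG0)
            _ = _ := by ring
        have i5 : ((∏ i, 1 / (r i : ℝ)) - lowerWeight r) * shiftSq f j y (logPoint R r) ≤
            ((∏ i, 1 / (r i : ℝ)) - lowerWeight r) * Z :=
          mul_le_mul_of_nonneg_left (hs1 r) (sub_nonneg.2 i2.2)
        linarith
      · have := mul_le_mul_of_nonneg_left (hs1 r) (hinv r)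
        have := mul_nonneg hZ0 hg
        linarith
    have l2 : ∑ r ∈ T, (∏ i, majorant (r i)) * (planeCount Q j y (logPoint R r) + 8 * k ^ 2 / p) ≤
        V' * ((4 * k + 2) * (e * (5 * w)) + 8 * k ^ 2 * (1 / D) * V) := by
      simp only [mul_add, sum_add_distrib]
      rw [← sum_mul, sum_piFinset_prod]
      refine add_le_add (hplane.trans (mul_le_mul_of_nonneg_right
        (pow_le_pow_left₀ hM0 hM _) (by positivity))) ?_
      calc _ ≤ V ^ k * (8 * k ^ 2 / p) := mul_le_mul_of_nonneg_right
            (pow_le_pow_left₀ hM0 hM _) (by positivity)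
        _ = V' * (8 * k ^ 2 / (p : ℝ) * V) := by rw [← hVV]; ring
        _ ≤ _ := mul_le_mul_of_nonneg_left hpl hV'0
    have l3 : 7 * k ^ 2 / D * μ ^ k ≤ 7 * k ^ 2 / D * (V' * V) := by
      refine mul_le_mul_of_nonneg_left ?_ (by positivity)
      rw [hVV]
      exact pow_le_pow_left₀ hμ0 (hmajle.trans hM) _
    have l4 := mul_le_mul_of_nonneg_left l2 hZ0
    have l5 := mul_le_mul_of_nonneg_left (hlow.trans l3) hZ0
    have l6 : 0 ≤ Z * (k * V' * (12 * (e * 2) * (c / D) + 7 * w)) := by positivity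
    linarith [hdis2.1]
  · -- upper bound
    have u1 : ∑ r ∈ T, (∏ i, majorant (r i)) * shiftSq f j y (logPoint R r) ≤
        ∑ r ∈ T, (∏ i, 1 / (r i : ℝ)) * shiftSq f j y (logPoint R r) + Z * (M ^ k - μ ^ k) := by
      have : M ^ k - μ ^ k = ∑ r ∈ T, ((∏ i, majorant (r i)) - ∏ i, 1 / (r i : ℝ)) := by
        rw [sum_sub_distrib, hT, sum_piFinset_prod (sifted P R) majorant,
          sum_piFinset_prod (sifted P R) fun n => 1 / (n : ℝ)]
      rw [this, mul_sum, ← sum_add_distrib]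
      refine sum_le_sum fun r _ => ?_
      have := mul_le_mul_of_nonneg_left (hs1 r) (sub_nonneg.2 (hinvmaj r))
      linarith
    -- From M ≤ exp(12/D)(c + 5w) and μ ≥ c - 2w the difference M - μ is at most (exp(12/D) - 1)(c +
    -- 5w) + 7w; telescoping the powers costs the factor k V^(k-1).
    have u2 : M ^ k - μ ^ k ≤ k * V' * (12 * (e * 2) * (c / D) + 7 * w) := by
      refine (pow_sub_pow_le hμ0 hmajle hM k).trans ?_
      refine mul_le_mul_of_nonneg_left ?_ (mul_nonneg (by linarith) hV'0)
      -- This is exp x - 1 ≤ x exp x, a rewriting of 1 - x ≤ exp(-x).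
      have hx : Real.exp (12 / D) - 1 ≤ 12 / D * e := by
        have h1 := Real.add_one_le_exp (-(12 / D))
        have h2 : Real.exp (12 / D) * Real.exp (-(12 / D)) = 1 := by
          rw [← Real.exp_add]; simp
        have h3 := h.exp_le
        have h4 : 0 ≤ 12 / D := by positivity
        nlinarith [Real.exp_pos (12 / D), mul_le_mul_of_nonneg_left h1 (Real.exp_pos (12 / D)).le,
          mul_le_mul_of_nonneg_left h3 h4]
      have h5 : (Real.exp (12 / D) - 1) * (c + 5 * w) ≤ 12 / D * e * (2 * c) :=
        mul_le_mul hx (by linarith) (by linarith) (by positivity)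
      have h6 : 12 / D * e * (2 * c) = 12 * (e * 2) * (c / D) := by ring
      linarith [hm1.1]
    have u3 := mul_le_mul_of_nonneg_left u2 hZ0
    have u4 := mul_le_mul_of_nonneg_left hpl (mul_nonneg hZ0 hV'0)
    have u5 : 0 ≤ Z * (7 * k ^ 2 / D * (V' * V)) := by positivity
    linarith [hdis2.2]

end

end

/-! ### Piecewise smooth weights and Koksma's inequality -/

section

open MeasureTheory Set

theorem PieceLip.restrict {lo hi L M lo' : ℝ} {f : ℝ → ℝ} (hf : PieceLip lo hi L M f)
    (hlo : lo ≤ lo') : PieceLip lo' hi L M f := by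
  obtain ⟨I, hI, hIs, h1, h2, h3⟩ := hf
  refine ⟨I ∩ Icc lo' hi, hI.inter ordConnected_Icc, inter_subset_right,
    fun x hx y hy => h1 x hx.1 y hy.1, fun x hx => h2 x hx.1, fun x hx hn => ?_⟩
  exact h3 x ⟨hlo.trans hx.1, hx.2⟩ fun h => hn ⟨h, hx⟩

/-- Functions on `[0, T]` that may be multiplied into the comparison of sums over atoms with
integrals. -/
def IsKoksma (T : ℝ) (h : ℝ → ℝ) : Prop :=
  ∃ C : ℝ, 0 ≤ C ∧ (∀ y ∈ Icc 0 T, |h y| ≤ C) ∧ ∀ lo ∈ Icc 0 T, ∀ (L M : ℝ) (φ : ℝ → ℝ),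
    0 ≤ L → 0 ≤ M → PieceLip lo T L M φ →
    IntegrableOn (fun y => h y * φ y) (Icc lo T) volume ∧
    ∀ (A : Finset ℕ) (w x : ℕ → ℝ) (E : ℝ), (∀ n ∈ A, 0 ≤ w n) → (∀ n ∈ A, x n ∈ Icc lo T) →
      (∀ J : Set ℝ, J.OrdConnected → J ⊆ Icc lo T →
        |∑ n ∈ A, J.indicator (fun _ => w n) (x n) - 1 * volume.real J| ≤ E) →
      |∑ n ∈ A, w n * (h (x n) * φ (x n)) - ∫ y in Icc lo T, h y * φ y| ≤ C * (L + M) * E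

theorem PieceLip.isKoksma {T L₁ M₁ : ℝ} {h : ℝ → ℝ} (hL₁ : 0 ≤ L₁) (hM₁ : 0 ≤ M₁)
    (hh : PieceLip 0 T L₁ M₁ h) : IsKoksma T h := by
  by_cases hT : 0 ≤ T
  swap
  · refine ⟨0, le_rfl, fun y hy => absurd (hy.1.trans hy.2) hT,
      fun lo hlo => absurd (hlo.1.trans hlo.2) hT⟩
  refine ⟨3 * M₁ + 2 * T * (L₁ + M₁), by positivity, fun y hy => ?_, ?_⟩
  · refine (hh.bound hM₁ y hy).trans ?_
    have : 0 ≤ 2 * T * (L₁ + M₁) := by positivity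
    linarith
  · intro lo hlo L M φ hL hM hφ
    have hp := (hh.restrict hlo.1).mul hM₁ hφ
    refine ⟨hp.integrableOn (by positivity) volume, fun A w x E hw hx H => ?_⟩
    have hE : 0 ≤ E := (abs_nonneg _).trans (H ∅ ordConnected_empty (empty_subset _))
    have h1 := hp.sum_discrepancy A w x hw hlo.2 (by positivity) (by positivity) hx H
    rw [one_mul] at h1
    refine h1.trans (mul_le_mul_of_nonneg_right ?_ hE)
    have h2 : 2 * (L₁ * M + L * M₁) * (T - lo) ≤ 2 * (L₁ * M + L * M₁) * T :=
      mul_le_mul_of_nonneg_left (by linarith [hlo.1]) (by positivity)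
    have h3 : 0 ≤ M₁ * L := by positivity
    have h4 : 0 ≤ T * (L₁ * L) := by positivity
    have h5 : 0 ≤ T * (M₁ * M) := by positivity
    nlinarith

/-- Additivity is the purpose of the class: a piecewise smooth function is a finite sum of functions
living on one interval, but is not itself of that kind. -/
theorem IsKoksma.add {T : ℝ} {g h : ℝ → ℝ} (hg : IsKoksma T g) (hh : IsKoksma T h) :
    IsKoksma T fun y => g y + h y := by
  obtain ⟨C, hC, b1, k1⟩ := hg
  obtain ⟨C', hC', b2, k2⟩ := hh
  refine ⟨C + C', by positivity, fun y hy => (abs_add_le _ _).trans (add_le_add (b1 y hy) (b2 y hy)),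
    fun lo hlo L M φ hL hM hφ => ?_⟩
  obtain ⟨i1, e1⟩ := k1 lo hlo L M φ hL hM hφ
  obtain ⟨i2, e2⟩ := k2 lo hlo L M φ hL hM hφ
  simp only [add_mul]
  refine ⟨i1.add i2, fun A w x E hw hx H => ?_⟩
  rw [integral_add i1 i2]
  simp only [mul_add, Finset.sum_add_distrib]
  have := e1 A w x E hw hx H
  have := e2 A w x E hw hx H
  rw [abs_le] at *
  constructor <;> linarith

theorem IsKoksma.congr {T : ℝ} {g h : ℝ → ℝ} (hg : IsKoksma T g) (e : EqOn g h (Icc 0 T)) :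
    IsKoksma T h := by
  obtain ⟨C, hC, b1, k1⟩ := hg
  refine ⟨C, hC, fun y hy => e hy ▸ b1 y hy, fun lo hlo L M φ hL hM hφ => ?_⟩
  obtain ⟨i1, e1⟩ := k1 lo hlo L M φ hL hM hφ
  have hsub : Icc lo T ⊆ Icc 0 T := Icc_subset_Icc_left hlo.1
  have heq : EqOn (fun y => g y * φ y) (fun y => h y * φ y) (Icc lo T) := fun y hy => by
    simp only [e (hsub hy)]
  refine ⟨i1.congr_fun heq measurableSet_Icc, fun A w x E hw hx H => ?_⟩
  rw [← setIntegral_congr_fun measurableSet_Icc heq,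
    Finset.sum_congr rfl fun n hn => by rw [← e (hsub (hx n hn))]]
  exact e1 A w x E hw hx H

/-- At a breakpoint the value of the weight is unrestricted, and an atom log p / log R may sit
exactly there, so single points need their own summand. -/
theorem isKoksma_indicator_singleton {T : ℝ} (f : ℝ → ℝ) (a : ℝ) :
    IsKoksma T (indicator {a} f) := by
  refine PieceLip.isKoksma (L₁ := 0) (M₁ := |f a|) le_rfl (abs_nonneg _)
    ⟨{a} ∩ Icc 0 T, ordConnected_singleton.inter ordConnected_Icc, inter_subset_right, ?_, ?_, ?_⟩
  · rintro x ⟨rfl, -⟩ y ⟨rfl, -⟩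
    simp
  · rintro x ⟨rfl, -⟩
    simp
  · intro x hx hn
    exact indicator_of_notMem (fun h => hn ⟨h, hx⟩) _

theorem exists_lipschitz_bound {g : ℝ → ℝ} {a b : ℝ} (hg : ContDiffOn ℝ 1 g (Icc a b)) :
    ∃ L M : ℝ, 0 ≤ L ∧ 0 ≤ M ∧ (∀ x ∈ Icc a b, ∀ y ∈ Icc a b, |g x - g y| ≤ L * |x - y|) ∧
      ∀ x ∈ Icc a b, |g x| ≤ M := by
  have h1 : LocallyLipschitzOn (Icc a b) g := fun x hx =>
    (hg x hx).exists_lipschitzOnWith (convex_Icc a b)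
  obtain ⟨K, hK⟩ := h1.exists_lipschitzOnWith_of_compact isCompact_Icc
  obtain ⟨M, hM⟩ := isCompact_Icc.exists_bound_of_continuousOn hg.continuousOn
  refine ⟨K, max M 0, K.2, le_max_right _ _, fun x hx y hy => ?_,
    fun x hx => (hM x hx).trans (le_max_left _ _)⟩
  have := hK.dist_le_mul x hx y hy
  rwa [Real.dist_eq, Real.dist_eq] at this

theorem isKoksma_indicator_Ioo {T a b : ℝ} {f g : ℝ → ℝ} (hg : ContDiffOn ℝ 1 g (Icc a b))
    (hfg : EqOn f g (Ioo a b)) : IsKoksma T (indicator (Ioo a b) f) := by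
  obtain ⟨L, M, hL, hM, h1, h2⟩ := exists_lipschitz_bound hg
  refine PieceLip.isKoksma hL hM
    ⟨Ioo a b ∩ Icc 0 T, ordConnected_Ioo.inter ordConnected_Icc, inter_subset_right, ?_, ?_, ?_⟩
  · intro x hx y hy
    rw [indicator_of_mem hx.1, indicator_of_mem hy.1, hfg hx.1, hfg hy.1]
    exact h1 x (Ioo_subset_Icc_self hx.1) y (Ioo_subset_Icc_self hy.1)
  · intro x hx
    rw [indicator_of_mem hx.1, hfg hx.1]
    exact h2 x (Ioo_subset_Icc_self hx.1)
  · intro x hx hn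
    exact indicator_of_notMem (fun h => hn ⟨h, hx⟩) _

/-- The function is glued from its open pieces, where it coincides with a Lipschitz function, and
from its values at the breakpoints, one piece and one point at a time. -/
theorem AlmostPrimeSieve.PiecewiseSmoothOn.isKoksma {f : ℝ → ℝ} {T : ℝ}
    (hf : PiecewiseSmoothOn f 0 T) : IsKoksma T f := by
  obtain ⟨m, x, hx0, hxm, hlt, hg⟩ := hf
  have key : ∀ n ≤ m, x 0 ≤ x n ∧ IsKoksma T (indicator (Icc (x 0) (x n)) f) := by
    intro n
    induction n with
    | zero =>
      intro _
      rw [Icc_self]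
      exact ⟨le_rfl, isKoksma_indicator_singleton f _⟩
    | succ n ih =>
      intro hn
      obtain ⟨h0, ih⟩ := ih (by omega)
      have hl := hlt n (by omega)
      obtain ⟨g, hg1, hg2⟩ := hg n (by omega)
      refine ⟨h0.trans hl.le, ?_⟩
      have := (ih.add (isKoksma_indicator_Ioo (T := T) hg1 hg2)).add
        (isKoksma_indicator_singleton (T := T) f (x (n + 1)))
      refine this.congr fun y _ => ?_
      rcases le_or_gt y (x n) with h1 | h1
      · have n1 : y ∉ Ioo (x n) (x (n + 1)) := fun h => absurd h.1 (not_lt.2 h1)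
        have n2 : y ∉ ({x (n + 1)} : Set ℝ) := fun h => by
          rw [mem_singleton_iff] at h; linarith
        simp only [indicator_of_notMem n1, indicator_of_notMem n2, add_zero]
        by_cases h2 : x 0 ≤ y
        · rw [indicator_of_mem (show y ∈ Icc (x 0) (x n) from ⟨h2, h1⟩),
            indicator_of_mem (show y ∈ Icc (x 0) (x (n + 1)) from ⟨h2, by linarith⟩)]
        · rw [indicator_of_notMem (fun h : y ∈ Icc (x 0) (x n) => h2 h.1),
            indicator_of_notMem (fun h : y ∈ Icc (x 0) (x (n + 1)) => h2 h.1)]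
      · have n0 : y ∉ Icc (x 0) (x n) := fun h => absurd h.2 (not_le.2 h1)
        rcases lt_trichotomy y (x (n + 1)) with h2 | h2 | h2
        · have n2 : y ∉ ({x (n + 1)} : Set ℝ) := fun h => by
            rw [mem_singleton_iff] at h; linarith
          simp only [indicator_of_notMem n0, indicator_of_notMem n2, add_zero, zero_add]
          rw [indicator_of_mem (show y ∈ Ioo (x n) (x (n + 1)) from ⟨h1, h2⟩),
            indicator_of_mem (show y ∈ Icc (x 0) (x (n + 1)) from ⟨by linarith, h2.le⟩)]
        · have n1 : y ∉ Ioo (x n) (x (n + 1)) := fun h => absurd h.2 (by linarith)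
          simp only [indicator_of_notMem n0, indicator_of_notMem n1, zero_add]
          rw [indicator_of_mem (show y ∈ ({x (n + 1)} : Set ℝ) from h2),
            indicator_of_mem (show y ∈ Icc (x 0) (x (n + 1)) from ⟨by linarith, h2.le⟩)]
        · have n1 : y ∉ Ioo (x n) (x (n + 1)) := fun h => absurd h.2 (by linarith)
          have n2 : y ∉ ({x (n + 1)} : Set ℝ) := fun h => by
            rw [mem_singleton_iff] at h; linarith
          have n3 : y ∉ Icc (x 0) (x (n + 1)) := fun h => absurd h.2 (not_le.2 h2)
          simp only [indicator_of_notMem n0, indicator_of_notMem n1, indicator_of_notMem n2,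
            indicator_of_notMem n3, add_zero]
  have := (key m le_rfl).2
  rw [hx0, hxm] at this
  exact this.congr fun y hy => indicator_of_mem hy f

theorem PieceLip.one {lo hi : ℝ} : PieceLip lo hi 0 1 fun _ => 1 :=
  ⟨Icc lo hi, ordConnected_Icc, Subset.rfl, fun _ _ _ _ => by simp, fun _ _ => by simp,
    fun _ h h' => absurd h h'⟩

theorem PieceLip.inv {lo hi : ℝ} (hlo : 0 < lo) :
    PieceLip lo hi (1 / lo ^ 2) (1 / lo) fun y => 1 / y := by
  refine ⟨Icc lo hi, ordConnected_Icc, Subset.rfl, fun x hx y hy => ?_, fun x hx => ?_,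
    fun _ h h' => absurd h h'⟩
  · have hx0 : 0 < x := hlo.trans_le hx.1
    have hy0 : 0 < y := hlo.trans_le hy.1
    have e : 1 / x - 1 / y = -(1 / (x * y) * (x - y)) := by field_simp; ring
    rw [e, abs_neg, abs_mul, abs_of_pos (by positivity)]
    refine mul_le_mul_of_nonneg_right ?_ (abs_nonneg _)
    refine one_div_le_one_div_of_le (by positivity) ?_
    rw [sq]
    exact mul_le_mul hx.1 hy.1 hlo.le hx0.le
  · have hx0 : 0 < x := hlo.trans_le hx.1
    rw [abs_of_pos (by positivity)]
    exact one_div_le_one_div_of_le hlo hx.1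

/-- `G(y)/y` for a Lipschitz function `G` with `G(0) = 0`. -/
theorem PieceLip.div_self {lo hi K : ℝ} {G : ℝ → ℝ} (hlo : 0 < lo) (hK : 0 ≤ K)
    (h1 : ∀ x y, |G x - G y| ≤ K * |x - y|) (h0 : G 0 = 0) :
    PieceLip lo hi (2 * K / lo) K fun y => G y / y := by
  have hb : ∀ y, 0 < y → |G y| ≤ K * y := fun y hy => by
    have := h1 y 0
    rwa [h0, sub_zero, sub_zero, abs_of_pos hy] at this
  refine ⟨Icc lo hi, ordConnected_Icc, Subset.rfl, fun x hx y hy => ?_, fun x hx => ?_,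
    fun _ h h' => absurd h h'⟩
  · have hx0 : 0 < x := hlo.trans_le hx.1
    have hy0 : 0 < y := hlo.trans_le hy.1
    -- This splitting uses |G(y)/y| ≤ K and gives a Lipschitz constant of order 1/lo. The product
    -- rule applied to G and 1/y would only give 1/lo², too weak at lo = 1/D.
    have e : G x / x - G y / y = (G x - G y) / x + G y / y * ((y - x) / x) := by
      field_simp; ring
    have i1 : |(G x - G y) / x| ≤ K / lo * |x - y| := by
      rw [abs_div, abs_of_pos hx0]
      calc _ ≤ K * |x - y| / lo := by
            refine div_le_div₀ (by positivity) (h1 x y) hlo hx.1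
        _ = _ := by ring
    have i2 : |G y / y * ((y - x) / x)| ≤ K / lo * |x - y| := by
      rw [abs_mul, abs_div, abs_div, abs_of_pos hx0, abs_of_pos hy0, abs_sub_comm y x]
      have j1 : |G y| / y ≤ K := (div_le_iff₀ hy0).2 (hb y hy0)
      have j2 : |x - y| / x ≤ |x - y| / lo := div_le_div_of_nonneg_left (abs_nonneg _) hlo hx.1
      calc _ ≤ K * (|x - y| / lo) := mul_le_mul j1 j2 (by positivity) hK
        _ = _ := by ring
    rw [e]
    refine (abs_add_le _ _).trans ((add_le_add i1 i2).trans (le_of_eq ?_))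
    ring
  · have hx0 : 0 < x := hlo.trans_le hx.1
    rw [abs_div, abs_of_pos hx0]
    exact (div_le_iff₀ hx0).2 (hb x hx0)

end

/-! ### Sums over primes on the logarithmic scale -/

section

open MeasureTheory Finset

/-- The primes `p ≤ X` with `log p / log R > lo`. -/
noncomputable def largePrimes (R X lo : ℝ) : Finset ℕ :=
  (primesTo ⌊X⌋₊).filter fun p : ℕ => lo < Real.log p / Real.log R

theorem mem_primesTo_rpow {R t : ℝ} (hR : 1 < R) {p : ℕ} :
    p ∈ primesTo ⌊R ^ t⌋₊ ↔ p.Prime ∧ Real.log p / Real.log R ≤ t := by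
  rw [mem_primesTo]
  refine and_congr_right fun hp => ?_
  have hR0 : 0 < R := by linarith
  have hRt := Real.rpow_pos_of_pos hR0 t
  rw [Nat.le_floor_iff hRt.le, div_le_iff₀ (Real.log_pos hR), ← Real.log_rpow hR0,
    Real.log_le_log_iff (by exact_mod_cast hp.pos) hRt]

/-- By Mertens, the masses log p / (p log R) of the primes up to R^t total t + O(1/log R). The
strict lower bound on log p / log R makes the primes in (lo, t] a difference of two initial
segments. -/
theorem exists_largePrimes_discrepancy : ∃ C : ℝ, 0 ≤ C ∧ ∀ R T lo : ℝ, 1 < R → 0 ≤ lo →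
    ∀ J : Set ℝ, J.OrdConnected → J ⊆ Set.Icc lo T →
      |∑ p ∈ largePrimes R (R ^ T) lo, J.indicator
          (fun _ => Real.log p / (p * Real.log R)) (Real.log p / Real.log R) -
        1 * volume.real J| ≤ C / Real.log R := by
  obtain ⟨C, hC, hm⟩ := exists_mertens_first
  refine ⟨4 * C, by positivity, fun R T lo hR hlo J hJ hJs => ?_⟩
  have hL := Real.log_pos hR
  have hR0 : 0 < R := by linarith
  have hm' : ∀ t : ℝ, 0 ≤ t →
      |∑ p ∈ primesTo ⌊R ^ t⌋₊, Real.log p / (p * Real.log R) - t| ≤ C / Real.log R := by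
    intro t ht
    have h1 := hm (R ^ t) (Real.one_le_rpow hR.le ht)
    rw [Real.log_rpow hR0] at h1
    have e : ∑ p ∈ primesTo ⌊R ^ t⌋₊, Real.log p / (p * Real.log R) - t =
        (∑ p ∈ primesTo ⌊R ^ t⌋₊, Real.log p / p - t * Real.log R) / Real.log R := by
      rw [sub_div, mul_div_cancel_right₀ _ hL.ne', sum_div]
      congr 1
      exact sum_congr rfl fun p _ => by rw [div_div]
    rw [e, abs_div, abs_of_pos hL]
    exact div_le_div_of_nonneg_right h1 hL.le
  have h1 := discrepancy_of_distribution (largePrimes R (R ^ T) lo)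
    (fun p => Real.log p / (p * Real.log R)) (fun p => Real.log p / Real.log R)
    (fun p _ => by
      have := Real.log_natCast_nonneg p
      positivity) (lo := lo) (hi := T)
    zero_le_one (E := 2 * (C / Real.log R)) (by positivity) ?_ J hJ hJs
  · refine h1.trans (le_of_eq ?_)
    ring
  · intro t ht
    have ht0 : 0 ≤ t := hlo.trans ht.1
    have e : ∑ p ∈ largePrimes R (R ^ T) lo, (Set.Iic t).indicator
          (fun _ => Real.log p / (p * Real.log R)) (Real.log p / Real.log R) =
        ∑ p ∈ primesTo ⌊R ^ t⌋₊, Real.log p / (p * Real.log R) -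
          ∑ p ∈ primesTo ⌊R ^ lo⌋₊, Real.log p / (p * Real.log R) := by
      have hsub : primesTo ⌊R ^ lo⌋₊ ⊆ primesTo ⌊R ^ t⌋₊ := fun p hp => by
        rw [mem_primesTo_rpow hR] at hp ⊢
        exact ⟨hp.1, hp.2.trans ht.1⟩
      rw [eq_sub_iff_add_eq, ← sum_sdiff hsub]
      congr 1
      simp only [Set.indicator_apply]
      rw [← sum_filter]
      refine sum_congr ?_ fun _ _ => rfl
      ext p
      simp only [largePrimes, mem_filter, mem_sdiff, mem_primesTo_rpow hR, Set.mem_Iic]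
      constructor
      · rintro ⟨⟨⟨h1, h2⟩, h3⟩, h4⟩
        exact ⟨⟨h1, h4⟩, fun h => absurd h.2 (not_le.2 h3)⟩
      · rintro ⟨⟨h1, h2⟩, h3⟩
        exact ⟨⟨⟨h1, h2.trans ht.2⟩, not_le.1 fun h => h3 ⟨h1, h⟩⟩, h2⟩
    rw [e]
    have a1 := abs_le.1 (hm' t ht0)
    have a2 := abs_le.1 (hm' lo hlo)
    rw [abs_le]
    constructor <;> linarith

theorem largePrimes_facts {R T lo : ℝ} (hR : 1 < R) {p : ℕ}
    (hp : p ∈ largePrimes R (R ^ T) lo) : p.Prime ∧ lo < Real.log p / Real.log R ∧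
      Real.log p / Real.log R ≤ T := by
  rw [largePrimes, mem_filter, mem_primesTo_rpow hR] at hp
  exact ⟨hp.1.1, hp.2, hp.1.2⟩

theorem weight_mul_eq {R : ℝ} (hR : 1 < R) {p : ℕ} (hp : p.Prime) (a b : ℝ) :
    Real.log p / (p * Real.log R) * (a * (b / (Real.log p / Real.log R))) = a / p * b := by
  have h1 : Real.log p ≠ 0 := (Real.log_pos (by exact_mod_cast hp.one_lt)).ne'
  have h2 := (Real.log_pos hR).ne'
  have h3 : (p : ℝ) ≠ 0 := by exact_mod_cast hp.ne_zero
  field_simp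

/-- Here 1/p is the mass log p / (p log R) times 1/y, so the sum is compared with ∫ dy/y from 1/D to
T, which is log T + log D. The constants of 1/y on this range are of size D², whence D² ≤ log R. -/
theorem exists_sum_largePrimes_inv_le {T : ℝ} (hT : 0 < T) : ∃ C : ℝ, 0 ≤ C ∧ ∀ R D : ℝ, 1 < R →
    1 ≤ D → 1 / D ≤ T → D ^ 2 ≤ Real.log R →
    ∑ p ∈ largePrimes R (R ^ T) (1 / D), 1 / (p : ℝ) ≤ C * (1 + Real.log D) := by
  obtain ⟨C₀, hC₀, hd⟩ := exists_largePrimes_discrepancy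
  obtain ⟨C₁, hC₁, -, hk⟩ := (PieceLip.one (lo := 0) (hi := T)).isKoksma le_rfl zero_le_one
  refine ⟨|Real.log T| + 1 + 2 * C₁ * C₀, by positivity, fun R D hR hD hDT hDL => ?_⟩
  have hD0 : 0 < D := by linarith
  have hlo : 0 < 1 / D := by positivity
  have hL := Real.log_pos hR
  obtain ⟨-, h2⟩ := hk (1 / D) ⟨hlo.le, hDT⟩ _ _ _ (by positivity) (by positivity)
    (PieceLip.inv (hi := T) hlo)
  have h3 := h2 (largePrimes R (R ^ T) (1 / D)) (fun p => Real.log p / (p * Real.log R))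
    (fun p => Real.log p / Real.log R) (C₀ / Real.log R)
    (fun p _ => by have := Real.log_natCast_nonneg p; positivity)
    (fun p hp => ⟨(largePrimes_facts hR hp).2.1.le, (largePrimes_facts hR hp).2.2⟩)
    (hd R T (1 / D) hR hlo.le)
  have e1 : ∑ p ∈ largePrimes R (R ^ T) (1 / D), Real.log p / (p * Real.log R) *
      (1 * (1 / (Real.log p / Real.log R))) = ∑ p ∈ largePrimes R (R ^ T) (1 / D), 1 / (p : ℝ) := by
    refine sum_congr rfl fun p hp => ?_
    rw [weight_mul_eq hR (largePrimes_facts hR hp).1, mul_one]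
  have e2 : ∫ y in Set.Icc (1 / D) T, (1 : ℝ) * (1 / y) = Real.log T + Real.log D := by
    rw [integral_Icc_eq_integral_Ioc, ← intervalIntegral.integral_of_le hDT]
    simp only [one_mul]
    rw [integral_one_div_of_pos hlo hT, Real.log_div hT.ne' hlo.ne', one_div, Real.log_inv]
    ring
  rw [e1, e2] at h3
  have h4 := (abs_le.1 h3).2
  have hlD : 0 ≤ Real.log D := Real.log_nonneg hD
  have h5 : C₁ * (1 / (1 / D) ^ 2 + 1 / (1 / D)) * (C₀ / Real.log R) ≤ 2 * C₁ * C₀ := by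
    have : (1 / (1 / D) ^ 2 + 1 / (1 / D)) = D ^ 2 + D := by field_simp
    rw [this, mul_div_assoc', div_le_iff₀ hL]
    have : D ^ 2 + D ≤ 2 * Real.log R := by nlinarith
    calc C₁ * (D ^ 2 + D) * C₀ ≤ C₁ * (2 * Real.log R) * C₀ := by gcongr
      _ = _ := by ring
  have h6 := le_abs_self (Real.log T)
  have h7 : 0 ≤ |Real.log T| * Real.log D := by positivity
  have h8 : 0 ≤ 2 * C₁ * C₀ * Real.log D := by positivity
  linarith

/-- Summation over primes of the contributions of the single primes. -/
theorem exists_sum_primes_sub_integral_le {T : ℝ} (hT : 0 < T) {W₀ : ℝ → ℝ}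
    (hW₀ : IsKoksma T W₀) : ∃ C : ℝ, 0 ≤ C ∧ ∀ (R D c K η : ℝ) (k W : ℕ) (Q : ℕ → ℝ)
      (G : ℝ → ℝ), 1 < R → 1 ≤ D → 1 / D ≤ T → D ^ 2 ≤ Real.log R → 0 ≤ c → 0 ≤ K → 0 ≤ η →
      η * Real.sqrt (Real.log R) ≤ 1 / D →
      (∀ q : ℕ, q.Prime → q ∣ W → (q : ℝ) ≤ D) → (∀ q : ℕ, q.Prime → ¬ q ∣ W → D ≤ q) →
      (∀ x y, |G x - G y| ≤ K * |x - y|) → G 0 = 0 →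
      (∀ p ∈ roughPrimes W ⌊R ^ T⌋₊, 0 ≤ Q p ∧
        Q p ≤ K * (c ^ k * (Real.log p / Real.log R + 1 / p + η)) ∧
        |Q p - c ^ k * G (Real.log p / Real.log R)| ≤ K * (c ^ k * (1 / D + η))) →
      |∑ p ∈ roughPrimes W ⌊R ^ T⌋₊, W₀ (Real.log p / Real.log R) / p * Q p -
        c ^ k * ∫ y in Set.Icc (1 / D) T, W₀ y * (G y / y)| ≤
        C * (K * c ^ k * ((1 + Real.log D) / D)) := by
  obtain ⟨C₀, hC₀, hd⟩ := exists_largePrimes_discrepancy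
  obtain ⟨C₁, hC₁, hb, hk⟩ := hW₀
  obtain ⟨C₂, hC₂, hinv⟩ := exists_sum_largePrimes_inv_le hT
  obtain ⟨C₃, hC₃, hm⟩ := exists_mertens_first
  obtain ⟨C₄, hC₄, hsq⟩ := exists_sum_inv_primes_le
  refine ⟨C₁ * (3 + C₃ + C₄) + C₁ * (2 * C₂) + 3 * C₁ * C₀, by positivity,
    fun R D c K η k W Q G hR hD hDT hDL hc hK hη hηL hWD hWD' hG hG0 hQ => ?_⟩
  have hD0 : 0 < D := by linarith
  have hlo : 0 < 1 / D := by positivity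
  have hL := Real.log_pos hR
  have hR0 : 0 < R := by linarith
  have hL1 : 1 ≤ Real.log R := by nlinarith
  have hDL' : D ≤ Real.log R := by nlinarith
  have hlD : 0 ≤ Real.log D := Real.log_nonneg hD
  have hck : 0 ≤ c ^ k := pow_nonneg hc k
  set y : ℕ → ℝ := fun p => Real.log p / Real.log R with hy
  have hyT : ∀ p ∈ roughPrimes W ⌊R ^ T⌋₊, y p ∈ Set.Icc 0 T := by
    intro p hp
    rw [roughPrimes, mem_filter, mem_primesTo_rpow hR] at hp
    exact ⟨div_nonneg (Real.log_natCast_nonneg p) hL.le, hp.1.2⟩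
  rw [← sum_filter_add_sum_filter_not (roughPrimes W ⌊R ^ T⌋₊) (fun p => y p ≤ 1 / D)]
  -- large primes
  have hbig : (roughPrimes W ⌊R ^ T⌋₊).filter (fun p => ¬ y p ≤ 1 / D) =
      largePrimes R (R ^ T) (1 / D) := by
    ext p
    rw [mem_filter, roughPrimes, mem_filter, largePrimes, mem_filter, not_le]
    constructor
    · rintro ⟨⟨h1, -⟩, h2⟩
      exact ⟨h1, h2⟩
    · rintro ⟨h1, h2⟩
      refine ⟨⟨h1, fun hpW => ?_⟩, h2⟩
      have hp := (mem_primesTo.1 h1).1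
      have h3 := hWD p hp hpW
      rw [lt_div_iff₀ hL] at h2
      -- A prime dividing W is at most D, so its logarithm is at most D - 1; being large would
      -- require it to exceed log R / D ≥ D.
      have : Real.log R ≤ D ^ 2 - 1 := by
        have h5 := Real.log_le_sub_one_of_pos (show (0 : ℝ) < p by exact_mod_cast hp.pos)
        have h6 : 1 / D * Real.log R < D - 1 := by linarith
        rw [div_mul_eq_mul_div, one_mul, div_lt_iff₀ hD0] at h6
        nlinarith
      linarith
  rw [hbig]
  have hsub : ∀ p ∈ largePrimes R (R ^ T) (1 / D), p ∈ roughPrimes W ⌊R ^ T⌋₊ := fun p hp => by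
    rw [← hbig] at hp
    exact (mem_filter.1 hp).1
  have hηD : η ≤ 1 / D := by
    refine le_trans ?_ hηL
    exact le_mul_of_one_le_right hη (Real.one_le_sqrt.2 hL1)
  -- Large primes, replacing Q_p by its asymptotic value: the error of order 1/D is summed against
  -- 1/p, which produces log D.
  have B1 : |∑ p ∈ largePrimes R (R ^ T) (1 / D), W₀ (y p) / p * Q p -
      c ^ k * ∑ p ∈ largePrimes R (R ^ T) (1 / D), W₀ (y p) / p * G (y p)| ≤
      C₁ * (2 * C₂) * (K * c ^ k * ((1 + Real.log D) / D)) := by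
    rw [mul_sum, ← sum_sub_distrib]
    refine (abs_sum_le_sum_abs _ _).trans ?_
    calc _ ≤ ∑ p ∈ largePrimes R (R ^ T) (1 / D),
          1 / (p : ℝ) * (C₁ * (K * (c ^ k * (1 / D + 1 / D)))) := by
          refine sum_le_sum fun p hp => ?_
          have h1 := hb _ (hyT p (hsub p hp))
          have h2 := (hQ p (hsub p hp)).2.2
          have e : W₀ (y p) / p * Q p - c ^ k * (W₀ (y p) / p * G (y p)) =
              1 / p * (W₀ (y p) * (Q p - c ^ k * G (y p))) := by ring
          rw [e, abs_mul, abs_mul, abs_of_nonneg (by positivity : (0 : ℝ) ≤ 1 / p)]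
          refine mul_le_mul_of_nonneg_left (mul_le_mul h1 (h2.trans ?_) (abs_nonneg _) hC₁)
            (by positivity)
          gcongr
      _ = (∑ p ∈ largePrimes R (R ^ T) (1 / D), 1 / (p : ℝ)) *
          (C₁ * (K * (c ^ k * (1 / D + 1 / D)))) := by rw [sum_mul]
      _ ≤ (C₂ * (1 + Real.log D)) * (C₁ * (K * (c ^ k * (1 / D + 1 / D)))) :=
          mul_le_mul_of_nonneg_right (hinv R D hR hD hDT hDL) (by positivity)
      _ = _ := by ring
  -- Large primes, passing from the sum to the integral: G(y)/y has Lipschitz constant O(KD), and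
  -- D/log R ≤ 1/D.
  have B2 : |∑ p ∈ largePrimes R (R ^ T) (1 / D), W₀ (y p) / p * G (y p) -
      ∫ y in Set.Icc (1 / D) T, W₀ y * (G y / y)| ≤
      3 * C₁ * C₀ * (K * ((1 + Real.log D) / D)) := by
    obtain ⟨-, h2⟩ := hk (1 / D) ⟨hlo.le, hDT⟩ _ _ _ (by positivity) hK
      (PieceLip.div_self (hi := T) hlo hK hG hG0)
    have h3 := h2 (largePrimes R (R ^ T) (1 / D)) (fun p => Real.log p / (p * Real.log R))
      y (C₀ / Real.log R)
      (fun p _ => by have := Real.log_natCast_nonneg p; positivity)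
      (fun p hp => ⟨(largePrimes_facts hR hp).2.1.le, (largePrimes_facts hR hp).2.2⟩)
      (hd R T (1 / D) hR hlo.le)
    rw [sum_congr rfl fun p hp =>
      weight_mul_eq hR (largePrimes_facts hR hp).1 (W₀ (y p)) (G (y p))] at h3
    refine h3.trans ?_
    have e : C₁ * (2 * K / (1 / D) + K) * (C₀ / Real.log R) =
        C₁ * C₀ * K * ((2 * D + 1) / Real.log R) := by field_simp
    rw [e]
    have h4 : (2 * D + 1) / Real.log R ≤ 3 * ((1 + Real.log D) / D) := by
      calc (2 * D + 1) / Real.log R ≤ (3 * D) / (D ^ 2) := by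
            refine div_le_div₀ (by positivity) (by linarith) (by positivity) hDL
        _ = 3 * (1 / D) := by field_simp
        _ ≤ _ := by gcongr; linarith
    calc _ ≤ C₁ * C₀ * K * (3 * ((1 + Real.log D) / D)) := by gcongr
      _ = _ := by ring
  -- Small primes, by the upper bound alone: y sums to (1/log R) ∑ log p / p = O(1/D), 1/p to ∑ 1/p²
  -- = O(1/D), and η to η √(log R), which is at most 1/D by assumption.
  have B3 : |∑ p ∈ (roughPrimes W ⌊R ^ T⌋₊).filter (fun p => y p ≤ 1 / D),
      W₀ (y p) / p * Q p| ≤ C₁ * (3 + C₃ + C₄) * (K * c ^ k * ((1 + Real.log D) / D)) := by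
    have hS : ∀ p ∈ (roughPrimes W ⌊R ^ T⌋₊).filter (fun p => y p ≤ 1 / D),
        p ∈ primesTo ⌊R ^ (1 / D)⌋₊ ∧ D ≤ p := by
      intro p hp
      rw [mem_filter, mem_roughPrimes] at hp
      exact ⟨(mem_primesTo_rpow hR).2 ⟨hp.1.1.1, hp.2⟩, hWD' p hp.1.1.1 hp.1.2⟩
    set A := (roughPrimes W ⌊R ^ T⌋₊).filter (fun p => y p ≤ 1 / D) with hA
    have s1 : ∑ p ∈ A, Real.log p / p ≤ Real.log R / D + C₃ := by
      have h1 := (abs_le.1 (hm (R ^ (1 / D)) (Real.one_le_rpow hR.le hlo.le))).2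
      rw [Real.log_rpow hR0] at h1
      have h2 : ∑ p ∈ A, Real.log p / p ≤ ∑ p ∈ primesTo ⌊R ^ (1 / D)⌋₊, Real.log p / p :=
        sum_le_sum_of_subset_of_nonneg (fun p hp => (hS p hp).1) fun p _ _ =>
          div_nonneg (Real.log_natCast_nonneg p) (by positivity)
      have e : 1 / D * Real.log R = Real.log R / D := by ring
      linarith
    have s2 : ∑ p ∈ A, 1 / (p : ℝ) ^ 2 ≤ 2 / D := sum_inv_sq_le hD A fun p hp => (hS p hp).2
    have s3 : ∑ p ∈ A, 1 / (p : ℝ) ≤ C₄ * Real.sqrt (Real.log R) := by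
      have h1 := hsq R (by rw [← Real.le_log_iff_exp_le hR0]; exact hL1)
      refine le_trans (sum_le_sum_of_subset_of_nonneg (fun p hp => ?_) fun _ _ _ => by
        positivity) h1
      have h2 := (mem_primesTo_rpow hR).1 (hS p hp).1
      have h3 : p ∈ primesTo ⌊R ^ (1 : ℝ)⌋₊ := (mem_primesTo_rpow hR).2
        ⟨h2.1, h2.2.trans ((div_le_one hD0).2 hD)⟩
      simpa using h3
    refine (abs_sum_le_sum_abs _ _).trans ?_
    calc _ ≤ ∑ p ∈ A, C₁ * (K * c ^ k) *
          (1 / Real.log R * (Real.log p / p) + 1 / (p : ℝ) ^ 2 + η * (1 / p)) := by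
          refine sum_le_sum fun p hp => ?_
          have hpr := (mem_filter.1 hp).1
          have h1 := hb _ (hyT p hpr)
          have h2 := hQ p hpr
          rw [abs_mul, abs_div, abs_of_nonneg h2.1, Nat.abs_cast]
          calc |W₀ (y p)| / p * Q p ≤ C₁ / p *
                (K * (c ^ k * (Real.log p / Real.log R + 1 / p + η))) :=
                mul_le_mul (div_le_div_of_nonneg_right h1 (by positivity)) h2.2.1 h2.1
                  (by positivity)
            _ = _ := by
                have : (p : ℝ) ≠ 0 := by
                  exact_mod_cast (mem_primesTo.1 (hS p hp).1).1.ne_zero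
                field_simp
      _ = C₁ * (K * c ^ k) * (1 / Real.log R * (∑ p ∈ A, Real.log p / p) +
          ∑ p ∈ A, 1 / (p : ℝ) ^ 2 + η * ∑ p ∈ A, 1 / (p : ℝ)) := by
          rw [← mul_sum, sum_add_distrib, sum_add_distrib, ← mul_sum, ← mul_sum]
      _ ≤ C₁ * (K * c ^ k) * ((3 + C₃ + C₄) * (1 / D)) := by
          refine mul_le_mul_of_nonneg_left ?_ (by positivity)
          have t1 : 1 / Real.log R * (∑ p ∈ A, Real.log p / p) ≤ 1 / D + C₃ * (1 / D) := by
            calc _ ≤ 1 / Real.log R * (Real.log R / D + C₃) := by gcongr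
              _ = 1 / D + C₃ * (1 / Real.log R) := by field_simp
              _ ≤ _ := by gcongr
          have t2 : η * ∑ p ∈ A, 1 / (p : ℝ) ≤ C₄ * (1 / D) := by
            calc _ ≤ η * (C₄ * Real.sqrt (Real.log R)) := by gcongr
              _ = C₄ * (η * Real.sqrt (Real.log R)) := by ring
              _ ≤ _ := by gcongr
          have t3 : (2 : ℝ) / D = 2 * (1 / D) := by ring
          linarith
      _ ≤ C₁ * (K * c ^ k) * ((3 + C₃ + C₄) * ((1 + Real.log D) / D)) := by
          gcongr
          linarith
      _ = _ := by ring
  have B2' : |c ^ k * ∑ p ∈ largePrimes R (R ^ T) (1 / D), W₀ (y p) / p * G (y p) -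
      c ^ k * ∫ y in Set.Icc (1 / D) T, W₀ y * (G y / y)| ≤
      3 * C₁ * C₀ * (K * c ^ k * ((1 + Real.log D) / D)) := by
    rw [← mul_sub, abs_mul, abs_of_nonneg hck]
    refine (mul_le_mul_of_nonneg_left B2 hck).trans (le_of_eq ?_)
    ring
  rw [abs_le] at *
  constructor <;> linarith [B1.1, B1.2, B2'.1, B2'.2, B3.1, B3.2]

end

/-! ### The parameter W and the sieve sum for large N -/

section

open Finset

theorem natCast_primorialW (N : ℝ) : (primorialW N : ℝ) = ∏ p ∈ smallPrimes N, (p : ℝ) := by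
  rw [primorialW, smallPrimes]
  push_cast
  rfl

theorem totient_primorialW (N : ℝ) : (Nat.totient (primorialW N) : ℝ) =
    primorialW N * ∏ p ∈ smallPrimes N, (1 - 1 / (p : ℝ)) := by
  have h1 := Nat.totient_eq_mul_prod_factors (primorialW N)
  have h2 : ((Nat.totient (primorialW N) : ℚ) : ℝ) =
    ((primorialW N * ∏ q ∈ (primorialW N).primeFactors, (1 - (q : ℚ)⁻¹) : ℚ) : ℝ) := by rw [h1]
  push_cast at h2
  rw [h2]
  congr 1
  have : (primorialW N).primeFactors = smallPrimes N := by
    ext q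
    rw [Nat.mem_primeFactors]
    constructor
    · rintro ⟨h1, h2, -⟩
      exact (prime_dvd_primorialW h1).1 h2
    · intro h
      have hq := prime_of_mem_smallPrimes h
      exact ⟨hq, (prime_dvd_primorialW hq).2 h, (primorialW_pos N).ne'⟩
  rw [this]
  exact prod_congr rfl fun q _ => by rw [one_div]

theorem mainSize_eq (k : ℕ) (θ N : ℝ) : mainSize k θ N =
    N / primorialW N * logDensity (smallPrimes N) (N ^ θ) ^ k := by
  have hw : (primorialW N : ℝ) ≠ 0 := by exact_mod_cast (primorialW_pos N).ne'
  rw [mainSize, totient_primorialW, logDensity, mul_pow, mul_pow, pow_succ]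
  field_simp

/-- Each prime satisfies 1/p ≤ 1 - 1/p. This crude lower bound for φ(W)/W suffices because powers of
W are negligible against log R. -/
theorem inv_primorialW_le (N : ℝ) :
    1 / (primorialW N : ℝ) ≤ ∏ p ∈ smallPrimes N, (1 - 1 / (p : ℝ)) := by
  rw [natCast_primorialW, one_div, ← prod_inv_distrib]
  refine prod_le_prod (fun _ _ => by positivity) fun p hp => ?_
  have h2 : (2 : ℝ) ≤ p := by exact_mod_cast (prime_of_mem_smallPrimes hp).two_le
  rw [le_sub_iff_add_le, inv_eq_one_div, ← add_div, div_le_one (by linarith)]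
  linarith

theorem one_le_primorialW (N : ℝ) : (1 : ℝ) ≤ primorialW N := by
  exact_mod_cast primorialW_pos N

theorem log_div_primorialW_le {N R : ℝ} (hR : 1 ≤ R) :
    Real.log R / primorialW N ≤ logDensity (smallPrimes N) R := by
  rw [logDensity, div_eq_mul_one_div, mul_comm]
  exact mul_le_mul_of_nonneg_right (inv_primorialW_le N) (Real.log_nonneg hR)

/-- The `ℓ¹` norm of the sieve coefficients. -/
theorem exists_sum_abs_lambdaOf_le (k : ℕ) {θ θ₀ : ℝ} (hθ : 0 < θ) (hθ₀ : 0 < θ₀) :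
    ∃ C : ℝ, 0 ≤ C ∧ ∀ (N : ℝ) (S U : Set (Fin k → ℝ)) (κ : ℝ) (F : (Fin k → ℝ) → ℝ) (W : ℕ),
      16 < N → SieveRegion S U κ → IsSieveFunction S F →
      ∑ d ∈ divTuples k (roughProduct W (max ⌊N ^ θ⌋₊ ⌊N ^ θ₀⌋₊)),
        |lambdaOf k (roughProduct W (max ⌊N ^ θ⌋₊ ⌊N ^ θ₀⌋₊)) (sieveY W (N ^ θ) F) d| ≤
        Fmax F * N ^ (κ * θ) * Real.exp (C * Real.sqrt (Real.log N)) := by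
  obtain ⟨C, hC, hs⟩ := exists_sum_inv_primes_le
  refine ⟨3 * k * (C * Real.sqrt (θ + θ₀ + 1)), by positivity,
    fun N S U κ F W hN hS hF => ?_⟩
  have hN0 : 0 < N := by linarith
  have hN1 : 1 < N := by linarith
  have hlog : 1 ≤ Real.log N := by
    rw [Real.le_log_iff_exp_le hN0]
    have := Real.exp_one_lt_d9
    linarith
  set Z := max ⌊N ^ θ⌋₊ ⌊N ^ θ₀⌋₊ with hZ
  set m := roughProduct W Z with hm
  have hsq : Squarefree m := squarefree_roughProduct W Z
  have hR : 1 < N ^ θ := Real.one_lt_rpow hN1 hθ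
  have hY : 0 ≤ Fmax F * N ^ (κ * θ) := mul_nonneg hF.Fmax_nonneg (by positivity)
  refine (sum_abs_lambdaOf_le hsq _ hY fun r hr => ?_).trans
    (mul_le_mul_of_nonneg_left ?_ hY)
  · have hr' := (mem_divTuples hsq.ne_zero).1 hr
    have hpos : 0 < ∏ i, r i := Nat.pos_of_ne_zero fun h0 => by
      rw [h0] at hr'
      exact hsq.ne_zero (Nat.eq_zero_of_zero_dvd hr')
    have hpos' : (0 : ℝ) < ∏ i, (r i : ℝ) := by exact_mod_cast hpos
    rw [le_div_iff₀ hpos', abs_of_nonneg (SieveRegion.sieveY_nonneg hF _ _ _)]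
    -- On the support of y one has ∏ r_i ≤ R^κ, which turns the bound by `Fmax` into the required
    -- bound with 1/∏ r_i.
    by_cases h : (N ^ θ) ^ κ < ((∏ i, r i : ℕ) : ℝ)
    · rw [hS.sieveY_eq_zero_of_lt hF hR h, zero_mul]
      exact hY
    · refine mul_le_mul (hS.sieveY_le hF _ _ _) ?_ hpos'.le hF.Fmax_nonneg
      rw [← Real.rpow_mul hN0.le, mul_comm] at h
      push_cast at h
      exact not_lt.1 h
  · have h1 : ∏ q ∈ m.primeFactors, (1 + 3 * k / (q : ℝ)) ≤
        Real.exp (∑ q ∈ m.primeFactors, 3 * k / (q : ℝ)) := by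
      rw [Real.exp_sum]
      refine prod_le_prod (fun _ _ => by positivity) fun q _ => ?_
      rw [add_comm]
      exact Real.add_one_le_exp _
    refine h1.trans (Real.exp_le_exp.2 ?_)
    have h2 : ∑ q ∈ m.primeFactors, 3 * k / (q : ℝ) =
        3 * k * ∑ q ∈ m.primeFactors, 1 / (q : ℝ) := by
      rw [mul_sum]
      exact sum_congr rfl fun q _ => by ring
    rw [h2, mul_assoc (3 * (k : ℝ)), mul_assoc C, ← Real.sqrt_mul (by positivity)]
    refine mul_le_mul_of_nonneg_left ?_ (by positivity)
    -- A cut-off that exceeds both R and R₀ and is at least e, as the bound for ∑ 1/p requires.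
    have hX : Real.exp 1 ≤ Real.exp 1 * N ^ (θ + θ₀) :=
      le_mul_of_one_le_right (Real.exp_pos 1).le (Real.one_le_rpow hN1.le (by positivity))
    have h3 := hs _ hX
    rw [Real.log_mul (Real.exp_pos 1).ne' (by positivity), Real.log_exp, Real.log_rpow hN0] at h3
    have h4 : ∑ q ∈ m.primeFactors, 1 / (q : ℝ) ≤
        ∑ q ∈ primesTo ⌊Real.exp 1 * N ^ (θ + θ₀)⌋₊, 1 / (q : ℝ) := by
      refine sum_le_sum_of_subset_of_nonneg (fun q hq => ?_) fun _ _ _ => by positivity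
      have hqp := Nat.prime_of_mem_primeFactors hq
      refine mem_primesTo.2 ⟨hqp, ?_⟩
      refine (((prime_dvd_roughProduct hqp).1 (Nat.dvd_of_mem_primeFactors hq)).1).trans ?_
      have h5 : N ^ (θ + θ₀) ≤ Real.exp 1 * N ^ (θ + θ₀) :=
        le_mul_of_one_le_left (by positivity) (Real.one_le_exp (by norm_num))
      refine max_le (Nat.floor_le_floor (le_trans ?_ h5)) (Nat.floor_le_floor (le_trans ?_ h5))
      · exact Real.rpow_le_rpow_of_exponent_le hN1.le (by linarith)
      · exact Real.rpow_le_rpow_of_exponent_le hN1.le (by linarith)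
    refine h4.trans (h3.trans (mul_le_mul_of_nonneg_left (Real.sqrt_le_sqrt ?_) hC))
    linarith

theorem sieveModulus_roughProduct {N R : ℝ} {Z p : ℕ} (hZ : ⌊R⌋₊ ≤ Z) (hp : p.Prime)
    (hpZ : p ≤ Z) (hpW : ¬ p ∣ primorialW N) :
    SieveModulus (smallPrimes N) R p (roughProduct (primorialW N) Z / p) := by
  obtain ⟨h1, h2, h3⟩ := roughProduct_facts hp hpZ hpW
  refine ⟨h2, fun q hq hqR hqP hqp => ?_, fun q hq hqm => ⟨fun hqP => ?_, fun hqp => ?_⟩⟩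
  · have h4 : q ∣ roughProduct (primorialW N) Z := (prime_dvd_roughProduct hq).2
      ⟨hqR.trans hZ, fun h => hqP ((prime_dvd_primorialW hq).1 h)⟩
    rw [h1] at h4
    exact (hq.dvd_mul.1 h4).resolve_left fun h => hqp ((Nat.prime_dvd_prime_iff_eq hq hp).1 h)
  · have h4 : q ∣ roughProduct (primorialW N) Z := h1 ▸ hqm.mul_left p
    exact ((prime_dvd_roughProduct hq).1 h4).2 ((prime_dvd_primorialW hq).2 hqP)
  · exact h3 (hqp ▸ hqm)

/-- `N` is so large that the error terms are dominated. -/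
structure IsLarge (k : ℕ) (θ θ₀ κ C N : ℝ) : Prop where
  gt : 16 < N
  three_le : 3 ≤ D0 N
  k_le : (k : ℝ) ≤ D0 N
  inv_le : 1 / D0 N ≤ θ₀ / θ
  sq_le : (primorialW N : ℝ) ^ 2 * D0 N ^ 2 ≤ Real.sqrt (Real.log (N ^ θ))
  pow_le : N ^ θ₀ * (N ^ (κ * θ) * Real.exp (C * Real.sqrt (Real.log N))) ^ 2 *
    (primorialW N * D0 N) ≤ N

theorem IsLarge.one_lt {k : ℕ} {θ θ₀ κ C N : ℝ} (hθ : 0 < θ) (h : IsLarge k θ θ₀ κ C N) :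
    1 < N ^ θ := Real.one_lt_rpow (by linarith [h.gt]) hθ

theorem IsLarge.sq_le_log {k : ℕ} {θ θ₀ κ C N : ℝ} (h : IsLarge k θ θ₀ κ C N) :
    (primorialW N : ℝ) ^ 2 * D0 N ^ 2 ≤ Real.log (N ^ θ) := by
  have h1 := one_le_primorialW N
  have h2 := h.three_le
  have h3 : 1 ≤ (primorialW N : ℝ) ^ 2 * D0 N ^ 2 := by
    have : 1 ≤ (primorialW N : ℝ) * D0 N := by nlinarith
    rw [← mul_pow]
    exact one_le_pow₀ this
  have h4 : 1 ≤ Real.sqrt (Real.log (N ^ θ)) := h3.trans h.sq_le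
  have h5 : 0 ≤ Real.log (N ^ θ) := by
    by_contra hneg
    rw [Real.sqrt_eq_zero_of_nonpos (not_le.1 hneg).le] at h4
    linarith
  refine h.sq_le.trans ?_
  nlinarith [Real.sq_sqrt h5]

theorem IsLarge.sieveScale {k : ℕ} {θ θ₀ κ C N : ℝ} (hθ : 0 < θ) (h : IsLarge k θ θ₀ κ C N) :
    SieveScale k (smallPrimes N) (D0 N) (N ^ θ) := by
  refine ⟨fun p hp => prime_of_mem_smallPrimes hp, by linarith [h.three_le], h.k_le,
    fun q hq hqP => D0_le_of_not_dvd hq fun hd => hqP ((prime_dvd_primorialW hq).1 hd),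
    h.one_lt hθ, ?_⟩
  rw [← natCast_primorialW]
  refine le_trans ?_ (log_div_primorialW_le (h.one_lt hθ).le)
  have h1 := one_le_primorialW N
  rw [le_div_iff₀ (by linarith)]
  refine le_trans ?_ h.sq_le_log
  have : (9 : ℝ) ≤ D0 N ^ 2 := by nlinarith [h.three_le]
  nlinarith [sq_nonneg (primorialW N : ℝ)]

theorem one_le_primeConst {k : ℕ} (hk : 1 ≤ k) : 6 ≤ primeConst k := by
  have h1 : (1 : ℝ) ≤ k := by exact_mod_cast hk
  have h2 : (1 : ℝ) ≤ (2 * Real.exp 12) ^ k := one_le_pow₀ (by linarith [one_le_exp_twelve])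
  have h3 : (1 : ℝ) ≤ (k : ℝ) ^ 2 := one_le_pow₀ h1
  rw [primeConst]
  nlinarith

/-- The sieve sum for large `N`, with the main term truncated at `1/D₀`. -/
theorem exists_abs_sigma0_sub_le {k : ℕ} (hk : 2 ≤ k) {A : Fin k → ℕ} {B : Fin k → ℤ}
    (hAB : Admissible A B) {θ θ₀ : ℝ} (hθ : 0 < θ) (hθ₀ : 0 < θ₀) {W₀ : ℝ → ℝ}
    (hW₀ : IsKoksma (θ₀ / θ) W₀) : ∃ C₁ C : ℝ, 0 ≤ C ∧ ∀ (S U : Set (Fin k → ℝ)) (κ : ℝ)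
      (F : (Fin k → ℝ) → ℝ) (N : ℝ) (ν₀ : ℤ), SieveRegion S U κ → IsSieveFunction S F →
      IsLarge k θ θ₀ κ C₁ N → LargeEnough A B N →
      IsCoprime (prodForm A B ν₀) (primorialW N : ℤ) →
      |sigma0 A B θ θ₀ W₀ F N ν₀ - mainSize k θ N *
        ∑ j, ∫ y in Set.Icc (1 / D0 N) (θ₀ / θ), W₀ y * (I0 F j y / y)| ≤
        C * (Fmax F ^ 2 * mainSize k θ N * ((1 + Real.log (D0 N)) / D0 N)) := by
  have hT : 0 < θ₀ / θ := by positivity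
  obtain ⟨C₁, hC₁, hlam⟩ := exists_sum_abs_lambdaOf_le k hθ hθ₀
  obtain ⟨C₂, hC₂, hsum⟩ := exists_sum_primes_sub_integral_le hT hW₀
  obtain ⟨M₀, hM₀, hb, -⟩ := hW₀
  have hpc : 0 ≤ primeConst k := by linarith [one_le_primeConst (show 1 ≤ k by omega)]
  refine ⟨C₁, k * (C₂ * primeConst k) + k * (M₀ * 2), by positivity,
    fun S U κ F N ν₀ hS hF hN hNL hν => ?_⟩
  have hN16 := hN.gt
  have hN0 : 0 < N := by linarith
  have hsc := hN.sieveScale hθ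
  have hR := hN.one_lt hθ
  have hD3 := hN.three_le
  have hD0 : 0 < D0 N := by linarith
  have hRT : (N ^ θ) ^ (θ₀ / θ) = N ^ θ₀ := by
    rw [← Real.rpow_mul hN0.le, mul_div_cancel₀ _ hθ.ne']
  have hL := hsc.log_pos
  set Z := max ⌊N ^ θ⌋₊ ⌊N ^ θ₀⌋₊ with hZ
  have hw1 := one_le_primorialW N
  set c := logDensity (smallPrimes N) (N ^ θ) with hc
  have hc0 : 0 < c := hsc.logDensity_pos
  have hcw : Real.log (N ^ θ) / primorialW N ≤ c := log_div_primorialW_le hR.le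
  have hKnn : 0 ≤ primeConst k * Fmax F ^ 2 := by positivity
  -- the sum over primes, for each form
  have hj : ∀ j : Fin k, |∑ p ∈ roughPrimes (primorialW N) ⌊N ^ θ₀⌋₊,
      W₀ (Real.log p / Real.log (N ^ θ)) / p *
        primeForm k (roughProduct (primorialW N) Z) p j (sieveY (primorialW N) (N ^ θ) F) -
      c ^ k * ∫ y in Set.Icc (1 / D0 N) (θ₀ / θ), W₀ y * (I0 F j y / y)| ≤
      C₂ * (primeConst k * Fmax F ^ 2 * c ^ k * ((1 + Real.log (D0 N)) / D0 N)) := by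
    intro j
    have hD2 : D0 N ^ 2 ≤ Real.log (N ^ θ) := by
      refine le_trans ?_ hN.sq_le_log
      exact le_mul_of_one_le_left (by positivity) (one_le_pow₀ hw1)
    -- The relative error W/c is at most W²/log R, so after multiplication by √(log R) it is still
    -- at most 1/D₀ by the size condition on W.
    have hη : (primorialW N : ℝ) / c * Real.sqrt (Real.log (N ^ θ)) ≤ 1 / D0 N := by
      have h1 : (primorialW N : ℝ) / c ≤ (primorialW N : ℝ) ^ 2 / Real.log (N ^ θ) := by
        rw [div_le_div_iff₀ hc0 hL]
        rw [div_le_iff₀ (by linarith)] at hcw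
        nlinarith
      have hs := Real.sqrt_pos.2 hL
      calc _ ≤ (primorialW N : ℝ) ^ 2 / Real.log (N ^ θ) * Real.sqrt (Real.log (N ^ θ)) := by
            gcongr
        _ = (primorialW N : ℝ) ^ 2 / Real.sqrt (Real.log (N ^ θ)) := by
            rw [div_mul_eq_mul_div, div_eq_div_iff hL.ne' hs.ne', mul_assoc,
              Real.mul_self_sqrt hL.le]
        _ ≤ _ := by
            rw [div_le_div_iff₀ hs hD0, one_mul]
            refine le_trans ?_ hN.sq_le
            refine mul_le_mul_of_nonneg_left ?_ (by positivity)
            nlinarith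
    have := hsum (N ^ θ) (D0 N) c (primeConst k * Fmax F ^ 2) (primorialW N / c) k (primorialW N)
      (fun p => primeForm k (roughProduct (primorialW N) Z) p j (sieveY (primorialW N) (N ^ θ) F))
      (I0 F j) hR (by linarith) hN.inv_le hD2 hc0.le hKnn (by positivity) hη
      (fun q hq hqW => by
        rw [prime_dvd_primorialW hq, smallPrimes, mem_filter, mem_range] at hqW
        exact (Nat.lt_ceil.1 hqW.1).le)
      (fun q hq hqW => D0_le_of_not_dvd hq hqW)
      (fun x y => by
        refine (hS.abs_I0_sub_le hF j x y).trans ?_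
        gcongr
        exact one_le_primeConst (by omega))
      (I0_zero F j) (fun p hp => by
        rw [hRT, mem_roughPrimes] at hp
        have hpZ : p ≤ Z := hp.1.2.trans (le_max_right _ _)
        have hmod := sieveModulus_roughProduct (R := N ^ θ) (le_max_left _ ⌊N ^ θ₀⌋₊) hp.1.1
          hpZ hp.2
        have hpP : p ∉ smallPrimes N := fun h => hp.2 ((prime_dvd_primorialW hp.1.1).2 h)
        have hWP : ∀ q : ℕ, q.Prime → q ∣ primorialW N → q ∈ smallPrimes N :=
          fun q hq h => (prime_dvd_primorialW hq).1 h
        refine ⟨selbergForm_nonneg hmod.squarefree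
          (fun q hq hqm => hmod.le_of_dvd hsc hq hqm) _, ?_, ?_⟩
        · have := primeForm_le hk hsc hmod hWP hp.1.1 hpP hS hF j
          rw [← natCast_primorialW] at this
          refine this.trans (le_of_eq ?_)
          ring
        · have := abs_primeForm_sub_le hk hsc hmod hWP hp.1.1 hpP hS hF j
          rw [← natCast_primorialW] at this
          refine this.trans (le_of_eq ?_)
          ring)
    rw [hRT] at this
    exact this
  have hs0 := abs_sigma0_sub_le hk hAB (θ := θ) (θ₀ := θ₀) (F := F) hNL hν
    (le_max_left ⌊N ^ θ⌋₊ ⌊N ^ θ₀⌋₊) (le_max_right ⌊N ^ θ⌋₊ ⌊N ^ θ₀⌋₊) hM₀ (W₀ := W₀)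
    (fun p hp => by
      refine hb _ ?_
      rw [mem_roughPrimes] at hp
      have h1 : p ∈ primesTo ⌊(N ^ θ) ^ (θ₀ / θ)⌋₊ := by
        rw [hRT]; exact mem_primesTo.2 hp.1
      exact ⟨div_nonneg (Real.log_natCast_nonneg p) hL.le, ((mem_primesTo_rpow hR).1 h1).2⟩)
  rw [← hZ] at hs0
  have hl1 := hlam N S U κ F (primorialW N) hN16 hS hF
  rw [← hZ] at hl1
  have hms : mainSize k θ N = N / primorialW N * c ^ k := mainSize_eq k θ N
  have hNw : 0 < N / primorialW N := by positivity
  have hlogD : 0 ≤ Real.log (D0 N) := Real.log_nonneg (by linarith)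
  -- the error from counting
  have herr : N ^ θ₀ * (k * (M₀ * (2 * (∑ d ∈ divTuples k (roughProduct (primorialW N) Z),
      |lambdaOf k (roughProduct (primorialW N) Z) (sieveY (primorialW N) (N ^ θ) F) d|) ^ 2))) ≤
      k * (M₀ * 2) * (Fmax F ^ 2 * mainSize k θ N * ((1 + Real.log (D0 N)) / D0 N)) := by
    have hc1 : 1 ≤ c := by
      have h1 := hsc.prod_le
      have h2 := hsc.one_le_prod
      linarith
    have h0 : 0 ≤ ∑ d ∈ divTuples k (roughProduct (primorialW N) Z),
      |lambdaOf k (roughProduct (primorialW N) Z) (sieveY (primorialW N) (N ^ θ) F) d| :=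
      sum_nonneg fun _ _ => abs_nonneg _
    have h1 := pow_le_pow_left₀ h0 hl1 2
    set E := N ^ (κ * θ) * Real.exp (C₁ * Real.sqrt (Real.log N)) with hE
    -- The power saving in `IsLarge` makes the counting error at most N/(W D₀), which is a fraction
    -- 1/D₀ of the main size because c ≥ 1.
    have h2 : N ^ θ₀ * E ^ 2 ≤ mainSize k θ N * ((1 + Real.log (D0 N)) / D0 N) := by
      have h3 : N ^ θ₀ * E ^ 2 ≤ N / (primorialW N * D0 N) := by
        rw [le_div_iff₀ (by positivity)]
        exact hN.pow_le
      refine h3.trans ?_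
      rw [hms]
      calc N / (primorialW N * D0 N) = N / primorialW N * 1 * (1 / D0 N) := by
            field_simp
        _ ≤ _ := by
            gcongr
            · exact one_le_pow₀ hc1
            · linarith
    calc _ ≤ N ^ θ₀ * (k * (M₀ * (2 * (Fmax F * N ^ (κ * θ) *
          Real.exp (C₁ * Real.sqrt (Real.log N))) ^ 2))) := by gcongr
      _ = k * (M₀ * 2) * (Fmax F ^ 2 * (N ^ θ₀ * E ^ 2)) := by rw [hE]; ring
      _ ≤ k * (M₀ * 2) * (Fmax F ^ 2 *
          (mainSize k θ N * ((1 + Real.log (D0 N)) / D0 N))) := by gcongr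
      _ = _ := by ring
  have hmain : |∑ p ∈ roughPrimes (primorialW N) ⌊N ^ θ₀⌋₊, ∑ j,
      W₀ (Real.log p / Real.log (N ^ θ)) * (N / (primorialW N * p) *
        primeForm k (roughProduct (primorialW N) Z) p j (sieveY (primorialW N) (N ^ θ) F)) -
      mainSize k θ N * ∑ j, ∫ y in Set.Icc (1 / D0 N) (θ₀ / θ), W₀ y * (I0 F j y / y)| ≤
      k * (C₂ * primeConst k) * (Fmax F ^ 2 * mainSize k θ N *
        ((1 + Real.log (D0 N)) / D0 N)) := by
    have e : ∑ p ∈ roughPrimes (primorialW N) ⌊N ^ θ₀⌋₊, ∑ j,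
        W₀ (Real.log p / Real.log (N ^ θ)) * (N / (primorialW N * p) *
          primeForm k (roughProduct (primorialW N) Z) p j (sieveY (primorialW N) (N ^ θ) F)) -
        mainSize k θ N * ∑ j, ∫ y in Set.Icc (1 / D0 N) (θ₀ / θ), W₀ y * (I0 F j y / y) =
        ∑ j, N / primorialW N * (∑ p ∈ roughPrimes (primorialW N) ⌊N ^ θ₀⌋₊,
          W₀ (Real.log p / Real.log (N ^ θ)) / p *
          primeForm k (roughProduct (primorialW N) Z) p j (sieveY (primorialW N) (N ^ θ) F) -
          c ^ k * ∫ y in Set.Icc (1 / D0 N) (θ₀ / θ), W₀ y * (I0 F j y / y)) := by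
      simp only [mul_sub, sum_sub_distrib]
      rw [sum_comm, hms]
      congr 1
      · refine sum_congr rfl fun j _ => ?_
        rw [mul_sum]
        refine sum_congr rfl fun p _ => ?_
        rw [← div_div]
        ring
      · rw [mul_sum]
        exact sum_congr rfl fun j _ => by ring
    rw [e]
    refine (abs_sum_le_sum_abs _ _).trans ?_
    calc _ ≤ ∑ _j : Fin k, N / primorialW N * (C₂ * (primeConst k * Fmax F ^ 2 * c ^ k *
          ((1 + Real.log (D0 N)) / D0 N))) := by
          refine sum_le_sum fun j _ => ?_
          rw [abs_mul, abs_of_pos hNw]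
          exact mul_le_mul_of_nonneg_left (hj j) hNw.le
      _ = _ := by
          simp only [sum_const, card_univ, Fintype.card_fin, nsmul_eq_mul]
          rw [hms]
          ring
  rw [add_mul]
  have := abs_le.1 (hs0.trans herr)
  have := abs_le.1 hmain
  rw [abs_le]
  constructor <;> linarith

end

/-! ### Truncation of the main term and the size of N -/

section

open MeasureTheory Filter

section Truncation

variable {k : ℕ} {S U : Set (Fin k → ℝ)} {κ : ℝ} {F : (Fin k → ℝ) → ℝ}

theorem SieveRegion.abs_weight_mul_I0_le (hS : SieveRegion S U κ) (hF : IsSieveFunction S F)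
    (j : Fin k) {W₀ : ℝ → ℝ} {M₀ y : ℝ} (hy : 0 < y) (hM₀ : |W₀ y| ≤ M₀) :
    |W₀ y / y * I0 F j y| ≤ M₀ * (6 * Fmax F ^ 2) := by
  have h1 := hS.I0_le hF j hy.le
  have h2 := I0_nonneg F j y
  have h3 : I0 F j y / y ≤ 6 * Fmax F ^ 2 := by rwa [div_le_iff₀ hy]
  rw [div_mul_eq_mul_div, mul_div_assoc, abs_mul, abs_of_nonneg (by positivity : 0 ≤ I0 F j y / y)]
  exact mul_le_mul hM₀ h3 (by positivity) ((abs_nonneg _).trans hM₀)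

/-- The dependence of the main term on the truncation point. -/
theorem SieveRegion.abs_J0_sub_le (hS : SieveRegion S U κ) (hF : IsSieveFunction S F)
    {W₀ : ℝ → ℝ} {θ θ₀ M₀ ε δ : ℝ} (hW₀ : IsKoksma (θ₀ / θ) W₀)
    (hM₀ : ∀ y ∈ Set.Icc 0 (θ₀ / θ), |W₀ y| ≤ M₀) (hε : 0 < ε) (hεT : ε ≤ θ₀ / θ) (hδ : 0 < δ)
    (hδT : δ ≤ θ₀ / θ) (j : Fin k) :
    |J0 θ θ₀ W₀ F ε j - ∫ y in Set.Icc δ (θ₀ / θ), W₀ y * (I0 F j y / y)| ≤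
      M₀ * (6 * Fmax F ^ 2) * |ε - δ| := by
  obtain ⟨_, -, -, hI⟩ := hW₀
  have hK : 0 ≤ 6 * Fmax F ^ 2 := by positivity
  have key : ∀ a : ℝ, 0 < a → a ≤ θ₀ / θ →
      IntervalIntegrable (fun y => W₀ y / y * I0 F j y) volume a (θ₀ / θ) := by
    intro a ha haT
    have hp : PieceLip a (θ₀ / θ) _ _ fun y => I0 F j y / y :=
      PieceLip.div_self ha hK (fun x y => hS.abs_I0_sub_le hF j x y) (I0_zero F j)
    have h1 := (hI a ⟨ha.le, haT⟩ _ _ _ (by positivity) hK hp).1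
    rw [intervalIntegrable_iff_integrableOn_Icc_of_le haT]
    refine h1.congr_fun (fun y _ => ?_) measurableSet_Icc
    dsimp only
    ring
  have e : ∫ y in Set.Icc δ (θ₀ / θ), W₀ y * (I0 F j y / y) =
      ∫ y in δ..(θ₀ / θ), W₀ y / y * I0 F j y := by
    rw [intervalIntegral.integral_of_le hδT, integral_Icc_eq_integral_Ioc]
    refine integral_congr_ae (Eventually.of_forall fun y => ?_)
    dsimp only
    ring
  rw [e, J0, intervalIntegral.integral_interval_sub_interval_comm' (key ε hε hεT) (key δ hδ hδT)
    ((key ε hε hεT).trans (key δ hδ hδT).symm), intervalIntegral.integral_same, zero_sub,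
    abs_neg, ← Real.norm_eq_abs]
  refine intervalIntegral.norm_integral_le_of_norm_le_const fun y hy => ?_
  have hy0 : 0 < y := (lt_min hδ hε).trans hy.1
  exact hS.abs_weight_mul_I0_le hF j hy0 (hM₀ y ⟨hy0.le, hy.2.trans (max_le hδT hεT)⟩)

theorem SieveRegion.abs_J0_le (hS : SieveRegion S U κ) (hF : IsSieveFunction S F)
    {W₀ : ℝ → ℝ} {θ θ₀ M₀ ε : ℝ} (h0 : 0 ≤ M₀)
    (hM₀ : ∀ y ∈ Set.Icc 0 (θ₀ / θ), |W₀ y| ≤ M₀) (hε : 0 < ε) (hεT : ε ≤ θ₀ / θ) (j : Fin k) :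
    |J0 θ θ₀ W₀ F ε j| ≤ M₀ * (6 * Fmax F ^ 2) * (θ₀ / θ) := by
  have h1 : |J0 θ θ₀ W₀ F ε j| ≤ M₀ * (6 * Fmax F ^ 2) * |θ₀ / θ - ε| := by
    rw [J0, ← Real.norm_eq_abs]
    refine intervalIntegral.norm_integral_le_of_norm_le_const fun y hy => ?_
    rw [Real.norm_eq_abs]
    rw [Set.uIoc_of_le hεT] at hy
    have hy0 : 0 < y := hε.trans hy.1
    exact hS.abs_weight_mul_I0_le hF j hy0 (hM₀ y ⟨hy0.le, hy.2⟩)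
  refine h1.trans (mul_le_mul_of_nonneg_left ?_ (by positivity))
  rw [abs_of_nonneg (by linarith)]
  linarith

end Truncation

/-- Converts the error of the truncation at 1/D into the error allowed for an arbitrary ε. If ε ≥
D^(-1/2), then log D ≤ 2(√D - 1) and √D ≤ εD; if ε is smaller, then |log ε| ≥ (log D)/2. -/
theorem one_add_log_div_le {D ε : ℝ} (hD : Real.exp 1 ≤ D) (hε : 0 < ε) :
    (1 + Real.log D) / D ≤ 4 * (ε + |Real.log ε| / D) := by
  have hD0 : 0 < D := (Real.exp_pos 1).trans_le hD
  have hl : 1 ≤ Real.log D := (Real.le_log_iff_exp_le hD0).2 hD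
  rw [div_le_iff₀ hD0, mul_assoc, add_mul, div_mul_cancel₀ _ hD0.ne']
  by_cases h : 1 ≤ ε * Real.sqrt D
  · have h1 : Real.log D ≤ 2 * (Real.sqrt D - 1) := by
      have := Real.log_le_sub_one_of_pos (Real.sqrt_pos.2 hD0)
      rw [Real.log_sqrt hD0.le] at this
      linarith
    have h2 : Real.sqrt D ≤ ε * D := by
      have := mul_le_mul_of_nonneg_right h (Real.sqrt_nonneg D)
      rwa [one_mul, mul_assoc, Real.mul_self_sqrt hD0.le] at this
    have := abs_nonneg (Real.log ε)
    linarith [Real.sqrt_nonneg D]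
  · have h1 := Real.log_le_log (by positivity) (not_le.1 h).le
    rw [Real.log_mul hε.ne' (Real.sqrt_pos.2 hD0).ne', Real.log_sqrt hD0.le, Real.log_one] at h1
    have h2 := neg_le_abs (Real.log ε)
    have h3 : 0 < ε * D := by positivity
    linarith

/-- For bounded D the allowed error cannot be small: either ε ≥ 1/2, or |log ε| ≥ log 2. -/
theorem half_div_le {D D₁ ε : ℝ} (hD : 0 < D) (hD₁ : 1 ≤ D₁) (h : D ≤ D₁) (hε : 0 < ε) :
    1 / (2 * D₁) ≤ ε + |Real.log ε| / D := by
  have h0 : 0 ≤ |Real.log ε| / D := by positivity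
  by_cases h1 : 1 / 2 ≤ ε
  · have : 1 / (2 * D₁) ≤ 1 / 2 := by
      apply one_div_le_one_div_of_le <;> linarith
    linarith
  · have h2 := Real.log_le_log hε (not_le.1 h1).le
    rw [one_div, Real.log_inv] at h2
    have h3 : 1 / 2 ≤ |Real.log ε| := by
      have := neg_le_abs (Real.log ε)
      have := Real.log_two_gt_d9
      linarith
    have : 1 / (2 * D₁) ≤ |Real.log ε| / D := by
      rw [← div_div]
      exact div_le_div₀ (abs_nonneg _) h3 hD h
    linarith

theorem primorialW_le (N : ℝ) : primorialW N ≤ 4 ^ ⌈D0 N⌉₊ := by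
  refine le_trans ?_ (primorial_le_four_pow ⌈D0 N⌉₊)
  rw [primorialW, primorial]
  refine Finset.prod_le_prod_of_subset_of_one_le' (Finset.filter_subset_filter _
    (Finset.range_mono (Nat.le_succ _))) fun p hp _ => (Finset.mem_filter.1 hp).2.one_lt.le

theorem tendsto_D0 : Tendsto D0 atTop atTop :=
  Real.tendsto_log_atTop.comp (Real.tendsto_log_atTop.comp Real.tendsto_log_atTop)

/-- The product of the primes below D₀ is at most 4^⌈D₀⌉, and 4 ≤ e² together with e^{D₀} = log log
N makes this at most 4 (log log N)². -/
theorem primorialW_mul_le {N : ℝ} (hD : 1 ≤ D0 N) (hl : 0 < Real.log (Real.log N)) :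
    (primorialW N : ℝ) * D0 N ≤ 4 * Real.log (Real.log N) ^ 3 := by
  have h1 : (primorialW N : ℝ) ≤ 4 ^ ⌈D0 N⌉₊ := by exact_mod_cast primorialW_le N
  have h2 : (4 : ℝ) ^ ⌈D0 N⌉₊ ≤ 4 * Real.log (Real.log N) ^ 2 := by
    rw [← Real.rpow_natCast]
    calc (4 : ℝ) ^ (⌈D0 N⌉₊ : ℝ) ≤ 4 ^ (1 + D0 N) := by
          refine Real.rpow_le_rpow_of_exponent_le (by norm_num) ?_
          have := Nat.ceil_lt_add_one (show 0 ≤ D0 N by linarith)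
          linarith
      _ = 4 * 4 ^ D0 N := by rw [Real.rpow_add (by norm_num), Real.rpow_one]
      _ ≤ 4 * Real.log (Real.log N) ^ 2 := by
          refine mul_le_mul_of_nonneg_left ?_ (by norm_num)
          have h4 : (4 : ℝ) ≤ Real.exp 2 := by
            have := Real.exp_one_gt_d9
            have e : Real.exp 2 = Real.exp 1 * Real.exp 1 := by
              rw [← Real.exp_add]; norm_num
            rw [e]
            nlinarith
          calc (4 : ℝ) ^ D0 N ≤ Real.exp 2 ^ D0 N :=
                Real.rpow_le_rpow (by norm_num) h4 (by linarith)
            _ = Real.log (Real.log N) ^ 2 := by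
                rw [← Real.exp_mul, mul_comm, Real.exp_mul, D0, Real.exp_log hl, Real.rpow_two]
  have h3 : D0 N ≤ Real.log (Real.log N) := Real.log_le_self hl.le
  calc _ ≤ 4 * Real.log (Real.log N) ^ 2 * Real.log (Real.log N) :=
        mul_le_mul (h1.trans h2) h3 (by linarith) (by positivity)
    _ = _ := by ring

/-- Powers of W and D₀ are powers of log log N, hence negligible against log N. The left side of the
last condition is N^{θ₀ + 2κθ} times exp(O(√log N)), which stays below N because the exponent is
less than 1. -/
theorem eventually_isLarge (k : ℕ) {θ θ₀ κ : ℝ} (C : ℝ) (hθ : 0 < θ) (hθ₀ : 0 < θ₀)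
    (h : θ₀ + 2 * (κ * θ) < 1) : ∀ᶠ N in atTop, IsLarge k θ θ₀ κ C N := by
  have hL : Tendsto (fun N : ℝ => Real.log N) atTop atTop := Real.tendsto_log_atTop
  have hs : Tendsto (fun N : ℝ => Real.sqrt (Real.log N)) atTop atTop :=
    Real.tendsto_sqrt_atTop.comp hL
  -- The fourth power of W D₀ is at most (4x³)⁴ = 256 x¹² with x = log log N; this explains the
  -- exponent and the constant.
  have hlit : ∀ᶠ x : ℝ in atTop, ‖Real.log x ^ 12‖ ≤ θ / 256 * ‖id x‖ :=
    (Real.isLittleO_pow_log_id_atTop (n := 12)).bound (by positivity)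
  filter_upwards [eventually_gt_atTop 16, tendsto_D0.eventually_ge_atTop 3,
    tendsto_D0.eventually_ge_atTop (k : ℝ), tendsto_D0.eventually_ge_atTop (θ / θ₀),
    hL.eventually_ge_atTop 1, (Real.tendsto_log_atTop.comp hL).eventually_ge_atTop 1,
    hL.eventually hlit,
    hs.eventually_ge_atTop ((2 * C + Real.sqrt θ) / (1 - (θ₀ + 2 * (κ * θ))))]
    with N h16 h3 hk hinv hL1 hl1 hlog hsq
  have hN0 : 0 < N := by linarith
  simp only [Function.comp_apply] at hl1
  have hlogN : Real.log (N ^ θ) = θ * Real.log N := Real.log_rpow hN0 _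
  have hw1 := one_le_primorialW N
  have hwd := primorialW_mul_le (N := N) (by linarith) (by linarith)
  have hwd0 : 1 ≤ primorialW N * D0 N := by nlinarith
  have hsqle : (primorialW N * D0 N) ^ 2 ≤ Real.sqrt (Real.log (N ^ θ)) := by
    refine Real.le_sqrt_of_sq_le ?_
    rw [hlogN]
    rw [id, Real.norm_of_nonneg (by positivity), Real.norm_of_nonneg (by linarith)] at hlog
    calc ((primorialW N * D0 N) ^ 2) ^ 2 ≤ ((4 * Real.log (Real.log N) ^ 3) ^ 2) ^ 2 := by gcongr
      _ = 256 * Real.log (Real.log N) ^ 12 := by ring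
      _ ≤ _ := by linarith
  refine ⟨h16, h3, hk, ?_, by rwa [← mul_pow], ?_⟩
  · rw [one_div, ← inv_div]
    exact inv_anti₀ (by positivity) hinv
  · have e1 : ∀ a : ℝ, N ^ a = Real.exp (Real.log N * a) := fun a => Real.rpow_def_of_pos hN0 a
    have h4 : primorialW N * D0 N ≤ Real.exp (Real.sqrt θ * Real.sqrt (Real.log N)) := by
      have h5 : primorialW N * D0 N ≤ (primorialW N * D0 N) ^ 2 := by nlinarith
      rw [hlogN, Real.sqrt_mul hθ.le] at hsqle
      have := Real.add_one_le_exp (Real.sqrt θ * Real.sqrt (Real.log N))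
      linarith
    calc _ ≤ N ^ θ₀ * (N ^ (κ * θ) * Real.exp (C * Real.sqrt (Real.log N))) ^ 2 *
          Real.exp (Real.sqrt θ * Real.sqrt (Real.log N)) := by gcongr
      _ = Real.exp (Real.log N * (θ₀ + 2 * (κ * θ)) +
          (2 * C + Real.sqrt θ) * Real.sqrt (Real.log N)) := by
          rw [e1, e1, ← Real.exp_add, ← Real.exp_nat_mul, ← Real.exp_add, ← Real.exp_add]
          congr 1
          push_cast
          ring
      _ ≤ Real.exp (Real.log N) := by
          refine Real.exp_le_exp.2 ?_
          rw [div_le_iff₀ (by linarith)] at hsq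
          have := mul_le_mul_of_nonneg_right hsq (Real.sqrt_nonneg (Real.log N))
          have h6 := Real.mul_self_sqrt (show 0 ≤ Real.log N by linarith)
          have h7 : Real.sqrt (Real.log N) * (1 - (θ₀ + 2 * (κ * θ))) * Real.sqrt (Real.log N) =
              Real.log N * (1 - (θ₀ + 2 * (κ * θ))) := by
            rw [mul_right_comm, h6]
          linarith
      _ = N := Real.exp_log hN0

/-- The trivial bound for the sieve sum. -/
theorem abs_sigma0_le {k : ℕ} (hk : 2 ≤ k) (A : Fin k → ℕ) (B : Fin k → ℤ) {θ θ₀ : ℝ}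
    {W₀ : ℝ → ℝ} {F : (Fin k → ℝ) → ℝ} {N : ℝ} (hN : 16 < N) (hθ : 0 < θ) (ν₀ : ℤ) {Z : ℕ}
    (hZ : ⌊N ^ θ⌋₊ ≤ Z) {M₀ E : ℝ} (h0 : 0 ≤ M₀)
    (hM₀ : ∀ y ∈ Set.Icc 0 (θ₀ / θ), |W₀ y| ≤ M₀)
    (hE : ∑ d ∈ divTuples k (roughProduct (primorialW N) Z),
      |lambdaOf k (roughProduct (primorialW N) Z) (sieveY (primorialW N) (N ^ θ) F) d| ≤ E) :
    |sigma0 A B θ θ₀ W₀ F N ν₀| ≤ 2 * N * (N ^ θ₀ * M₀ * E ^ 2) := by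
  have hN0 : 0 < N := by linarith
  have hR : 1 < N ^ θ := Real.one_lt_rpow (by linarith) hθ
  have hRT : (N ^ θ) ^ (θ₀ / θ) = N ^ θ₀ := by
    rw [← Real.rpow_mul hN0.le, mul_div_cancel₀ _ hθ.ne']
  have hsel : ∀ n : ℤ, |selbergWeight A B (primorialW N) (N ^ θ) F n| ≤ E ^ 2 := by
    intro n
    rw [selbergWeight_eq hk A B hZ, abs_pow]
    refine pow_le_pow_left₀ (abs_nonneg _) ?_ 2
    refine (Finset.abs_sum_le_sum_abs _ _).trans (le_trans ?_ hE)
    exact Finset.sum_le_sum_of_subset_of_nonneg (Finset.filter_subset _ _)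
      fun _ _ _ => abs_nonneg _
  have hpr : ∀ n : ℕ, |∑ p ∈ (Finset.Icc 1 ⌊N ^ θ₀⌋₊).filter
      (fun p : ℕ => p.Prime ∧ (p : ℤ) ∣ prodForm A B (n : ℤ)),
      W₀ (Real.log p / Real.log (N ^ θ))| ≤ N ^ θ₀ * M₀ := by
    intro n
    refine (Finset.abs_sum_le_sum_abs _ _).trans ?_
    have h1 : ∀ p ∈ (Finset.Icc 1 ⌊N ^ θ₀⌋₊).filter
        (fun p : ℕ => p.Prime ∧ (p : ℤ) ∣ prodForm A B (n : ℤ)),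
        |W₀ (Real.log p / Real.log (N ^ θ))| ≤ M₀ := by
      intro p hp
      rw [Finset.mem_filter, Finset.mem_Icc] at hp
      have h1 : p ∈ primesTo ⌊(N ^ θ) ^ (θ₀ / θ)⌋₊ := by
        rw [hRT]; exact mem_primesTo.2 ⟨hp.2.1, hp.1.2⟩
      exact hM₀ _ ⟨div_nonneg (Real.log_natCast_nonneg p) (Real.log_pos hR).le,
        ((mem_primesTo_rpow hR).1 h1).2⟩
    refine (Finset.sum_le_sum h1).trans ?_
    rw [Finset.sum_const, nsmul_eq_mul]
    refine mul_le_mul_of_nonneg_right ?_ h0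
    have h2 := Finset.card_filter_le (Finset.Icc 1 ⌊N ^ θ₀⌋₊)
      (fun p : ℕ => p.Prime ∧ (p : ℤ) ∣ prodForm A B (n : ℤ))
    rw [Nat.card_Icc, Nat.add_sub_cancel] at h2
    exact (Nat.cast_le.2 h2).trans (Nat.floor_le (by positivity))
  rw [sigma0]
  refine (Finset.abs_sum_le_sum_abs _ _).trans ?_
  calc _ ≤ ∑ n ∈ (Finset.Ioc ⌊N⌋₊ ⌊2 * N⌋₊).filter
        (fun n : ℕ => (n : ℤ) ≡ ν₀ [ZMOD (primorialW N : ℤ)]), N ^ θ₀ * M₀ * E ^ 2 := by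
        refine Finset.sum_le_sum fun n _ => ?_
        rw [abs_mul]
        exact mul_le_mul (hpr n) (hsel n) (abs_nonneg _) (by positivity)
    _ ≤ 2 * N * (N ^ θ₀ * M₀ * E ^ 2) := by
        rw [Finset.sum_const, nsmul_eq_mul]
        refine mul_le_mul_of_nonneg_right ?_ (by positivity)
        have h2 := Finset.card_filter_le (Finset.Ioc ⌊N⌋₊ ⌊2 * N⌋₊)
          (fun n : ℕ => (n : ℤ) ≡ ν₀ [ZMOD (primorialW N : ℤ)])
        rw [Nat.card_Ioc] at h2
        exact (Nat.cast_le.2 (h2.trans (Nat.sub_le _ _))).trans (Nat.floor_le (by positivity))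

end

/-! ### Large N, bounded N and the two regions -/

section

theorem mainSize_pos {k : ℕ} {θ N : ℝ} (hθ : 0 < θ) (hN : 16 < N) : 0 < mainSize k θ N := by
  have hR : 1 < N ^ θ := Real.one_lt_rpow (by linarith) hθ
  have h1 := one_le_primorialW N
  have h2 := log_div_primorialW_le (N := N) hR.le
  have h3 : 0 < Real.log (N ^ θ) / primorialW N := div_pos (Real.log_pos hR) (by linarith)
  rw [mainSize_eq]
  exact mul_pos (div_pos (by linarith) (by linarith)) (pow_pos (h3.trans_le h2) k)

theorem D0_le_D0 {N N₁ : ℝ} (hN : 16 < N) (h : N ≤ N₁) : D0 N ≤ D0 N₁ := by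
  have h1 : 1 < Real.log N := by
    rw [Real.lt_log_iff_exp_lt (by linarith)]
    linarith [Real.exp_one_lt_d9]
  have h2 : Real.log N ≤ Real.log N₁ := Real.log_le_log (by linarith) h
  exact Real.log_le_log (Real.log_pos h1) (Real.log_le_log (by linarith) h2)

/-- The estimate for large `N`. -/
theorem exists_large_bound {k : ℕ} (hk : 2 ≤ k) {A : Fin k → ℕ} {B : Fin k → ℤ}
    (hAB : Admissible A B) {θ θ₀ : ℝ} (hθ : 0 < θ) (hθ₀ : 0 < θ₀) {W₀ : ℝ → ℝ}
    (hW₀ : IsKoksma (θ₀ / θ) W₀) {S U : Set (Fin k → ℝ)} {κ : ℝ} (hS : SieveRegion S U κ) :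
    ∃ C₁ C : ℝ, 0 ≤ C ∧ ∀ (F : (Fin k → ℝ) → ℝ) (N : ℝ) (ν₀ : ℤ) (ε : ℝ), IsSieveFunction S F →
      IsLarge k θ θ₀ κ C₁ N → LargeEnough A B N →
      IsCoprime (prodForm A B ν₀) (primorialW N : ℤ) → 0 < ε → ε < θ₀ / θ →
      |sigma0 A B θ θ₀ W₀ F N ν₀ - mainSize k θ N * ∑ j, J0 θ θ₀ W₀ F ε j| ≤
        C * (Fmax F ^ 2 * mainSize k θ N * (ε + |Real.log ε| / D0 N)) := by
  obtain ⟨C₁, C, hC, hmain⟩ := exists_abs_sigma0_sub_le hk hAB hθ hθ₀ hW₀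
  obtain ⟨M₀, h0, hM₀, -⟩ := id hW₀
  refine ⟨C₁, 4 * C + k * (M₀ * 6 * 5), by positivity,
    fun F N ν₀ ε hF hN hNL hν hε hεT => ?_⟩
  have hD : Real.exp 1 ≤ D0 N := by linarith [hN.three_le, Real.exp_one_lt_d9]
  have hD0 : 0 < D0 N := by linarith [hN.three_le]
  have h1 := hmain S U κ F N ν₀ hS hF hN hNL hν
  have hred := one_add_log_div_le hD hε
  have hms := mainSize_pos (k := k) hθ hN.gt
  set X := ε + |Real.log ε| / D0 N with hX
  -- The old truncation point is itself at most (1 + log D₀)/D₀ ≤ 4X, and ε ≤ X.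
  have hdist : |ε - 1 / D0 N| ≤ 5 * X := by
    have h2 : 1 / D0 N ≤ (1 + Real.log (D0 N)) / D0 N := by
      refine div_le_div_of_nonneg_right ?_ hD0.le
      linarith [Real.log_nonneg (show 1 ≤ D0 N by linarith [hN.three_le])]
    have h3 : 0 < 1 / D0 N := by positivity
    have h4 : 0 ≤ |Real.log ε| / D0 N := by positivity
    rw [abs_le]
    constructor <;> linarith
  have hJ : |mainSize k θ N * ∑ j, J0 θ θ₀ W₀ F ε j - mainSize k θ N *
      ∑ j, ∫ y in Set.Icc (1 / D0 N) (θ₀ / θ), W₀ y * (I0 F j y / y)| ≤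
      mainSize k θ N * (k * (M₀ * (6 * Fmax F ^ 2) * (5 * X))) := by
    rw [← mul_sub, ← Finset.sum_sub_distrib, abs_mul, abs_of_pos hms]
    refine mul_le_mul_of_nonneg_left ((Finset.abs_sum_le_sum_abs _ _).trans ?_) hms.le
    calc _ ≤ ∑ _j : Fin k, M₀ * (6 * Fmax F ^ 2) * (5 * X) := by
          refine Finset.sum_le_sum fun j _ => ?_
          refine (hS.abs_J0_sub_le hF hW₀ hM₀ hε hεT.le (by positivity) hN.inv_le j).trans ?_
          exact mul_le_mul_of_nonneg_left hdist (by positivity)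
      _ = _ := by simp
  have h2 : C * (Fmax F ^ 2 * mainSize k θ N * ((1 + Real.log (D0 N)) / D0 N)) ≤
      C * (Fmax F ^ 2 * mainSize k θ N * (4 * X)) := by gcongr
  calc _ ≤ _ := abs_sub_le _ _ _
    _ ≤ C * (Fmax F ^ 2 * mainSize k θ N * (4 * X)) +
        mainSize k θ N * (k * (M₀ * (6 * Fmax F ^ 2) * (5 * X))) :=
        add_le_add (h1.trans h2) (by rw [abs_sub_comm]; exact hJ)
    _ = _ := by ring

/-- The estimate for bounded `N`. -/
theorem exists_bounded_bound {k : ℕ} (hk : 2 ≤ k) (A : Fin k → ℕ) (B : Fin k → ℤ)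
    {θ θ₀ : ℝ} (hθ : 0 < θ) (hθ₀ : 0 < θ₀) {W₀ : ℝ → ℝ}
    (hW₀ : IsKoksma (θ₀ / θ) W₀) {S U : Set (Fin k → ℝ)} {κ : ℝ} (hS : SieveRegion S U κ)
    (hκ : 0 ≤ κ) (N₁ : ℝ) :
    ∃ C : ℝ, 0 ≤ C ∧ ∀ (F : (Fin k → ℝ) → ℝ) (N : ℝ) (ν₀ : ℤ) (ε : ℝ), IsSieveFunction S F →
      16 < N → N ≤ N₁ → 0 < D0 N → 0 < ε → ε < θ₀ / θ →
      |sigma0 A B θ θ₀ W₀ F N ν₀ - mainSize k θ N * ∑ j, J0 θ θ₀ W₀ F ε j| ≤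
        C * (Fmax F ^ 2 * mainSize k θ N * (ε + |Real.log ε| / D0 N)) := by
  by_cases hN₁ : 16 < N₁
  swap
  · exact ⟨0, le_rfl, fun F N ν₀ ε _ h1 h2 => absurd (h1.trans_le h2) hN₁⟩
  obtain ⟨C₁, hC₁, hlam⟩ := exists_sum_abs_lambdaOf_le k hθ hθ₀
  obtain ⟨M₀, h0, hM₀, -⟩ := id hW₀
  have hN₁0 : 0 < N₁ := by linarith
  set D₁ := max 1 (D0 N₁) with hD₁
  have hD₁1 : 1 ≤ D₁ := le_max_left _ _
  set w : ℝ := 4 ^ ⌈D0 N₁⌉₊ with hw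
  have hw0 : 0 < w := by positivity
  -- A lower bound for `mainSize` on 16 < N ≤ N₁: w bounds W from above, N and log N are at least 1,
  -- and `logDensity` is at least θ log N / W.
  set m := 1 / w * (θ / w) ^ k with hm
  have hm0 : 0 < m := by positivity
  set b₁ := 2 * N₁ * (N₁ ^ θ₀ * M₀ *
    (N₁ ^ (κ * θ) * Real.exp (C₁ * Real.sqrt (Real.log N₁))) ^ 2) with hb₁
  have hb₁0 : 0 ≤ b₁ := by positivity
  have hT : 0 < θ₀ / θ := by positivity
  refine ⟨(b₁ / m + k * (M₀ * 6 * (θ₀ / θ))) * (2 * D₁), by positivity,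
    fun F N ν₀ ε hF hN hNN hD hε hεT => ?_⟩
  have hN0 : 0 < N := by linarith
  have hlogN : 1 ≤ Real.log N := by
    rw [Real.le_log_iff_exp_le hN0]
    linarith [Real.exp_one_lt_d9]
  have hms : m ≤ mainSize k θ N := by
    have hR : 1 < N ^ θ := Real.one_lt_rpow (by linarith) hθ
    have hwN : (primorialW N : ℝ) ≤ w := by
      have h1 : (primorialW N : ℝ) ≤ 4 ^ ⌈D0 N⌉₊ := by exact_mod_cast primorialW_le N
      exact h1.trans (pow_le_pow_right₀ (by norm_num) (Nat.ceil_le_ceil (D0_le_D0 hN hNN)))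
    have hw1 : 0 < (primorialW N : ℝ) := by linarith [one_le_primorialW N]
    rw [mainSize_eq]
    have h2 : θ / w ≤ logDensity (smallPrimes N) (N ^ θ) := by
      refine le_trans ?_ (log_div_primorialW_le hR.le)
      rw [Real.log_rpow hN0]
      refine div_le_div₀ (by positivity) ?_ hw1 hwN
      nlinarith
    have h3 : 1 / w ≤ N / primorialW N := div_le_div₀ hN0.le (by linarith) hw1 hwN
    exact mul_le_mul h3 (pow_le_pow_left₀ (by positivity) h2 k) (by positivity) (by positivity)
  have hms0 : 0 < mainSize k θ N := hm0.trans_le hms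
  have hF0 := hF.Fmax_nonneg
  have hσ : |sigma0 A B θ θ₀ W₀ F N ν₀| ≤ Fmax F ^ 2 * b₁ := by
    refine (abs_sigma0_le hk A B hN hθ ν₀ (le_max_left _ ⌊N ^ θ₀⌋₊) h0 hM₀
      (hlam N S U κ F _ hN hS hF)).trans ?_
    calc _ ≤ 2 * N₁ * (N₁ ^ θ₀ * M₀ * (Fmax F * N₁ ^ (κ * θ) *
          Real.exp (C₁ * Real.sqrt (Real.log N₁))) ^ 2) := by gcongr
      _ = _ := by rw [hb₁]; ring
  -- The allowed error is bounded below uniformly in ε, so the bounded sieve sum and main term are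
  -- absorbed by enlarging the constant.
  have hX : 1 ≤ (ε + |Real.log ε| / D0 N) * (2 * D₁) := by
    have := half_div_le hD hD₁1 ((D0_le_D0 hN hNN).trans (le_max_right _ _)) hε
    rwa [div_le_iff₀ (by positivity)] at this
  set X := ε + |Real.log ε| / D0 N
  have hJ : |mainSize k θ N * ∑ j, J0 θ θ₀ W₀ F ε j| ≤
      mainSize k θ N * (k * (M₀ * (6 * Fmax F ^ 2) * (θ₀ / θ))) := by
    rw [abs_mul, abs_of_pos hms0]
    refine mul_le_mul_of_nonneg_left ((Finset.abs_sum_le_sum_abs _ _).trans ?_) hms0.le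
    calc _ ≤ ∑ _j : Fin k, M₀ * (6 * Fmax F ^ 2) * (θ₀ / θ) :=
          Finset.sum_le_sum fun j _ => hS.abs_J0_le hF h0 hM₀ hε hεT.le j
      _ = _ := by simp
  have hb : Fmax F ^ 2 * b₁ ≤ Fmax F ^ 2 * (b₁ / m * mainSize k θ N) := by
    refine mul_le_mul_of_nonneg_left ?_ (by positivity)
    rw [div_mul_eq_mul_div, le_div_iff₀ hm0]
    exact mul_le_mul_of_nonneg_left hms hb₁0
  calc _ ≤ |sigma0 A B θ θ₀ W₀ F N ν₀| + |mainSize k θ N * ∑ j, J0 θ θ₀ W₀ F ε j| := abs_sub _ _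
    _ ≤ Fmax F ^ 2 * (b₁ / m * mainSize k θ N) +
        mainSize k θ N * (k * (M₀ * (6 * Fmax F ^ 2) * (θ₀ / θ))) :=
        add_le_add (hσ.trans hb) hJ
    _ = (b₁ / m + k * (M₀ * 6 * (θ₀ / θ))) * (Fmax F ^ 2 * mainSize k θ N) * 1 := by ring
    _ ≤ (b₁ / m + k * (M₀ * 6 * (θ₀ / θ))) * (Fmax F ^ 2 * mainSize k θ N) * (X * (2 * D₁)) :=
        mul_le_mul_of_nonneg_left hX (by positivity)
    _ = _ := by ring

/-- The threshold N₁ beyond which the asymptotic argument works depends only on k, θ, θ₀, κ and the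
constant `C₁` from the ℓ¹ bound, not on F, ν₀ or ε; below it the bounded case applies. The summand 1
only makes the constant positive. -/
theorem SieveRegion.exists_sigma0_bound {k : ℕ} (hk : 2 ≤ k) {A : Fin k → ℕ} {B : Fin k → ℤ}
    (hAB : Admissible A B) {θ θ₀ : ℝ} (hθ : 0 < θ) (hθ₀ : 0 < θ₀) {W₀ : ℝ → ℝ}
    (hW₀ : PiecewiseSmoothOn W₀ 0 (θ₀ / θ)) {S U : Set (Fin k → ℝ)} {κ : ℝ}
    (hS : SieveRegion S U κ) (hκ : 0 ≤ κ) (h : θ₀ + 2 * (κ * θ) < 1) :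
    ∃ C : ℝ, 0 < C ∧
      ∀ F : (Fin k → ℝ) → ℝ, IsSieveFunction S F →
      ∀ N : ℝ, LargeEnough A B N →
      ∀ ν₀ : ℤ, IsCoprime (prodForm A B ν₀) (primorialW N : ℤ) →
      ∀ ε : ℝ, 0 < ε → ε < θ₀ / θ →
        |sigma0 A B θ θ₀ W₀ F N ν₀ - mainSize k θ N * ∑ j, J0 θ θ₀ W₀ F ε j| ≤
          C * (Fmax F ^ 2 * mainSize k θ N * (ε + |Real.log ε| / D0 N)) := by
  have hW := hW₀.isKoksma
  obtain ⟨C₁, C, hC, hlarge⟩ := exists_large_bound hk hAB hθ hθ₀ hW hS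
  obtain ⟨N₁, hN₁⟩ := Filter.eventually_atTop.1 (eventually_isLarge k C₁ hθ hθ₀ h)
  obtain ⟨C', hC', hsmall⟩ := exists_bounded_bound hk A B hθ hθ₀ hW hS hκ N₁
  refine ⟨C + C' + 1, by positivity, fun F hF N hN ν₀ hν ε hε hεT => ?_⟩
  -- Positivity of D₀ comes from D₀ > A_i ≥ 0.
  have hD : 0 < D0 N := (Nat.cast_nonneg (A ⟨0, by omega⟩)).trans_lt (hN.coeff_lt _)
  have hms := mainSize_pos (k := k) hθ hN.gt_sixteen
  have hnn : 0 ≤ Fmax F ^ 2 * mainSize k θ N * (ε + |Real.log ε| / D0 N) := by positivity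
  rcases le_total N₁ N with h1 | h1
  · refine (hlarge F N ν₀ ε hF (hN₁ N h1) hN hν hε hεT).trans ?_
    exact mul_le_mul_of_nonneg_right (by linarith) hnn
  · refine (hsmall F N ν₀ ε hF hN.gt_sixteen h1 hD hε hεT).trans ?_
    exact mul_le_mul_of_nonneg_right (by linarith) hnn

end

theorem proposition1p10 (k : ℕ) (hk : 3 ≤ k)
    (A : Fin k → ℕ) (B : Fin k → ℤ) (hAB : Admissible A B)
    (θ θ₀ : ℝ) (hθ : 0 < θ) (hθ₀ : 0 < θ₀)
    (W₀ : ℝ → ℝ) (hW₀ : PiecewiseSmoothOn W₀ 0 (θ₀ / θ))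
    (hW₀_nonneg : ∀ y ∈ Set.Icc (0 : ℝ) (θ₀ / θ), 0 ≤ W₀ y)
    (S : Set (Fin k → ℝ))
    (hS : (θ₀ + 2 * θ < 1 ∧ S = simplexRegion k) ∨
      (θ₀ + 2 * (k : ℝ) / ((k : ℝ) - 1) * θ < 1 ∧ S = extendedRegion k)) :
    ∃ C : ℝ, 0 < C ∧
      ∀ F : (Fin k → ℝ) → ℝ, IsSieveFunction S F →
      ∀ N : ℝ, LargeEnough A B N →
      ∀ ν₀ : ℤ, IsCoprime (prodForm A B ν₀) (primorialW N : ℤ) →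
      ∀ ε : ℝ, 0 < ε → ε < θ₀ / θ →
        |sigma0 A B θ θ₀ W₀ F N ν₀ - mainSize k θ N * ∑ j, J0 θ θ₀ W₀ F ε j| ≤
          C * (Fmax F ^ 2 * mainSize k θ N * (ε + |Real.log ε| / D0 N)) := by
  have hk' : (3 : ℝ) ≤ k := by exact_mod_cast hk
  have hk1 : (0 : ℝ) < k - 1 := by linarith
  -- The level condition is θ₀ + 2κθ < 1 in both cases, with κ = 1 for the simplex and κ = k/(k-1)
  -- for the extended region.
  rcases hS with ⟨h, rfl⟩ | ⟨h, rfl⟩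
  · exact (sieveRegion_simplex hk).exists_sigma0_bound (by omega) hAB hθ hθ₀ hW₀ zero_le_one
      (by linarith)
  · refine (sieveRegion_extended hk).exists_sigma0_bound (by omega) hAB hθ hθ₀ hW₀
      (by positivity) ?_
    rwa [← mul_assoc, ← mul_div_assoc]
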